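/- All graphs are finite and simple; $\Delta(G)$, $\omega(G)$, $\alpha(G)$ are the maximum degree, the clique number and the independence number, and $N_G[S]$ is the set consisting of the vertices of $S$ and all their neighbours. Parts of partitions are non-empty. **Tight graphs.** A *diamond* is a clique on four vertices minus an edge; its two non-adjacent vertices are its *tips*. The *diamond necklaces* are the following three graphs: (i) a diamond and two adjacent further vertices $y,b$, with $y$ joined to one tip and $b$ to the other (6 vertices); (ii) two disjoint diamonds and a further vertex $q$, where a tip of the first diamond is joined to a tip of the second and $q$ is joined to the two remaining tips (9 vertices); (iii) three disjoint diamonds joined in a ring by three edges that match their six tips (12 vertices). The *Havel necklaces* are: (iv) two disjoint triangles $abc$ and $xyz$ and vertices $k,l,q$, with the additional edges $ax,\ bk,\ ky,\ cl,\ lz,\ kq,\ ql$ (9 vertices); (v) the graph obtained from (iv) by replacing $q$ by a diamond, with one tip joined to $k$ and the other to $l$ (12 vertices). A *necklace* is a diamond necklace or a Havel necklace. The *triangle-dominated 6-cycle* consists of disjoint triangles $z_1z_2z_3$ and $w_1w_2w_3$, the 6-cycle $x_1y_1x_2y_3x_3y_2$ and the edges $x_iz_i$, $y_iw_i$ ($i=1,2,3$).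 The *extended clique* consists of a clique $\{x_0,x_1,x_2,x_3\}$, a vertex $z_1$ adjacent to $x_0,x_3$, a vertex $z_2$ adjacent to $x_1,x_2$, and two adjacent vertices $e_1,e_2$, both adjacent to $z_1$ and $z_2$. The *extended double-clique* consists of two disjoint copies of the subgraph of the extended clique induced by $\{x_0,x_1,x_2,x_3,z_1,z_2\}$, with the copies of $z_1,z_2$ in the first joined to the copies of $z_1,z_2$ in the second by all four edges. A graph $H$ is *$\Delta$-tight* if $H$ is a clique on $\Delta$ vertices; or $\Delta=5$ and $H$ is the strong product $C_5\boxtimes K_2$; or $\Delta=4$ and $H$ is the square $C_8^2$ of the 8-cycle, the extended clique or the extended double-clique; or $\Delta=3$ and $H$ is a necklace or the triangle-dominated 6-cycle. **Further notions.** A graph is *$\Delta$-tightly partitioned* (*$K_\Delta$-partitioned*) if its vertex set has a partition into parts each inducing a $\Delta$-tight graph (a clique of size $\Delta$). A vertex of $G$ is *$\Delta$-free* in $G$ if it lies in no $\Delta$-tight induced subgraph of $G$; a set of vertices inducing a diamond in $G$ is a *free diamond* if it is contained in no induced subgraph of $G$ that is a necklace. A set $Z\subseteq V(G)$ is *$\Delta$-free*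 in $G$ if either $\Delta>3$ and all vertices of $Z$ are $\Delta$-free in $G$, or $\Delta=3$ and $Z$ can be partitioned so that each part induces a free diamond of $G$ or contains only $3$-free vertices of $G$. A set $Z$ is *$\Delta$-profitable* in $G$ if there is an independent set $S\subseteq Z$ with $N_G[S]\subseteq Z$ and $|Z|\le\Delta|S|-1$. A set $Z$ is *$\Delta$-profitably nibbled* in $G$ if it has a partition $Z_1,\dots,Z_r$ such that for every $a$, $Z_a$ is $\Delta$-profitable in $G-\bigcup_{i<a}Z_i$ and $|Z_a|\le\max(\Delta+3,10)$. **Lemma.** There exist an algorithm and a constant $c$ such that, for every integer $\Delta\ge3$ and every $n$-vertex graph $G$ with $\max(\Delta(G),\omega(G))\le\Delta$, the algorithm, given $\Delta$, $n$ and arbitrarily ordered adjacency lists of $G$, halts after at most $c(\Delta^2n+1)$ steps (that is, in time $O(\Delta^2n)$ for $n\ge1$) and returns a partition of $V(G)$ into four (possibly empty) sets $A,B,C,D$ such that - $G[A]$ is $\Delta$-tightly partitioned; - $G[B]$ is $K_\Delta$-partitioned and $|B|\le3\Delta(|C|+|D|)$; - $C$ is $\Delta$-profitably nibbled in $G$;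 - $D$ is $\Delta$-free in $G-C$; - $\alpha(G)=\alpha(G[B\cup C\cup D])+|A|/\Delta$. Here an algorithm is a single program, independent of $\Delta$ and $G$, for a unit-cost random access machine whose arithmetic operations are addition and truncated subtraction of natural numbers. -/

import Mathlib

/-! ### Machine model

A unit-cost random access machine without multiplication: finitely many registers and finitely many
one-dimensional arrays of natural numbers (those named in the program), programmed in a structured
language. Every evaluated node of an expression, every instruction and every test costs one step. -/

namespace RAM

/-- Memory contents: `reg x` is register `x`, and `arr a i` is cell `i` of array `a`. -/
structure State where
  reg : ℕ → ℕ
  arr : ℕ → ℕ → ℕ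

/-- The state after writing `k` to register `x`. -/
def State.setReg (s : State) (x k : ℕ) : State :=
  { s with reg := Function.update s.reg x k }

/-- The state after writing `k` to cell `i` of array `a`. -/
def State.setArr (s : State) (a i k : ℕ) : State :=
  { s with arr := Function.update s.arr a (Function.update (s.arr a) i k) }

/-- Arithmetic expressions: constants, registers, array cells, sums and truncated differences. -/
inductive Exp : Type where
  | lit (k : ℕ) : Exp
  | var (x : ℕ) : Exp
  | get (a : ℕ) (e : Exp) : Exp
  | add (e f : Exp) : Exp
  | sub (e f : Exp) : Exp

/-- The value of an expression. -/
def Exp.eval (s : State) : Exp → ℕ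
  | .lit k => k
  | .var x => s.reg x
  | .get a e => s.arr a (e.eval s)
  | .add e f => e.eval s + f.eval s
  | .sub e f => e.eval s - f.eval s

/-- The number of steps needed to evaluate an expression. -/
def Exp.cost : Exp → ℕ
  | .lit _ => 1
  | .var _ => 1
  | .get _ e => e.cost + 1
  | .add e f => e.cost + f.cost + 1
  | .sub e f => e.cost + f.cost + 1

/-- Programs. The tests of `ite` and `while` are of the form `e < f`. -/
inductive Cmd : Type where
  | skip : Cmd
  | assign (x : ℕ) (e : Exp) : Cmd
  | store (a : ℕ) (i e : Exp) : Cmd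
  | seq (p q : Cmd) : Cmd
  | ite (e f : Exp) (p q : Cmd) : Cmd
  | while (e f : Exp) (p : Cmd) : Cmd

/-- `Exec p s t s'`: the program `p`, started in state `s`, halts after exactly `t` steps in
state `s'`. -/
inductive Exec : Cmd → State → ℕ → State → Prop where
  | skip (s : State) : Exec .skip s 1 s
  | assign (x : ℕ) (e : Exp) (s : State) :
      Exec (.assign x e) s (e.cost + 1) (s.setReg x (e.eval s))
  | store (a : ℕ) (i e : Exp) (s : State) :
      Exec (.store a i e) s (i.cost + e.cost + 1) (s.setArr a (i.eval s) (e.eval s))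
  | seq {p q : Cmd} {s s' s'' : State} {t t' : ℕ} :
      Exec p s t s' → Exec q s' t' s'' → Exec (.seq p q) s (t + t') s''
  | ite_true {e f : Exp} {p q : Cmd} {s s' : State} {t : ℕ} :
      e.eval s < f.eval s → Exec p s t s' → Exec (.ite e f p q) s (e.cost + f.cost + 1 + t) s'
  | ite_false {e f : Exp} {p q : Cmd} {s s' : State} {t : ℕ} :
      ¬ e.eval s < f.eval s → Exec q s t s' → Exec (.ite e f p q) s (e.cost + f.cost + 1 + t) s'
  | while_true {e f : Exp} {p : Cmd} {s s' s'' : State} {t t' : ℕ} :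
      e.eval s < f.eval s → Exec p s t s' → Exec (.while e f p) s' t' s'' →
      Exec (.while e f p) s (e.cost + f.cost + 1 + t + t') s''
  | while_false {e f : Exp} {p : Cmd} {s : State} :
      ¬ e.eval s < f.eval s → Exec (.while e f p) s (e.cost + f.cost + 1) s

/-- `IsInput Δ G s`: the state `s` holds the number of vertices `n` (register 0), the integer `Δ`
(register 1) and the graph `G` on the vertices `0, …, n - 1`, given by adjacency lists: the list of
neighbours of `v`, in some order and without repetition, occupies the cells of array 1 from
`arr 0 v` on and before `arr 0 (v + 1)`. All other registers and arrays are zero. -/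
structure IsInput (Δ : ℕ) {n : ℕ} (G : SimpleGraph (Fin n)) (s : State) : Prop where
  reg_zero : s.reg 0 = n
  reg_one : s.reg 1 = Δ
  reg_other : ∀ x, 2 ≤ x → s.reg x = 0
  start : s.arr 0 0 = 0
  adjacency : ∀ v : Fin n, ∃ l : List (Fin n), l.Nodup ∧ (∀ w, w ∈ l ↔ G.Adj v w) ∧
    s.arr 0 (v + 1) = s.arr 0 v + l.length ∧
    ∀ (i : ℕ) (h : i < l.length), s.arr 1 (s.arr 0 v + i) = (l[i] : Fin n)
  arr_other : ∀ a i, 2 ≤ a → s.arr a i = 0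

/-- The set of vertices `v` among `0, …, n - 1` that are given the label `k` by the output
array 2. -/
def State.labelled (s : State) (n k : ℕ) : Set (Fin n) := {v | s.arr 2 v = k}

end RAM

namespace SimpleGraph

/-! ### Tight graphs -/

/-- The graph on `0, …, n - 1` with the listed edges. -/
def ofEdges (n : ℕ) (E : List (ℕ × ℕ)) : SimpleGraph (Fin n) :=
  fromRel fun i j => ((i : ℕ), (j : ℕ)) ∈ E

/-- The strong product `G ⊠ H`. -/
def strongProduct {V W : Type*} (G : SimpleGraph V) (H : SimpleGraph W) : SimpleGraph (V × W) where
  Adj p q := p ≠ q ∧ (p.1 = q.1 ∨ G.Adj p.1 q.1) ∧ (p.2 = q.2 ∨ H.Adj p.2 q.2)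
  symm := ⟨fun _ _ h => ⟨h.1.symm, h.2.1.imp Eq.symm Adj.symm, h.2.2.imp Eq.symm Adj.symm⟩⟩
  loopless := ⟨fun _ h => h.1 rfl⟩

/-- The square of the 8-cycle. -/
def cycleEightSquared : SimpleGraph (Fin 8) := circulantGraph {1, 2}

/-- The extended clique: a clique `0, 1, 2, 3`, a vertex `4` joined to `0` and `3`, a vertex `5`
joined to `1` and `2`, and two adjacent vertices `6`, `7` (the attachments), each joined to `4`
and `5`. -/
def extendedClique : SimpleGraph (Fin 8) :=
  ofEdges 8 [(0, 1), (0, 2), (0, 3), (1, 2), (1, 3), (2, 3), (4, 0), (4, 3), (5, 1), (5, 2),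
    (6, 4), (6, 5), (7, 4), (7, 5), (6, 7)]

/-- The extended double-clique: two copies of a clique on four vertices together with two further
vertices, one joined to two vertices of the clique and one to the other two; the further vertices
`4`, `5` of the first copy are joined to the further vertices `10`, `11` of the second copy. -/
def extendedDoubleClique : SimpleGraph (Fin 12) :=
  ofEdges 12 [(0, 1), (0, 2), (0, 3), (1, 2), (1, 3), (2, 3), (4, 0), (4, 3), (5, 1), (5, 2),
    (6, 7), (6, 8), (6, 9), (7, 8), (7, 9), (8, 9), (10, 6), (10, 9), (11, 7), (11, 8),
    (4, 10), (4, 11), (5, 10), (5, 11)]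

/-- The diamond: a clique on four vertices minus the edge between `2` and `3`. -/
def diamond : SimpleGraph (Fin 4) :=
  ofEdges 4 [(0, 1), (0, 2), (0, 3), (1, 2), (1, 3)]

/-- The diamond necklace with one diamond (and two further adjacent vertices). -/
def diamondNecklace₁ : SimpleGraph (Fin 6) :=
  ofEdges 6 [(0, 1), (0, 2), (0, 3), (1, 2), (1, 3), (3, 4), (4, 5), (5, 2)]

/-- The diamond necklace with two diamonds (and one further vertex). -/
def diamondNecklace₂ : SimpleGraph (Fin 9) :=
  ofEdges 9 [(0, 1), (0, 2), (0, 3), (1, 2), (1, 3), (4, 5), (4, 6), (4, 7), (5, 6), (5, 7),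
    (2, 6), (7, 8), (8, 3)]

/-- The diamond necklace with three diamonds. -/
def diamondNecklace₃ : SimpleGraph (Fin 12) :=
  ofEdges 12 [(0, 1), (0, 2), (0, 3), (1, 2), (1, 3), (4, 5), (4, 6), (4, 7), (5, 6), (5, 7),
    (8, 9), (8, 10), (8, 11), (9, 10), (9, 11), (3, 6), (7, 10), (11, 2)]

/-- The Havel necklace on nine vertices: triangles `0 1 2` and `3 4 5`, the edge `0 3`, the paths
`1 6 4` and `2 7 5`, and the path `6 8 7`. -/
def havelNecklace₁ : SimpleGraph (Fin 9) :=
  ofEdges 9 [(0, 1), (0, 2), (1, 2), (3, 4), (3, 5), (4, 5), (0, 3), (1, 6), (6, 4), (2, 7), (7, 5),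
    (6, 8), (8, 7)]

/-- The Havel necklace on twelve vertices: as the one on nine vertices, but with the vertex of
degree two replaced by a diamond. -/
def havelNecklace₂ : SimpleGraph (Fin 12) :=
  ofEdges 12 [(0, 1), (0, 2), (1, 2), (3, 4), (3, 5), (4, 5), (0, 3), (1, 6), (6, 4), (2, 7),
    (7, 5), (8, 9), (8, 10), (8, 11), (9, 10), (9, 11), (6, 10), (11, 7)]

/-- The triangle-dominated 6-cycle: triangles `0 1 2` and `3 4 5`, and the 6-cycle
`6 9 7 11 8 10`, whose vertices `6`, `7`, `8` are matched to `0`, `1`, `2` and whose vertices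
`9`, `10`, `11` are matched to `3`, `4`, `5`. -/
def triangleDominatedSixCycle : SimpleGraph (Fin 12) :=
  ofEdges 12 [(0, 1), (0, 2), (1, 2), (3, 4), (3, 5), (4, 5), (6, 0), (7, 1), (8, 2), (9, 3),
    (10, 4), (11, 5), (6, 9), (9, 7), (7, 11), (11, 8), (8, 10), (10, 6)]

/-- `H` is a necklace, i.e. a diamond necklace or a Havel necklace. -/
def IsNecklace {V : Type*} (H : SimpleGraph V) : Prop :=
  Nonempty (H ≃g diamondNecklace₁) ∨ Nonempty (H ≃g diamondNecklace₂) ∨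
  Nonempty (H ≃g diamondNecklace₃) ∨ Nonempty (H ≃g havelNecklace₁) ∨
  Nonempty (H ≃g havelNecklace₂)

/-- `H` is `Δ`-tight. -/
def IsTight (Δ : ℕ) {V : Type*} (H : SimpleGraph V) : Prop :=
  Nonempty (H ≃g (⊤ : SimpleGraph (Fin Δ))) ∨
  (Δ = 5 ∧ Nonempty (H ≃g (cycleGraph 5).strongProduct (⊤ : SimpleGraph (Fin 2)))) ∨
  (Δ = 4 ∧ (Nonempty (H ≃g cycleEightSquared) ∨ Nonempty (H ≃g extendedClique) ∨
    Nonempty (H ≃g extendedDoubleClique))) ∨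
  (Δ = 3 ∧ (H.IsNecklace ∨ Nonempty (H ≃g triangleDominatedSixCycle)))

/-! ### Partitions, free, profitable and nibbled sets -/

/-- `P` is a partition of the set `Z` into non-empty parts. -/
def IsPartitionOf {V : Type*} (P : Set (Set V)) (Z : Set V) : Prop :=
  ∅ ∉ P ∧ P.PairwiseDisjoint id ∧ ⋃₀ P = Z

/-- The vertices of `G` can be partitioned so that each part induces a `Δ`-tight subgraph. -/
def IsTightlyPartitioned (Δ : ℕ) {V : Type*} (G : SimpleGraph V) : Prop :=
  ∃ P : Set (Set V), IsPartitionOf P Set.univ ∧ ∀ X ∈ P, (G.induce X).IsTight Δ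

/-- The vertices of `G` can be partitioned so that each part induces a clique of size `Δ`. -/
def IsCliquePartitioned (Δ : ℕ) {V : Type*} (G : SimpleGraph V) : Prop :=
  ∃ P : Set (Set V), IsPartitionOf P Set.univ ∧ ∀ X ∈ P, G.IsClique X ∧ X.ncard = Δ

/-- The vertex `v` is contained in no `Δ`-tight induced subgraph of `G`. -/
def IsFreeVertex (Δ : ℕ) {V : Type*} (G : SimpleGraph V) (v : V) : Prop :=
  ∀ X : Set V, v ∈ X → ¬ (G.induce X).IsTight Δ

/-- `X` induces a diamond in `G` that is contained in no induced subgraph isomorphic to a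
necklace. -/
def IsFreeDiamond {V : Type*} (G : SimpleGraph V) (X : Set V) : Prop :=
  Nonempty (G.induce X ≃g diamond) ∧ ∀ Y : Set V, X ⊆ Y → ¬ (G.induce Y).IsNecklace

/-- The set `Z` is `Δ`-free in `G` (a notion for `Δ ≥ 3`). -/
def IsFreeSet (Δ : ℕ) {V : Type*} (G : SimpleGraph V) (Z : Set V) : Prop :=
  (3 < Δ ∧ ∀ v ∈ Z, G.IsFreeVertex Δ v) ∨
  (Δ = 3 ∧ ∃ P : Set (Set V), IsPartitionOf P Z ∧
    ∀ X ∈ P, G.IsFreeDiamond X ∨ ∀ v ∈ X, G.IsFreeVertex 3 v)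

/-- The closed neighbourhood `N_G[S]`. -/
def closedNeighborhood {V : Type*} (G : SimpleGraph V) (S : Set V) : Set V :=
  {w | ∃ v ∈ S, w = v ∨ G.Adj v w}

/-- `Z` is `Δ`-profitable in `G`: some independent set `S` of `G[Z]` satisfies `N_G[S] ⊆ Z` and
`|Z| ≤ Δ |S| - 1`. -/
def IsProfitable (Δ : ℕ) {V : Type*} [Finite V] (G : SimpleGraph V) (Z : Set V) : Prop :=
  ∃ S : Set V, S ⊆ Z ∧ G.IsIndepSet S ∧ G.closedNeighborhood S ⊆ Z ∧ Z.ncard + 1 ≤ Δ * S.ncard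

/-- `Z` is `Δ`-profitably nibbled in `G`: it has a partition `Z₁, …, Zᵣ` such that every `Zₐ` has
at most `max (Δ + 3) 10` elements and is `Δ`-profitable in the graph obtained from `G` by deleting
the earlier parts. (The parts are non-empty because profitable sets are.) -/
def IsProfitablyNibbled (Δ : ℕ) {V : Type*} [Finite V] (G : SimpleGraph V) (Z : Set V) : Prop :=
  ∃ (r : ℕ) (Y : Fin r → Set V), Pairwise (fun a b => Disjoint (Y a) (Y b)) ∧ (⋃ a, Y a) = Z ∧
    ∀ a, (G.induce (⋃ b < a, Y b)ᶜ).IsProfitable Δ (Subtype.val ⁻¹' Y a) ∧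
      (Y a).ncard ≤ max (Δ + 3) 10

/-- The properties of the decomposition of the vertex set of `G` into `A`, `B`, `C`, `D`. -/
structure IsDecomposition (Δ : ℕ) {V : Type*} [Finite V] (G : SimpleGraph V)
    (A B C D : Set V) : Prop where
  cover : A ∪ B ∪ C ∪ D = Set.univ
  disjoint : [A, B, C, D].Pairwise Disjoint
  tight : (G.induce A).IsTightlyPartitioned Δ
  cliques : (G.induce B).IsCliquePartitioned Δ
  card_le : B.ncard ≤ 3 * Δ * (C.ncard + D.ncard)
  nibbled : G.IsProfitablyNibbled Δ C
  free : (G.induce Cᶜ).IsFreeSet Δ (Subtype.val ⁻¹' D)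
  indepNum_eq : (G.indepNum : ℚ) = (G.induce (B ∪ C ∪ D)).indepNum + (A.ncard : ℚ) / Δ

end SimpleGraph

namespace RAM

/-! The decomposition is built greedily by an explicit program that gives every vertex a status: 0
undecided, 1 in a chosen tight set other than a clique, 2 nibbled, 3 in a chosen diamond, 4 in a
pending Δ-clique, 5 in a peeled Δ-clique. At the end A consists of statuses 1 and 4, B of 5, C of 2,
and D of 0 and 3.

Greedy choices are harmless once tight sets no longer overlap badly, and bad overlaps can be nibbled
away. If Δ ≥ 4 and a vertex lies in two Δ-cliques, it has Δ neighbours, all but two of which are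
adjacent to all the others. These two are not adjacent, since there is no clique on Δ + 1 vertices,
and their closed neighbourhoods cover at most Δ + 3 ≤ 2Δ - 1 vertices: a profitable set
(`Nibbled.consume_defective`). For Δ = 3 the two patterns `linkPat₁` and `linkPat₂` are nibbled
instead. Afterwards a tight set that meets a tight set X other than a clique is contained in X
(`subset_of_not_disjoint`): few edges leave X, whereas the tight graphs have no small edge cuts.
This connectivity is checked by evaluation. Only the one-diamond necklace needs more care, and there
the exceptional cuts are exactly those that create a link pattern. Two triangles with a common
vertex form a diamond, so after the choice of diamonds the remaining Δ-cliques are pairwise disjoint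
in all cases. Whatever then has status 0 or 3 is free in G - C (`Prepared.free_vertex`,
`Prepared.isFreeDiamond`).

For the independence number it suffices that an independent set takes at most |A|/Δ vertices of A,
and that some independent set of exactly this size in A has no neighbours outside A
(`indepNum_induce_add`). Tight sets other than cliques contain such independent sets of their own.
For the cliques, those in which at most one vertex has all its neighbours in A are peeled off into
B, repeatedly. In each surviving clique at least two vertices have no neighbours outside A. Since
each vertex of a Δ-clique has at most one neighbour outside the clique, Hall's theorem selects one
such vertex per clique so that no two are adjacent (`exists_transversal`). The bound on |B| is a
double count: each peeled clique contributes at least Δ - 1 edges to earlier peeled cliques or to C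
∪ D, while each of its vertices has only one edge leaving the clique (`PeelCount`).

For the running time, peeling one clique can make at most one further clique peelable, so a single
walk of 2n steps suffices (`PeelInv`). Programs are written in a language whose loops are all capped
by 5, Δ, n or 2n; a syntactic check that loops over vertices are not nested and contain at most two
nested loops over neighbours gives O(Δ²n) (`bound_le_of_quadratic`). The pattern searches are
executed only for Δ ≤ 5, and their cap 5 keeps their bound constant for every Δ. -/

@[simp] theorem State.setReg_reg (s : State) (x k y : ℕ) :
    (s.setReg x k).reg y = if y = x then k else s.reg y := by
  simp [State.setReg, Function.update_apply]

@[simp] theorem State.setReg_arr (s : State) (x k : ℕ) : (s.setReg x k).arr = s.arr := rfl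

@[simp] theorem State.setArr_reg (s : State) (a i k : ℕ) : (s.setArr a i k).reg = s.reg := rfl

theorem State.setArr_arr (s : State) (a i k b j : ℕ) :
    (s.setArr a i k).arr b j = if b = a ∧ j = i then k else s.arr b j := by
  by_cases h : b = a
  · subst h; simp [State.setArr, Function.update_apply]
  · simp [State.setArr, h]

/-! ### A language of bounded loops -/

/-- The bounds that cap the number of iterations of a loop. -/
inductive Cap : Type where
  | five | deg | verts | twice

/-- The expression that computes a cap. -/
def Cap.exp : Cap → Exp
  | .five => .lit 5
  | .deg => .var 1
  | .verts => .var 0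
  | .twice => .add (.var 0) (.var 0)

/-- The value of a cap. -/
def Cap.val (Δ n : ℕ) : Cap → ℕ
  | .five => 5
  | .deg => Δ
  | .verts => n
  | .twice => n + n

theorem Cap.eval_exp (c : Cap) (s : State) : c.exp.eval s = c.val (s.reg 1) (s.reg 0) := by
  cases c <;> rfl

/-- Programs whose only loops run a counter `x` from `0` to a bound computed beforehand, which is
kept in register `x + 1`. -/
inductive Stmt : Type where
  | skip : Stmt
  | assign (x : ℕ) (e : Exp) : Stmt
  | store (a : ℕ) (i e : Exp) : Stmt
  | seq (p q : Stmt) : Stmt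
  | ite (e f : Exp) (p q : Stmt) : Stmt
  | loop (x : ℕ) (c : Cap) (k : Exp) (p : Stmt) : Stmt

namespace Stmt

/-- Translation into programs of the machine. -/
def compile : Stmt → Cmd
  | skip => .skip
  | assign x e => .assign x e
  | store a i e => .store a i e
  | seq p q => .seq p.compile q.compile
  | ite e f p q => .ite e f p.compile q.compile
  | loop x c k p =>
      .seq (.assign (x + 1) (.sub k (.sub k c.exp))) (.seq (.assign x (.lit 0))
        (.while (.var x) (.var (x + 1)) (.seq p.compile (.assign x (.add (.var x) (.lit 1))))))

/-- One round of a loop with counter `x`. -/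
def round (x : ℕ) (f : State → State) (s : State) : State :=
  (f s).setReg x ((f s).reg x + 1)

/-- The state reached by a program. -/
def denote : Stmt → State → State
  | skip, s => s
  | assign x e, s => s.setReg x (e.eval s)
  | store a i e, s => s.setArr a (i.eval s) (e.eval s)
  | seq p q, s => q.denote (p.denote s)
  | ite e f p q, s => if e.eval s < f.eval s then p.denote s else q.denote s
  | loop x c k p, s =>
      (round x p.denote)^[k.eval s - (k.eval s - c.exp.eval s)]
        ((s.setReg (x + 1) (k.eval s - (k.eval s - c.exp.eval s))).setReg x 0)

/-- The registers that a program may write to. -/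
def writes : Stmt → ℕ → Bool
  | skip, _ => false
  | assign x _, y => y == x
  | store _ _ _, _ => false
  | seq p q, y => p.writes y || q.writes y
  | ite _ _ p q, y => p.writes y || q.writes y
  | loop x _ _ p, y => y == x || y == x + 1 || p.writes y

/-- The arrays that a program may write to. -/
def stores : Stmt → ℕ → Bool
  | skip, _ => false
  | assign _ _, _ => false
  | store a _ _, b => b == a
  | seq p q, b => p.stores b || q.stores b
  | ite _ _ p q, b => p.stores b || q.stores b
  | loop _ _ _ p, b => p.stores b

/-- The loops of the program do not tamper with their counters. -/
def WF : Stmt → Bool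
  | skip => true
  | assign _ _ => true
  | store _ _ _ => true
  | seq p q => p.WF && q.WF
  | ite _ _ p q => p.WF && q.WF
  | loop x _ _ p => p.WF && !p.writes x && !p.writes (x + 1)

/-- An upper bound for the running time. -/
def bound (Δ n : ℕ) : Stmt → ℕ
  | skip => 1
  | assign _ e => e.cost + 1
  | store _ i e => i.cost + e.cost + 1
  | seq p q => p.bound Δ n + q.bound Δ n
  | ite e f p q => e.cost + f.cost + 1 + (p.bound Δ n + q.bound Δ n)
  | loop _ c k p => (k.cost + k.cost + c.exp.cost + 8) + c.val Δ n * (p.bound Δ n + 7)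

/-- The frame rule for registers. Because `writes` is a Boolean function of the program text, its
hypothesis is usually discharged by evaluation. -/
theorem denote_reg (p : Stmt) {y : ℕ} (h : p.writes y = false) (s : State) :
    (p.denote s).reg y = s.reg y := by
  induction p generalizing s with
  | skip => rfl
  | assign x e => simp_all [writes, denote]
  | store a i e => rfl
  | seq p q hp hq => simp_all [writes, denote]
  | ite e f p q hp hq =>
    simp only [writes, Bool.or_eq_false_iff] at h
    simp only [denote]
    split_ifs <;> simp [*]
  | loop x c k p hp =>
    simp only [writes, Bool.or_eq_false_iff, beq_eq_false_iff_ne, ne_eq] at h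
    simp only [denote]
    generalize k.eval s - (k.eval s - c.exp.eval s) = m
    have hr : ∀ (i : ℕ) (s : State), ((round x p.denote)^[i] s).reg y = s.reg y := by
      intro i
      induction i with
      | zero => intro s; rfl
      | succ i ih => intro s; rw [Function.iterate_succ_apply, ih]; simp [round, h, hp]
    rw [hr]; simp [h]

theorem denote_arr (p : Stmt) {a : ℕ} (h : p.stores a = false) (s : State) :
    (p.denote s).arr a = s.arr a := by
  induction p generalizing s with
  | skip => rfl
  | assign x e => rfl
  | store b i e =>
    simp only [stores, beq_eq_false_iff_ne, ne_eq] at h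
    ext j
    simp [denote, State.setArr_arr, h]
  | seq p q hp hq => simp_all [stores, denote]
  | ite e f p q hp hq =>
    simp only [stores, Bool.or_eq_false_iff] at h
    simp only [denote]
    split_ifs <;> simp [*]
  | loop x c k p hp =>
    simp only [stores] at h
    simp only [denote]
    generalize k.eval s - (k.eval s - c.exp.eval s) = m
    have hr : ∀ (i : ℕ) (s : State), ((round x p.denote)^[i] s).arr a = s.arr a := by
      intro i
      induction i with
      | zero => intro s; rfl
      | succ i ih => intro s; rw [Function.iterate_succ_apply, ih]; simp [round, h, hp]
    rw [hr]; simp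

/-- The number `d` is the number of rounds still to come. The 7 steps per round are 3 for the test
and 4 for increasing the counter; the last 3 are for the failing test. The invariant `I` lets the
bound `B` of the body depend on registers that the loop leaves alone. -/
theorem exec_while {p : Stmt} {x m B : ℕ} (hx : p.writes x = false) (hm : p.writes (x + 1) = false)
    (I : State → Prop) (hI : ∀ s, I s → I (round x p.denote s))
    (hp : ∀ s, I s → ∃ t, t ≤ B ∧ Exec p.compile s t (p.denote s)) (d : ℕ) :
    ∀ (s : State), I s → s.reg x + d = m → s.reg (x + 1) = m →
      ∃ t, t ≤ d * (B + 7) + 3 ∧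
        Exec (.while (.var x) (.var (x + 1)) (.seq p.compile (.assign x (.add (.var x) (.lit 1)))))
          s t ((round x p.denote)^[d] s) := by
  induction d with
  | zero =>
    intro s _ h1 h2
    refine ⟨3, by simp, ?_⟩
    exact Exec.while_false (by simp [Exp.eval]; omega)
  | succ d ih =>
    intro s hs h1 h2
    obtain ⟨t, ht, hexec⟩ := hp s hs
    obtain ⟨t', ht', hexec'⟩ := ih (round x p.denote s) (hI s hs)
      (by simp [round, denote_reg p hx]; omega) (by simp [round, denote_reg p hm, h2])
    refine ⟨_, ?_, Exec.while_true (by simp [Exp.eval]; omega)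
      (Exec.seq hexec (Exec.assign x _ _)) hexec'⟩
    simp only [Exp.cost]
    nlinarith

/-- Induction on the program. As registers 0 and 1 are never written, every cap evaluates to the
same number throughout the execution, so the bound can be read off from the initial state. -/
theorem exec_compile (p : Stmt) (h : p.WF = true) (h0 : p.writes 0 = false)
    (h1 : p.writes 1 = false) (s : State) :
    ∃ t, t ≤ p.bound (s.reg 1) (s.reg 0) ∧ Exec p.compile s t (p.denote s) := by
  induction p generalizing s with
  | skip => exact ⟨1, le_rfl, Exec.skip s⟩
  | assign x e => exact ⟨_, le_rfl, Exec.assign x e s⟩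
  | store b i e => exact ⟨_, le_rfl, Exec.store b i e s⟩
  | seq p q hp hq =>
    simp only [writes, Bool.or_eq_false_iff, WF, Bool.and_eq_true] at h h0 h1
    obtain ⟨t, ht, he⟩ := hp h.1 h0.1 h1.1 s
    obtain ⟨t', ht', he'⟩ := hq h.2 h0.2 h1.2 (p.denote s)
    rw [denote_reg p h0.1, denote_reg p h1.1] at ht'
    exact ⟨_, Nat.add_le_add ht ht', Exec.seq he he'⟩
  | ite e f p q hp hq =>
    simp only [writes, Bool.or_eq_false_iff, WF, Bool.and_eq_true] at h h0 h1
    obtain ⟨t, ht, he⟩ := hp h.1 h0.1 h1.1 s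
    obtain ⟨t', ht', he'⟩ := hq h.2 h0.2 h1.2 s
    simp only [denote, bound, compile]
    split_ifs with hlt
    · exact ⟨_, by omega, Exec.ite_true hlt he⟩
    · exact ⟨_, by omega, Exec.ite_false hlt he'⟩
  | loop x c k p hp =>
    simp only [writes, Bool.or_eq_false_iff, WF, Bool.and_eq_true, Bool.not_eq_true',
      beq_eq_false_iff_ne, ne_eq] at h h0 h1
    obtain ⟨⟨hw, hx⟩, hx1⟩ := h
    -- With truncated subtraction, `k - (k - c)` is the minimum of `k` and `c`.
    set m := k.eval s - (k.eval s - c.exp.eval s) with hm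
    obtain ⟨t, ht, he⟩ := exec_while (p := p) (x := x) (m := m)
      (B := p.bound (s.reg 1) (s.reg 0)) hx hx1
      (fun s' => s'.reg 0 = s.reg 0 ∧ s'.reg 1 = s.reg 1)
      (by
        rintro s' ⟨h2, h3⟩
        simp [round, denote_reg p h0.2, denote_reg p h1.2, h2, h3, h0, h1])
      (by
        rintro s' ⟨h2, h3⟩
        rw [← h2, ← h3]
        exact hp hw h0.2 h1.2 s') m ((s.setReg (x + 1) m).setReg x 0)
      ⟨by simp [h0], by simp [h1.1.1]; omega⟩ (by simp) (by simp)
    refine ⟨_, ?_, Exec.seq (Exec.assign (x + 1) _ s) (Exec.seq (Exec.assign x _ _) he)⟩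
    simp only [bound, Exp.cost]
    have hmc : m ≤ c.val (s.reg 1) (s.reg 0) := by
      rw [hm, Cap.eval_exp]; omega
    have := Nat.mul_le_mul_right (p.bound (s.reg 1) (s.reg 0) + 7) hmc
    omega

/-- Invariant rule for loops. -/
theorem loop_induction {x : ℕ} {c : Cap} {k : Exp} {p : Stmt} (hx : p.writes x = false) {s : State} {m : ℕ}
    (hm : min (k.eval s) (c.val (s.reg 1) (s.reg 0)) = m)
    (Inv : ℕ → State → Prop) (h0 : Inv 0 ((s.setReg (x + 1) m).setReg x 0))
    (hs : ∀ (j : ℕ) (s' : State), j < m → s'.reg x = j → Inv j s' →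
      Inv (j + 1) ((p.denote s').setReg x (j + 1))) :
    Inv m ((loop x c k p).denote s) := by
  have hm' : k.eval s - (k.eval s - c.exp.eval s) = m := by
    rw [Cap.eval_exp]; omega
  simp only [denote, hm']
  have key : ∀ j ≤ m, Inv j ((round x p.denote)^[j] ((s.setReg (x + 1) m).setReg x 0)) ∧
      ((round x p.denote)^[j] ((s.setReg (x + 1) m).setReg x 0)).reg x = j := by
    intro j
    induction j with
    | zero => intro _; exact ⟨h0, by simp⟩
    | succ j ih =>
      intro hj
      obtain ⟨h1, h2⟩ := ih (by omega)
      rw [Function.iterate_succ_apply']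
      have := hs j _ (by omega) h2 h1
      simp only [round, denote_reg p hx, h2]
      exact ⟨this, by simp⟩
  exact (key m le_rfl).1

/-! ### Running time -/

/-- The nesting depth of the loops capped by the degree; `none` if there are other loops. -/
def depth : Stmt → Option ℕ
  | skip => some 0
  | assign _ _ => some 0
  | store _ _ _ => some 0
  | seq p q => (Option.map₂ max p.depth q.depth)
  | ite _ _ p q => (Option.map₂ max p.depth q.depth)
  | loop _ .five _ p => p.depth
  | loop _ .deg _ p => p.depth.map (· + 1)
  | loop _ _ _ _ => none

/-- No loop over the vertices contains another such loop or more than two nested loops over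
neighbours. -/
def quadratic : Stmt → Bool
  | skip => true
  | assign _ _ => true
  | store _ _ _ => true
  | seq p q => p.quadratic && q.quadratic
  | ite _ _ p q => p.quadratic && q.quadratic
  | loop _ .verts _ p => p.depth.any (· ≤ 2)
  | loop _ .twice _ p => p.depth.any (· ≤ 2)
  | loop _ _ _ _ => false

/-- Each loop capped by the degree multiplies the bound by Δ plus lower order terms, which are
absorbed because Δ ≥ 1; a loop capped by 5 only changes the constant. -/
theorem bound_le_of_depth (p : Stmt) :
    ∀ d, p.depth = some d → ∃ c, ∀ Δ n, 1 ≤ Δ → p.bound Δ n ≤ c * Δ ^ d := by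
  have mono : ∀ {p q : Stmt} {d : ℕ}, Option.map₂ max p.depth q.depth = some d →
      (∀ d, p.depth = some d → ∃ c, ∀ Δ n, 1 ≤ Δ → p.bound Δ n ≤ c * Δ ^ d) →
      (∀ d, q.depth = some d → ∃ c, ∀ Δ n, 1 ≤ Δ → q.bound Δ n ≤ c * Δ ^ d) →
      ∃ c, ∀ Δ n, 1 ≤ Δ → p.bound Δ n + q.bound Δ n ≤ c * Δ ^ d := by
    intro p q d h hp hq
    rw [Option.map₂_eq_some_iff] at h
    obtain ⟨a, b, ha, hb, rfl⟩ := h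
    obtain ⟨c, hc⟩ := hp a ha
    obtain ⟨c', hc'⟩ := hq b hb
    refine ⟨c + c', fun Δ n hΔ => ?_⟩
    rw [add_mul]
    refine Nat.add_le_add ((hc Δ n hΔ).trans ?_) ((hc' Δ n hΔ).trans ?_)
    · exact Nat.mul_le_mul_left _ (Nat.pow_le_pow_right hΔ (le_max_left _ _))
    · exact Nat.mul_le_mul_left _ (Nat.pow_le_pow_right hΔ (le_max_right _ _))
  induction p with
  | skip => exact fun d _ => ⟨1, fun Δ n h => by simpa [bound] using Nat.one_le_pow _ _ h⟩
  | assign x e =>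
    exact fun d _ => ⟨e.cost + 1, fun Δ n h => Nat.le_mul_of_pos_right _ (Nat.pow_pos h)⟩
  | store a i e =>
    exact fun d _ => ⟨i.cost + e.cost + 1, fun Δ n h => Nat.le_mul_of_pos_right _ (Nat.pow_pos h)⟩
  | seq p q hp hq => exact fun d h => mono h hp hq
  | ite e f p q hp hq =>
    intro d h
    obtain ⟨c, hc⟩ := mono h hp hq
    refine ⟨e.cost + f.cost + 1 + c, fun Δ n hΔ => ?_⟩
    rw [add_mul, bound]
    exact Nat.add_le_add (Nat.le_mul_of_pos_right _ (Nat.pow_pos hΔ)) (hc Δ n hΔ)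
  | loop x c k p hp =>
    intro d h
    cases c with
    | five =>
      obtain ⟨c, hc⟩ := hp d h
      refine ⟨(k.cost + k.cost + Cap.five.exp.cost + 8) + 5 * (c + 7), fun Δ n hΔ => ?_⟩
      have h1 : 1 ≤ Δ ^ d := Nat.one_le_pow _ _ hΔ
      have := hc Δ n hΔ
      simp only [bound, Cap.val]
      rw [add_mul]
      refine Nat.add_le_add (Nat.le_mul_of_pos_right _ h1) ?_
      nlinarith
    | deg =>
      simp only [depth, Option.map_eq_some_iff] at h
      obtain ⟨e, he, rfl⟩ := h
      obtain ⟨c, hc⟩ := hp e he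
      refine ⟨(k.cost + k.cost + Cap.deg.exp.cost + 8) + (c + 7), fun Δ n hΔ => ?_⟩
      have h1 : 1 ≤ Δ ^ e := Nat.one_le_pow _ _ hΔ
      have := hc Δ n hΔ
      simp only [bound, Cap.val]
      rw [add_mul]
      refine Nat.add_le_add (Nat.le_mul_of_pos_right _ (Nat.pow_pos hΔ)) ?_
      calc Δ * (p.bound Δ n + 7) ≤ Δ * ((c + 7) * Δ ^ e) := Nat.mul_le_mul_left _ (by nlinarith)
        _ = (c + 7) * Δ ^ (e + 1) := by ring
    | verts => simp [depth] at h
    | twice => simp [depth] at h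

/-- The only loops outside of loop bodies run over the vertices, at most 2n times, and their bodies
cost O(Δ²) by `bound_le_of_depth`. The summand 1 in the bound covers the straight-line code when n =
0. -/
theorem bound_le_of_quadratic (p : Stmt) (h : p.quadratic = true) :
    ∃ c, ∀ Δ n, 1 ≤ Δ → p.bound Δ n ≤ c * (Δ ^ 2 * n + 1) := by
  have body : ∀ {p : Stmt}, (p.depth.any (· ≤ 2)) = true → ∀ a : ℕ,
      ∃ c, ∀ Δ n, 1 ≤ Δ → a + (n + n) * (p.bound Δ n + 7) ≤ c * (Δ ^ 2 * n + 1) := by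
    intro p hp a
    rw [Option.any_eq_true] at hp
    obtain ⟨d, hd, hd2⟩ := hp
    obtain ⟨c, hc⟩ := bound_le_of_depth p d hd
    have hd2 : d ≤ 2 := by simpa using hd2
    refine ⟨a + 2 * (c + 7), fun Δ n hΔ => ?_⟩
    have h1 : Δ ^ d ≤ Δ ^ 2 := Nat.pow_le_pow_right hΔ hd2
    have h2 : 1 ≤ Δ ^ 2 := Nat.one_le_pow _ _ hΔ
    have h3 : p.bound Δ n + 7 ≤ (c + 7) * Δ ^ 2 := by
      have := (hc Δ n hΔ).trans (Nat.mul_le_mul_left c h1)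
      nlinarith
    have h4 := Nat.mul_le_mul_left (n + n) h3
    nlinarith [Nat.zero_le (a * (Δ ^ 2 * n))]
  induction p with
  | skip => exact ⟨1, fun Δ n h => by simp [bound]⟩
  | assign x e => exact ⟨e.cost + 1, fun Δ n h => Nat.le_mul_of_pos_right _ (by omega)⟩
  | store a i e => exact ⟨i.cost + e.cost + 1, fun Δ n h => Nat.le_mul_of_pos_right _ (by omega)⟩
  | seq p q hp hq =>
    simp only [quadratic, Bool.and_eq_true] at h
    obtain ⟨c, hc⟩ := hp h.1
    obtain ⟨c', hc'⟩ := hq h.2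
    refine ⟨c + c', fun Δ n hΔ => ?_⟩
    rw [add_mul]
    exact Nat.add_le_add (hc Δ n hΔ) (hc' Δ n hΔ)
  | ite e f p q hp hq =>
    simp only [quadratic, Bool.and_eq_true] at h
    obtain ⟨c, hc⟩ := hp h.1
    obtain ⟨c', hc'⟩ := hq h.2
    refine ⟨e.cost + f.cost + 1 + (c + c'), fun Δ n hΔ => ?_⟩
    rw [add_mul, add_mul c, bound]
    exact Nat.add_le_add (Nat.le_mul_of_pos_right _ (by omega))
      (Nat.add_le_add (hc Δ n hΔ) (hc' Δ n hΔ))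
  | loop x c k p hp =>
    cases c with
    | five => simp [quadratic] at h
    | deg => simp [quadratic] at h
    | verts =>
      obtain ⟨c, hc⟩ := body (p := p) h (k.cost + k.cost + Cap.verts.exp.cost + 8)
      refine ⟨c, fun Δ n hΔ => le_trans ?_ (hc Δ n hΔ)⟩
      simp only [bound, Cap.val]
      nlinarith
    | twice => exact body (p := p) h (k.cost + k.cost + Cap.twice.exp.cost + 8)

/-- The conditional on an equality of expressions. -/
def ifEq (e f : Exp) (p : Stmt) : Stmt := ite e f skip (ite f e skip p)

theorem denote_ifEq (e f : Exp) (p : Stmt) (s : State) :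
    (ifEq e f p).denote s = if e.eval s = f.eval s then p.denote s else s := by
  simp only [ifEq, denote]
  split_ifs <;> first | rfl | omega

theorem writes_ifEq (e f : Exp) (p : Stmt) (y : ℕ) : (ifEq e f p).writes y = p.writes y := by
  simp [ifEq, writes]

theorem stores_ifEq (e f : Exp) (p : Stmt) (y : ℕ) : (ifEq e f p).stores y = p.stores y := by
  simp [ifEq, stores]

end Stmt

end RAM

/-! ### Loops over adjacency lists -/

namespace RAM

/-- The state `s` holds `n`, `Δ` and the adjacency lists of `G`. -/
structure Rep (Δ : ℕ) {n : ℕ} (G : SimpleGraph (Fin n)) (s : State) : Prop where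
  reg_zero : s.reg 0 = n
  reg_one : s.reg 1 = Δ
  adjacency : ∀ v : Fin n, ∃ l : List (Fin n), l.Nodup ∧ (∀ w, w ∈ l ↔ G.Adj v w) ∧
    s.arr 0 (v + 1) = s.arr 0 v + l.length ∧
    ∀ (i : ℕ) (h : i < l.length), s.arr 1 (s.arr 0 v + i) = (l[i] : Fin n)

theorem IsInput.rep {Δ n : ℕ} {G : SimpleGraph (Fin n)} {s : State} (h : IsInput Δ G s) :
    Rep Δ G s :=
  ⟨h.reg_zero, h.reg_one, h.adjacency⟩

theorem Rep.congr {Δ n : ℕ} {G : SimpleGraph (Fin n)} {s s' : State} (h : Rep Δ G s)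
    (h0 : s'.reg 0 = s.reg 0) (h1 : s'.reg 1 = s.reg 1) (h2 : s'.arr 0 = s.arr 0)
    (h3 : s'.arr 1 = s.arr 1) : Rep Δ G s' := by
  refine ⟨h0.trans h.reg_zero, h1.trans h.reg_one, ?_⟩
  rw [h2, h3]
  exact h.adjacency

theorem Rep.setReg {Δ n : ℕ} {G : SimpleGraph (Fin n)} {s : State} (h : Rep Δ G s) {x : ℕ}
    (hx : 2 ≤ x) (k : ℕ) : Rep Δ G (s.setReg x k) :=
  h.congr (by simp; omega) (by simp; omega) rfl rfl

namespace Stmt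

/-- The program does not change the input. -/
def safe (p : Stmt) : Bool := !p.writes 0 && !p.writes 1 && !p.stores 0 && !p.stores 1

theorem safe_iff {p : Stmt} : p.safe = true ↔
    p.writes 0 = false ∧ p.writes 1 = false ∧ p.stores 0 = false ∧ p.stores 1 = false := by
  simp [safe, and_assoc]

theorem rep_denote {Δ n : ℕ} {G : SimpleGraph (Fin n)} {s : State} (h : Rep Δ G s) {p : Stmt}
    (hp : p.safe = true) : Rep Δ G (p.denote s) := by
  rw [safe_iff] at hp
  exact h.congr (denote_reg p hp.1 s) (denote_reg p hp.2.1 s) (denote_arr p hp.2.2.1 s)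
    (denote_arr p hp.2.2.2 s)

/-- Run `p` with register `x` set to each neighbour of the vertex in register `u`. -/
def nbrLoop (c : Cap) (u x j : ℕ) (p : Stmt) : Stmt :=
  loop j c (.sub (.get 0 (.add (.var u) (.lit 1))) (.get 0 (.var u)))
    (seq (assign x (.get 1 (.add (.get 0 (.var u)) (.var j)))) p)

theorem writes_nbrLoop (c : Cap) (u x j : ℕ) (p : Stmt) (y : ℕ) :
    (nbrLoop c u x j p).writes y = (y == j || y == j + 1 || (y == x || p.writes y)) := rfl

theorem stores_nbrLoop (c : Cap) (u x j : ℕ) (p : Stmt) (y : ℕ) :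
    (nbrLoop c u x j p).stores y = p.stores y := by
  simp [nbrLoop, stores]

/-- The registers of a loop over neighbours are distinct and the body respects them. -/
def nbrOK (u x j : ℕ) (p : Stmt) : Bool :=
  u != x && u != j && u != j + 1 && x != j && x != j + 1 && decide (2 ≤ x) && decide (2 ≤ j) &&
    !p.writes j && !p.writes u && p.safe

/-- The invariant is indexed by the set of neighbours already visited, so that clients need not know
the order of the adjacency list. The cap does no harm as long as it is at least the degree. -/
theorem nbrLoop_induction {Δ n : ℕ} {G : SimpleGraph (Fin n)} [DecidableRel G.Adj] {s : State}
    (rep : Rep Δ G s) {u : ℕ} {v : Fin n} (hu : s.reg u = v) {c : Cap}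
    (hdeg : G.degree v ≤ c.val Δ n) {x j : ℕ} {p : Stmt} (hp : nbrOK u x j p = true)
    (Inv : Finset (Fin n) → State → Prop)
    (h0 : ∀ k l, Inv ∅ ((s.setReg (j + 1) k).setReg j l))
    (hs : ∀ (T : Finset (Fin n)) (w : Fin n) (s' : State), w ∉ T → T ⊆ G.neighborFinset v →
      G.Adj v w → Rep Δ G s' → s'.reg u = v → Inv T s' →
      ∀ k, Inv (insert w T) ((p.denote (s'.setReg x w)).setReg j k)) :
    Inv (G.neighborFinset v) ((nbrLoop c u x j p).denote s) := by
  simp only [nbrOK, Bool.and_eq_true, bne_iff_ne, ne_eq, decide_eq_true_eq,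
    Bool.not_eq_true', and_assoc] at hp
  obtain ⟨hux, huj, huj1, hxj, hxj1, hx2, hj2, hpj, hpu, hsafe⟩ := hp
  obtain ⟨l, hnd, hmem, hlen, hget⟩ := rep.adjacency v
  have hfin : l.toFinset = G.neighborFinset v := by
    ext w; simp [hmem]
  have hcard : l.length = G.degree v := by
    rw [← G.card_neighborFinset_eq_degree, ← hfin, List.toFinset_card_of_nodup hnd]
  have key := loop_induction (x := j) (c := c)
    (k := .sub (.get 0 (.add (.var u) (.lit 1))) (.get 0 (.var u)))
    (p := seq (assign x (.get 1 (.add (.get 0 (.var u)) (.var j)))) p)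
    (by simp [writes, hpj]; omega) (s := s) (m := l.length)
    (by
      simp only [Exp.eval, hu, hlen, rep.reg_zero, rep.reg_one]
      omega)
    (fun i s' => Rep Δ G s' ∧ s'.reg u = v ∧ s'.arr 0 = s.arr 0 ∧ s'.arr 1 = s.arr 1 ∧
      Inv (l.take i).toFinset s')
    ⟨(rep.setReg (by omega) _).setReg hj2 _, by simp [huj, huj1, hu], rfl, rfl,
      by simpa using h0 _ _⟩
    (by
      rintro i s' hi hji ⟨h1, h2, h3, h4, h5⟩
      have hev : s'.arr 1 (s'.arr 0 (s'.reg u) + s'.reg j) = (l[i] : Fin n) := by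
        rw [h2, h3, h4, hji, hget i hi]
      have hr : Rep Δ G (p.denote (s'.setReg x (l[i] : Fin n))) :=
        rep_denote (h1.setReg hx2 _) hsafe
      rw [safe_iff] at hsafe
      simp only [denote, Exp.eval, hev]
      refine ⟨hr.setReg hj2 _, ?_, ?_, ?_, ?_⟩
      · simp [huj, denote_reg p hpu, hux, h2]
      · simp [denote_arr p hsafe.2.2.1, h3]
      · simp [denote_arr p hsafe.2.2.2, h4]
      -- Position `i` adds exactly one vertex to the processed prefix, and a new one because the
      -- list has no repetitions.
      · have hins : (l.take (i + 1)).toFinset = insert l[i] (l.take i).toFinset := by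
          ext w
          simp only [List.take_add_one, List.getElem?_eq_getElem hi, Option.toList_some,
            List.toFinset_append, Finset.mem_union, List.mem_toFinset, List.mem_singleton,
            Finset.mem_insert]
          exact or_comm
        rw [hins]
        refine hs _ _ _ ?_ ?_ ((hmem _).1 (List.getElem_mem hi)) h1 h2 h5 _
        · rw [List.mem_toFinset]
          intro hc
          obtain ⟨a, ha, hae⟩ := List.mem_iff_getElem.1 hc
          rw [List.getElem_take] at hae
          rw [List.length_take] at ha
          have := (List.Nodup.getElem_inj_iff hnd).1 hae
          omega
        · rw [← hfin]
          intro w hw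
          rw [List.mem_toFinset] at hw ⊢
          exact List.mem_of_mem_take hw)
  have := key.2.2.2.2
  rwa [List.take_length, hfin] at this

/-- Count in register `c` the neighbours for which `p` increases `c`. -/
def countNbr (b : Cap) (c u x j : ℕ) (p : Stmt) : Stmt :=
  seq (assign c (.lit 0)) (nbrLoop b u x j p)

theorem writes_countNbr (b : Cap) (c u x j : ℕ) (p : Stmt) (y : ℕ) :
    (countNbr b c u x j p).writes y =
      (y == c || (y == j || y == j + 1 || (y == x || p.writes y))) := rfl

theorem stores_countNbr (b : Cap) (c u x j : ℕ) (p : Stmt) (y : ℕ) :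
    (countNbr b c u x j p).stores y = p.stores y := by
  simp [countNbr, nbrLoop, stores]

/-- The hypothesis on the body only speaks of states that agree with the initial one on all arrays
and on all registers outside the loop; this is what allows nested counts. -/
theorem countNbr_spec {Δ n : ℕ} {G : SimpleGraph (Fin n)} [DecidableRel G.Adj] {s : State}
    (rep : Rep Δ G s) {u : ℕ} {v : Fin n} (hu : s.reg u = v) {b : Cap}
    (hdeg : G.degree v ≤ b.val Δ n) {c x j : ℕ} {p : Stmt} (hp : nbrOK u x j p = true)
    (hc : c ≠ u ∧ c ≠ j ∧ c ≠ j + 1 ∧ c ≠ x ∧ 2 ≤ c) (hpure : ∀ a, p.stores a = false)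
    (P : Fin n → Prop) [DecidablePred P]
    (hs : ∀ (w : Fin n) (s' : State), G.Adj v w → s'.arr = s.arr → Rep Δ G s' →
      (∀ y, (countNbr b c u x j p).writes y = false → s'.reg y = s.reg y) → s'.reg x = w →
      (p.denote s').reg c = s'.reg c + if P w then 1 else 0) :
    ((countNbr b c u x j p).denote s).reg c = ((G.neighborFinset v).filter P).card := by
  have key := nbrLoop_induction (rep.setReg hc.2.2.2.2 0) (u := u) (v := v) (c := b)
    (by simp [hu, hc.1.symm]) hdeg hp
    (fun T s' => s'.arr = s.arr ∧
      (∀ y, (countNbr b c u x j p).writes y = false → s'.reg y = s.reg y) ∧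
      s'.reg c = (T.filter P).card)
    (by
      intro k l
      refine ⟨rfl, ?_, ?_⟩
      · intro y hy
        simp only [writes_countNbr, Bool.or_eq_false_iff, beq_eq_false_iff_ne, ne_eq] at hy
        simp [hy]
      · simp [hc])
    (by
      rintro T w s' hwT - hvw hrep - ⟨h1, h2, h3⟩ k
      have hx2 : 2 ≤ x := by
        simp only [nbrOK, Bool.and_eq_true, decide_eq_true_eq] at hp
        tauto
      refine ⟨?_, ?_, ?_⟩
      · ext a i
        simp [denote_arr p (hpure a), h1]
      · intro y hy
        have hy' := hy
        simp only [writes_countNbr, Bool.or_eq_false_iff, beq_eq_false_iff_ne, ne_eq] at hy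
        simp [denote_reg p hy.2.2.2, hy, h2 y hy']
      · have := hs w (s'.setReg x w) hvw (by simp [h1]) (hrep.setReg hx2 _) (by
          intro y hy
          have hy' := hy
          simp only [writes_countNbr, Bool.or_eq_false_iff, beq_eq_false_iff_ne, ne_eq] at hy
          simp [hy, h2 y hy']) (by simp)
        simp only [State.setReg_reg, hc, if_false, this, h3]
        rw [Finset.filter_insert]
        split_ifs
        · rw [Finset.card_insert_of_notMem (by simp [hwT])]
        · simp)
  exact key.2.2

theorem countNbr_arr {b : Cap} {c u x j : ℕ} {p : Stmt} (hpure : ∀ a, p.stores a = false)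
    (s : State) : ((countNbr b c u x j p).denote s).arr = s.arr := by
  ext a i
  rw [denote_arr _ (by rw [stores_countNbr, hpure])]

/-- Increase `c` if `e = f`. -/
def tick (c : ℕ) (e f : Exp) : Stmt := ifEq e f (assign c (.add (.var c) (.lit 1)))

end Stmt

end RAM

/-! ### Backtracking search for a small pattern -/

namespace RAM

/-- `i` and `j` are joined by one of the listed edges. -/
def Joined (E : List (ℕ × ℕ)) (i j : ℕ) : Prop := (i, j) ∈ E ∨ (j, i) ∈ E

instance (E : List (ℕ × ℕ)) (i j : ℕ) : Decidable (Joined E i j) := instDecidableOr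

theorem Joined.symm {E : List (ℕ × ℕ)} {i j : ℕ} (h : Joined E i j) : Joined E j i := Or.symm h

/-- `g` maps the listed vertices injectively into `W` and the edges of `E` between them to edges of
`G`. -/
def Valid {n : ℕ} (G : SimpleGraph (Fin n)) (E : List (ℕ × ℕ)) (W : Set (Fin n)) (D : List ℕ)
    (g : ℕ → Fin n) : Prop :=
  (∀ j ∈ D, g j ∈ W) ∧ ∀ i ∈ D, ∀ j ∈ D, i ≠ j → g i ≠ g j ∧ (Joined E i j → G.Adj (g i) (g j))

theorem Valid.mono {n : ℕ} {G : SimpleGraph (Fin n)} {E : List (ℕ × ℕ)} {W W' : Set (Fin n)}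
    {D D' : List ℕ} {g : ℕ → Fin n} (h : Valid G E W D g) (hD : D' ⊆ D) (hW : W ⊆ W') :
    Valid G E W' D' g :=
  ⟨fun j hj => hW (h.1 j (hD hj)), fun i hi j hj => h.2 i (hD hi) j (hD hj)⟩

theorem Valid.congr {n : ℕ} {G : SimpleGraph (Fin n)} {E : List (ℕ × ℕ)} {W : Set (Fin n)}
    {D : List ℕ} {g g' : ℕ → Fin n} (h : Valid G E W D g) (hg : ∀ j ∈ D, g' j = g j) :
    Valid G E W D g' := by
  refine ⟨fun j hj => by rw [hg j hj]; exact h.1 j hj, fun i hi j hj => ?_⟩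
  rw [hg i hi, hg j hj]
  exact h.2 i hi j hj

/-- Extending a partial map by one vertex requires only checks against the vertices placed before;
`check` performs exactly these. -/
theorem valid_cons {n : ℕ} {G : SimpleGraph (Fin n)} {E : List (ℕ × ℕ)} {W : Set (Fin n)}
    {k : ℕ} {D : List ℕ} {g : ℕ → Fin n} (hk : k ∉ D) : Valid G E W (k :: D) g ↔
      Valid G E W D g ∧ g k ∈ W ∧ ∀ j ∈ D, g k ≠ g j ∧ (Joined E j k → G.Adj (g j) (g k)) := by
  constructor
  · intro h
    refine ⟨h.mono (List.subset_cons_self _ _) le_rfl, h.1 k (by simp), fun j hj => ?_⟩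
    have hjk : j ≠ k := by rintro rfl; exact hk hj
    exact ⟨(h.2 k (by simp) j (by simp [hj]) hjk.symm).1, (h.2 j (by simp [hj]) k (by simp) hjk).2⟩
  · rintro ⟨h1, h2, h3⟩
    refine ⟨by simpa using ⟨h2, h1.1⟩, ?_⟩
    intro i hi j hj hij
    rw [List.mem_cons] at hi hj
    rcases hi with rfl | hi <;> rcases hj with rfl | hj
    · exact absurd rfl hij
    · exact ⟨(h3 j hj).1, fun h => ((h3 j hj).2 h.symm).symm⟩
    · exact ⟨(h3 i hi).1.symm, (h3 i hi).2⟩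
    · exact h1.2 i hi j hj hij

/-- The listed vertices of a pattern are held in the registers from `100` on. -/
def Holds {n : ℕ} (D : List ℕ) (g : ℕ → Fin n) (s : State) : Prop :=
  ∀ j ∈ D, s.reg (100 + j) = g j

namespace Stmt

/-- Set register 22 to zero unless register `a` holds a neighbour of the vertex in register `b`. -/
def checkEdge (a b : ℕ) : Stmt :=
  seq (countNbr .five 21 b 24 25 (tick 21 (.var 24) (.var a)))
    (ite (.lit 0) (.var 21) skip (assign 22 (.lit 0)))

/-- Set register 22 to zero unless the candidate for the vertex `k` of the pattern is compatible
with the vertices in `D`. -/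
def checkAll (E : List (ℕ × ℕ)) (k : ℕ) : List ℕ → Stmt
  | [] => skip
  | j :: D => seq (seq (ifEq (.var (100 + k)) (.var (100 + j)) (assign 22 (.lit 0)))
      (if Joined E j k then checkEdge (100 + k) (100 + j) else skip)) (checkAll E k D)

/-- Set register 22 to one or zero according to whether the candidate for the vertex `k` of the
pattern is good. -/
def check (E : List (ℕ × ℕ)) (k : ℕ) (D : List ℕ) : Stmt :=
  seq (ite (.lit 0) (.get 3 (.var (100 + k))) (assign 22 (.lit 0)) (assign 22 (.lit 1)))
    (checkAll E k D)

/-- Search for an extension of the map defined on `D` to the vertices in `L`, each given together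
with an earlier neighbour. -/
def search (E : List (ℕ × ℕ)) : List (ℕ × ℕ) → List ℕ → Stmt
  | [], _ => assign 27 (.lit 1)
  | (k, q) :: L, D => nbrLoop .five (100 + q) 20 (200 + 2 * k)
      (ite (.var 27) (.lit 1)
        (seq (assign (100 + k) (.var 20)) (seq (check E k D)
          (ite (.lit 0) (.var 22) (search E L (k :: D)) skip))) skip)

/-- `L` lists distinct vertices outside `D`, each with an earlier neighbour. -/
def Fits (E : List (ℕ × ℕ)) : List (ℕ × ℕ) → List ℕ → Bool
  | [], _ => true
  | (k, q) :: L, D => decide (k ∉ D) && decide (q ∈ D) && decide (Joined E q k) && decide (k < 50) &&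
      decide (q < 50) && Fits E L (k :: D)

/-- The vertices in `D` and those in `L`. -/
def full : List (ℕ × ℕ) → List ℕ → List ℕ
  | [], D => D
  | (k, _) :: L, D => full L (k :: D)

theorem subset_full (L : List (ℕ × ℕ)) : ∀ D, D ⊆ full L D := by
  induction L with
  | nil => exact fun D => List.Subset.refl _
  | cons a L ih => exact fun D => List.Subset.trans (List.subset_cons_self _ _) (ih _)

theorem Fits.full_lt {E : List (ℕ × ℕ)} : ∀ {L : List (ℕ × ℕ)} {D : List ℕ},
    Fits E L D = true → (∀ j ∈ D, j < 50) → ∀ j ∈ full L D, j < 50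
  | [], _, _, hD => hD
  | (k, q) :: L, D, h, hD => by
    simp only [Fits, Bool.and_eq_true, decide_eq_true_eq] at h
    exact Fits.full_lt (L := L) (D := k :: D) h.2 (List.forall_mem_cons.2 ⟨h.1.1.2, hD⟩)

theorem Fits.notMem {E : List (ℕ × ℕ)} : ∀ {L : List (ℕ × ℕ)} {D : List ℕ},
    Fits E L D = true → ∀ a ∈ L, a.1 ∉ D ∧ a.1 < 50
  | [], _, _ => by simp
  | (k, q) :: L, D, h => by
    simp only [Fits, Bool.and_eq_true, decide_eq_true_eq] at h
    intro a ha
    rw [List.mem_cons] at ha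
    rcases ha with rfl | ha
    · exact ⟨h.1.1.1.1.1, h.1.1.2⟩
    · have := Fits.notMem h.2 a ha
      exact ⟨fun h' => this.1 (List.mem_cons_of_mem _ h'), this.2⟩

theorem stores_checkAll (E : List (ℕ × ℕ)) (k : ℕ) (D : List ℕ) (a : ℕ) :
    (checkAll E k D).stores a = false := by
  induction D with
  | nil => rfl
  | cons j D ih =>
    simp only [checkAll, stores, ih, stores_ifEq]
    split_ifs <;> rfl

theorem writes_checkAll (E : List (ℕ × ℕ)) (k : ℕ) (D : List ℕ) {y : ℕ} (hy : y < 21 ∨ 26 < y) :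
    (checkAll E k D).writes y = false := by
  induction D with
  | nil => rfl
  | cons j D ih =>
    simp only [checkAll, writes, ih, writes_ifEq]
    split_ifs
    · simp [checkEdge, writes, writes_countNbr, tick, writes_ifEq]; omega
    · simp [writes]; omega

theorem stores_check (E : List (ℕ × ℕ)) (k : ℕ) (D : List ℕ) (a : ℕ) :
    (check E k D).stores a = false := by
  simp [check, stores, stores_checkAll]

theorem writes_check (E : List (ℕ × ℕ)) (k : ℕ) (D : List ℕ) {y : ℕ} (hy : y < 21 ∨ 26 < y) :
    (check E k D).writes y = false := by
  simp [check, writes, writes_checkAll E k D hy]; omega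

theorem stores_search (E : List (ℕ × ℕ)) (L : List (ℕ × ℕ)) :
    ∀ (D : List ℕ) (a : ℕ), (search E L D).stores a = false := by
  induction L with
  | nil => exact fun _ _ => rfl
  | cons b L ih => intro D a; simp [search, stores_nbrLoop, stores, stores_check, ih]

theorem writes_search (E : List (ℕ × ℕ)) (L : List (ℕ × ℕ)) :
    ∀ (D : List ℕ) {y : ℕ}, (y < 20 ∨ 27 < y) →
      (∀ a ∈ L, y ≠ 100 + a.1 ∧ y ≠ 200 + 2 * a.1 ∧ y ≠ 200 + 2 * a.1 + 1) →
      (search E L D).writes y = false := by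
  induction L with
  | nil => intro D y hy _; simp [search, writes]; omega
  | cons b L ih =>
    intro D y hy h
    simp only [search, writes_nbrLoop, writes, writes_check E b.1 D (y := y) (by omega),
      ih (b.1 :: D) hy (fun a ha => h a (List.mem_cons_of_mem _ ha)), Bool.or_eq_false_iff,
      beq_eq_false_iff_ne]
    have := h b List.mem_cons_self
    refine ⟨⟨?_, ?_⟩, ?_, ⟨?_, ?_⟩, ?_⟩ <;> first | rfl | omega | trivial

variable {Δ n : ℕ} {G : SimpleGraph (Fin n)} [DecidableRel G.Adj]

/-- There is no adjacency matrix, so adjacency is decided by scanning a list of at most five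
neighbours. -/
theorem checkEdge_spec {s : State} (rep : Rep Δ G s) (h5 : ∀ v, G.degree v ≤ 5) {a b : ℕ}
    {v w : Fin n} (ha : s.reg a = v) (hb : s.reg b = w) (hA : 26 < a) (hB : 26 < b) :
    ((checkEdge a b).denote s).reg 22 = if G.Adj w v then s.reg 22 else 0 := by
  have hc := countNbr_spec rep hb (b := .five) (h5 w) (c := 21) (x := 24) (j := 25)
    (p := tick 21 (.var 24) (.var a))
    (by simp [nbrOK, tick, writes_ifEq, writes, safe, stores_ifEq, stores]; omega)
    (by omega) (fun a => by simp [tick, stores_ifEq, stores]) (fun w => w = v)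
    (by
      intro w' s' _ _ _ h2 h3
      have : s'.reg a = v := by
        rw [h2 a (by simp [writes_countNbr, tick, writes_ifEq, writes]; omega), ha]
      simp only [tick, denote_ifEq, denote, Exp.eval, h3, this, Fin.val_inj]
      split_ifs <;> simp)
  have h22 := denote_reg (countNbr .five 21 b 24 25 (tick 21 (.var 24) (.var a))) (y := 22)
    (by simp [writes_countNbr, tick, writes_ifEq, writes]) s
  simp only [checkEdge, denote, Exp.eval, hc]
  have hpos : 0 < ((G.neighborFinset w).filter (fun w => w = v)).card ↔ G.Adj w v := by
    rw [Finset.card_pos]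
    constructor
    · rintro ⟨z, hz⟩
      simp only [Finset.mem_filter, SimpleGraph.mem_neighborFinset] at hz
      exact hz.2 ▸ hz.1
    · intro h
      exact ⟨v, by simp [h]⟩
  by_cases h : G.Adj w v
  · rw [if_pos (hpos.2 h), if_pos h, h22]
  · rw [if_neg (mt hpos.1 h), if_neg h]; simp

/-- Register 22 is only ever reset to zero. The third alternative records that it was zero already,
in which case nothing is claimed about compatibility; it is needed for the induction. -/
theorem checkAll_spec (h5 : ∀ v, G.degree v ≤ 5) (E : List (ℕ × ℕ)) (k : ℕ) {g : ℕ → Fin n}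
    (D : List ℕ) : ∀ {s : State}, Rep Δ G s → Holds (k :: D) g s →
    (((checkAll E k D).denote s).reg 22 = s.reg 22 ∧
        ∀ j ∈ D, g k ≠ g j ∧ (Joined E j k → G.Adj (g j) (g k))) ∨
      (((checkAll E k D).denote s).reg 22 = 0 ∧
        ¬ ∀ j ∈ D, g k ≠ g j ∧ (Joined E j k → G.Adj (g j) (g k))) ∨
      s.reg 22 = 0 ∧ ((checkAll E k D).denote s).reg 22 = 0 := by
  induction D with
  | nil => intro s _ _; left; exact ⟨rfl, by simp⟩
  | cons j D ih =>
    intro s rep hg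
    set p := seq (ifEq (.var (100 + k)) (.var (100 + j)) (assign 22 (.lit 0)))
      (if Joined E j k then checkEdge (100 + k) (100 + j) else skip) with hpdef
    have hk : s.reg (100 + k) = g k := hg k (by simp)
    have hj : s.reg (100 + j) = g j := hg j (by simp)
    have hw : ∀ y, y < 21 ∨ 26 < y → p.writes y = false := by
      intro y hy
      have := writes_checkAll E k [j] hy
      simp only [checkAll, writes, Bool.or_false] at this
      simpa [hpdef, writes] using this
    have hst : ∀ a, p.stores a = false := by
      intro a
      have := stores_checkAll E k [j] a
      simp only [checkAll, stores, Bool.or_false] at this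
      simpa [hpdef, stores] using this
    have hrep : Rep Δ G (p.denote s) := rep_denote rep (by
      rw [safe_iff]; exact ⟨hw 0 (by omega), hw 1 (by omega), hst 0, hst 1⟩)
    have hp : (p.denote s).reg 22 =
        if g k ≠ g j ∧ (Joined E j k → G.Adj (g j) (g k)) then s.reg 22 else 0 := by
      simp only [hpdef, denote, denote_ifEq, Exp.eval, hk, hj, Fin.val_inj]
      by_cases hE : Joined E j k
      · simp only [hE, if_true]
        by_cases he : g k = g j
        · rw [if_pos he, checkEdge_spec (rep.setReg (by omega) _) h5 (v := g k) (w := g j)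
            (by simp [hk]; omega) (by simp [hj]; omega) (by omega) (by omega)]
          simp [he]
        · rw [if_neg he, checkEdge_spec rep h5 hk hj (by omega) (by omega)]
          simp [he]
      · simp only [hE, if_false, denote]
        by_cases he : g k = g j <;> simp [he]
    have := ih hrep (s := p.denote s) (by
      intro i hi
      rw [denote_reg p (hw _ (by omega))]
      exact hg i (by simp at hi ⊢; tauto))
    change (((checkAll E k D).denote (p.denote s)).reg 22 = _ ∧ _) ∨
      (((checkAll E k D).denote (p.denote s)).reg 22 = _ ∧ _) ∨ _ ∧
      ((checkAll E k D).denote (p.denote s)).reg 22 = 0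
    rw [hp] at this
    simp only [List.forall_mem_cons]
    by_cases hc : g k ≠ g j ∧ (Joined E j k → G.Adj (g j) (g k))
    · rw [if_pos hc] at this
      tauto
    · rw [if_neg hc] at this
      tauto

theorem check_spec (h5 : ∀ v, G.degree v ≤ 5) (E : List (ℕ × ℕ)) {k : ℕ} {g : ℕ → Fin n}
    {D : List ℕ} {s : State} {W : Set (Fin n)} (hW : ∀ v, v ∈ W ↔ s.arr 3 v = 0) (rep : Rep Δ G s)
    (hg : Holds (k :: D) g s) :
    0 < ((check E k D).denote s).reg 22 ↔
      g k ∈ W ∧ ∀ j ∈ D, g k ≠ g j ∧ (Joined E j k → G.Adj (g j) (g k)) := by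
  have hk : s.reg (100 + k) = g k := hg k (by simp)
  simp only [check, denote, Exp.eval, hk, hW]
  split_ifs with h
  · have := checkAll_spec h5 E k D (s := s.setReg 22 0) (rep.setReg (by omega) _) (g := g) (by
      intro i hi; simp [hg i hi]; omega)
    simp at this
    have h' : s.arr 3 (g k) ≠ 0 := by omega
    simp only [h', false_and, iff_false]
    omega
  · have := checkAll_spec h5 E k D (s := s.setReg 22 1) (rep.setReg (by omega) _) (g := g) (by
      intro i hi; simp [hg i hi]; omega)
    have h' : s.arr 3 (g k) = 0 := by omega
    simp only [State.setReg_reg, if_true, one_ne_zero, false_and, or_false] at this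
    simp only [h', true_and]
    rcases this with ⟨h1, h2⟩ | ⟨h1, h2⟩
    · rw [h1]; simpa using h2
    · rw [h1]; simpa using h2

/-- Depth-first search is complete because each new pattern vertex has an earlier neighbour in the
pattern, so its image is found in the adjacency list of an image already fixed. Once register 27 is
set, nothing more is done, so the registers from 100 on still hold the copy at the end. -/
theorem search_spec (h5 : ∀ v, G.degree v ≤ 5) (E : List (ℕ × ℕ)) (W : Set (Fin n))
    (L : List (ℕ × ℕ)) : ∀ (D : List ℕ) (g : ℕ → Fin n) (s : State), Fits E L D = true →
    (∀ j ∈ D, j < 50) → (∀ v, v ∈ W ↔ s.arr 3 v = 0) → Rep Δ G s → Valid G E W D g → Holds D g s → s.reg 27 = 0 →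
    (((search E L D).denote s).reg 27 = 1 ∧ ∃ g' : ℕ → Fin n, (∀ j ∈ D, g' j = g j) ∧
      Valid G E W (full L D) g' ∧ Holds (full L D) g' ((search E L D).denote s)) ∨
    (((search E L D).denote s).reg 27 = 0 ∧ Holds D g ((search E L D).denote s) ∧
      ∀ g' : ℕ → Fin n, (∀ j ∈ D, g' j = g j) → ¬ Valid G E W (full L D) g') := by
  induction L with
  | nil =>
    intro D g s _ hD _ _ hv hh _
    left
    refine ⟨by simp [search, denote, Exp.eval], g, fun _ _ => rfl, hv, ?_⟩
    intro j hj
    simp [search, denote, full] at hj ⊢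
    rw [if_neg (by omega), hh j hj]
  | cons a L ih =>
    obtain ⟨k, q⟩ := a
    intro D g s hfit hD hW rep hv hh hf
    have hfit' := hfit
    simp only [Fits, Bool.and_eq_true, decide_eq_true_eq] at hfit
    obtain ⟨⟨⟨⟨⟨hkD, hqD⟩, hqk⟩, hk50⟩, hq50⟩, hfitL⟩ := hfit
    have hsub := subset_full L (k :: D)
    set body := ite (.var 27) (.lit 1)
        (seq (assign (100 + k) (.var 20)) (seq (check E k D)
          (ite (.lit 0) (.var 22) (search E L (k :: D)) skip))) skip with hbody
    have hnot := Fits.notMem hfitL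
    have hqk' : q ≠ k := by rintro rfl; exact hkD hqD
    have hok : nbrOK (100 + q) 20 (200 + 2 * k) body = true := by
      have hws : ∀ y, (y < 20 ∨ y = 200 + 2 * k ∨ y = 100 + q) →
          (search E L (k :: D)).writes y = false := by
        intro y hy
        refine writes_search E L _ (by omega) ?_
        intro a ha
        have h1 := hnot a ha
        have h2 : a.1 ≠ k := by rintro h; exact h1.1 (by simp [h])
        have h3 : a.1 ≠ q := by rintro h; exact h1.1 (by simp [h, hqD])
        omega
      have hb : ∀ y, (y < 20 ∨ y = 200 + 2 * k ∨ y = 100 + q) → body.writes y = false := by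
        intro y hy
        simp only [hbody, writes, hws y hy, writes_check E k D (y := y) (by omega),
          Bool.or_false, beq_eq_false_iff_ne]
        omega
      have hs : ∀ a, body.stores a = false := by
        intro a; simp [hbody, stores, stores_check, stores_search]
      simp only [nbrOK, Bool.and_eq_true, bne_iff_ne, decide_eq_true_eq, Bool.not_eq_true',
        safe_iff]
      exact ⟨⟨⟨by omega, hb _ (by omega)⟩, hb _ (by omega)⟩, hb _ (by omega), hb _ (by omega),
        hs _, hs _⟩
    have hq : s.reg (100 + q) = g q := hh q hqD
    -- The invariant: either a copy has been found and is preserved, or no completion sends `k` to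
    -- one of the neighbours tried so far.
    have key := nbrLoop_induction rep hq (c := .five) (h5 (g q)) hok
      (fun T s' => s'.arr = s.arr ∧
        ((s'.reg 27 = 1 ∧ ∃ g' : ℕ → Fin n, (∀ j ∈ D, g' j = g j) ∧
          Valid G E W (full L (k :: D)) g' ∧ Holds (full L (k :: D)) g' s') ∨
        (s'.reg 27 = 0 ∧ Holds D g s' ∧ ∀ g' : ℕ → Fin n, (∀ j ∈ D, g' j = g j) → g' k ∈ T →
          ¬ Valid G E W (full L (k :: D)) g')))
      (by
        intro a b
        refine ⟨rfl, Or.inr ⟨?_, ?_, by simp⟩⟩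
        · simp only [State.setReg_reg]
          rw [if_neg (by omega), if_neg (by omega), hf]
        · intro j hj
          have := hD j hj
          simp only [State.setReg_reg]
          rw [if_neg (by omega), if_neg (by omega), hh j hj])
      (by
        rintro T w s' hwT - hqw rep' hq' ⟨harr, hdisj⟩ l
        have hstore : ∀ a, body.stores a = false := by
          intro a; simp [hbody, stores, stores_check, stores_search]
        refine ⟨?_, ?_⟩
        · ext a i
          simp [denote_arr body (hstore a), harr]
        have hH : ∀ (D' : List ℕ) (g' : ℕ → Fin n) (t : State) (r : ℕ), r < 100 ∨ 200 ≤ r →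
            ∀ l, (∀ j ∈ D', j < 50) → Holds D' g' t → Holds D' g' (t.setReg r l) := by
          intro D' g' t r hr l hD' ht j hj
          have := hD' j hj
          simp only [State.setReg_reg]
          rw [if_neg (by omega), ht j hj]
        have hkD50 : ∀ j ∈ k :: D, j < 50 := by simpa using ⟨hk50, hD⟩
        have hfull50 := Fits.full_lt hfitL hkD50
        simp only [State.setReg_reg, show ¬ (27 : ℕ) = 200 + 2 * k by omega, if_false]
        rcases hdisj with ⟨hd1, g', hg'1, hg'2, hg'3⟩ | ⟨hd0, hd1, hd2⟩
        · left
          have hden : body.denote (s'.setReg 20 w) = s'.setReg 20 w := by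
            simp [hbody, denote, Exp.eval, hd1]
          rw [hden]
          refine ⟨by simp [hd1], g', hg'1, hg'2, ?_⟩
          exact hH _ _ _ _ (by omega) _ hfull50 (hH _ _ _ _ (by omega) _ hfull50 hg'3)
        -- The candidate `w` becomes the image of `k`; the rest of the pattern is searched for only
        -- if this extension passes the check.
        · set g1 := Function.update g k w with hg1
          have hg1D : ∀ j ∈ D, g1 j = g j := by
            intro j hj
            rw [hg1, Function.update_of_ne]
            rintro rfl; exact hkD hj
          have hg1k : g1 k = w := by simp [hg1]
          set t0 := (s'.setReg 20 w).setReg (100 + k) w with ht0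
          have hrep0 : Rep Δ G t0 := (rep'.setReg (by omega) _).setReg (by omega) _
          have hholds0 : Holds (k :: D) g1 t0 := by
            intro j hj
            rw [List.mem_cons] at hj
            rcases hj with rfl | hj
            · simp [ht0, hg1k]
            · have hjk : j ≠ k := by rintro rfl; exact hkD hj
              have := hD j hj
              simp only [ht0, State.setReg_reg]
              rw [if_neg (by omega), if_neg (by omega), hd1 j hj, hg1D j hj]
          set t1 := (check E k D).denote t0 with ht1
          have hden : body.denote (s'.setReg 20 w) =
              if 0 < t1.reg 22 then (search E L (k :: D)).denote t1 else t1 := by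
            simp [hbody, denote, Exp.eval, hd0, ht1, ht0]
          have harr0 : t0.arr 3 = s.arr 3 := by simp [ht0, harr]
          have hchk := check_spec h5 E (k := k) (D := D) (W := W) (g := g1) (s := t0)
            (by simpa [harr0] using hW) hrep0 hholds0
          have hrep1 : Rep Δ G t1 := rep_denote hrep0 (by
            rw [safe_iff]
            exact ⟨writes_check _ _ _ (by omega), writes_check _ _ _ (by omega),
              stores_check _ _ _ _, stores_check _ _ _ _⟩)
          have hholds1 : Holds (k :: D) g1 t1 := by
            intro j hj
            rw [ht1, denote_reg _ (writes_check _ _ _ (by omega)), hholds0 j hj]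
          have h27 : t1.reg 27 = 0 := by
            rw [ht1, denote_reg _ (writes_check _ _ _ (by omega)), ht0]
            simp only [State.setReg_reg]
            rw [if_neg (by omega), if_neg (by omega), hd0]
          have hvg1 : Valid G E W D g1 := hv.congr hg1D
          have hiff : Valid G E W (k :: D) g1 ↔ 0 < t1.reg 22 := by
            rw [hchk, valid_cons hkD]
            exact ⟨fun h => h.2, fun h => ⟨hvg1, h⟩⟩
          rw [hden]
          by_cases hpos : 0 < t1.reg 22
          · rw [if_pos hpos]
            have := ih (k :: D) g1 t1 hfitL hkD50 (by
              rw [ht1, denote_arr _ (stores_check _ _ _ _), harr0]; exact hW) hrep1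
              (hiff.2 hpos) hholds1 h27
            rcases this with ⟨h1, g', h2, h3, h4⟩ | ⟨h1, h2, h3⟩
            · left
              refine ⟨h1, g', fun j hj => ?_, h3, hH _ _ _ _ (by omega) _ hfull50 h4⟩
              rw [h2 j (by simp [hj]), hg1D j hj]
            · right
              refine ⟨h1, hH _ _ _ _ (by omega) _ hD ?_, ?_⟩
              · intro j hj
                rw [h2 j (by simp [hj]), hg1D j hj]
              · intro g' hg' hk' hvalid
                rw [Finset.mem_insert] at hk'
                rcases hk' with hk' | hk'
                · refine h3 g' ?_ hvalid
                  intro j hj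
                  rw [List.mem_cons] at hj
                  rcases hj with rfl | hj
                  · rw [hk', hg1k]
                  · rw [hg' j hj, hg1D j hj]
                · exact hd2 g' hg' hk' hvalid
          · rw [if_neg hpos]
            right
            refine ⟨h27, hH _ _ _ _ (by omega) _ hD ?_, ?_⟩
            · intro j hj
              rw [hholds1 j (by simp [hj]), hg1D j hj]
            · intro g' hg' hk' hvalid
              rw [Finset.mem_insert] at hk'
              rcases hk' with hk' | hk'
              · refine hpos (hiff.1 ?_)
                refine (hvalid.mono hsub le_rfl).congr ?_
                intro j hj
                rw [List.mem_cons] at hj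
                rcases hj with rfl | hj
                · rw [hk', hg1k]
                · rw [hg' j hj, hg1D j hj]
              · exact hd2 g' hg' hk' hvalid)
    obtain ⟨-, h | ⟨h1, h2, h3⟩⟩ := key
    · exact Or.inl h
    -- All candidates have been tried, since every completion maps `k` to a neighbour of the image
    -- of `q`.
    · refine Or.inr ⟨h1, h2, fun g' hg' hvg => h3 g' hg' ?_ hvg⟩
      rw [SimpleGraph.mem_neighborFinset, ← hg' q hqD]
      exact (hvg.2 q (hsub (by simp [hqD])) k (hsub (by simp)) hqk').2 hqk

end Stmt

end RAM

/-! ### Vertex statuses and the search for patterns at all vertices -/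

namespace RAM

/-- The status of the vertices, kept in array 3. -/
def State.status (n : ℕ) (s : State) (v : Fin n) : ℕ := s.arr 3 v

/-- The status of the free vertices in `N[X]` becomes 2. -/
def consume {n : ℕ} (G : SimpleGraph (Fin n)) [DecidableRel G.Adj] (X : Finset (Fin n))
    (st : Fin n → ℕ) (w : Fin n) : ℕ :=
  if st w = 0 ∧ ∃ v ∈ X, w = v ∨ G.Adj v w then 2 else st w

namespace Stmt

variable {Δ n : ℕ} {G : SimpleGraph (Fin n)}

/-- Run `p` for every vertex, held in register 2. -/
def vertLoop (p : Stmt) : Stmt := loop 2 .verts (.var 0) p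

/-- The invariant has to survive arbitrary values in the loop counter, because the counter is
advanced after the body. -/
theorem vertLoop_induction {s : State} (rep : Rep Δ G s) {p : Stmt} (h2 : p.writes 2 = false)
    (hp : p.safe = true) (J : ℕ → State → Prop) (h0 : ∀ k l, J 0 ((s.setReg 3 k).setReg 2 l))
    (hs : ∀ (v : Fin n) (s' : State), Rep Δ G s' → s'.reg 2 = v → J v s' →
      ∀ k, J (v + 1) ((p.denote s').setReg 2 k)) :
    J n ((vertLoop p).denote s) := by
  have := loop_induction (x := 2) (c := .verts) (k := .var 0) (p := p) h2 (s := s) (m := n)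
    (by simp [Exp.eval, Cap.val, rep.reg_zero]) (fun j s' => Rep Δ G s' ∧ J j s')
    ⟨(rep.setReg (by omega) _).setReg (by omega) _, h0 _ _⟩
    (fun j s' hj hx h => ⟨(rep_denote h.1 hp).setReg (by omega) _,
      hs ⟨j, hj⟩ s' h.1 hx h.2 _⟩)
  exact this.2

variable [DecidableRel G.Adj]

/-- Give status 2 to the vertex in register `r` and its neighbours, as far as they have
status 0. -/
def markNbhd (c : Cap) (r : ℕ) : Stmt :=
  seq (ite (.get 3 (.var r)) (.lit 1) (store 3 (.var r) (.lit 2)) skip)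
    (nbrLoop c r 28 29 (ite (.get 3 (.var 28)) (.lit 1) (store 3 (.var 28) (.lit 2)) skip))

theorem writes_markNbhd (c : Cap) (r y : ℕ) (hy : y < 28 ∨ 30 < y) :
    (markNbhd c r).writes y = false := by
  simp [markNbhd, writes, writes_nbrLoop]; omega

theorem stores_markNbhd (c : Cap) (r a : ℕ) (ha : a ≠ 3) : (markNbhd c r).stores a = false := by
  simp [markNbhd, stores, stores_nbrLoop, ha]

theorem safe_markNbhd (c : Cap) (r : ℕ) : (markNbhd c r).safe = true := by
  rw [safe_iff]
  exact ⟨writes_markNbhd _ _ _ (by omega), writes_markNbhd _ _ _ (by omega),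
    stores_markNbhd _ _ _ (by omega), stores_markNbhd _ _ _ (by omega)⟩

theorem markNbhd_spec {s : State} (rep : Rep Δ G s) {c : Cap} {r : ℕ} {v : Fin n}
    (hr : s.reg r = v) (hr' : r < 28 ∨ 30 < r) (hdeg : G.degree v ≤ c.val Δ n) :
    ((markNbhd c r).denote s).status n = consume G {v} (s.status n) := by
  set s1 := (ite (.get 3 (.var r)) (.lit 1) (store 3 (.var r) (.lit 2)) skip).denote s with hs1
  have h1 : ∀ w : Fin n, s1.arr 3 w = if s.arr 3 w = 0 ∧ w = v then 2 else s.arr 3 w := by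
    intro w
    simp only [hs1, denote, Exp.eval, hr]
    by_cases h : s.arr 3 v < 1
    · rw [if_pos h]
      simp only [State.setArr_arr, Fin.val_inj, true_and]
      by_cases hw : w = v
      · subst hw; simp [show s.arr 3 w = 0 by omega]
      · simp [hw]
    · rw [if_neg h]
      by_cases hw : w = v
      · subst hw; rw [if_neg (by omega)]
      · simp [hw]
  have hr1 : s1.reg = s.reg := by
    simp only [hs1, denote]; split_ifs <;> rfl
  have hrep1 : Rep Δ G s1 := by
    refine rep.congr (by rw [hr1]) (by rw [hr1]) ?_ ?_ <;>
    · ext i; simp only [hs1, denote]; split_ifs <;> simp [State.setArr_arr]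
  have key := nbrLoop_induction hrep1 (u := r) (v := v) (by rw [hr1, hr]) hdeg (x := 28) (j := 29)
    (p := ite (.get 3 (.var 28)) (.lit 1) (store 3 (.var 28) (.lit 2)) skip)
    (by simp [nbrOK, writes, safe, stores]; omega)
    (fun T s' => ∀ w : Fin n, s'.arr 3 w = if s.arr 3 w = 0 ∧ (w = v ∨ w ∈ T) then 2
      else s.arr 3 w)
    (by intro k l w; simp [h1])
    (by
      rintro T u s' hT - - - - hI k w
      simp only [denote, Exp.eval, State.setReg_reg, if_true, State.setReg_arr,
        apply_ite State.arr, Finset.mem_insert]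
      have hw := hI w
      have hu := hI u
      by_cases hwu : w = u
      · subst hwu
        split_ifs with h <;> (try simp [State.setArr_arr]) <;> grind
      · split_ifs with h <;> (try simp [State.setArr_arr, Fin.val_inj, hwu]) <;> grind)
  ext w
  simp only [consume, State.status, Finset.mem_singleton, exists_eq_left]
  have := key w
  simp only [SimpleGraph.mem_neighborFinset] at this
  exact this

/-- Vertices of status 2 are never changed back, so neighbourhoods can be consumed one after the
other in any order. -/
theorem consume_union [DecidableEq (Fin n)] (X Y : Finset (Fin n)) (st : Fin n → ℕ) :
    consume G Y (consume G X st) = consume G (X ∪ Y) st := by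
  ext w
  simp only [consume, Finset.mem_union]
  by_cases h0 : st w = 0 <;> by_cases hX : ∃ v ∈ X, w = v ∨ G.Adj v w <;>
    by_cases hY : ∃ v ∈ Y, w = v ∨ G.Adj v w <;> simp [h0, hX, hY] <;> grind

/-- `markNbhd` for all listed vertices of a pattern. -/
def markNbhds : List ℕ → Stmt
  | [] => skip
  | i :: D => seq (markNbhd .five (100 + i)) (markNbhds D)

/-- Give the status `c` to all listed vertices of a pattern. -/
def markAll (c : ℕ) : List ℕ → Stmt
  | [] => skip
  | i :: D => seq (store 3 (.var (100 + i)) (.lit c)) (markAll c D)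

/-- The program only modifies array 3 and auxiliary registers. -/
def Marks (p : Stmt) : Prop :=
  (∀ y, y < 28 ∨ 30 < y → p.writes y = false) ∧ ∀ a, a ≠ 3 → p.stores a = false

theorem marks_markNbhds (D : List ℕ) : Marks (markNbhds D) := by
  induction D with
  | nil => exact ⟨fun _ _ => rfl, fun _ _ => rfl⟩
  | cons i D ih =>
    exact ⟨fun y hy => by simp [markNbhds, writes, ih.1 y hy, writes_markNbhd _ _ _ hy],
      fun a ha => by simp [markNbhds, stores, ih.2 a ha, stores_markNbhd _ _ _ ha]⟩

theorem marks_markAll (c : ℕ) (D : List ℕ) : Marks (markAll c D) := by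
  induction D with
  | nil => exact ⟨fun _ _ => rfl, fun _ _ => rfl⟩
  | cons i D ih =>
    exact ⟨fun y hy => by simp [markAll, writes, ih.1 y hy],
      fun a ha => by simp [markAll, stores, ih.2 a ha, ha]⟩

theorem markNbhds_spec (h5 : ∀ v, G.degree v ≤ 5) {g : ℕ → Fin n} (D : List ℕ) :
    ∀ {s : State}, Rep Δ G s → Holds D g s →
      ((markNbhds D).denote s).status n = consume G (D.toFinset.image g) (s.status n) := by
  induction D with
  | nil => intro s _ _; ext w; simp [markNbhds, denote, consume]
  | cons i D ih =>
    intro s rep hg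
    simp only [markNbhds, denote]
    rw [ih (rep_denote rep (safe_markNbhd _ _)),
      markNbhd_spec rep (hg i (by simp)) (by omega) (h5 _), consume_union]
    · congr 1
      ext w; simp [Finset.mem_image]
    · intro j hj
      rw [denote_reg _ (writes_markNbhd _ _ _ (by omega))]
      exact hg j (by simp [hj])

theorem markAll_spec (c : ℕ) {g : ℕ → Fin n} (D : List ℕ) :
    ∀ {s : State}, Holds D g s → ((markAll c D).denote s).status n =
      fun w => if ∃ i ∈ D, g i = w then c else s.status n w := by
  induction D with
  | nil => intro s _; ext w; simp [markAll, denote]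
  | cons i D ih =>
    intro s hg
    simp only [markAll, denote, Exp.eval]
    rw [ih (fun j hj => by rw [State.setArr_reg]; exact hg j (by simp [hj]))]
    ext w
    simp only [State.status, State.setArr_arr, hg i (by simp), List.mem_cons, true_and, Fin.val_inj]
    simp only [eq_comm (a := w)]
    by_cases h : ∃ j ∈ D, g j = w <;> by_cases hw : g i = w <;> simp [h, hw]

/-- For every vertex `v` of status 0, search for a copy of the pattern on vertices of status 0 in
which `v` is the vertex 0, and run `act` if one is found. -/
def searchPhase (E L : List (ℕ × ℕ)) (act : Stmt) : Stmt :=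
  vertLoop (ite (.get 3 (.var 2)) (.lit 1)
    (seq (assign 100 (.var 2)) (seq (assign 27 (.lit 0)) (seq (search E L [0])
      (ite (.lit 0) (.var 27) act skip)))) skip)

theorem stores_searchPhase (E L : List (ℕ × ℕ)) {act : Stmt} (hact : Marks act) {a : ℕ}
    (ha : a ≠ 3) : (searchPhase E L act).stores a = false := by
  simp [searchPhase, vertLoop, stores, stores_search, hact.2 a ha]

theorem writes_searchPhase {E L : List (ℕ × ℕ)} {act : Stmt} (hact : Marks act) {y : ℕ}
    (hy : y < 2) : (searchPhase E L act).writes y = false := by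
  simp [searchPhase, vertLoop, writes, hact.1 y (by omega)]
  rw [writes_search _ _ _ (by omega) (by intros; omega)]
  simp; omega

/-- One pass over the vertices suffices: vertices never return to status 0, so no new copies arise,
and after a vertex has been treated either no copy was rooted at it or the vertex itself has lost
status 0, by `hroot`. The predicate `I` carries whatever the update of the statuses is to preserve.
-/
theorem searchPhase_spec (h5 : ∀ v, G.degree v ≤ 5) {E L : List (ℕ × ℕ)} {act : Stmt}
    (hfit : Fits E L [0] = true) (hact : Marks act) (upd : (ℕ → Fin n) → (Fin n → ℕ) → Fin n → ℕ)
    (hupd : ∀ g (s : State), Rep Δ G s → Holds (full L [0]) g s →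
      (act.denote s).status n = upd g (s.status n))
    (hzero : ∀ g st w, upd g st w = 0 → st w = 0)
    (hroot : ∀ g st, Valid G E {w | st w = 0} (full L [0]) g → upd g st (g 0) ≠ 0)
    (I : (Fin n → ℕ) → Prop)
    (hI : ∀ g st, I st → Valid G E {w | st w = 0} (full L [0]) g → I (upd g st))
    {s : State} (rep : Rep Δ G s) (hs : I (s.status n)) :
    I (((searchPhase E L act).denote s).status n) ∧
      ∀ g, ¬ Valid G E {w | ((searchPhase E L act).denote s).status n w = 0} (full L [0]) g := by
  set body := ite (.get 3 (.var 2)) (.lit 1)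
    (seq (assign 100 (.var 2)) (seq (assign 27 (.lit 0)) (seq (search E L [0])
      (ite (.lit 0) (.var 27) act skip)))) skip with hbody
  have hws : ∀ y < 20, (search E L [0]).writes y = false := fun y hy =>
    writes_search _ _ _ (by omega) (by intros; omega)
  have hw : ∀ y < 20, body.writes y = false := by
    intro y hy
    simp [hbody, writes, hws y hy, hact.1 y (by omega)]; omega
  have hsafe : body.safe = true := by
    rw [safe_iff]
    refine ⟨hw _ (by omega), hw _ (by omega), ?_, ?_⟩ <;>
    simp [hbody, stores, stores_search, hact.2]
  have key := vertLoop_induction rep (p := body) (hw 2 (by omega)) hsafe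
    (fun j s' => I (s'.status n) ∧ ∀ g : ℕ → Fin n, (g 0 : ℕ) < j →
      ¬ Valid G E {w | s'.status n w = 0} (full L [0]) g)
    (fun k l => ⟨hs, by simp⟩)
    (by
      rintro v s' rep' hv ⟨hI', hno⟩ k
      change I ((body.denote s').status n) ∧ ∀ g : ℕ → Fin n, (g 0 : ℕ) < (v : ℕ) + 1 →
        ¬ Valid G E {w | (body.denote s').status n w = 0} (full L [0]) g
      have h0full : 0 ∈ full L [0] := subset_full L [0] (by simp)
      by_cases hst : s'.status n v = 0
      · set t := (s'.setReg 100 v).setReg 27 0 with ht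
        have hdb : body.denote s' = if 0 < ((search E L [0]).denote t).reg 27 then
            act.denote ((search E L [0]).denote t) else (search E L [0]).denote t := by
          have : s'.arr 3 v < 1 := by simpa [State.status] using hst
          simp [hbody, denote, Exp.eval, hv, this, ht]
        have hrept : Rep Δ G t := (rep'.setReg (by omega) _).setReg (by omega) _
        have hrep2 : Rep Δ G ((search E L [0]).denote t) := rep_denote hrept (by
          rw [safe_iff]
          exact ⟨hws _ (by omega), hws _ (by omega), stores_search _ _ _ _, stores_search _ _ _ _⟩)
        have hstat : ((search E L [0]).denote t).status n = s'.status n := by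
          ext w
          simp [State.status, denote_arr _ (stores_search _ _ _ _), ht]
        have := search_spec h5 E {w | s'.status n w = 0} L [0] (fun _ => v) t hfit (by simp)
          (by intro w; rfl) hrept ⟨by simp [hst], by simp⟩ (by simp [Holds, ht]) (by simp [ht])
        rcases this with ⟨h1, g, h2, h3, h4⟩ | ⟨h1, h2, h3⟩
        · rw [hdb, if_pos (by omega), hupd g _ hrep2 h4, hstat]
          have hg0 : g 0 = v := h2 0 (by simp)
          refine ⟨hI g _ hI' h3, fun g' hg' hval => ?_⟩
          rcases Nat.lt_succ_iff_lt_or_eq.1 hg' with h | h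
          · exact hno g' h (hval.mono (List.Subset.refl _) fun w hw => hzero _ _ _ hw)
          -- A copy rooted at `v` itself cannot survive, as `v` has just lost status 0.
          · have hr := hroot g _ h3
            rw [hg0] at hr
            refine hr ?_
            have := hval.1 0 h0full
            rwa [Fin.ext h] at this
        · rw [hdb, if_neg (by omega), hstat]
          refine ⟨hI', fun g' hg' => ?_⟩
          rcases Nat.lt_succ_iff_lt_or_eq.1 hg' with h | h
          · exact hno g' h
          · exact h3 g' (by simpa using Fin.ext h)
      · have hdb : body.denote s' = s' := by
          have : ¬ s'.arr 3 v < 1 := by simpa [State.status] using hst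
          simp [hbody, denote, Exp.eval, hv, this]
        rw [hdb]
        refine ⟨hI', fun g' hg' hval => ?_⟩
        rcases Nat.lt_succ_iff_lt_or_eq.1 hg' with h | h
        · exact hno g' h hval
        · have := hval.1 0 h0full
          rw [Fin.ext h] at this
          exact hst this)
  exact ⟨key.1, fun g => key.2 g (g 0).isLt⟩

end Stmt

end RAM

/-! ### Timestamps -/

namespace RAM

section

variable {n : ℕ} (G : SimpleGraph (Fin n)) [DecidableRel G.Adj]

/-- The neighbours of `v` that have status 0. -/
def freeNbrs (st : Fin n → ℕ) (v : Fin n) : Finset (Fin n) :=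
  (G.neighborFinset v).filter fun u => st u = 0

/-- The number of neighbours of `u` in `X`. -/
def degIn (X : Finset (Fin n)) (u : Fin n) : ℕ := ((G.neighborFinset u).filter (· ∈ X)).card

end

namespace Stmt

variable {Δ n : ℕ} {G : SimpleGraph (Fin n)} [DecidableRel G.Adj]

/-- Stamp the neighbours of status 0 of the vertex in register 2 in array `a` and count them in
register 10. -/
def stampNbrs (a : ℕ) : Stmt :=
  seq (assign 10 (.lit 0)) (nbrLoop .deg 2 12 13 (ite (.get 3 (.var 12)) (.lit 1)
    (seq (store a (.var 12) (.add (.var 2) (.lit 1))) (assign 10 (.add (.var 10) (.lit 1)))) skip))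

/-- Count in register 18 the neighbours of the vertex in register 12 that are stamped in
array `a`. -/
def countStamped (a : ℕ) : Stmt :=
  countNbr .deg 18 12 15 16 (tick 18 (.get a (.var 15)) (.add (.var 2) (.lit 1)))

theorem writes_countStamped (a y : ℕ) (hy : y < 15 ∨ 18 < y) :
    (countStamped a).writes y = false := by
  simp [countStamped, writes_countNbr, tick, writes_ifEq, writes]; omega

theorem stores_countStamped (a b : ℕ) : (countStamped a).stores b = false := by
  simp [countStamped, stores_countNbr, tick, stores_ifEq, stores]

/-- A set of neighbours of `v` is stored by stamping its members with `v + 1`. Membership is then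
tested in constant time, and the array never has to be cleared between vertices. -/
theorem countStamped_spec (hΔ : ∀ v, G.degree v ≤ Δ) {s : State} (rep : Rep Δ G s) {u v : Fin n}
    (hu : s.reg 12 = u) (hv : s.reg 2 = v) (a : ℕ) {X : Finset (Fin n)}
    (hX : ∀ w : Fin n, s.arr a w = v + 1 ↔ w ∈ X) :
    ((countStamped a).denote s).reg 18 = degIn G X u := by
  refine countNbr_spec rep hu (b := .deg) (hΔ u) (by
    simp [nbrOK, tick, writes_ifEq, writes, safe, stores_ifEq, stores]) (by simp)
    (fun b => by simp [tick, stores_ifEq, stores]) (· ∈ X) ?_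
  intro w s' _ harr _ hreg hw
  have h2 := hreg 2 (by simp [writes_countNbr, tick, writes_ifEq, writes])
  simp only [tick, denote_ifEq, Exp.eval, hw, h2, hv, harr, hX, denote]
  split_ifs <;> simp

theorem stampNbrs_spec (hΔ : ∀ v, G.degree v ≤ Δ) {s : State} (rep : Rep Δ G s) {v : Fin n}
    (hv : s.reg 2 = v) {a : ℕ} (ha : 4 ≤ a) :
    (∀ w : Fin n, ((stampNbrs a).denote s).arr a w =
      if w ∈ freeNbrs G (s.status n) v then (v : ℕ) + 1 else s.arr a w) ∧
    ((stampNbrs a).denote s).reg 10 = (freeNbrs G (s.status n) v).card := by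
  have key := nbrLoop_induction (rep.setReg (x := 10) (by omega) 0) (u := 2) (v := v) (c := .deg)
    (by simp [hv]) (hΔ v) (x := 12) (j := 13)
    (p := ite (.get 3 (.var 12)) (.lit 1) (seq (store a (.var 12) (.add (.var 2) (.lit 1)))
      (assign 10 (.add (.var 10) (.lit 1)))) skip)
    (by simp [nbrOK, writes, safe, stores]; omega)
    (fun T s' => s'.arr 3 = s.arr 3 ∧ (∀ w : Fin n, s'.arr a w =
      if w ∈ T.filter (fun u => s.status n u = 0) then (v : ℕ) + 1 else s.arr a w) ∧
      s'.reg 10 = (T.filter (fun u => s.status n u = 0)).card)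
    (by intro k l; simp)
    (by
      rintro T w s' hwT - - - h2 ⟨h3, hI, h10⟩ k
      have h3a : ¬ 3 = a := by omega
      simp only [denote, Exp.eval, State.setReg_reg, State.setReg_arr, h3, if_true,
        Finset.filter_insert]
      by_cases hst : s.status n w = 0
      · have hst' : s.arr 3 w < 1 := by simpa [State.status] using hst
        rw [if_pos hst', if_pos hst]
        refine ⟨?_, ?_, ?_⟩
        · ext i; simp [State.setArr_arr, h3a, h3]
        · intro z
          simp only [State.setReg_arr, State.setArr_arr, Finset.mem_insert, h2]
          have := hI z
          by_cases hz : z = w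
          · simp [hz]
          · simp [Fin.val_inj, hz, this]
        · rw [Finset.card_insert_of_notMem (by simp [hwT])]
          simp [State.setArr_reg, h10]
      · have hst' : ¬ s.arr 3 w < 1 := by simpa [State.status] using hst
        rw [if_neg hst', if_neg hst]
        exact ⟨h3, hI, by simpa using h10⟩)
  exact key.2

/-! ### Removing pairs of intersecting cliques -/

/-- Count in register 11 the neighbours of status 0 of the vertex in register 2 that are adjacent
to all others. -/
def countUniversal : Stmt :=
  countNbr .deg 11 2 12 13 (ite (.get 3 (.var 12)) (.lit 1) (seq (countStamped 4)
    (ite (.add (.var 18) (.lit 1)) (.var 1) skip (assign 11 (.add (.var 11) (.lit 1))))) skip)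

/-- Consume the closed neighbourhoods of the free neighbours that are not adjacent to all
others. -/
def consumeOthers : Stmt :=
  nbrLoop .deg 2 12 13 (ifEq (.get 4 (.var 12)) (.add (.var 2) (.lit 1)) (seq (countStamped 4)
    (ite (.add (.var 18) (.lit 1)) (.var 1) (markNbhd .deg 12) skip)))

/-- Treat the vertex in register 2. -/
def pairBody : Stmt :=
  ite (.get 3 (.var 2)) (.lit 1) (seq (stampNbrs 4) (seq countUniversal
    (ite (.var 10) (.var 1) skip (ite (.add (.var 11) (.lit 2)) (.var 1) skip consumeOthers)))) skip

/-- Remove intersecting cliques. -/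
def pairPhase : Stmt := vertLoop pairBody

end Stmt

section

variable {n : ℕ} (Δ : ℕ) (G : SimpleGraph (Fin n)) [DecidableRel G.Adj]

/-- The free neighbours of `v` that are adjacent to fewer than `Δ - 1` others. -/
def defective (st : Fin n → ℕ) (v : Fin n) : Finset (Fin n) :=
  (freeNbrs G st v).filter fun u => degIn G (freeNbrs G st v) u + 1 < Δ

/-- The test that detects two intersecting cliques. -/
def PairTest (st : Fin n → ℕ) (v : Fin n) : Prop :=
  Δ ≤ (freeNbrs G st v).card ∧
    Δ ≤ ((freeNbrs G st v).filter fun u => ¬ degIn G (freeNbrs G st v) u + 1 < Δ).card + 2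

instance (st : Fin n → ℕ) (v : Fin n) : Decidable (PairTest Δ G st v) := instDecidableAnd

end

namespace Stmt

variable {Δ n : ℕ} {G : SimpleGraph (Fin n)} [DecidableRel G.Adj]

theorem countUniversal_spec (hΔ : ∀ v, G.degree v ≤ Δ) {s : State} (rep : Rep Δ G s) {v : Fin n}
    (hv : s.reg 2 = v) {X : Finset (Fin n)} (hX : ∀ w : Fin n, s.arr 4 w = v + 1 ↔ w ∈ X) :
    (countUniversal.denote s).reg 11 =
      ((freeNbrs G (s.status n) v).filter fun u => ¬ degIn G X u + 1 < Δ).card := by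
  rw [freeNbrs, Finset.filter_filter]
  refine countNbr_spec rep hv (b := .deg) (hΔ v) rfl (by simp)
    (fun b => by simp [stores, stores_countStamped]) _ ?_
  intro w s' _ harr hrep hreg hw
  have h2 := hreg 2 rfl
  have h11 := denote_reg (countStamped 4) (y := 11) (writes_countStamped _ _ (by omega)) s'
  have h1 := denote_reg (countStamped 4) (y := 1) (writes_countStamped _ _ (by omega)) s'
  simp only [denote, Exp.eval, hw, harr, countStamped_spec hΔ hrep hw (h2.trans hv) 4
    (X := X) (by rw [harr]; exact hX), h1, hrep.reg_one]
  by_cases h0 : s.status n w = 0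
  · have h0' : s.arr 3 w < 1 := by simpa [State.status] using h0
    simp only [h0', if_true, h0, true_and]
    by_cases hd : degIn G X w + 1 < Δ <;> simp [hd, h11]
  · have h0' : ¬ s.arr 3 w < 1 := by simpa [State.status] using h0
    simp [h0', h0]

theorem consumeOthers_spec (hΔ : ∀ v, G.degree v ≤ Δ) {s : State} (rep : Rep Δ G s) {v : Fin n}
    (hv : s.reg 2 = v) {X : Finset (Fin n)} (hX : ∀ w : Fin n, s.arr 4 w = v + 1 ↔ w ∈ X)
    (hXv : X ⊆ G.neighborFinset v) :
    (consumeOthers.denote s).status n =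
      consume G (X.filter fun u => degIn G X u + 1 < Δ) (s.status n) := by
  have key := nbrLoop_induction rep hv (c := .deg) (hΔ v) (x := 12) (j := 13)
    (p := ifEq (.get 4 (.var 12)) (.add (.var 2) (.lit 1)) (seq (countStamped 4)
      (ite (.add (.var 18) (.lit 1)) (.var 1) (markNbhd .deg 12) skip))) rfl
    (fun T s' => s'.arr 4 = s.arr 4 ∧ s'.status n =
      consume G (T.filter fun u => u ∈ X ∧ degIn G X u + 1 < Δ) (s.status n))
    (by
      intro k l
      refine ⟨rfl, ?_⟩
      ext w; simp [consume, State.status])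
    (by
      rintro T w s' hwT - - hrep h2 ⟨h4, hst⟩ k
      have hrep' := hrep.setReg (x := 12) (by omega) w
      have hcs := countStamped_spec hΔ hrep' (u := w) (v := v) (by simp) (by simp [h2]) 4
        (X := X) (by simpa [h4] using hX)
      set t := (countStamped 4).denote (s'.setReg 12 w) with ht
      have hrept : Rep Δ G t := rep_denote hrep' (by
        rw [safe_iff]
        exact ⟨writes_countStamped _ _ (by omega), writes_countStamped _ _ (by omega),
          stores_countStamped _ _, stores_countStamped _ _⟩)
      have ht12 : t.reg 12 = w := by
        rw [ht, denote_reg _ (writes_countStamped _ _ (by omega))]; simp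
      have htarr : t.arr = s'.arr := by
        ext a i; rw [ht, denote_arr _ (stores_countStamped _ _)]; rfl
      simp only [denote_ifEq, denote, Exp.eval, State.setReg_reg, State.setReg_arr, ← ht, hcs,
        hrept.reg_one, if_true, h2, h4, Finset.filter_insert]
      rw [if_neg (by omega : ¬ (2 : ℕ) = 12)]
      by_cases hwX : w ∈ X
      · rw [if_pos ((hX w).2 hwX)]
        by_cases hd : degIn G X w + 1 < Δ
        · rw [if_pos hd, if_pos ⟨hwX, hd⟩]
          constructor
          · rw [denote_arr _ (stores_markNbhd _ _ _ (by omega)), htarr, h4]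
          · have := markNbhd_spec hrept ht12 (c := .deg) (by omega) (hΔ w)
            rw [show t.status n = s'.status n by ext; simp [State.status, htarr], hst,
              consume_union] at this
            rw [Finset.insert_eq, Finset.union_comm]
            exact this
        · rw [if_neg hd, if_neg (fun h => hd h.2)]
          exact ⟨by rw [htarr, h4], by rw [← hst]; ext; simp [State.status, htarr]⟩
      · rw [if_neg (mt (hX w).1 hwX), if_neg (fun h => hwX h.1)]
        exact ⟨h4, hst⟩)
  have h := key.2
  have hset : ((G.neighborFinset v).filter fun u => u ∈ X ∧ degIn G X u + 1 < Δ) =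
      X.filter fun u => degIn G X u + 1 < Δ := by
    ext u
    simp only [Finset.mem_filter]
    exact ⟨fun h => h.2, fun h => ⟨hXv h.1, h⟩⟩
  rwa [hset] at h

/-- The bound on array 4 says that all stamps come from smaller vertices, which makes the stamp `v +
1` fresh; it is passed on to the next vertex with `v + 1` in place of `v`. -/
theorem pairBody_spec (hΔ : ∀ v, G.degree v ≤ Δ) {s : State} (rep : Rep Δ G s) {v : Fin n}
    (hv : s.reg 2 = v) (h4 : ∀ w : Fin n, s.arr 4 w ≤ v) :
    (∀ w : Fin n, (pairBody.denote s).arr 4 w ≤ v + 1) ∧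
    (s.status n v = 0 → PairTest Δ G (s.status n) v →
      (pairBody.denote s).status n = consume G (defective Δ G (s.status n) v) (s.status n)) ∧
    (¬ (s.status n v = 0 ∧ PairTest Δ G (s.status n) v) →
      (pairBody.denote s).status n = s.status n) := by
  by_cases h0 : s.status n v = 0
  · have h0' : s.arr 3 v < 1 := by simpa [State.status] using h0
    set t := (stampNbrs 4).denote s with ht
    obtain ⟨ha, hb⟩ := stampNbrs_spec hΔ rep hv (a := 4) (by omega)
    rw [← ht] at ha hb
    have hsafe : (stampNbrs 4).safe = true := rfl
    have hrept : Rep Δ G t := rep_denote rep hsafe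
    have hstat : t.status n = s.status n := by
      ext w; rw [State.status, ht, denote_arr _ rfl]; rfl
    have ht2 : t.reg 2 = v := by rw [ht, denote_reg _ rfl, hv]
    -- Old entries are at most `v`, hence differ from the stamp `v + 1`.
    have hX : ∀ w : Fin n, t.arr 4 w = v + 1 ↔ w ∈ freeNbrs G (s.status n) v := by
      intro w
      rw [ha]
      have := h4 w
      split_ifs with h
      · simp [h]
      · simp only [h, iff_false]; omega
    have hu := countUniversal_spec hΔ hrept ht2 hX
    rw [hstat] at hu
    set r := countUniversal.denote t with hr
    have hrarr : r.arr = t.arr := by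
      rw [hr]; exact countNbr_arr (fun b => by simp [stores, stores_countStamped]) _
    have hrepr : Rep Δ G r := rep_denote hrept rfl
    have hr2 : r.reg 2 = v := by rw [hr, denote_reg _ rfl, ht2]
    have hr10 : r.reg 10 = (freeNbrs G (s.status n) v).card := by
      rw [hr, denote_reg _ rfl, hb]
    have hrstat : r.status n = s.status n := by
      rw [← hstat]; ext w; simp [State.status, hrarr]
    have hden : pairBody.denote s = if PairTest Δ G (s.status n) v then consumeOthers.denote r
        else r := by
      simp only [pairBody, denote, Exp.eval, hv, h0', if_true, ← ht, ← hr, hr10, hrepr.reg_one, hu]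
      by_cases hT : PairTest Δ G (s.status n) v
      · rw [if_pos hT]
        obtain ⟨h1, h2⟩ := hT
        rw [if_neg (by omega), if_neg (by omega)]
      · rw [if_neg hT]
        by_cases h1 : (freeNbrs G (s.status n) v).card < Δ
        · rw [if_pos h1]
        · rw [if_neg h1, if_pos]
          by_contra h2
          exact hT ⟨by omega, by omega⟩
    rw [hden]
    have harr4 : ∀ w : Fin n, r.arr 4 w ≤ v + 1 := by
      intro w
      rw [hrarr, ha]
      have := h4 w
      split_ifs <;> omega
    refine ⟨?_, fun _ h => ?_, fun h => ?_⟩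
    · intro w
      split_ifs
      · rw [denote_arr _ rfl]; exact harr4 w
      · exact harr4 w
    · rw [if_pos h, consumeOthers_spec hΔ hrepr hr2 (by rw [hrarr]; exact hX), hrstat]
      · rfl
      · exact Finset.filter_subset _ _
    · rw [if_neg (fun h' => h ⟨h0, h'⟩), hrstat]
  · have h0' : ¬ s.arr 3 v < 1 := by simpa [State.status] using h0
    have hden : pairBody.denote s = s := by
      simp [pairBody, denote, Exp.eval, hv, h0']
    rw [hden]
    exact ⟨fun w => (h4 w).trans (Nat.le_succ _), fun h => absurd h h0, fun _ => rfl⟩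

/-- As in the search for patterns, the bad property can only disappear when statuses change, so
treating each vertex once is enough. The hypothesis `hroot` says that a vertex that passes the test
is not bad once its defective neighbours have been consumed. -/
theorem pairPhase_spec (hΔ : ∀ v, G.degree v ≤ Δ) (I : (Fin n → ℕ) → Prop)
    (hI : ∀ v st, I st → st v = 0 → PairTest Δ G st v → I (consume G (defective Δ G st v) st))
    (Bad : (Fin n → ℕ) → Fin n → Prop)
    (hmono : ∀ st st' v, (∀ w, st' w = 0 → st w = 0) → Bad st' v → Bad st v)
    (hbad : ∀ st v, Bad st v → st v = 0 ∧ PairTest Δ G st v)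
    (hroot : ∀ st v, Bad (consume G (defective Δ G st v) st) v → ¬ PairTest Δ G st v)
    {s : State} (rep : Rep Δ G s) (hs : I (s.status n)) (h4 : ∀ w : Fin n, s.arr 4 w = 0) :
    I ((pairPhase.denote s).status n) ∧ ∀ v, ¬ Bad ((pairPhase.denote s).status n) v := by
  have key := vertLoop_induction rep (p := pairBody) rfl rfl
    (fun j s' => I (s'.status n) ∧ (∀ v : Fin n, (v : ℕ) < j → ¬ Bad (s'.status n) v) ∧
      ∀ w : Fin n, s'.arr 4 w ≤ j)
    (fun k l => ⟨hs, by simp, by simp [h4]⟩)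
    (by
      rintro v s' hrep hv ⟨h1, h2, h3⟩ k
      obtain ⟨ha, hb, hc⟩ := pairBody_spec hΔ hrep hv h3
      change I ((pairBody.denote s').status n) ∧
        (∀ u : Fin n, (u : ℕ) < v + 1 → ¬ Bad ((pairBody.denote s').status n) u) ∧
        ∀ w : Fin n, (pairBody.denote s').arr 4 w ≤ v + 1
      by_cases ht : s'.status n v = 0 ∧ PairTest Δ G (s'.status n) v
      · rw [hb ht.1 ht.2]
        refine ⟨hI v _ h1 ht.1 ht.2, fun u hu hbu => ?_, ha⟩
        rcases Nat.lt_succ_iff_lt_or_eq.1 hu with h | h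
        · refine h2 u h (hmono _ _ _ ?_ hbu)
          intro w
          simp only [consume]
          split_ifs <;> simp_all
        · rw [Fin.ext h] at hbu
          exact hroot _ _ hbu ht.2
      · rw [hc ht]
        refine ⟨h1, fun u hu hbu => ?_, ha⟩
        rcases Nat.lt_succ_iff_lt_or_eq.1 hu with h | h
        · exact h2 u h hbu
        · rw [Fin.ext h] at hbu
          exact ht (hbad _ _ hbu))
  exact ⟨key.1, fun v => key.2.1 v v.isLt⟩

end Stmt

end RAM

/-! ### Detecting cliques -/

namespace RAM

section

variable {n : ℕ} (Δ : ℕ) (G : SimpleGraph (Fin n)) [DecidableRel G.Adj]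

/-- The free neighbours of `v` with at least `Δ - 2` neighbours among the free neighbours. -/
def core (st : Fin n → ℕ) (v : Fin n) : Finset (Fin n) :=
  (freeNbrs G st v).filter fun u => ¬ degIn G (freeNbrs G st v) u + 2 < Δ

/-- The test that detects a clique. -/
def CliqueTest (st : Fin n → ℕ) (v : Fin n) : Prop :=
  (core Δ G st v).card + 1 = Δ ∧
    Δ ≤ ((core Δ G st v).filter fun u => ¬ degIn G (core Δ G st v) u + 2 < Δ).card + 1

instance (st : Fin n → ℕ) (v : Fin n) : Decidable (CliqueTest Δ G st v) := instDecidableAnd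

end

namespace Stmt

variable {Δ n : ℕ} {G : SimpleGraph (Fin n)} [DecidableRel G.Adj]

/-- Stamp the core in array 5 and compute its size in register 11. -/
def stampCore : Stmt :=
  seq (assign 11 (.lit 0)) (nbrLoop .deg 2 12 13 (ite (.get 3 (.var 12)) (.lit 1)
    (seq (countStamped 6) (ite (.add (.var 18) (.lit 2)) (.var 1) skip
      (seq (store 5 (.var 12) (.add (.var 2) (.lit 1)))
        (assign 11 (.add (.var 11) (.lit 1)))))) skip))

/-- Count in register 19 the vertices of the core that are adjacent to all others. -/
def countCore : Stmt :=
  countNbr .deg 19 2 12 13 (ifEq (.get 5 (.var 12)) (.add (.var 2) (.lit 1)) (seq (countStamped 5)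
    (ite (.add (.var 18) (.lit 2)) (.var 1) skip (assign 19 (.add (.var 19) (.lit 1))))))

/-- Give status 4 to the stamped vertices. -/
def markCore : Stmt :=
  seq (seq (store 5 (.var 2) (.add (.var 2) (.lit 1))) (store 3 (.var 2) (.lit 4)))
    (nbrLoop .deg 2 12 13
      (ifEq (.get 5 (.var 12)) (.add (.var 2) (.lit 1)) (store 3 (.var 12) (.lit 4))))

/-- Treat the vertex in register 2. -/
def cliqueBody : Stmt :=
  ite (.get 3 (.var 2)) (.lit 1) (seq (stampNbrs 6) (seq stampCore (seq countCore
    (ite (.add (.var 19) (.lit 1)) (.var 1) skip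
      (ifEq (.add (.var 11) (.lit 1)) (.var 1) markCore))))) skip

/-- Find the cliques. -/
def cliquePhase : Stmt := vertLoop cliqueBody

theorem stampCore_spec (hΔ : ∀ v, G.degree v ≤ Δ) {s : State} (rep : Rep Δ G s) {v : Fin n}
    (hv : s.reg 2 = v) (hX : ∀ w : Fin n, s.arr 6 w = v + 1 ↔ w ∈ freeNbrs G (s.status n) v) :
    (∀ w : Fin n, (stampCore.denote s).arr 5 w =
      if w ∈ core Δ G (s.status n) v then (v : ℕ) + 1 else s.arr 5 w) ∧
    (stampCore.denote s).reg 11 = (core Δ G (s.status n) v).card := by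
  set X := freeNbrs G (s.status n) v with hXdef
  have key := nbrLoop_induction (rep.setReg (x := 11) (by omega) 0) (u := 2) (v := v) (c := .deg)
    (by simp [hv]) (hΔ v) (x := 12) (j := 13)
    (p := ite (.get 3 (.var 12)) (.lit 1)
      (seq (countStamped 6) (ite (.add (.var 18) (.lit 2)) (.var 1) skip
      (seq (store 5 (.var 12) (.add (.var 2) (.lit 1)))
        (assign 11 (.add (.var 11) (.lit 1)))))) skip) rfl
    (fun T s' => s'.arr 3 = s.arr 3 ∧ s'.arr 6 = s.arr 6 ∧ (∀ w : Fin n, s'.arr 5 w =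
      if w ∈ T.filter (fun u => s.status n u = 0 ∧ ¬ degIn G X u + 2 < Δ)
        then (v : ℕ) + 1 else s.arr 5 w) ∧
      s'.reg 11 = (T.filter (fun u => s.status n u = 0 ∧ ¬ degIn G X u + 2 < Δ)).card)
    (by intro k l; simp)
    (by
      rintro T w s' hwT - - hrep h2 ⟨h3, h6, hI, h11⟩ k
      have hrep' := hrep.setReg (x := 12) (by omega) w
      have hcs := countStamped_spec hΔ hrep' (u := w) (v := v) (by simp) (by simp [h2]) 6
        (X := X) (by simpa [h6] using hX)
      set t := (countStamped 6).denote (s'.setReg 12 w) with ht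
      have ht12 : t.reg 12 = w := by
        rw [ht, denote_reg _ (writes_countStamped _ _ (by omega))]; simp
      have ht2 : t.reg 2 = v := by
        rw [ht, denote_reg _ (writes_countStamped _ _ (by omega))]; simp [h2]
      have ht1 : t.reg 1 = Δ := by
        rw [ht, denote_reg _ (writes_countStamped _ _ (by omega))]; simp [hrep.reg_one]
      have ht11 : t.reg 11 = s'.reg 11 := by
        rw [ht, denote_reg _ (writes_countStamped _ _ (by omega))]; simp
      have htarr : t.arr = s'.arr := by
        ext a i; rw [ht, denote_arr _ (stores_countStamped _ _)]; rfl
      simp only [denote, Exp.eval, State.setReg_reg, State.setReg_arr, h3, if_true,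
        Finset.filter_insert, ← ht, hcs, ht1]
      by_cases hst : s.status n w = 0
      · have hst' : s.arr 3 w < 1 := by simpa [State.status] using hst
        rw [if_pos hst']
        by_cases hd : degIn G X w + 2 < Δ
        · rw [if_pos hd, if_neg (fun h => h.2 hd)]
          rw [htarr]
          exact ⟨h3, h6, hI, by simpa [ht11] using h11⟩
        · rw [if_neg hd, if_pos ⟨hst, hd⟩]
          refine ⟨?_, ?_, ?_, ?_⟩
          · ext i; simp [State.setArr_arr, htarr, h3]
          · ext i; simp [State.setArr_arr, htarr, h6]
          · intro z
            simp only [State.setReg_arr, State.setArr_arr, Finset.mem_insert, ht2, ht12, htarr]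
            have := hI z
            by_cases hz : z = w
            · simp [hz]
            · simp [Fin.val_inj, hz, this]
          · rw [Finset.card_insert_of_notMem (by simp [hwT])]
            simp [State.setArr_reg, ht11, h11]
      · have hst' : ¬ s.arr 3 w < 1 := by simpa [State.status] using hst
        rw [if_neg hst', if_neg (fun h => hst h.1)]
        exact ⟨h3, h6, hI, by simpa using h11⟩)
  rw [core, ← hXdef, hXdef, freeNbrs, Finset.filter_filter, ← freeNbrs, ← hXdef]
  exact key.2.2

theorem countCore_spec (hΔ : ∀ v, G.degree v ≤ Δ) {s : State} (rep : Rep Δ G s) {v : Fin n}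
    (hv : s.reg 2 = v) {X : Finset (Fin n)} (hX : ∀ w : Fin n, s.arr 5 w = v + 1 ↔ w ∈ X)
    (hXv : X ⊆ G.neighborFinset v) :
    (countCore.denote s).reg 19 = (X.filter fun u => ¬ degIn G X u + 2 < Δ).card := by
  have hset : (X.filter fun u => ¬ degIn G X u + 2 < Δ) =
      (G.neighborFinset v).filter fun u => u ∈ X ∧ ¬ degIn G X u + 2 < Δ := by
    ext u
    simp only [Finset.mem_filter]
    exact ⟨fun h => ⟨hXv h.1, h⟩, fun h => h.2⟩
  rw [hset]
  refine countNbr_spec rep hv (b := .deg) (hΔ v) rfl (by simp)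
    (fun b => by simp [stores, stores_ifEq, stores_countStamped]) _ ?_
  intro w s' _ harr hrep hreg hw
  have h2 := hreg 2 rfl
  have h11 := denote_reg (countStamped 5) (y := 19) (writes_countStamped _ _ (by omega)) s'
  have h1 := denote_reg (countStamped 5) (y := 1) (writes_countStamped _ _ (by omega)) s'
  simp only [denote, denote_ifEq, Exp.eval, hw, h2, hv, countStamped_spec hΔ hrep hw (h2.trans hv) 5
    (X := X) (by rw [harr]; exact hX), h1, hrep.reg_one]
  by_cases h0 : w ∈ X
  · rw [if_pos (by rw [harr]; exact (hX w).2 h0)]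
    by_cases hd : degIn G X w + 2 < Δ <;> simp [hd, h11, h0]
  · rw [if_neg (by rw [harr]; exact mt (hX w).1 h0)]
    simp [h0]

theorem markCore_spec (hΔ : ∀ v, G.degree v ≤ Δ) {s : State} (rep : Rep Δ G s) {v : Fin n}
    (hv : s.reg 2 = v) {X : Finset (Fin n)} (hX : ∀ w : Fin n, s.arr 5 w = v + 1 ↔ w ∈ X)
    (hXv : X ⊆ G.neighborFinset v) :
    (markCore.denote s).status n = (fun w => if w = v ∨ w ∈ X then 4 else s.status n w) ∧
    ∀ w : Fin n, (markCore.denote s).arr 5 w = if w = v ∨ w ∈ X then (v : ℕ) + 1 else s.arr 5 w := by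
  set s1 := (seq (store 5 (.var 2) (.add (.var 2) (.lit 1))) (store 3 (.var 2) (.lit 4))).denote s
    with hs1
  have hs1r : s1.reg = s.reg := rfl
  have hrep1 : Rep Δ G s1 := rep_denote rep rfl
  have h5 : ∀ w : Fin n, s1.arr 5 w = if w = v then (v : ℕ) + 1 else s.arr 5 w := by
    intro w; simp [hs1, denote, Exp.eval, State.setArr_arr, hv, Fin.val_inj, State.setArr_reg]
  have h3 : ∀ w : Fin n, s1.arr 3 w = if w = v then 4 else s.arr 3 w := by
    intro w; simp [hs1, denote, Exp.eval, State.setArr_arr, hv, Fin.val_inj, State.setArr_reg]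
  have hvX : v ∉ X := fun h => by simpa using hXv h
  have key := nbrLoop_induction hrep1 (u := 2) (v := v) (c := .deg)
    (by rw [hs1r, hv]) (hΔ v) (x := 12) (j := 13)
    (p := ifEq (.get 5 (.var 12)) (.add (.var 2) (.lit 1)) (store 3 (.var 12) (.lit 4))) rfl
    (fun T s' => s'.arr 5 = s1.arr 5 ∧ ∀ w : Fin n, s'.arr 3 w =
      if w = v ∨ w ∈ X ∧ w ∈ T then 4 else s.arr 3 w)
    (by intro k l; simp [h3])
    (by
      rintro T w s' hwT - hvw hrep h2 ⟨h5', hI⟩ k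
      have hwv : w ≠ v := hvw.ne'
      simp only [denote_ifEq, denote, Exp.eval, State.setReg_reg, State.setReg_arr, if_true]
      rw [if_neg (by omega : ¬ (2 : ℕ) = 12), h2]
      by_cases hw : w ∈ X
      · rw [if_pos (by rw [h5', h5, if_neg hwv]; exact (hX w).2 hw)]
        refine ⟨?_, ?_⟩
        · ext i; simp [State.setArr_arr, h5']
        · intro z
          simp only [State.setArr_arr, State.setReg_arr, Fin.val_inj, true_and, hI z,
            Finset.mem_insert]
          by_cases hz : z = w
          · simp [hz, hw]
          · simp [hz]
      · rw [if_neg (by rw [h5', h5, if_neg hwv]; exact mt (hX w).1 hw)]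
        refine ⟨h5', fun z => ?_⟩
        simp only [State.setReg_arr, hI z, Finset.mem_insert]
        by_cases hz : z = w
        · simp [hz, hw]
        · simp [hz])
  refine ⟨?_, fun w => ?_⟩
  · ext w
    have := key.2 w
    have hm : (w ∈ X ∧ w ∈ G.neighborFinset v) ↔ w ∈ X := ⟨fun h => h.1, fun h => ⟨h, hXv h⟩⟩
    simp only [hm] at this
    exact this
  · have : (markCore.denote s).arr 5 w = s1.arr 5 w := congrFun key.1 w
    rw [this, h5]
    by_cases hw : w = v
    · simp [hw]
    · simp only [hw, if_false, false_or]
      split_ifs with h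
      · exact (hX w).2 h
      · rfl

/-- Array 5 serves two purposes: it holds the stamps of the core while a vertex is treated, and the
identifier `v + 1` of the clique if the test succeeds. A failed test may leave stamps behind, but
only on vertices of status 0, where identifiers mean nothing yet. -/
theorem cliqueBody_spec (hΔ : ∀ v, G.degree v ≤ Δ) {s : State} (rep : Rep Δ G s) {v : Fin n}
    (hv : s.reg 2 = v) (h5 : ∀ w : Fin n, s.arr 5 w ≤ v) (h6 : ∀ w : Fin n, s.arr 6 w ≤ v) :
    (∀ w : Fin n, (cliqueBody.denote s).arr 6 w ≤ v + 1) ∧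
    (∀ w : Fin n, (cliqueBody.denote s).arr 5 w ≤ v + 1) ∧
    (s.status n v = 0 → CliqueTest Δ G (s.status n) v →
      (cliqueBody.denote s).status n =
        (fun w => if w = v ∨ w ∈ core Δ G (s.status n) v then 4 else s.status n w) ∧
      ∀ w : Fin n, (cliqueBody.denote s).arr 5 w =
        if w = v ∨ w ∈ core Δ G (s.status n) v then (v : ℕ) + 1 else s.arr 5 w) ∧
    (¬ (s.status n v = 0 ∧ CliqueTest Δ G (s.status n) v) →
      (cliqueBody.denote s).status n = s.status n ∧
      ∀ w : Fin n, s.status n w ≠ 0 → (cliqueBody.denote s).arr 5 w = s.arr 5 w) := by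
  by_cases h0 : s.status n v = 0
  · have h0' : s.arr 3 v < 1 := by simpa [State.status] using h0
    set t := (stampNbrs 6).denote s with ht
    obtain ⟨ha, -⟩ := stampNbrs_spec hΔ rep hv (a := 6) (by omega)
    rw [← ht] at ha
    have hrept : Rep Δ G t := rep_denote rep rfl
    have hstat : t.status n = s.status n := by
      ext w; rw [State.status, ht, denote_arr _ rfl]; rfl
    have ht2 : t.reg 2 = v := by rw [ht, denote_reg _ rfl, hv]
    have ht5 : t.arr 5 = s.arr 5 := by rw [ht, denote_arr _ rfl]
    obtain ⟨hb, hc⟩ := stampCore_spec hΔ hrept ht2 (by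
      intro w
      rw [ha, hstat]
      have := h6 w
      split_ifs with h
      · simp [h]
      · simp only [h, iff_false]; omega)
    set r := stampCore.denote t with hr
    rw [hstat, ht5] at hb
    rw [hstat] at hc
    have hrepr : Rep Δ G r := rep_denote hrept rfl
    have hr2 : r.reg 2 = v := by rw [hr, denote_reg _ rfl, ht2]
    have hrstat : r.status n = s.status n := by
      rw [← hstat]; ext w; rw [State.status, hr, denote_arr _ rfl]; rfl
    set X := core Δ G (s.status n) v with hXdef
    have hXsub : X ⊆ G.neighborFinset v :=
      (Finset.filter_subset _ _).trans (Finset.filter_subset _ _)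
    have hX : ∀ w : Fin n, r.arr 5 w = v + 1 ↔ w ∈ X := by
      intro w
      rw [hb]
      have := h5 w
      split_ifs with h
      · simp [h]
      · simp only [h, iff_false]; omega
    have hd := countCore_spec hΔ hrepr hr2 hX hXsub
    set q := countCore.denote r with hq
    have hqarr : q.arr = r.arr := by
      rw [hq]; exact countNbr_arr (fun b => by simp [stores, stores_ifEq, stores_countStamped]) _
    have hrepq : Rep Δ G q := rep_denote hrepr rfl
    have hq2 : q.reg 2 = v := by rw [hq, denote_reg _ rfl, hr2]
    have hq11 : q.reg 11 = X.card := by rw [hq, denote_reg _ rfl, hc]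
    have hqstat : q.status n = s.status n := by
      rw [← hrstat]; ext w; simp [State.status, hqarr]
    have hden : cliqueBody.denote s = if CliqueTest Δ G (s.status n) v then markCore.denote q
        else q := by
      simp only [cliqueBody, denote, denote_ifEq, Exp.eval, hv, h0', if_true, ← ht, ← hr, ← hq,
        hrepq.reg_one, hd, hq11]
      by_cases hT : CliqueTest Δ G (s.status n) v
      · rw [if_pos hT]
        obtain ⟨h1, h2⟩ := hT
        rw [← hXdef] at h1 h2
        rw [if_neg (by omega), if_pos h1]
      · rw [if_neg hT]
        by_cases h1 : X.card + 1 = Δ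
        · rw [if_pos]
          by_contra h2
          exact hT ⟨h1, by rw [← hXdef]; omega⟩
        · rw [if_neg h1]; simp
    have hq5 : ∀ w : Fin n, q.arr 5 w = if w ∈ X then (v : ℕ) + 1 else s.arr 5 w := by
      intro w; rw [hqarr, hb]
    have hmark := markCore_spec hΔ hrepq hq2 (by rw [hqarr]; exact hX) hXsub
    have hq6 : ∀ w : Fin n, q.arr 6 w ≤ v + 1 := by
      intro w
      rw [hqarr, hr, denote_arr _ rfl, ha]
      have := h6 w
      split_ifs <;> omega
    rw [hden]
    refine ⟨?_, ?_, fun _ h => ?_, fun h => ?_⟩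
    · intro w
      split_ifs
      · rw [denote_arr _ rfl]; exact hq6 w
      · exact hq6 w
    · intro w
      have := h5 w
      split_ifs
      · rw [hmark.2, hq5]; split_ifs <;> omega
      · rw [hq5]; split_ifs <;> omega
    · rw [if_pos h]
      refine ⟨by rw [hmark.1, hqstat], fun w => ?_⟩
      rw [hmark.2, hq5]
      by_cases h1 : w = v <;> by_cases h2 : w ∈ X <;> simp [h1, h2]
    · rw [if_neg (fun h' => h ⟨h0, h'⟩)]
      -- The core consists of vertices of status 0, so identifiers of other vertices are untouched.
      refine ⟨hqstat, fun w hw => ?_⟩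
      rw [hq5, if_neg]
      intro hwX
      have := (Finset.mem_filter.1 (Finset.mem_filter.1 hwX).1).2
      exact hw this
  · have h0' : ¬ s.arr 3 v < 1 := by simpa [State.status] using h0
    have hden : cliqueBody.denote s = s := by
      simp [cliqueBody, denote, Exp.eval, hv, h0']
    rw [hden]
    exact ⟨fun w => (h6 w).trans (Nat.le_succ _), fun w => (h5 w).trans (Nat.le_succ _),
      fun h => absurd h h0, fun _ => ⟨rfl, fun _ _ => rfl⟩⟩

/-- The entries of array 5, kept for every vertex. -/
def _root_.RAM.State.ident (n : ℕ) (s : State) (v : Fin n) : ℕ := s.arr 5 v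

/-- The predicate `I` speaks of the identifiers too; `hcongr` demands that it ignores those of
vertices of status 0. The identifier of a new clique is fresh because all earlier entries of array 5
are at most `v`. -/
theorem cliquePhase_spec (hΔ : ∀ v, G.degree v ≤ Δ) (I : (Fin n → ℕ) → (Fin n → ℕ) → Prop)
    (hcongr : ∀ st id id', I st id → (∀ w, st w ≠ 0 → id' w = id w) → I st id')
    (hI : ∀ v st id, I st id → st v = 0 → CliqueTest Δ G st v → (∀ w, id w ≠ v + 1) →
      I (fun w => if w = v ∨ w ∈ core Δ G st v then 4 else st w)
        (fun w => if w = v ∨ w ∈ core Δ G st v then (v : ℕ) + 1 else id w))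
    (Bad : (Fin n → ℕ) → Fin n → Prop)
    (hmono : ∀ st st' v, (∀ w, st' w = 0 → st w = 0) → Bad st' v → Bad st v)
    (hbad : ∀ st id v, I st id → Bad st v → st v = 0 ∧ CliqueTest Δ G st v)
    {s : State} (rep : Rep Δ G s) (hs : I (s.status n) (s.ident n))
    (h5 : ∀ w : Fin n, s.arr 5 w = 0) (h6 : ∀ w : Fin n, s.arr 6 w = 0) :
    I ((cliquePhase.denote s).status n) ((cliquePhase.denote s).ident n) ∧
      ∀ v, ¬ Bad ((cliquePhase.denote s).status n) v := by
  have key := vertLoop_induction rep (p := cliqueBody) rfl rfl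
    (fun j s' => I (s'.status n) (s'.ident n) ∧
      (∀ v : Fin n, (v : ℕ) < j → ¬ Bad (s'.status n) v) ∧
      (∀ w : Fin n, s'.arr 5 w ≤ j) ∧ ∀ w : Fin n, s'.arr 6 w ≤ j)
    (fun k l => ⟨hs, by simp, by simp [h5], by simp [h6]⟩)
    (by
      rintro v s' hrep hv ⟨h1, h2, h3, h4⟩ k
      obtain ⟨ha, hb, hc, hd⟩ := cliqueBody_spec hΔ hrep hv h3 h4
      change I ((cliqueBody.denote s').status n) ((cliqueBody.denote s').ident n) ∧
        (∀ u : Fin n, (u : ℕ) < v + 1 → ¬ Bad ((cliqueBody.denote s').status n) u) ∧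
        (∀ w : Fin n, (cliqueBody.denote s').arr 5 w ≤ v + 1) ∧
        ∀ w : Fin n, (cliqueBody.denote s').arr 6 w ≤ v + 1
      by_cases ht : s'.status n v = 0 ∧ CliqueTest Δ G (s'.status n) v
      · obtain ⟨he, hf⟩ := hc ht.1 ht.2
        have hf' : (cliqueBody.denote s').ident n = fun w : Fin n =>
          if w = v ∨ w ∈ core Δ G (s'.status n) v then (v : ℕ) + 1 else s'.ident n w := by
          ext w; exact hf w
        rw [he, hf']
        refine ⟨hI v _ _ h1 ht.1 ht.2 ?_, fun u hu hbu => ?_, hb, ha⟩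
        · intro w
          have := h3 w
          simp only [State.ident]; omega
        rcases Nat.lt_succ_iff_lt_or_eq.1 hu with h | h
        · refine h2 u h (hmono _ _ _ ?_ hbu)
          intro w hw
          split_ifs at hw
          exact hw
        · rw [Fin.ext h] at hbu
          -- The vertex `v` now has status 4, while bad vertices have status 0.
          have := hbad _ _ _ (hI v _ _ h1 ht.1 ht.2 (by
            intro w
            have := h3 w
            simp only [State.ident]; omega)) hbu
          simp at this
      · obtain ⟨he, hf⟩ := hd ht
        rw [he]
        refine ⟨hcongr _ _ _ h1 hf, fun u hu hbu => ?_, hb, ha⟩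
        rcases Nat.lt_succ_iff_lt_or_eq.1 hu with h | h
        · exact h2 u h hbu
        · rw [Fin.ext h] at hbu
          exact ht (hbad _ _ _ h1 hbu))
  exact ⟨key.1, fun v => key.2.1 v v.isLt⟩

end Stmt

end RAM

/-! ### The program that peels cliques -/

namespace RAM

section

variable {n : ℕ} (Δ : ℕ) (G : SimpleGraph (Fin n)) [DecidableRel G.Adj]

/-- The pending clique of `c`. -/
def members (st id : Fin n → ℕ) (c : Fin n) : Finset (Fin n) :=
  insert c ((G.neighborFinset c).filter fun u => st u = 4 ∧ id u = id c)

/-- The neighbours of `u` that are neither pending nor in a tight subgraph found before. -/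
def lostNbrs (st : Fin n → ℕ) (u : Fin n) : Finset (Fin n) :=
  (G.neighborFinset u).filter fun y => st y ≠ 1 ∧ st y ≠ 4

/-- At most one vertex of the pending clique of `c` has no lost neighbour. -/
def Peelable (st id : Fin n → ℕ) (c : Fin n) : Prop :=
  st c = 4 ∧ Δ ≤ ((members G st id c).filter fun u => 0 < (lostNbrs G st u).card).card + 1

/-- `y` lies in another pending clique and has a neighbour in that of `c`. -/
def IsNext (st id : Fin n → ℕ) (c y : Fin n) : Prop :=
  st y = 4 ∧ id y ≠ id c ∧ ∃ u ∈ members G st id c, G.Adj u y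

end

namespace Stmt

variable {Δ n : ℕ} {G : SimpleGraph (Fin n)} [DecidableRel G.Adj]

/-- Count in register 18 the lost neighbours of the vertex in register 12. -/
def countLost : Stmt :=
  countNbr .deg 18 12 15 16 (seq (assign 19 (.lit 1)) (seq
    (ifEq (.get 3 (.var 15)) (.lit 1) (assign 19 (.lit 0))) (seq
    (ifEq (.get 3 (.var 15)) (.lit 4) (assign 19 (.lit 0)))
    (assign 18 (.add (.var 18) (.var 19))))))

/-- Run `p` if the vertex in register 12 belongs to the clique of that in register 32. -/
def ifMember (p : Stmt) : Stmt :=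
  ifEq (.get 3 (.var 12)) (.lit 4) (ifEq (.get 5 (.var 12)) (.get 5 (.var 32)) p)

/-- Count in register 35 the neighbours in the clique of the vertex in register 32 that have lost
neighbours. -/
def countBad : Stmt :=
  seq (seq (assign 12 (.var 32)) (seq countLost
      (ite (.lit 0) (.var 18) (assign 36 (.lit 1)) (assign 36 (.lit 0)))))
    (countNbr .deg 35 32 12 13 (ifMember
      (seq countLost (ite (.lit 0) (.var 18) (assign 35 (.add (.var 35) (.lit 1))) skip))))

/-- Put the neighbours of the vertex in register 12 that are in other pending cliques into
register 34. -/
def scanNext : Stmt :=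
  nbrLoop .deg 12 15 16 (ifEq (.get 3 (.var 15)) (.lit 4)
    (ite (.get 5 (.var 15)) (.get 5 (.var 32)) (assign 34 (.var 15))
      (ite (.get 5 (.var 32)) (.get 5 (.var 15)) (assign 34 (.var 15)) skip)))

/-- Find a neighbour of the clique in another pending clique. -/
def findNext : Stmt :=
  seq (seq (assign 34 (.var 31)) (seq (assign 12 (.var 32)) scanNext))
    (nbrLoop .deg 32 12 13 (ifMember scanNext))

/-- Give status 5 to the clique of the vertex in register 32. -/
def peel : Stmt :=
  seq (nbrLoop .deg 32 12 13 (ifMember (store 3 (.var 12) (.lit 5)))) (store 3 (.var 32) (.lit 5))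

/-- Set register 33 to one if the clique of the vertex in register 32 can be peeled. -/
def testPeel : Stmt :=
  seq (assign 33 (.lit 0)) (ite (.var 32) (.var 0) (ifEq (.get 3 (.var 32)) (.lit 4)
    (seq countBad (ite (.add (.add (.var 35) (.var 36)) (.lit 1)) (.var 1) skip
      (assign 33 (.lit 1))))) skip)

/-- Peel the clique of the vertex in register 32 or advance register 31. -/
def peelStep : Stmt :=
  seq testPeel (ite (.lit 0) (.var 33) (seq findNext (seq peel (assign 32 (.var 34))))
    (seq (assign 31 (.add (.var 31) (.lit 1))) (assign 32 (.var 31))))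

/-- Peel cliques with few neighbours in other pending cliques. -/
def peelPhase : Stmt :=
  seq (seq (assign 31 (.lit 0)) (assign 32 (.lit 0)))
    (loop 8 .twice (.add (.var 0) (.var 0)) peelStep)

theorem countLost_spec (hΔ : ∀ v, G.degree v ≤ Δ) {s : State} (rep : Rep Δ G s) {u : Fin n}
    (hu : s.reg 12 = u) :
    (countLost.denote s).reg 18 = (lostNbrs G (s.status n) u).card := by
  refine countNbr_spec rep hu (b := .deg) (hΔ u) rfl (by simp) (fun b => rfl) _ ?_
  intro w s' _ harr hrep hreg hw
  simp only [denote, denote_ifEq, Exp.eval, State.setReg_reg, State.setReg_arr]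
  have hw' : (if 15 = 19 then 1 else s'.reg 15) = (w : ℕ) := by simp [hw]
  simp only [hw', harr, State.status]
  by_cases h1 : s.arr 3 w = 1
  · simp [h1, hw, harr]
  · by_cases h4 : s.arr 3 w = 4
    · simp [h4, hw, harr]
    · simp [h1, h4, hw, harr]

/-- Register 36 accounts for the vertex `c` itself and register 35 for the neighbours of `c` in its
clique, since a loop over neighbours does not visit `c`. -/
theorem countBad_spec (hΔ : ∀ v, G.degree v ≤ Δ) {s : State} (rep : Rep Δ G s) {c : Fin n}
    (hc : s.reg 32 = c) :
    (countBad.denote s).reg 35 + (countBad.denote s).reg 36 =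
      ((members G (s.status n) (s.ident n) c).filter
        fun u => 0 < (lostNbrs G (s.status n) u).card).card := by
  set t := (seq (assign 12 (.var 32)) (seq countLost
      (ite (.lit 0) (.var 18) (assign 36 (.lit 1)) (assign 36 (.lit 0))))).denote s with ht
  have htarr : t.arr = s.arr := by
    ext a i; rw [ht, denote_arr _ rfl]
  have hrept : Rep Δ G t := rep_denote rep rfl
  have ht32 : t.reg 32 = c := by rw [ht, denote_reg _ rfl, hc]
  have htst : t.status n = s.status n := by ext; simp [State.status, htarr]
  have htid : t.ident n = s.ident n := by ext; simp [State.ident, htarr]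
  have ht36 : t.reg 36 = if 0 < (lostNbrs G (s.status n) c).card then 1 else 0 := by
    have := countLost_spec hΔ (rep.setReg (x := 12) (by omega) (s.reg 32)) (u := c) (by simp [hc])
    simp only [ht, denote, Exp.eval, this]
    change (if 0 < (lostNbrs G (s.status n) c).card then _ else _ : State).reg 36 = _
    split_ifs <;> simp
  have key : (countBad.denote s).reg 35 = ((G.neighborFinset c).filter fun u =>
      (s.status n u = 4 ∧ s.ident n u = s.ident n c) ∧ 0 < (lostNbrs G (s.status n) u).card).card := by
    refine countNbr_spec hrept ht32 (b := .deg) (hΔ c) rfl (by simp) (fun b => rfl) _ ?_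
    intro w s' _ harr hrep hreg hw
    have h32 := (hreg 32 rfl).trans ht32
    have hst : s'.status n = s.status n := by rw [← htst]; ext; simp [State.status, harr]
    have hcl := countLost_spec hΔ hrep hw
    rw [hst] at hcl
    have h35 : (countLost.denote s').reg 35 = s'.reg 35 := denote_reg _ rfl _
    simp only [ifMember, denote, denote_ifEq, Exp.eval, hw, h32, hcl, harr, htarr, State.status,
      State.ident]
    by_cases h1 : s.arr 3 w = 4 <;> by_cases h2 : s.arr 5 w = s.arr 5 c <;>
      by_cases h3 : 0 < (lostNbrs G (s.status n) w).card
    all_goals simp [h1, h2, h3, h35]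
  have h36 : (countBad.denote s).reg 36 = t.reg 36 := denote_reg (countNbr .deg 35 32 12 13
    (ifMember (seq countLost (ite (.lit 0) (.var 18) (assign 35 (.add (.var 35) (.lit 1))) skip))))
    rfl t
  rw [key, h36, ht36, members, Finset.filter_insert, Finset.filter_filter]
  split_ifs
  · rw [Finset.card_insert_of_notMem (by simp)]
  · simp

theorem scanNext_spec (hΔ : ∀ v, G.degree v ≤ Δ) {s : State} (rep : Rep Δ G s) {u c : Fin n}
    (hu : s.reg 12 = u) (hc : s.reg 32 = c) :
    ((scanNext.denote s).reg 34 = s.reg 34 ∧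
        ∀ y, G.Adj u y → s.status n y = 4 → s.ident n y = s.ident n c) ∨
      ∃ y : Fin n, (scanNext.denote s).reg 34 = (y : ℕ) ∧ G.Adj u y ∧ s.status n y = 4 ∧
        s.ident n y ≠ s.ident n c := by
  have key := nbrLoop_induction rep hu (c := .deg) (hΔ u) (x := 15) (j := 16)
    (p := ifEq (.get 3 (.var 15)) (.lit 4)
    (ite (.get 5 (.var 15)) (.get 5 (.var 32)) (assign 34 (.var 15))
      (ite (.get 5 (.var 32)) (.get 5 (.var 15)) (assign 34 (.var 15)) skip))) rfl
    (fun T s' => s'.arr = s.arr ∧ s'.reg 32 = c ∧ ((s'.reg 34 = s.reg 34 ∧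
        ∀ y ∈ T, G.Adj u y → s.status n y = 4 → s.ident n y = s.ident n c) ∨
      ∃ y : Fin n, s'.reg 34 = (y : ℕ) ∧ G.Adj u y ∧ s.status n y = 4 ∧ s.ident n y ≠ s.ident n c))
    (by intro k l; simp [hc])
    (by
      rintro T w s' - - huw - - ⟨h1, h2, h3⟩ k
      simp only [denote, denote_ifEq, Exp.eval, State.setReg_reg, State.setReg_arr, h1, if_true]
      rw [if_neg (by omega : ¬ (32 : ℕ) = 15), h2]
      by_cases h4 : s.arr 3 w = 4
      · rw [if_pos h4]
        by_cases h5 : s.arr 5 w = s.arr 5 c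
        · rw [if_neg (by omega), if_neg (by omega)]
          refine ⟨h1, by simp [h2], ?_⟩
          rcases h3 with ⟨h3, h6⟩ | ⟨y, h3, h6⟩
          · left
            refine ⟨by simp [h3], fun y hy h h' => ?_⟩
            rcases Finset.mem_insert.1 hy with rfl | hy
            · exact h5
            · exact h6 y hy h h'
          · exact Or.inr ⟨y, by simp [h3], h6⟩
        · refine ⟨?_, ?_, Or.inr ⟨w, ?_, huw, h4, h5⟩⟩
          · split_ifs <;> exact h1
          · split_ifs <;> first | omega | simp [h2]
          · by_cases h6 : s.arr 5 w < s.arr 5 c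
            · simp [h6]
            · simp [show s.arr 5 c < s.arr 5 w by omega]
      · rw [if_neg h4]
        refine ⟨h1, by simp [h2], ?_⟩
        rcases h3 with ⟨h3, h6⟩ | ⟨y, h3, h6⟩
        · left
          refine ⟨by simp [h3], fun y hy h h' => ?_⟩
          rcases Finset.mem_insert.1 hy with rfl | hy
          · exact absurd h' h4
          · exact h6 y hy h h'
        · exact Or.inr ⟨y, by simp [h3], h6⟩)
  rcases key.2.2 with ⟨h1, h2⟩ | h
  · exact Or.inl ⟨h1, fun y hy => h2 y (by simpa using hy) hy⟩
  · exact Or.inr h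

/-- If several vertices qualify, any one of them may be returned; that they coincide when the clique
is peelable is part of the proof of `PeelInv.peel`. Register 31 is the default, so the walk falls
back to the outer pointer. -/
theorem findNext_spec (hΔ : ∀ v, G.degree v ≤ Δ) {s : State} (rep : Rep Δ G s) {c : Fin n}
    (hc : s.reg 32 = c) :
    ((findNext.denote s).reg 34 = s.reg 31 ∧ ∀ y, ¬ IsNext G (s.status n) (s.ident n) c y) ∨
      ∃ y : Fin n, (findNext.denote s).reg 34 = (y : ℕ) ∧ IsNext G (s.status n) (s.ident n) c y := by
  set t0 := (seq (assign 34 (.var 31)) (assign 12 (.var 32))).denote s with ht0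
  set t := scanNext.denote t0 with ht
  have htarr : t.arr = s.arr := by
    ext a i; rw [ht, denote_arr _ rfl]; rfl
  have hrept0 : Rep Δ G t0 := rep_denote rep rfl
  have hrept : Rep Δ G t := rep_denote hrept0 rfl
  have ht32 : t.reg 32 = c := by rw [ht, denote_reg _ rfl, ht0, denote_reg _ rfl, hc]
  have hscan := scanNext_spec hΔ hrept0 (u := c) (c := c) (by simp [ht0, denote, Exp.eval, hc])
    (by simp [ht0, denote, hc])
  have h34 : t0.reg 34 = s.reg 31 := by simp [ht0, denote, Exp.eval]
  rw [← ht, h34] at hscan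
  change (t.reg 34 = s.reg 31 ∧ ∀ y, G.Adj c y → s.status n y = 4 → s.ident n y = s.ident n c) ∨
      ∃ y : Fin n, t.reg 34 = (y : ℕ) ∧ G.Adj c y ∧ s.status n y = 4 ∧ s.ident n y ≠ s.ident n c at hscan
  have key := nbrLoop_induction hrept ht32 (c := .deg) (hΔ c) (x := 12) (j := 13)
    (p := ifMember scanNext) rfl
    (fun T s' => s'.arr = s.arr ∧ ((s'.reg 34 = s.reg 31 ∧
        ∀ u, (u = c ∨ u ∈ T ∧ s.status n u = 4 ∧ s.ident n u = s.ident n c) →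
          ∀ y, G.Adj u y → s.status n y = 4 → s.ident n y = s.ident n c) ∨
      ∃ y : Fin n, s'.reg 34 = (y : ℕ) ∧ IsNext G (s.status n) (s.ident n) c y))
    (by
      intro k l
      refine ⟨by simp [htarr], ?_⟩
      rcases hscan with ⟨h1, h2⟩ | ⟨y, h1, h2, h3, h4⟩
      · left
        refine ⟨by simp [h1], ?_⟩
        rintro u (rfl | ⟨h, -⟩)
        · exact h2
        · simp at h
      · exact Or.inr ⟨y, by simp [h1], h3, h4, c, by simp [members], h2⟩)
    (by
      rintro T w s' - - hcw hrep h32 ⟨h1, h2⟩ k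
      have h32' : (s'.setReg 12 w).reg 32 = c := by simp [h32]
      have hsc := scanNext_spec hΔ (hrep.setReg (x := 12) (by omega) w) (u := w) (by simp) h32'
      have hstat : (s'.setReg 12 w).status n = s.status n := by ext; simp [State.status, h1]
      have hid : (s'.setReg 12 w).ident n = s.ident n := by ext; simp [State.ident, h1]
      rw [hstat, hid] at hsc
      have hden : (ifMember scanNext).denote (s'.setReg 12 w) =
          if s.status n w = 4 ∧ s.ident n w = s.ident n c then scanNext.denote (s'.setReg 12 w)
          else s'.setReg 12 w := by
        simp only [ifMember, denote_ifEq, Exp.eval, h32', State.setReg_arr, h1]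
        simp only [State.setReg_reg, if_true, State.status, State.ident]
        by_cases h1 : s.arr 3 w = 4 <;> by_cases h2 : s.arr 5 w = s.arr 5 c <;> simp [h1, h2]
      rw [hden]
      by_cases hw : s.status n w = 4 ∧ s.ident n w = s.ident n c
      · rw [if_pos hw]
        refine ⟨?_, ?_⟩
        · ext a i; rw [State.setReg_arr, denote_arr _ rfl]; simp [h1]
        rcases hsc with ⟨h3, h4⟩ | ⟨y, h3, h4, h5⟩
        · rcases h2 with ⟨h5, h6⟩ | ⟨y, h5, h6⟩
          · left
            refine ⟨by simp [h3, h5], ?_⟩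
            rintro u (rfl | ⟨hu, hu'⟩)
            · exact h6 u (Or.inl rfl)
            · rcases Finset.mem_insert.1 hu with rfl | hu
              · exact h4
              · exact h6 u (Or.inr ⟨hu, hu'⟩)
          · exact Or.inr ⟨y, by simp [h3, h5], h6⟩
        · exact Or.inr ⟨y, by simp [h3], h5.1, h5.2, w, by simp [members, hcw, hw], h4⟩
      · rw [if_neg hw]
        refine ⟨by simp [h1], ?_⟩
        rcases h2 with ⟨h5, h6⟩ | ⟨y, h5, h6⟩
        · left
          refine ⟨by simp [h5], ?_⟩
          rintro u (rfl | ⟨hu, hu'⟩)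
          · exact h6 u (Or.inl rfl)
          · rcases Finset.mem_insert.1 hu with rfl | hu
            · exact absurd hu' hw
            · exact h6 u (Or.inr ⟨hu, hu'⟩)
        · exact Or.inr ⟨y, by simp [h5], h6⟩)
  rcases key.2 with ⟨h1, h2⟩ | h
  · left
    refine ⟨h1, ?_⟩
    rintro y ⟨h3, h4, u, hu, huy⟩
    refine h4 (h2 u ?_ y huy h3)
    simp only [members, Finset.mem_insert, Finset.mem_filter] at hu
    exact hu
  · exact Or.inr h

theorem peel_spec (hΔ : ∀ v, G.degree v ≤ Δ) {s : State} (rep : Rep Δ G s) {c : Fin n}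
    (hc : s.reg 32 = c) : (peel.denote s).status n =
      fun w => if w ∈ members G (s.status n) (s.ident n) c then 5 else s.status n w := by
  have key := nbrLoop_induction rep hc (c := .deg) (hΔ c) (x := 12) (j := 13)
    (p := ifMember (store 3 (.var 12) (.lit 5))) rfl
    (fun T s' => s'.arr 5 = s.arr 5 ∧ ∀ w : Fin n, s'.arr 3 w =
      if w ∈ T ∧ s.status n w = 4 ∧ s.ident n w = s.ident n c then 5 else s.arr 3 w)
    (by intro k l; simp)
    (by
      rintro T w s' hwT - - hrep h32 ⟨h5, h3⟩ k
      simp only [ifMember, denote, denote_ifEq, Exp.eval, State.setReg_reg, State.setReg_arr, h5,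
        if_true]
      have hw3 : s'.arr 3 w = s.arr 3 w := by rw [h3, if_neg (fun h => hwT h.1)]
      rw [if_neg (by omega : ¬ (32 : ℕ) = 12), h32, hw3]
      by_cases h : s.status n w = 4 ∧ s.ident n w = s.ident n c
      · rw [if_pos (show s.arr 3 w = 4 from h.1), if_pos (show s.arr 5 w = s.arr 5 c from h.2)]
        refine ⟨by ext i; simp [State.setArr_arr, h5], fun z => ?_⟩
        by_cases hz : z = w
        · simp [hz, State.setArr_arr, h]
        · simp [State.setArr_arr, h3, hz, Fin.val_inj]
      · have : (if s.arr 3 w = 4 then if s.arr 5 w = s.arr 5 c then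
            (s'.setReg 12 w).setArr 3 w 5 else s'.setReg 12 w else s'.setReg 12 w) =
            s'.setReg 12 w := by
          simp only [State.status, State.ident] at h
          split_ifs <;> first | rfl | tauto
        rw [this]
        refine ⟨by simp [h5], fun z => ?_⟩
        by_cases hz : z = w
        · subst hz
          simp [h3, hwT]
          intro h1 h2; exact absurd ⟨h1, h2⟩ h
        · simp [h3, hz])
  have h32 : ((nbrLoop .deg 32 12 13 (ifMember (store 3 (.var 12) (.lit 5)))).denote s).reg 32 = c := by
    rw [denote_reg _ rfl, hc]
  ext w
  have hk := key.2 w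
  have hmem : w ∈ members G (s.status n) (s.ident n) c ↔ w = c ∨
      (w ∈ G.neighborFinset c ∧ s.status n w = 4 ∧ s.ident n w = s.ident n c) := by
    simp [members]
  simp only [hmem]
  simp only [State.status, peel, denote, Exp.eval, State.setArr_arr, h32, Fin.val_inj, true_and]
  by_cases hw : w = c
  · simp [hw]
  · simp only [hw, if_false, false_or]
    exact hk

/-- The bound on register 32 is tested first, since the walk may already have run past the last
vertex. -/
theorem testPeel_spec (hΔ : ∀ v, G.degree v ≤ Δ) {s : State} (rep : Rep Δ G s) :
    (0 < (testPeel.denote s).reg 33 ↔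
      ∃ c : Fin n, s.reg 32 = c ∧ Peelable Δ G (s.status n) (s.ident n) c) := by
  have rep' := rep.setReg (x := 33) (by omega) 0
  by_cases hn : s.reg 32 < n
  · set c : Fin n := ⟨s.reg 32, hn⟩ with hcdef
    have hc : s.reg 32 = c := rfl
    have hb := countBad_spec hΔ rep' (c := c) (by simp [hc])
    change _ = ((members G (s.status n) (s.ident n) c).filter
        fun u => 0 < (lostNbrs G (s.status n) u).card).card at hb
    have h1 : (countBad.denote (s.setReg 33 0)).reg 1 = Δ := by
      rw [denote_reg _ rfl]; simp [rep.reg_one]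
    have h33 : (countBad.denote (s.setReg 33 0)).reg 33 = 0 := by
      rw [denote_reg _ rfl]; simp
    have hiff : (∃ c : Fin n, s.reg 32 = c ∧ Peelable Δ G (s.status n) (s.ident n) c) ↔
        Peelable Δ G (s.status n) (s.ident n) c := by
      constructor
      · rintro ⟨d, hd, h⟩
        rwa [show c = d from Fin.ext hd]
      · exact fun h => ⟨c, rfl, h⟩
    rw [hiff]
    simp only [testPeel, denote, denote_ifEq, Exp.eval, hb, h1, State.setReg_arr,
      State.setReg_reg]
    rw [if_neg (by omega : ¬ (32 : ℕ) = 33), if_neg (by omega : ¬ (0 : ℕ) = 33), rep.reg_zero,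
      if_pos hn, hc, Peelable]
    by_cases h4 : s.arr 3 c = 4
    · rw [if_pos h4]
      split_ifs with h
      · rw [h33]
        simp only [lt_irrefl, false_iff, not_and]
        intro _; omega
      · simp only [State.setReg_reg, if_true, zero_lt_one, true_iff]
        exact ⟨h4, by omega⟩
    · rw [if_neg h4]
      simp only [State.setReg_reg, if_true, lt_irrefl, false_iff]
      exact fun h => h4 h.1
  · have : ¬ ∃ c : Fin n, s.reg 32 = c ∧ Peelable Δ G (s.status n) (s.ident n) c := by
      rintro ⟨c, h, -⟩
      exact hn (h ▸ c.isLt)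
    simp only [this, iff_false]
    simp [testPeel, denote, Exp.eval, rep.reg_zero, hn]

theorem peelStep_spec (hΔ : ∀ v, G.degree v ≤ Δ) {s : State} (rep : Rep Δ G s) :
    (∃ c : Fin n, s.reg 32 = c ∧ Peelable Δ G (s.status n) (s.ident n) c ∧
      (peelStep.denote s).reg 31 = s.reg 31 ∧
      (peelStep.denote s).status n =
        (fun w => if w ∈ members G (s.status n) (s.ident n) c then 5 else s.status n w) ∧
      (((peelStep.denote s).reg 32 = s.reg 31 ∧ ∀ y, ¬ IsNext G (s.status n) (s.ident n) c y) ∨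
      ∃ y : Fin n, (peelStep.denote s).reg 32 = (y : ℕ) ∧ IsNext G (s.status n) (s.ident n) c y)) ∨
    ((∀ c : Fin n, s.reg 32 = c → ¬ Peelable Δ G (s.status n) (s.ident n) c) ∧
      (peelStep.denote s).reg 31 = s.reg 31 + 1 ∧ (peelStep.denote s).reg 32 = s.reg 31 + 1 ∧
      (peelStep.denote s).status n = s.status n) := by
  have htest := testPeel_spec hΔ rep
  set t := testPeel.denote s with ht
  have htarr : t.arr = s.arr := by
    ext a i; rw [ht, denote_arr _ rfl]
  have hrept : Rep Δ G t := rep_denote rep rfl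
  have ht31 : t.reg 31 = s.reg 31 := by rw [ht, denote_reg _ rfl]
  have htst : t.status n = s.status n := by ext; simp [State.status, htarr]
  have htid : t.ident n = s.ident n := by ext; simp [State.ident, htarr]
  have ht32 : t.reg 32 = s.reg 32 := by rw [ht, denote_reg _ rfl]
  have hden : peelStep.denote s = if 0 < t.reg 33 then
      (seq findNext (seq peel (assign 32 (.var 34)))).denote t else
      (seq (assign 31 (.add (.var 31) (.lit 1))) (assign 32 (.var 31))).denote t := rfl
  rw [hden]
  by_cases h : 0 < t.reg 33
  · left
    rw [if_pos h]
    obtain ⟨c, hc, hp⟩ := htest.1 h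
    refine ⟨c, hc, hp, ?_, ?_, ?_⟩
    · rw [denote_reg _ rfl, ht31]
    · have hrep2 : Rep Δ G (findNext.denote t) := rep_denote hrept rfl
      have := peel_spec hΔ hrep2 (c := c) (by rw [denote_reg _ rfl, ht32, hc])
      have harr : (findNext.denote t).arr = s.arr := by
        ext a i; rw [denote_arr _ rfl, htarr]
      have h1 : (findNext.denote t).status n = s.status n := by ext; simp [State.status, harr]
      have h2 : (findNext.denote t).ident n = s.ident n := by ext; simp [State.ident, harr]
      rw [h1, h2] at this
      exact this
    · have := findNext_spec hΔ hrept (c := c) (by rw [ht32, hc])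
      rw [htst, htid, ht31] at this
      have h34 : ((seq findNext (seq peel (assign 32 (.var 34)))).denote t).reg 32 =
          (findNext.denote t).reg 34 := by
        simp only [denote, Exp.eval, State.setReg_reg, if_true]
        rw [denote_reg _ rfl]
      rw [h34]
      exact this
  · right
    rw [if_neg h]
    refine ⟨fun c hc hp => h (htest.2 ⟨c, hc, hp⟩), ?_, ?_, ?_⟩
    · simp [denote, Exp.eval, ht31]
    · simp [denote, Exp.eval, ht31]
    · rw [← htst]; rfl

/-- Register 31 is the outer pointer `v` and register 32 the vertex `x` under inspection. A step
either peels the clique of `x` and jumps to a neighbouring clique or back to `v`, or advances both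
registers to `v + 1`. -/
theorem peelPhase_spec (hΔ : ∀ v, G.degree v ≤ Δ) (id : Fin n → ℕ)
    (I : (Fin n → ℕ) → ℕ → ℕ → Prop)
    (hpeel : ∀ st (v : ℕ) (c : Fin n) (x : ℕ), I st v c → Peelable Δ G st id c →
      ((x = v ∧ ∀ y, ¬ IsNext G st id c y) ∨ ∃ y : Fin n, x = y ∧ IsNext G st id c y) →
      I (fun w => if w ∈ members G st id c then 5 else st w) v x)
    (hadv : ∀ st (v x : ℕ), I st v x → (∀ c : Fin n, x = c → ¬ Peelable Δ G st id c) →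
      I st (v + 1) (v + 1))
    {s : State} (rep : Rep Δ G s) (hid : s.ident n = id) (hs : I (s.status n) 0 0) :
    ∃ v x, n ≤ v ∧ I ((peelPhase.denote s).status n) v x := by
  set s0 := (s.setReg 31 0).setReg 32 0 with hs0
  have rep0 : Rep Δ G s0 := (rep.setReg (by omega) _).setReg (by omega) _
  -- The potential `v` plus the number of peeled vertices grows by at least one in every round.
  have key := loop_induction (x := 8) (c := .twice) (k := .add (.var 0) (.var 0)) (p := peelStep)
    rfl (s := s0) (m := n + n) (by simp [Exp.eval, Cap.val, rep0.reg_zero])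
    (fun j s' => Rep Δ G s' ∧ s'.ident n = id ∧ I (s'.status n) (s'.reg 31) (s'.reg 32) ∧
      j ≤ s'.reg 31 + (Finset.univ.filter fun w => s'.status n w = 5).card)
    ⟨(rep0.setReg (by omega) _).setReg (by omega) _, hid, hs, Nat.zero_le _⟩
    (by
      rintro j s' - - ⟨h1, h2, h3, h4⟩
      refine ⟨(rep_denote h1 rfl).setReg (by omega) _, ?_, ?_⟩
      · rw [← h2]; ext w
        simp only [State.ident, State.setReg_arr]
        rw [denote_arr _ rfl]
      change I ((peelStep.denote s').status n) ((peelStep.denote s').reg 31)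
        ((peelStep.denote s').reg 32) ∧ j + 1 ≤ (peelStep.denote s').reg 31 +
          (Finset.univ.filter fun w => (peelStep.denote s').status n w = 5).card
      rcases peelStep_spec hΔ h1 with ⟨c, hc, hp, ha, hb, hd⟩ | ⟨ha, hb, hd, he⟩
      · rw [ha, hb]
        rw [h2] at hp hd
        rw [hc] at h3
        refine ⟨by rw [h2]; exact hpeel _ _ c _ h3 hp hd, ?_⟩
        have : (Finset.univ.filter fun w => s'.status n w = 5) ⊂ Finset.univ.filter fun w =>
            (if w ∈ members G (s'.status n) (s'.ident n) c then 5 else s'.status n w) = 5 := by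
          rw [Finset.ssubset_iff_of_subset]
          · refine ⟨c, by simp [members], ?_⟩
            simp [hp.1]
          · intro w hw
            simp only [Finset.mem_filter, Finset.mem_univ, true_and] at hw ⊢
            simp [hw]
        have := Finset.card_lt_card this
        dsimp only
        omega
      · rw [hb, hd, he]
        rw [h2] at ha
        exact ⟨hadv _ _ _ h3 ha, by omega⟩)
  refine ⟨_, _, ?_, key.2.2.1⟩
  have h := key.2.2.2
  -- At most n vertices can be peeled, so after 2n rounds the outer pointer has passed all vertices.
  have : (Finset.univ.filter fun w =>
      ((loop 8 .twice (.add (.var 0) (.var 0)) peelStep).denote s0).status n w = 5).card ≤ n := by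
    simpa using Finset.card_filter_le (s := (Finset.univ : Finset (Fin n))) (p := fun w =>
      ((loop 8 .twice (.add (.var 0) (.var 0)) peelStep).denote s0).status n w = 5)
  omega

end Stmt

end RAM

/-! ### Patterns -/

/-- A small graph on `0, …, size - 1`, given by its edges, with an order in which its vertices can be
found from the vertex 0, each as a neighbour of an earlier one. -/
structure Pattern where
  size : ℕ
  edges : List (ℕ × ℕ)
  order : List (ℕ × ℕ)

namespace Pattern

/-- All extensions of `l` by `m` entries satisfy `leaf`, unless `prune` applies earlier. -/
def allExt (prune leaf : List Bool → Bool) : ℕ → List Bool → Bool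
  | 0, l => prune l || leaf l
  | m + 1, l => prune l || (allExt prune leaf m (l ++ [true]) && allExt prune leaf m (l ++ [false]))

/-- Pruning is sound when the pruning condition persists under extension of the list, as it does for
the number of edges already known to be cut. It shrinks the enumeration of subsets done by
evaluation. -/
theorem allExt_spec {prune leaf : List Bool → Bool}
    (hprune : ∀ l l', prune l = true → prune (l ++ l') = true) :
    ∀ (m : ℕ) (l : List Bool), allExt prune leaf m l = true →
      ∀ l' : List Bool, l'.length = m → prune (l ++ l') = true ∨ leaf (l ++ l') = true
  | 0, l, h, l', hl' => by
    obtain rfl := List.length_eq_zero_iff.1 hl'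
    simpa [allExt] using h
  | m + 1, l, h, l', hl' => by
    rw [allExt, Bool.or_eq_true, Bool.and_eq_true] at h
    rcases h with h | ⟨h₁, h₂⟩
    · exact Or.inl (hprune _ _ h)
    · match l', hl' with
      | b :: l', hl' =>
        have hl : l'.length = m := by simpa using hl'
        have := allExt_spec hprune m (l ++ [b]) (by cases b <;> assumption) l' hl
        simpa using this

/-- Exactly one end of the edge `e` is in the set described by `l`. -/
def cuts (l : List Bool) (e : ℕ × ℕ) : Bool :=
  decide (e.1 < l.length) && decide (e.2 < l.length) && (l.getD e.1 false != l.getD e.2 false)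

theorem cuts_append (l l' : List Bool) (e : ℕ × ℕ) (h : cuts l e = true) :
    cuts (l ++ l') e = true := by
  simp only [cuts, Bool.and_eq_true, decide_eq_true_eq] at h ⊢
  obtain ⟨⟨h₁, h₂⟩, h₃⟩ := h
  refine ⟨⟨by simp; omega, by simp; omega⟩, ?_⟩
  rwa [List.getD_append _ _ _ _ h₁, List.getD_append _ _ _ _ h₂]

/-- Every cut that does not satisfy `ex` has more than `k` edges. -/
def cutTest (H : Pattern) (k : ℕ) (ex : List Bool → Bool) : Bool :=
  allExt (fun l => decide (k < H.edges.countP (cuts l)))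
    (fun l => l.all id || l.all not || ex l) H.size []

/-- The exceptions `l.all id` and `l.all not` are the two trivial cuts; `ex` describes the small
cuts that are tolerated. -/
theorem cutTest_spec {H : Pattern} {k : ℕ} {ex : List Bool → Bool} (h : H.cutTest k ex = true)
    (l : List Bool) (hl : l.length = H.size) :
    k < H.edges.countP (cuts l) ∨ l.all id = true ∨ l.all not = true ∨ ex l = true := by
  have := allExt_spec (fun l l' h => by
    simp only [decide_eq_true_eq] at h ⊢
    exact h.trans_le (List.countP_mono_left fun e _ => cuts_append l l' e)) _ _ h l hl
  simpa [or_assoc] using this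

/-- The end of `e` in the set described by `l`. -/
def inner (l : List Bool) (e : ℕ × ℕ) : ℕ := if l.getD e.1 false then e.1 else e.2

/-- Two edges of the cut have equal or non-adjacent ends in the set described by `l`. -/
def badCut (H : Pattern) (l : List Bool) : Bool :=
  (H.edges.filter (cuts l)).any fun e => (H.edges.filter (cuts l)).any fun f =>
    e != f && (inner l e == inner l f || !decide (RAM.Joined H.edges (inner l e) (inner l f)))

/-- No vertex of `l` sublist: there is no independent set of `k` vertices of `l` without neighbours
in `c`. -/
def noIndep (E : List (ℕ × ℕ)) : List ℕ → ℕ → List ℕ → Bool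
  | _, 0, _ => false
  | [], _ + 1, _ => true
  | v :: l, k + 1, c => noIndep E l (k + 1) c &&
      (c.any (fun w => E.contains (v, w) || E.contains (w, v)) || noIndep E l k (v :: c))

/-- The number of edges at `i`. -/
def deg (H : Pattern) (i : ℕ) : ℕ :=
  ((List.range H.size).filter fun j => i != j && decide (RAM.Joined H.edges i j)).length

end Pattern

open Pattern

/-- The diamond. -/
def diamondPat : Pattern :=
  ⟨4, [(0, 1), (0, 2), (0, 3), (1, 2), (1, 3)], [(1, 0), (2, 0), (3, 0)]⟩

/-- The diamond necklace with one diamond. -/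
def necklacePat₁ : Pattern :=
  ⟨6, [(0, 1), (0, 2), (0, 3), (1, 2), (1, 3), (3, 4), (4, 5), (5, 2)],
    [(1, 0), (2, 0), (3, 0), (4, 3), (5, 4)]⟩

/-- The diamond necklace with two diamonds. -/
def necklacePat₂ : Pattern :=
  ⟨9, [(0, 1), (0, 2), (0, 3), (1, 2), (1, 3), (4, 5), (4, 6), (4, 7), (5, 6), (5, 7),
    (2, 6), (7, 8), (8, 3)],
    [(1, 0), (2, 0), (3, 0), (6, 2), (4, 6), (5, 6), (7, 4), (8, 7)]⟩

/-- The diamond necklace with three diamonds. -/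
def necklacePat₃ : Pattern :=
  ⟨12, [(0, 1), (0, 2), (0, 3), (1, 2), (1, 3), (4, 5), (4, 6), (4, 7), (5, 6), (5, 7),
    (8, 9), (8, 10), (8, 11), (9, 10), (9, 11), (3, 6), (7, 10), (11, 2)],
    [(1, 0), (2, 0), (3, 0), (6, 3), (4, 6), (5, 6), (7, 4), (10, 7), (8, 10), (9, 10), (11, 8)]⟩

/-- The Havel necklace on nine vertices. -/
def havelPat₁ : Pattern :=
  ⟨9, [(0, 1), (0, 2), (1, 2), (3, 4), (3, 5), (4, 5), (0, 3), (1, 6), (6, 4), (2, 7), (7, 5),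
    (6, 8), (8, 7)],
    [(1, 0), (2, 0), (3, 0), (4, 3), (5, 3), (6, 1), (7, 2), (8, 6)]⟩

/-- The Havel necklace on twelve vertices. -/
def havelPat₂ : Pattern :=
  ⟨12, [(0, 1), (0, 2), (1, 2), (3, 4), (3, 5), (4, 5), (0, 3), (1, 6), (6, 4), (2, 7),
    (7, 5), (8, 9), (8, 10), (8, 11), (9, 10), (9, 11), (6, 10), (11, 7)],
    [(1, 0), (2, 0), (3, 0), (4, 3), (5, 3), (6, 1), (7, 2), (10, 6), (8, 10), (9, 10), (11, 8)]⟩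

/-- The triangle-dominated 6-cycle. -/
def sixCyclePat : Pattern :=
  ⟨12, [(0, 1), (0, 2), (1, 2), (3, 4), (3, 5), (4, 5), (6, 0), (7, 1), (8, 2), (9, 3),
    (10, 4), (11, 5), (6, 9), (9, 7), (7, 11), (11, 8), (8, 10), (10, 6)],
    [(1, 0), (2, 0), (6, 0), (7, 1), (8, 2), (9, 6), (11, 7), (10, 8), (3, 9), (4, 10), (5, 11)]⟩

/-- The square of the 8-cycle. -/
def squarePat : Pattern :=
  ⟨8, [(0, 1), (0, 2), (1, 2), (1, 3), (2, 3), (2, 4), (3, 4), (3, 5), (4, 5), (4, 6), (5, 6),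
    (5, 7), (6, 7), (6, 0), (7, 0), (7, 1)],
    [(1, 0), (2, 0), (3, 1), (4, 2), (5, 3), (6, 4), (7, 5)]⟩

/-- The extended clique. -/
def extendedPat₁ : Pattern :=
  ⟨8, [(0, 1), (0, 2), (0, 3), (1, 2), (1, 3), (2, 3), (4, 0), (4, 3), (5, 1), (5, 2),
    (6, 4), (6, 5), (7, 4), (7, 5), (6, 7)],
    [(1, 0), (2, 0), (3, 0), (4, 0), (5, 1), (6, 4), (7, 4)]⟩

/-- The extended double-clique. -/
def extendedPat₂ : Pattern :=
  ⟨12, [(0, 1), (0, 2), (0, 3), (1, 2), (1, 3), (2, 3), (4, 0), (4, 3), (5, 1), (5, 2),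
    (6, 7), (6, 8), (6, 9), (7, 8), (7, 9), (8, 9), (10, 6), (10, 9), (11, 7), (11, 8),
    (4, 10), (4, 11), (5, 10), (5, 11)],
    [(1, 0), (2, 0), (3, 0), (4, 0), (5, 1), (10, 4), (11, 4), (6, 10), (7, 11), (8, 11), (9, 10)]⟩

/-- The strong product of the 5-cycle and an edge. -/
def productPat : Pattern :=
  ⟨10, [(0, 1), (2, 3), (4, 5), (6, 7), (8, 9), (0, 2), (0, 3), (1, 2), (1, 3), (2, 4), (2, 5),
    (3, 4), (3, 5), (4, 6), (4, 7), (5, 6), (5, 7), (6, 8), (6, 9), (7, 8), (7, 9), (8, 0), (8, 1),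
    (9, 0), (9, 1)],
    [(1, 0), (2, 0), (3, 0), (4, 2), (5, 2), (6, 4), (7, 4), (8, 6), (9, 6)]⟩

/-- The diamond necklace with one diamond, whose two other vertices have a common neighbour. -/
def linkPat₁ : Pattern :=
  ⟨7, [(0, 1), (0, 2), (0, 3), (1, 2), (1, 3), (3, 4), (4, 5), (5, 2), (6, 4), (6, 5)],
    [(1, 0), (2, 0), (3, 0), (4, 3), (5, 4), (6, 4)]⟩

/-- Two diamonds and two adjacent vertices, each joined to both diamonds. -/
def linkPat₂ : Pattern :=
  ⟨10, [(0, 1), (0, 2), (0, 3), (1, 2), (1, 3), (3, 4), (4, 5), (5, 2), (6, 7), (6, 8), (6, 9),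
    (7, 8), (7, 9), (4, 9), (5, 8)],
    [(1, 0), (2, 0), (3, 0), (4, 3), (5, 2), (9, 4), (8, 5), (6, 8), (7, 8)]⟩

/-- The clique on `k` vertices. -/
def cliquePat (k : ℕ) : Pattern :=
  ⟨k, (List.range k).flatMap fun i => (List.range i).map fun j => (j, i), []⟩

/-- The tight patterns that are not cliques, each with an independent set of vertices without
neighbours outside. -/
def tightPats (Δ : ℕ) : List (Pattern × List ℕ) :=
  if Δ = 3 then [(necklacePat₁, [2, 3]), (necklacePat₂, [2, 3, 4]), (necklacePat₃, [2, 3, 4, 8]),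
    (havelPat₁, [0, 6, 7]), (havelPat₂, [0, 6, 7, 8]), (sixCyclePat, [6, 7, 8, 3])]
  else if Δ = 4 then [(squarePat, [0, 3]), (extendedPat₁, [1, 4]), (extendedPat₂, [0, 5, 6])]
  else if Δ = 5 then [(productPat, [0, 4])]
  else []

namespace Pattern

/-- The general requirements on a pattern. -/
def wf (H : Pattern) : Bool :=
  decide (0 < H.size) && H.edges.all (fun e => decide (e.1 < H.size) && decide (e.2 < H.size) && e.1 != e.2) &&
    decide (H.edges.Pairwise fun e f => e ≠ f ∧ e ≠ (f.2, f.1))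

/-- The order lists all vertices. -/
def orderOK (H : Pattern) : Bool :=
  RAM.Stmt.Fits H.edges H.order [0] &&
    (List.range H.size).all (fun i => (RAM.Stmt.full H.order [0]).contains i) &&
    (RAM.Stmt.full H.order [0]).all (· < H.size)

/-- Vertices of degree less than `Δ` are adjacent. -/
def closedUp (Δ : ℕ) (H : Pattern) : Bool :=
  (List.range H.size).all fun i => (List.range H.size).all fun j =>
    i == j || decide (Δ ≤ H.deg i) || decide (Δ ≤ H.deg j) || decide (RAM.Joined H.edges i j)

/-- `J` is an independent set of vertices of degree `Δ`. -/
def indepOK (Δ : ℕ) (H : Pattern) (J : List ℕ) : Bool :=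
  decide J.Nodup && J.all (fun i => decide (i < H.size) && decide (Δ ≤ H.deg i)) &&
    J.all (fun i => J.all fun j => !decide (RAM.Joined H.edges i j))

/-- The number of edges that may leave a copy of the pattern. -/
def slots (Δ : ℕ) (H : Pattern) : ℕ := ((List.range H.size).map fun i => Δ - H.deg i).sum

/-- All requirements on a tight pattern. -/
def tightOK (Δ : ℕ) (H : Pattern) (J : List ℕ) : Bool :=
  H.wf && H.orderOK && H.closedUp Δ && H.indepOK Δ J && decide (Δ * J.length = H.size) &&
    noIndep H.edges (List.range H.size) (J.length + 1) []

end Pattern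

/-- A finite computation, which settles everything intrinsic to the tight graphs: copies are
automatically induced, the listed independent set has `size / Δ` vertices of full degree, and no
independent set is larger. -/
theorem tightOK_of_mem {Δ : ℕ} {H : Pattern} {J : List ℕ} (h : (H, J) ∈ tightPats Δ) :
    H.tightOK Δ J = true := by
  have h3 : (tightPats 3).all (fun a => a.1.tightOK 3 a.2) = true := by decide +kernel
  have h4 : (tightPats 4).all (fun a => a.1.tightOK 4 a.2) = true := by decide +kernel
  have h5 : (tightPats 5).all (fun a => a.1.tightOK 5 a.2) = true := by decide +kernel
  rw [List.all_eq_true] at h3 h4 h5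
  by_cases e3 : Δ = 3
  · subst e3; exact h3 _ h
  by_cases e4 : Δ = 4
  · subst e4; exact h4 _ h
  by_cases e5 : Δ = 5
  · subst e5; exact h5 _ h
  simp [tightPats, e3, e4, e5] at h

/-- The tight patterns, including the clique. -/
def allTightPats (Δ : ℕ) : List Pattern := cliquePat Δ :: (tightPats Δ).map Prod.fst

/-- All tight graphs for Δ = 4 are 3-edge-connected, while `slots_four` allows at most two edges to
leave one of the graphs other than the clique. The next two checks are paired with the numbers of
slots in the same way. -/
theorem cutTest_four : (allTightPats 4).all (fun H => H.cutTest 2 fun _ => false) = true := by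
  decide +kernel

theorem cutTest_five : (allTightPats 5).all (fun H => H.cutTest 0 fun _ => false) = true := by
  decide +kernel

theorem cutTest_three : (allTightPats 3).all (fun H => H.cutTest 1 fun _ => false) = true := by
  decide +kernel

/-- These three checks are for cuts along the one-diamond necklace, which may have two outgoing
edges. These edges start at the distinct adjacent vertices 4 and 5, so a cut by them cannot be a
`badCut`. -/
theorem cutTest_three' : ((tightPats 3).map Prod.fst).tail.all
    (fun H => H.cutTest 2 fun l => H.badCut l) = true := by
  decide +kernel

/-- The exception is the cut that separates the diamond 0, 1, 2, 3 from the vertices 4 and 5; it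
leads to `linkPat₂`. -/
theorem cutTest_necklacePat₁ : necklacePat₁.cutTest 2 (fun l => necklacePat₁.badCut l ||
    l == [false, false, false, false, true, true]) = true := by
  decide +kernel

/-- The exception is a triangle with exactly two vertices inside; it leads to `linkPat₁`. -/
theorem cutTest_cliquePat_three : (cliquePat 3).cutTest 2
    (fun l => (cliquePat 3).badCut l || l.count true == 2) = true := by
  decide +kernel

theorem slots_four : (tightPats 4).all (fun a => decide (a.1.slots 4 ≤ 2)) = true := by decide +kernel

theorem slots_five : (tightPats 5).all (fun a => decide (a.1.slots 5 = 0)) = true := by decide +kernel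

/-- The tail omits the one-diamond necklace, whose vertices 4 and 5 give two slots. -/
theorem slots_three : (tightPats 3).tail.all (fun a => decide (a.1.slots 3 ≤ 1)) = true := by
  decide +kernel

/-! ### Copies of patterns in a graph of bounded degree -/

namespace Pattern

open RAM

section

variable {n : ℕ} {G : SimpleGraph (Fin n)}

/-- The vertices of the pattern are mapped injectively, and adjacent ones to adjacent ones. -/
structure IsCopy (H : Pattern) (G : SimpleGraph (Fin n)) (g : ℕ → Fin n) : Prop where
  inj : ∀ i < H.size, ∀ j < H.size, g i = g j → i = j
  adj : ∀ i < H.size, ∀ j < H.size, i ≠ j → Joined H.edges i j → G.Adj (g i) (g j)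

/-- The set of images of the vertices of the pattern. -/
def verts (H : Pattern) (g : ℕ → Fin n) : Finset (Fin n) := (Finset.range H.size).image g

theorem mem_verts {H : Pattern} {g : ℕ → Fin n} {w : Fin n} :
    w ∈ H.verts g ↔ ∃ i < H.size, g i = w := by
  simp [verts]

theorem IsCopy.card_verts {H : Pattern} {g : ℕ → Fin n} (h : H.IsCopy G g) :
    (H.verts g).card = H.size := by
  rw [verts, Finset.card_image_of_injOn, Finset.card_range]
  intro i hi j hj hij
  exact h.inj i (by simpa using hi) j (by simpa using hj) hij

/-- All adjacencies between the images come from edges of the pattern. -/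
def IsInduced (H : Pattern) (G : SimpleGraph (Fin n)) (g : ℕ → Fin n) : Prop :=
  ∀ i < H.size, ∀ j < H.size, G.Adj (g i) (g j) → Joined H.edges i j

theorem mem_full_iff {H : Pattern} (h : H.orderOK = true) (i : ℕ) :
    i ∈ Stmt.full H.order [0] ↔ i < H.size := by
  simp only [orderOK, Bool.and_eq_true, List.all_eq_true, List.mem_range, List.contains_iff_mem,
    decide_eq_true_eq] at h
  exact ⟨h.2 i, h.1.2 i⟩

/-- Translates between what the search program finds and copies of the pattern inside `W`. -/
theorem valid_iff {H : Pattern} (h : H.orderOK = true) {W : Set (Fin n)} {g : ℕ → Fin n} :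
    Valid G H.edges W (Stmt.full H.order [0]) g ↔ H.IsCopy G g ∧ ∀ w ∈ H.verts g, w ∈ W := by
  constructor
  · rintro ⟨h₁, h₂⟩
    refine ⟨⟨fun i hi j hj hij => ?_, fun i hi j hj hij hJ => ?_⟩, fun w hw => ?_⟩
    · by_contra hne
      exact (h₂ i ((mem_full_iff h i).2 hi) j ((mem_full_iff h j).2 hj) hne).1 hij
    · exact (h₂ i ((mem_full_iff h i).2 hi) j ((mem_full_iff h j).2 hj) hij).2 hJ
    · obtain ⟨i, hi, rfl⟩ := mem_verts.1 hw
      exact h₁ i ((mem_full_iff h i).2 hi)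
  · rintro ⟨h₁, h₂⟩
    refine ⟨fun j hj => h₂ _ (mem_verts.2 ⟨j, (mem_full_iff h j).1 hj, rfl⟩),
      fun i hi j hj hij => ?_⟩
    rw [mem_full_iff h] at hi hj
    exact ⟨fun h => hij (h₁.inj i hi j hj h), h₁.adj i hi j hj hij⟩

variable [DecidableRel G.Adj]

/-- The neighbours of `v` outside `X`. -/
def outNbrs (G : SimpleGraph (Fin n)) [DecidableRel G.Adj] (X : Finset (Fin n)) (v : Fin n) :
    Finset (Fin n) := (G.neighborFinset v).filter (· ∉ X)

theorem mem_outNbrs {X : Finset (Fin n)} {v w : Fin n} :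
    w ∈ outNbrs G X v ↔ G.Adj v w ∧ w ∉ X := by
  simp [outNbrs]

/-- The images of the neighbours of `i` in the pattern use up `deg i` of the at most Δ edges at its
image. Hence vertices of full degree have no neighbours outside the copy. -/
theorem IsCopy.deg_add_card_outNbrs {Δ : ℕ} (hΔ : ∀ v, G.degree v ≤ Δ) {H : Pattern}
    {g : ℕ → Fin n} (h : H.IsCopy G g) {i : ℕ} (hi : i < H.size) :
    H.deg i + (outNbrs G (H.verts g) (g i)).card ≤ Δ := by
  have h₁ : H.deg i ≤ ((G.neighborFinset (g i)).filter (· ∈ H.verts g)).card := by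
    rw [deg, ← List.toFinset_card_of_nodup (List.nodup_range.filter _),
      ← Finset.card_image_of_injOn (f := g)]
    · apply Finset.card_le_card
      intro w hw
      simp only [Finset.mem_image, List.mem_toFinset, List.mem_filter, List.mem_range,
        Bool.and_eq_true, bne_iff_ne, decide_eq_true_eq] at hw
      obtain ⟨j, ⟨hj, hij, hJ⟩, rfl⟩ := hw
      simp only [Finset.mem_filter, SimpleGraph.mem_neighborFinset]
      exact ⟨h.adj i hi j hj hij hJ, mem_verts.2 ⟨j, hj, rfl⟩⟩
    · intro a ha b hb hab
      simp only [List.coe_toFinset, Set.mem_ofPred_eq, List.mem_filter, List.mem_range] at ha hb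
      exact h.inj a ha.1 b hb.1 hab
  have h₂ := hΔ (g i)
  rw [← SimpleGraph.card_neighborFinset_eq_degree,
    ← Finset.card_filter_add_card_filter_not (· ∈ H.verts g)] at h₂
  exact (Nat.add_le_add_right h₁ _).trans h₂

theorem IsCopy.mem_verts_of_adj {Δ : ℕ} (hΔ : ∀ v, G.degree v ≤ Δ) {H : Pattern}
    {g : ℕ → Fin n} (h : H.IsCopy G g) {i : ℕ} (hi : i < H.size) (hd : Δ ≤ H.deg i) {w : Fin n}
    (hw : G.Adj (g i) w) : w ∈ H.verts g := by
  by_contra hc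
  have h₁ := h.deg_add_card_outNbrs hΔ hi
  have h₂ : 0 < (outNbrs G (H.verts g) (g i)).card := Finset.card_pos.2 ⟨w, mem_outNbrs.2 ⟨hw, hc⟩⟩
  omega

theorem IsCopy.sum_card_outNbrs_le {Δ : ℕ} (hΔ : ∀ v, G.degree v ≤ Δ) {H : Pattern}
    {g : ℕ → Fin n} (h : H.IsCopy G g) :
    ∑ x ∈ H.verts g, (outNbrs G (H.verts g) x).card ≤ H.slots Δ := by
  rw [verts, Finset.sum_image (fun i hi j hj hij => h.inj i (by simpa using hi) j
    (by simpa using hj) hij), slots, ← List.sum_toFinset _ List.nodup_range, List.toFinset_range]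
  refine Finset.sum_le_sum fun i hi => ?_
  have := h.deg_add_card_outNbrs hΔ (Finset.mem_range.1 hi)
  rw [verts] at this
  omega

/-- A saturated vertex sends all its edges to the copy along edges of the pattern. -/
theorem IsCopy.joined_of_deg {Δ : ℕ} (hΔ : ∀ v, G.degree v ≤ Δ) {H : Pattern}
    {g : ℕ → Fin n} (h : H.IsCopy G g) {i j : ℕ} (hi : i < H.size) (hj : j < H.size)
    (hd : Δ ≤ H.deg i) (hw : G.Adj (g i) (g j)) : Joined H.edges i j := by
  by_contra hc
  have h₁ : insert (g j) ((((List.range H.size).filter fun j => i != j &&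
      decide (Joined H.edges i j)).toFinset).image g) ⊆ G.neighborFinset (g i) := by
    intro w hw'
    simp only [Finset.mem_insert, Finset.mem_image, List.mem_toFinset, List.mem_filter,
      List.mem_range, Bool.and_eq_true, bne_iff_ne, decide_eq_true_eq] at hw'
    rw [SimpleGraph.mem_neighborFinset]
    rcases hw' with rfl | ⟨k, ⟨hk, hik, hJ⟩, rfl⟩
    · exact hw
    · exact h.adj i hi k hk hik hJ
  have h₂ := Finset.card_le_card h₁
  rw [Finset.card_insert_of_notMem, Finset.card_image_of_injOn,
    List.toFinset_card_of_nodup (List.nodup_range.filter _),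
    SimpleGraph.card_neighborFinset_eq_degree] at h₂
  · have := hΔ (g i)
    rw [deg] at hd
    omega
  · intro a ha b hb hab
    simp only [List.coe_toFinset, Set.mem_ofPred_eq, List.mem_filter, List.mem_range] at ha hb
    exact h.inj a ha.1 b hb.1 hab
  · simp only [Finset.mem_image, List.mem_toFinset, List.mem_filter,
      List.mem_range, Bool.and_eq_true, bne_iff_ne, decide_eq_true_eq, not_exists, not_and]
    rintro k ⟨hk, -, hJ⟩ hkj
    rw [h.inj k hk j hj hkj] at hJ
    exact hc hJ

/-- An additional edge would need two ends that are not saturated, but unsaturated vertices are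
already joined in the pattern. So the program may search for subgraphs without testing
non-adjacency. -/
theorem IsCopy.isInduced {Δ : ℕ} (hΔ : ∀ v, G.degree v ≤ Δ) {H : Pattern}
    {g : ℕ → Fin n} (h : H.IsCopy G g) (hH : H.closedUp Δ = true) : H.IsInduced G g := by
  intro i hi j hj hij
  simp only [closedUp, List.all_eq_true, List.mem_range, Bool.or_eq_true, beq_iff_eq,
    decide_eq_true_eq] at hH
  rcases hH i hi j hj with ((rfl | h') | h') | h'
  · exact absurd hij (SimpleGraph.irrefl _)
  · exact h.joined_of_deg hΔ hi hj h' hij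
  · exact (h.joined_of_deg hΔ hj hi h' hij.symm).symm
  · exact h'

theorem ne_of_wf {H : Pattern} (h : H.wf = true) {e : ℕ × ℕ} (he : e ∈ H.edges) :
    e.1 < H.size ∧ e.2 < H.size ∧ e.1 ≠ e.2 := by
  simp only [wf, Bool.and_eq_true, List.all_eq_true, decide_eq_true_eq, bne_iff_ne] at h
  have := h.1.2 e he
  exact ⟨this.1.1, this.1.2, this.2⟩

theorem pos_of_wf {H : Pattern} (h : H.wf = true) : 0 < H.size := by
  simp only [wf, Bool.and_eq_true, decide_eq_true_eq] at h
  exact h.1.1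

theorem nodup_of_wf {H : Pattern} (h : H.wf = true) : H.edges.Nodup := by
  simp only [wf, Bool.and_eq_true, decide_eq_true_eq] at h
  exact h.2.imp fun h => h.1

theorem eq_of_swap {H : Pattern} (h : H.wf = true) {e f : ℕ × ℕ} (he : e ∈ H.edges)
    (hf : f ∈ H.edges) (hef : (e.1 = f.1 ∧ e.2 = f.2) ∨ (e.1 = f.2 ∧ e.2 = f.1)) : e = f := by
  have h' := h
  simp only [wf, Bool.and_eq_true, decide_eq_true_eq] at h'
  by_contra hne
  have : Std.Symm fun e f : ℕ × ℕ => e ≠ f ∧ e ≠ (f.2, f.1) :=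
    ⟨fun a b hab => ⟨hab.1.symm, fun hc => hab.2 (by rw [hc])⟩⟩
  have := h'.2.forall he hf hne
  rcases hef with h₁ | h₁
  · exact hne (Prod.ext h₁.1 h₁.2)
  · exact this.2 (Prod.ext h₁.1 h₁.2)

/-- The characteristic function of the part of a copy in `X`. -/
def trace (H : Pattern) (g : ℕ → Fin n) (X : Finset (Fin n)) : List Bool :=
  (List.range H.size).map fun i => decide (g i ∈ X)

theorem length_trace (H : Pattern) (g : ℕ → Fin n) (X : Finset (Fin n)) :
    (H.trace g X).length = H.size := by
  simp [trace]

theorem getD_trace {H : Pattern} {g : ℕ → Fin n} {X : Finset (Fin n)} {i : ℕ} (hi : i < H.size) :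
    (H.trace g X).getD i false = decide (g i ∈ X) := by
  simp [trace, hi]

theorem trace_all_id {H : Pattern} {g : ℕ → Fin n} {X : Finset (Fin n)}
    (h : (H.trace g X).all id = true) : H.verts g ⊆ X := by
  intro w hw
  obtain ⟨i, hi, rfl⟩ := mem_verts.1 hw
  simp only [trace, List.all_map, List.all_eq_true, List.mem_range] at h
  simpa using h i hi

theorem trace_all_not {H : Pattern} {g : ℕ → Fin n} {X : Finset (Fin n)}
    (h : (H.trace g X).all not = true) : Disjoint (H.verts g) X := by
  rw [Finset.disjoint_left]
  intro w hw
  obtain ⟨i, hi, rfl⟩ := mem_verts.1 hw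
  simp only [trace, List.all_map, List.all_eq_true, List.mem_range] at h
  simpa using h i hi

/-- The end of `e` outside the set described by `l`. -/
def outer (l : List Bool) (e : ℕ × ℕ) : ℕ := if l.getD e.1 false then e.2 else e.1

omit [DecidableRel G.Adj] in
theorem cuts_trace {H : Pattern} (hwf : H.wf = true) {g : ℕ → Fin n} (h : H.IsCopy G g)
    {X : Finset (Fin n)} {e : ℕ × ℕ} (he : e ∈ H.edges) (hc : cuts (H.trace g X) e = true) :
    inner (H.trace g X) e < H.size ∧ outer (H.trace g X) e < H.size ∧
      g (inner (H.trace g X) e) ∈ X ∧ g (outer (H.trace g X) e) ∉ X ∧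
      G.Adj (g (inner (H.trace g X) e)) (g (outer (H.trace g X) e)) := by
  obtain ⟨h₁, h₂, h₃⟩ := ne_of_wf hwf he
  simp only [cuts, Bool.and_eq_true, getD_trace h₁, getD_trace h₂, bne_iff_ne] at hc
  simp only [inner, outer, getD_trace h₁, decide_eq_true_eq]
  by_cases h1 : g e.1 ∈ X <;> by_cases h2 : g e.2 ∈ X <;> simp [h1, h2] at hc ⊢
  · exact ⟨h₁, h₂, h.adj _ h₁ _ h₂ h₃ (Or.inl he)⟩
  · exact ⟨h₂, h₁, (h.adj _ h₁ _ h₂ h₃ (Or.inl he)).symm⟩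

theorem inner_outer_inj {H : Pattern} (hwf : H.wf = true) {l : List Bool} {e f : ℕ × ℕ}
    (he : e ∈ H.edges) (hf : f ∈ H.edges) (h₁ : inner l e = inner l f)
    (h₂ : outer l e = outer l f) : e = f := by
  apply eq_of_swap hwf he hf
  unfold inner outer at *
  split_ifs at h₁ h₂ with h h'
  · exact Or.inl ⟨h₁, h₂⟩
  · exact Or.inr ⟨h₁, h₂⟩
  · exact Or.inr ⟨h₂, h₁⟩
  · exact Or.inl ⟨h₂, h₁⟩

/-- Each cut edge of the pattern yields an edge of the graph leaving `X`. The map is injective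
because an edge is determined by its inner and outer ends, and `wf` excludes repeated edges. -/
theorem countP_cuts_le {H : Pattern} (hwf : H.wf = true) {g : ℕ → Fin n} (h : H.IsCopy G g)
    (X : Finset (Fin n)) :
    H.edges.countP (cuts (H.trace g X)) ≤ ∑ x ∈ X, (outNbrs G X x).card := by
  rw [List.countP_eq_length_filter, ← List.toFinset_card_of_nodup ((nodup_of_wf hwf).filter _),
    ← Finset.card_sigma]
  refine Finset.card_le_card_of_injOn
    (fun e => ⟨g (inner (H.trace g X) e), g (outer (H.trace g X) e)⟩) ?_ ?_
  · intro e he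
    simp only [List.coe_toFinset, Set.mem_ofPred_eq, List.mem_filter] at he
    have := cuts_trace hwf h he.1 he.2
    simp only [Finset.coe_sigma, Set.mem_sigma_iff, Finset.mem_coe, mem_outNbrs]
    exact ⟨this.2.2.1, this.2.2.2.2, this.2.2.2.1⟩
  · intro e he f hf hef
    simp only [List.coe_toFinset, Set.mem_ofPred_eq, List.mem_filter] at he hf
    have h₁ := cuts_trace hwf h he.1 he.2
    have h₂ := cuts_trace hwf h hf.1 hf.2
    simp only [Sigma.mk.injEq, heq_eq_eq] at hef
    exact inner_outer_inj hwf he.1 hf.1 (h.inj _ h₁.1 _ h₂.1 hef.1)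
      (h.inj _ h₁.2.1 _ h₂.2.1 hef.2)

/-- A copy that is not separated by few edges lies inside or outside of a set with few outgoing
edges. -/
theorem subset_or_disjoint_or {H : Pattern} (hwf : H.wf = true) {g : ℕ → Fin n}
    (h : H.IsCopy G g) {X : Finset (Fin n)} {k : ℕ} (hX : ∑ x ∈ X, (outNbrs G X x).card ≤ k)
    {ex : List Bool → Bool} (hk : H.cutTest k ex = true) :
    H.verts g ⊆ X ∨ Disjoint (H.verts g) X ∨ ex (H.trace g X) = true := by
  rcases cutTest_spec hk (H.trace g X) (length_trace H g X) with h' | h' | h' | h'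
  · exact absurd ((countP_cuts_le hwf h X).trans hX) (by omega)
  · exact Or.inl (trace_all_id h')
  · exact Or.inr (Or.inl (trace_all_not h'))
  · exact Or.inr (Or.inr h')

/-- Two cut edges with the same inner end would give it two neighbours outside `X`. Distinct inner
ends both have neighbours outside `X`, so they are adjacent in the graph, and therefore joined in
the induced copy. -/
theorem badCut_eq_false {H : Pattern} (hwf : H.wf = true) {g : ℕ → Fin n}
    (h : H.IsCopy G g) (hi : H.IsInduced G g) {X : Finset (Fin n)}
    (h₁ : ∀ x ∈ X, (outNbrs G X x).card ≤ 1)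
    (h₂ : ∀ x ∈ X, ∀ y ∈ X, x ≠ y → (outNbrs G X x).Nonempty → (outNbrs G X y).Nonempty →
      G.Adj x y) : H.badCut (H.trace g X) = false := by
  rw [← Bool.not_eq_true]
  intro hb
  simp only [badCut, List.any_eq_true, List.mem_filter, Bool.and_eq_true, bne_iff_ne,
    Bool.or_eq_true, beq_iff_eq, Bool.not_eq_true', decide_eq_false_iff_not] at hb
  obtain ⟨e, ⟨he, hec⟩, f, ⟨hf, hfc⟩, hne, hb⟩ := hb
  have he' := cuts_trace hwf h he hec
  have hf' := cuts_trace hwf h hf hfc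
  by_cases hin : inner (H.trace g X) e = inner (H.trace g X) f
  · have := h₁ _ he'.2.2.1
    rw [Finset.card_le_one] at this
    have := this _ (mem_outNbrs.2 ⟨he'.2.2.2.2, he'.2.2.2.1⟩) _
      (mem_outNbrs.2 ⟨by rw [hin]; exact hf'.2.2.2.2, hf'.2.2.2.1⟩)
    exact hne (inner_outer_inj hwf he hf hin (h.inj _ he'.2.1 _ hf'.2.1 this))
  · have hJ := hb.resolve_left hin
    refine hJ (hi _ he'.1 _ hf'.1 (h₂ _ he'.2.2.1 _ hf'.2.2.1
      (fun hc => hin (h.inj _ he'.1 _ hf'.1 hc)) ⟨_, mem_outNbrs.2 ⟨he'.2.2.2.2, he'.2.2.2.1⟩⟩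
      ⟨_, mem_outNbrs.2 ⟨hf'.2.2.2.2, hf'.2.2.2.1⟩⟩))

end

end Pattern

/-! ### Tight sets as copies of patterns -/

namespace Pattern

open RAM SimpleGraph

section

variable {n : ℕ} {G : SimpleGraph (Fin n)}

theorem exists_copy_of_iso {H : Pattern} (hpos : 0 < H.size) {K : SimpleGraph (Fin H.size)}
    (hK : ∀ i j : Fin H.size, i ≠ j → Joined H.edges i j → K.Adj i j) {X : Finset (Fin n)}
    (φ : G.induce (X : Set (Fin n)) ≃g K) : ∃ g, H.IsCopy G g ∧ H.verts g = X := by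
  obtain ⟨g, hg⟩ : ∃ g : ℕ → Fin n, ∀ i (hi : i < H.size), g i = (φ.symm ⟨i, hi⟩ : _) :=
    ⟨fun i => if h : i < H.size then (φ.symm ⟨i, h⟩ : _) else (φ.symm ⟨0, hpos⟩ : _),
      fun i hi => dif_pos hi⟩
  refine ⟨g, ⟨fun i hi j hj hij => ?_, fun i hi j hj hij hJ => ?_⟩, ?_⟩
  · rw [hg i hi, hg j hj] at hij
    simpa using φ.symm.injective (Subtype.ext hij)
  · rw [hg i hi, hg j hj]
    have := φ.symm.map_adj_iff.2 (hK ⟨i, hi⟩ ⟨j, hj⟩ (by simpa using hij) hJ)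
    exact this
  · ext w
    rw [mem_verts]
    constructor
    · rintro ⟨i, hi, rfl⟩
      rw [hg i hi]
      exact (φ.symm ⟨i, hi⟩).2
    · intro hw
      refine ⟨φ ⟨w, hw⟩, (φ ⟨w, hw⟩).2, ?_⟩
      rw [hg _ (φ ⟨w, hw⟩).2]
      simp

theorem IsCopy.iso {H : Pattern} {g : ℕ → Fin n} (h : H.IsCopy G g) (hi : H.IsInduced G g)
    {K : SimpleGraph (Fin H.size)}
    (hK : ∀ i j : Fin H.size, K.Adj i j ↔ i ≠ j ∧ Joined H.edges i j) :
    Nonempty (G.induce (H.verts g : Set (Fin n)) ≃g K) := by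
  let f : Fin H.size → (H.verts g : Set (Fin n)) := fun i => ⟨g i, mem_verts.2 ⟨i, i.2, rfl⟩⟩
  have hf : Function.Bijective f := by
    constructor
    · intro i j hij
      exact Fin.ext (h.inj i i.2 j j.2 (congrArg Subtype.val hij))
    · rintro ⟨w, hw⟩
      obtain ⟨i, hi, rfl⟩ := mem_verts.1 hw
      exact ⟨⟨i, hi⟩, rfl⟩
  refine ⟨(RelIso.mk (Equiv.ofBijective f hf) ?_ : K ≃g _).symm⟩
  intro i j
  rw [hK]
  constructor
  · intro hij
    exact ⟨fun hc => by simp [hc] at hij, hi i i.2 j j.2 hij⟩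
  · rintro ⟨hne, hJ⟩
    exact h.adj i i.2 j j.2 (fun hc => hne (Fin.ext hc)) hJ

theorem joined_cliquePat {k i j : ℕ} (hi : i < k) (hj : j < k) (hij : i ≠ j) :
    Joined (cliquePat k).edges i j := by
  rcases lt_or_gt_of_ne hij with h | h
  · left
    simp only [cliquePat, List.mem_flatMap, List.mem_range, List.mem_map, Prod.mk.injEq]
    exact ⟨j, hj, i, h, rfl, rfl⟩
  · right
    simp only [cliquePat, List.mem_flatMap, List.mem_range, List.mem_map, Prod.mk.injEq]
    exact ⟨i, hi, j, h, rfl, rfl⟩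

theorem isInduced_cliquePat (k : ℕ) (g : ℕ → Fin n) : (cliquePat k).IsInduced G g :=
  fun _ hi _ hj hij => joined_cliquePat hi hj fun hc => G.irrefl (hc ▸ hij)

theorem isNClique_iff_iso {k : ℕ} {X : Finset (Fin n)} :
    G.IsNClique k X ↔ Nonempty (G.induce (X : Set (Fin n)) ≃g (⊤ : SimpleGraph (Fin k))) := by
  constructor
  · intro h
    refine ⟨⟨X.equivFinOfCardEq h.card_eq, ?_⟩⟩
    intro a b
    simp only [top_adj, ne_eq, EmbeddingLike.apply_eq_iff_eq, comap_adj, Function.Embedding.subtype_apply]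
    exact ⟨fun hab => h.isClique a.2 b.2 fun hc => hab (Subtype.ext hc), fun hab hc =>
      G.irrefl (hc ▸ hab)⟩
  · rintro ⟨φ⟩
    refine ⟨fun a ha b hb hab => ?_, ?_⟩
    · have : (⊤ : SimpleGraph (Fin k)).Adj (φ ⟨a, ha⟩) (φ ⟨b, hb⟩) := by
        simpa using hab
      exact φ.map_adj_iff.1 this
    · have := Fintype.card_congr φ.toEquiv
      simpa using this

theorem exists_copy_cliquePat {k : ℕ} (hk : 0 < k) {X : Finset (Fin n)} (h : G.IsNClique k X) :
    ∃ g, (cliquePat k).IsCopy G g ∧ (cliquePat k).verts g = X := by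
  obtain ⟨φ⟩ := isNClique_iff_iso.1 h
  exact exists_copy_of_iso (H := cliquePat k) hk (K := ⊤) (fun i j hij _ => hij) φ

theorem ofEdges_adj {m : ℕ} {E : List (ℕ × ℕ)} (i j : Fin m) :
    (ofEdges m E).Adj i j ↔ i ≠ j ∧ Joined E i j := by
  simp [ofEdges, RAM.Joined]

theorem cycleEightSquared_adj (i j : Fin 8) :
    cycleEightSquared.Adj i j ↔ i ≠ j ∧ Joined squarePat.edges i j := by
  simp only [cycleEightSquared, circulantGraph_adj]
  revert i j
  decide

/-- The strong product of the 5-cycle and an edge as a graph on ten numbers. -/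
def productIso : ((cycleGraph 5).strongProduct (⊤ : SimpleGraph (Fin 2))) ≃g
    ofEdges 10 productPat.edges where
  toEquiv := finProdFinEquiv
  map_rel_iff' := by
    intro a b
    rw [ofEdges_adj]
    simp only [strongProduct, cycleGraph_adj', top_adj]
    revert a b
    decide +kernel

variable [DecidableRel G.Adj]

/-- An isomorphism always gives a copy. Conversely, the degree bound makes copies of these patterns
induced, so isomorphism reduces to an injective map that preserves edges. -/
theorem isTight_iff {Δ : ℕ} (hΔ : ∀ v, G.degree v ≤ Δ) (X : Finset (Fin n)) :
    (G.induce (X : Set (Fin n))).IsTight Δ ↔ G.IsNClique Δ X ∨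
      ∃ H J, (H, J) ∈ tightPats Δ ∧ ∃ g, H.IsCopy G g ∧ H.verts g = X := by
  have key : ∀ (H : Pattern) (J : List ℕ) (K : SimpleGraph (Fin H.size)), (H, J) ∈ tightPats Δ →
      (∀ i j : Fin H.size, K.Adj i j ↔ i ≠ j ∧ Joined H.edges i j) →
      (Nonempty (G.induce (X : Set (Fin n)) ≃g K) ↔ ∃ g, H.IsCopy G g ∧ H.verts g = X) := by
    intro H J K hH hK
    have hOK := tightOK_of_mem hH
    simp only [tightOK, Bool.and_eq_true] at hOK
    constructor
    · rintro ⟨φ⟩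
      exact exists_copy_of_iso (pos_of_wf hOK.1.1.1.1.1) (fun i j h₁ h₂ => (hK i j).2 ⟨h₁, h₂⟩) φ
    · rintro ⟨g, hg, rfl⟩
      exact hg.iso (hg.isInduced hΔ hOK.1.1.1.2) hK
  rw [IsTight, ← isNClique_iff_iso]
  refine or_congr Iff.rfl ?_
  by_cases h3 : Δ = 3
  · subst h3
    simp only [Nat.reduceEqDiff, false_and, false_or, true_and, IsNecklace]
    have k₁ := key necklacePat₁ [2, 3] diamondNecklace₁ (by simp [tightPats]) ofEdges_adj
    have k₂ := key necklacePat₂ [2, 3, 4] diamondNecklace₂ (by simp [tightPats]) ofEdges_adj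
    have k₃ := key necklacePat₃ [2, 3, 4, 8] diamondNecklace₃ (by simp [tightPats]) ofEdges_adj
    have k₄ := key havelPat₁ [0, 6, 7] havelNecklace₁ (by simp [tightPats]) ofEdges_adj
    have k₅ := key havelPat₂ [0, 6, 7, 8] havelNecklace₂ (by simp [tightPats]) ofEdges_adj
    have k₆ := key sixCyclePat [6, 7, 8, 3] triangleDominatedSixCycle (by simp [tightPats])
      ofEdges_adj
    constructor
    · rintro ((h | h | h | h | h) | h)
      · exact ⟨necklacePat₁, [2, 3], by simp [tightPats], k₁.1 h⟩
      · exact ⟨necklacePat₂, [2, 3, 4], by simp [tightPats], k₂.1 h⟩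
      · exact ⟨necklacePat₃, [2, 3, 4, 8], by simp [tightPats], k₃.1 h⟩
      · exact ⟨havelPat₁, [0, 6, 7], by simp [tightPats], k₄.1 h⟩
      · exact ⟨havelPat₂, [0, 6, 7, 8], by simp [tightPats], k₅.1 h⟩
      · exact ⟨sixCyclePat, [6, 7, 8, 3], by simp [tightPats], k₆.1 h⟩
    · rintro ⟨H, J, hH, h⟩
      simp only [tightPats, if_true, List.mem_cons, Prod.mk.injEq, List.not_mem_nil, or_false] at hH
      rcases hH with ⟨rfl, -⟩ | ⟨rfl, -⟩ | ⟨rfl, -⟩ | ⟨rfl, -⟩ | ⟨rfl, -⟩ | ⟨rfl, -⟩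
      · exact Or.inl (Or.inl (k₁.2 h))
      · exact Or.inl (Or.inr (Or.inl (k₂.2 h)))
      · exact Or.inl (Or.inr (Or.inr (Or.inl (k₃.2 h))))
      · exact Or.inl (Or.inr (Or.inr (Or.inr (Or.inl (k₄.2 h)))))
      · exact Or.inl (Or.inr (Or.inr (Or.inr (Or.inr (k₅.2 h)))))
      · exact Or.inr (k₆.2 h)
  by_cases h4 : Δ = 4
  · subst h4
    simp only [Nat.reduceEqDiff, false_and, false_or, true_and, or_false]
    have k₁ := key squarePat [0, 3] cycleEightSquared (by simp [tightPats]) cycleEightSquared_adj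
    have k₂ := key extendedPat₁ [1, 4] extendedClique (by simp [tightPats]) ofEdges_adj
    have k₃ := key extendedPat₂ [0, 5, 6] extendedDoubleClique (by simp [tightPats]) ofEdges_adj
    constructor
    · rintro (h | h | h)
      · exact ⟨squarePat, [0, 3], by simp [tightPats], k₁.1 h⟩
      · exact ⟨extendedPat₁, [1, 4], by simp [tightPats], k₂.1 h⟩
      · exact ⟨extendedPat₂, [0, 5, 6], by simp [tightPats], k₃.1 h⟩
    · rintro ⟨H, J, hH, h⟩
      simp only [tightPats, if_true, List.mem_cons, Prod.mk.injEq, List.not_mem_nil, or_false,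
        Nat.reduceEqDiff, if_false] at hH
      rcases hH with ⟨rfl, -⟩ | ⟨rfl, -⟩ | ⟨rfl, -⟩
      · exact Or.inl (k₁.2 h)
      · exact Or.inr (Or.inl (k₂.2 h))
      · exact Or.inr (Or.inr (k₃.2 h))
  by_cases h5 : Δ = 5
  · subst h5
    simp only [Nat.reduceEqDiff, false_and, true_and, or_false]
    have k₁ := key productPat [0, 4] (ofEdges 10 productPat.edges) (by simp [tightPats]) ofEdges_adj
    constructor
    · rintro ⟨φ⟩
      exact ⟨productPat, [0, 4], by simp [tightPats], k₁.1 ⟨φ.trans productIso⟩⟩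
    · rintro ⟨H, J, hH, h⟩
      simp only [tightPats, if_true, List.mem_cons, Prod.mk.injEq, List.not_mem_nil, or_false,
        Nat.reduceEqDiff, if_false] at hH
      obtain ⟨rfl, -⟩ := hH
      obtain ⟨φ⟩ := k₁.2 h
      exact ⟨φ.trans productIso.symm⟩
  · simp [tightPats, h3, h4, h5]

/-- The tight set given by a pattern of the list. -/
theorem exists_copy_of_isTight {Δ : ℕ} (hpos : 0 < Δ) (hΔ : ∀ v, G.degree v ≤ Δ) {X : Finset (Fin n)}
    (h : (G.induce (X : Set (Fin n))).IsTight Δ) :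
    ∃ H ∈ allTightPats Δ, ∃ g, H.IsCopy G g ∧ H.IsInduced G g ∧ H.verts g = X := by
  rcases (isTight_iff hΔ X).1 h with h | ⟨H, J, hH, g, hg, hX⟩
  · obtain ⟨g, hg, hX⟩ := exists_copy_cliquePat hpos h
    exact ⟨_, List.mem_cons_self, g, hg, isInduced_cliquePat Δ g, hX⟩
  · have hOK := tightOK_of_mem hH
    simp only [tightOK, Bool.and_eq_true] at hOK
    exact ⟨H, List.mem_cons_of_mem _ (List.mem_map.2 ⟨_, hH, rfl⟩), g, hg,
      hg.isInduced hΔ hOK.1.1.1.2, hX⟩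

end

end Pattern

/-! ### Overlapping tight sets -/

namespace Pattern

open RAM SimpleGraph

section

variable {n : ℕ} {G : SimpleGraph (Fin n)}

/-- The set `W` contains no copy of the pattern. -/
def Avoids (H : Pattern) (G : SimpleGraph (Fin n)) (W : Set (Fin n)) : Prop :=
  ∀ g, H.IsCopy G g → ¬ ∀ w ∈ H.verts g, w ∈ W

theorem Avoids.mono {H : Pattern} {W W' : Set (Fin n)} (h : H.Avoids G W) (hW : W' ⊆ W) :
    H.Avoids G W' :=
  fun g hg hc => h g hg fun w hw => hW (hc w hw)

theorem isCopy_of_edges {H : Pattern} {g : ℕ → Fin n}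
    (hinj : ∀ i < H.size, ∀ j < H.size, i < j → g i ≠ g j)
    (hadj : ∀ e ∈ H.edges, G.Adj (g e.1) (g e.2)) : H.IsCopy G g where
  inj i hi j hj hij := by
    rcases lt_trichotomy i j with h | h | h
    · exact absurd hij (hinj i hi j hj h)
    · exact h
    · exact absurd hij.symm (hinj j hj i hi h)
  adj i _ j _ _ hJ := hJ.elim (fun h => hadj _ h) fun h => (hadj _ h).symm

theorem IsCopy.adj_edge {H : Pattern} (hwf : H.wf = true) {g : ℕ → Fin n} (h : H.IsCopy G g)
    {a b : ℕ} (he : (a, b) ∈ H.edges) : G.Adj (g a) (g b) :=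
  have := ne_of_wf hwf he
  h.adj a this.1 b this.2.1 this.2.2 (Or.inl he)

theorem wf_of_mem_allTightPats {H : Pattern} {Δ : ℕ} (hΔ : Δ = 3 ∨ Δ = 4 ∨ Δ = 5)
    (hH : H ∈ allTightPats Δ) : H.wf = true := by
  have h3 : (cliquePat 3).wf = true := by decide +kernel
  have h4 : (cliquePat 4).wf = true := by decide +kernel
  have h5 : (cliquePat 5).wf = true := by decide +kernel
  rcases List.mem_cons.1 hH with rfl | hH
  · rcases hΔ with rfl | rfl | rfl <;> assumption
  · obtain ⟨⟨H, J⟩, hHJ, rfl⟩ := List.mem_map.1 hH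
    have hOK := tightOK_of_mem hHJ
    simp only [tightOK, Bool.and_eq_true] at hOK
    exact hOK.1.1.1.1.1

/-- This arises when a triangle shares exactly the edge between 4 and 5 with a one-diamond necklace.
-/
theorem isCopy_linkPat₁ {g : ℕ → Fin n} (hg : necklacePat₁.IsCopy G g) {o : Fin n}
    (ho : o ∉ necklacePat₁.verts g) (h₁ : G.Adj o (g 4)) (h₂ : G.Adj o (g 5)) :
    linkPat₁.IsCopy G fun m => if m = 6 then o else g m := by
  have hwf : necklacePat₁.wf = true := by decide +kernel
  apply isCopy_of_edges
  · intro i hi j hj hij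
    have hi' : i < 6 := by simp [linkPat₁] at hi hj; omega
    rw [if_neg (by omega)]
    split_ifs with h
    · rintro rfl
      exact ho (mem_verts.2 ⟨i, hi', rfl⟩)
    · intro hc
      have hj' : j < 6 := by simp [linkPat₁] at hj; omega
      exact hij.ne (hg.inj i hi' j hj' hc)
  · intro e he
    simp only [linkPat₁, List.mem_cons, List.not_mem_nil, or_false] at he
    rcases he with rfl | rfl | rfl | rfl | rfl | rfl | rfl | rfl | rfl | rfl <;>
      first
        | exact h₁
        | exact h₂
        | exact hg.adj_edge hwf (by simp [necklacePat₁])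

/-- This arises when two one-diamond necklaces share exactly their vertices 4 and 5. The
alternatives for `a` and `b` reflect the two ways in which the tips of the second diamond can be
attached. -/
theorem isCopy_linkPat₂ {g h : ℕ → Fin n} (hg : necklacePat₁.IsCopy G g)
    (hh : necklacePat₁.IsCopy G h) (hd : ∀ i < 4, h i ∉ necklacePat₁.verts g) {a b : ℕ}
    (hab : (a = 2 ∧ b = 3) ∨ (a = 3 ∧ b = 2))
    (h₁ : G.Adj (g 4) (h b)) (h₂ : G.Adj (g 5) (h a)) :
    linkPat₂.IsCopy G fun m => if m < 6 then g m else h ([0, 1, a, b].getD (m - 6) 0) := by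
  have hwf : necklacePat₁.wf = true := by decide +kernel
  apply isCopy_of_edges
  · intro i hi j hj hij
    have hj' : j < 10 := hj
    have key : ∀ k, 6 ≤ k → k < 10 → [0, 1, a, b].getD (k - 6) 0 < 4 := by
      intro k hk hk'
      rcases hab with ⟨rfl, rfl⟩ | ⟨rfl, rfl⟩ <;> interval_cases k <;> decide
    have key' : ∀ k l, 6 ≤ k → k < l → l < 10 →
        [0, 1, a, b].getD (k - 6) 0 ≠ [0, 1, a, b].getD (l - 6) 0 := by
      intro k l hk hkl hl
      rcases hab with ⟨rfl, rfl⟩ | ⟨rfl, rfl⟩ <;> interval_cases l <;> interval_cases k <;> decide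
    split_ifs with h' h'' h''
    · exact fun hc => hij.ne (hg.inj i h' j h'' hc)
    · intro hc
      exact hd _ (key j (by omega) hj') (hc ▸ mem_verts.2 ⟨i, h', rfl⟩)
    · omega
    · intro hc
      have s₁ := key i (by omega) (by omega)
      have s₂ := key j (by omega) hj'
      exact key' i j (by omega) hij hj'
        (hh.inj _ (s₁.trans (by decide)) _ (s₂.trans (by decide)) hc)
  · intro e he
    simp only [linkPat₂, List.mem_cons, List.not_mem_nil, or_false] at he
    rcases hab with ⟨rfl, rfl⟩ | ⟨rfl, rfl⟩ <;>
    rcases he with rfl | rfl | rfl | rfl | rfl | rfl | rfl | rfl | rfl | rfl | rfl | rfl | rfl |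
      rfl | rfl <;>
      first
        | exact h₁
        | exact h₂
        | exact hg.adj_edge hwf (by simp [necklacePat₁])
        | exact hh.adj_edge hwf (by simp [necklacePat₁])

variable [DecidableRel G.Adj]

theorem necklacePat₁_outNbrs (hΔ : ∀ v, G.degree v ≤ 3) {g : ℕ → Fin n}
    (hg : necklacePat₁.IsCopy G g) {x : Fin n} (hx : x ∈ necklacePat₁.verts g) :
    (outNbrs G (necklacePat₁.verts g) x).card ≤ 1 ∧
      ((outNbrs G (necklacePat₁.verts g) x).Nonempty → x = g 4 ∨ x = g 5) := by
  obtain ⟨i, hi, rfl⟩ := mem_verts.1 hx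
  have h := hg.deg_add_card_outNbrs hΔ hi
  have h₁ : ∀ i < 6, 2 ≤ necklacePat₁.deg i ∧ (i = 4 ∨ i = 5 ∨ necklacePat₁.deg i = 3) := by
    decide +kernel
  have h₂ := h₁ i hi
  refine ⟨by omega, fun hne => ?_⟩
  have := hne.card_pos
  rcases h₂.2 with rfl | rfl | h₂
  · exact Or.inl rfl
  · exact Or.inr rfl
  · omega

/-- At most two edges leave the necklace, one from each of the adjacent vertices 4 and 5. Apart from
two exceptions, no tight graph has a cut of at most two edges with this shape, and the exceptions
produce link patterns, which `W` avoids. -/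
theorem subset_necklacePat₁ (hΔ : ∀ v, G.degree v ≤ 3) {W : Set (Fin n)}
    (hl₁ : linkPat₁.Avoids G W) (hl₂ : linkPat₂.Avoids G W) {g : ℕ → Fin n}
    (hg : necklacePat₁.IsCopy G g) (hgW : ∀ w ∈ necklacePat₁.verts g, w ∈ W) {K : Pattern}
    (hK : K ∈ allTightPats 3) {h : ℕ → Fin n} (hh : K.IsCopy G h) (hi : K.IsInduced G h)
    (hhW : ∀ w ∈ K.verts h, w ∈ W) (hd : ¬ Disjoint (K.verts h) (necklacePat₁.verts g)) :
    K.verts h ⊆ necklacePat₁.verts g := by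
  have hwf := wf_of_mem_allTightPats (Or.inl rfl) hK
  have hsl : ∑ x ∈ necklacePat₁.verts g, (outNbrs G (necklacePat₁.verts g) x).card ≤ 2 :=
    (hg.sum_card_outNbrs_le hΔ).trans (by decide +kernel)
  have hbad := badCut_eq_false hwf hh hi (X := necklacePat₁.verts g)
    (fun x hx => (necklacePat₁_outNbrs hΔ hg hx).1) (by
      have h45 : G.Adj (g 4) (g 5) := hg.adj_edge (by decide +kernel) (by simp [necklacePat₁])
      intro x hx y hy hxy hx' hy'
      rcases (necklacePat₁_outNbrs hΔ hg hx).2 hx' with rfl | rfl <;>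
        rcases (necklacePat₁_outNbrs hΔ hg hy).2 hy' with rfl | rfl
      · exact absurd rfl hxy
      · exact h45
      · exact h45.symm
      · exact absurd rfl hxy)
  have hout : ∀ x ∈ necklacePat₁.verts g, ∀ w, G.Adj x w → w ∉ necklacePat₁.verts g →
      x = g 4 ∨ x = g 5 := fun x hx w hxw hw =>
    (necklacePat₁_outNbrs hΔ hg hx).2 ⟨w, mem_outNbrs.2 ⟨hxw, hw⟩⟩
  rcases List.mem_cons.1 hK with rfl | hK'
  · rcases subset_or_disjoint_or hwf hh hsl cutTest_cliquePat_three with h' | h' | h'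
    · exact h'
    · exact absurd h' hd
    · exfalso
      rw [hbad, Bool.false_or, beq_iff_eq] at h'
      have key : ∀ i j k : ℕ, i < 3 → j < 3 → k < 3 → i ≠ j → i ≠ k → j ≠ k →
          h i ∈ necklacePat₁.verts g → h j ∈ necklacePat₁.verts g →
          h k ∉ necklacePat₁.verts g → False := by
        intro i j k hi hj hk hij hik hjk hiX hjX hkX
        have hki := hh.adj k hk i hi hik.symm (joined_cliquePat hk hi hik.symm)
        have hkj := hh.adj k hk j hj hjk.symm (joined_cliquePat hk hj hjk.symm)
        have hne : h i ≠ h j := fun hc => hij (hh.inj i hi j hj hc)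
        -- The two triangle vertices inside have the outside neighbour `h k`, so they are the
        -- vertices 4 and 5 of the necklace in some order.
        have h45 : G.Adj (h k) (g 4) ∧ G.Adj (h k) (g 5) := by
          rcases hout _ hiX _ hki.symm hkX with e | e <;>
            rcases hout _ hjX _ hkj.symm hkX with e' | e'
          · exact absurd (e.trans e'.symm) hne
          · exact ⟨e ▸ hki, e' ▸ hkj⟩
          · exact ⟨e' ▸ hkj, e ▸ hki⟩
          · exact absurd (e.trans e'.symm) hne
        refine hl₁ _ (isCopy_linkPat₁ hg hkX h45.1 h45.2) fun w hw => ?_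
        obtain ⟨m, hm, rfl⟩ := mem_verts.1 hw
        split_ifs with hm6
        · exact hhW _ (mem_verts.2 ⟨k, hk, rfl⟩)
        · have hm' : m < 7 := hm
          exact hgW _ (mem_verts.2 ⟨m, show m < 6 by omega, rfl⟩)
      have htr : (cliquePat 3).trace h (necklacePat₁.verts g) =
          [decide (h 0 ∈ necklacePat₁.verts g), decide (h 1 ∈ necklacePat₁.verts g),
            decide (h 2 ∈ necklacePat₁.verts g)] := rfl
      rw [htr] at h'
      by_cases h0 : h 0 ∈ necklacePat₁.verts g <;> by_cases h1 : h 1 ∈ necklacePat₁.verts g <;>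
        by_cases h2 : h 2 ∈ necklacePat₁.verts g <;> simp [h0, h1, h2] at h'
      · exact key 0 1 2 (by omega) (by omega) (by omega) (by omega) (by omega) (by omega) h0 h1 h2
      · exact key 0 2 1 (by omega) (by omega) (by omega) (by omega) (by omega) (by omega) h0 h2 h1
      · exact key 1 2 0 (by omega) (by omega) (by omega) (by omega) (by omega) (by omega) h1 h2 h0
  have hK'' : K = necklacePat₁ ∨ K ∈ ((tightPats 3).map Prod.fst).tail := by
    simpa [tightPats] using hK'
  rcases hK'' with rfl | hK''
  · rcases subset_or_disjoint_or hwf hh hsl cutTest_necklacePat₁ with h' | h' | h'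
    · exact h'
    · exact absurd h' hd
    · exfalso
      rw [hbad, Bool.false_or, beq_iff_eq] at h'
      have htr : necklacePat₁.trace h (necklacePat₁.verts g) =
          [decide (h 0 ∈ necklacePat₁.verts g), decide (h 1 ∈ necklacePat₁.verts g),
            decide (h 2 ∈ necklacePat₁.verts g), decide (h 3 ∈ necklacePat₁.verts g),
            decide (h 4 ∈ necklacePat₁.verts g), decide (h 5 ∈ necklacePat₁.verts g)] := rfl
      rw [htr] at h'
      simp only [List.cons.injEq, decide_eq_false_iff_not, decide_eq_true_eq, and_true] at h'
      obtain ⟨h0, h1, h2, h3, h4, h5⟩ := h'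
      have hd : ∀ i < 4, h i ∉ necklacePat₁.verts g := by
        intro i hi
        interval_cases i <;> assumption
      have e34 : G.Adj (h 3) (h 4) := hh.adj_edge hwf (by simp [necklacePat₁])
      have e52 : G.Adj (h 5) (h 2) := hh.adj_edge hwf (by simp [necklacePat₁])
      have hne : h 4 ≠ h 5 := fun hc => absurd (hh.inj 4 (by decide) 5 (by decide) hc) (by decide)
      have fin : ∀ a b : ℕ, ((a = 2 ∧ b = 3) ∨ (a = 3 ∧ b = 2)) → G.Adj (g 4) (h b) →
          G.Adj (g 5) (h a) → False := by
        intro a b hab h₁ h₂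
        refine hl₂ _ (isCopy_linkPat₂ hg hh hd hab h₁ h₂) fun w hw => ?_
        obtain ⟨m, hm, rfl⟩ := mem_verts.1 hw
        have hm' : m < 10 := hm
        split_ifs with hm6
        · exact hgW _ (mem_verts.2 ⟨m, hm6, rfl⟩)
        · refine hhW _ (mem_verts.2 ⟨_, ?_, rfl⟩)
          rcases hab with ⟨rfl, rfl⟩ | ⟨rfl, rfl⟩ <;> interval_cases m <;> decide
      -- The vertices 4 and 5 of the second necklace have neighbours outside the first, so they are
      -- its vertices 4 and 5, in either order.
      rcases hout _ h4 _ e34.symm h3 with e | e <;> rcases hout _ h5 _ e52 h2 with e' | e'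
      · exact hne (e.trans e'.symm)
      · exact fin 2 3 (Or.inl ⟨rfl, rfl⟩) (e ▸ e34.symm) (e' ▸ e52)
      · exact fin 3 2 (Or.inr ⟨rfl, rfl⟩) (e' ▸ e52) (e ▸ e34.symm)
      · exact hne (e.trans e'.symm)
  · rcases subset_or_disjoint_or hwf hh hsl (List.all_eq_true.1 cutTest_three' _ hK'') with
      h' | h' | h'
    · exact h'
    · exact absurd h' hd
    · rw [hbad] at h'
      exact absurd h' (by decide)

/-- A tight set that meets a tight set of another kind than a clique is contained in it. -/
theorem subset_of_not_disjoint {Δ : ℕ} (hΔ : ∀ v, G.degree v ≤ Δ) {W : Set (Fin n)}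
    (hl : Δ = 3 → linkPat₁.Avoids G W ∧ linkPat₂.Avoids G W) {H : Pattern} {J : List ℕ}
    (hH : (H, J) ∈ tightPats Δ) {g : ℕ → Fin n} (hg : H.IsCopy G g)
    (hgW : ∀ w ∈ H.verts g, w ∈ W) {K : Pattern} (hK : K ∈ allTightPats Δ) {h : ℕ → Fin n}
    (hh : K.IsCopy G h) (hi : K.IsInduced G h) (hhW : ∀ w ∈ K.verts h, w ∈ W)
    (hd : ¬ Disjoint (K.verts h) (H.verts g)) : K.verts h ⊆ H.verts g := by
  -- At most `k` edges leave the copy of `H`, and every nontrivial cut of `K` has more than `k`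
  -- edges.
  have main : ∀ k, (Δ = 3 ∨ Δ = 4 ∨ Δ = 5) → H.slots Δ ≤ k → K.cutTest k (fun _ => false) = true →
      K.verts h ⊆ H.verts g := by
    intro k hc hk hcut
    rcases subset_or_disjoint_or (wf_of_mem_allTightPats hc hK) hh
      ((hg.sum_card_outNbrs_le hΔ).trans hk) hcut with h' | h' | h'
    · exact h'
    · exact absurd h' hd
    · simp at h'
  by_cases h3 : Δ = 3
  · subst h3
    by_cases hN : H = necklacePat₁
    · subst hN
      exact subset_necklacePat₁ hΔ (hl rfl).1 (hl rfl).2 hg hgW hK hh hi hhW hd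
    · have hH' : (H, J) ∈ (tightPats 3).tail := by
        simpa [tightPats, hN] using hH
      exact main 1 (Or.inl rfl) (by simpa using List.all_eq_true.1 slots_three _ hH')
        (List.all_eq_true.1 cutTest_three _ hK)
  by_cases h4 : Δ = 4
  · subst h4
    exact main 2 (by simp) (by simpa using List.all_eq_true.1 slots_four _ hH)
      (List.all_eq_true.1 cutTest_four _ hK)
  by_cases h5 : Δ = 5
  · subst h5
    exact main 0 (by simp) (by simpa using List.all_eq_true.1 slots_five _ hH)
      (List.all_eq_true.1 cutTest_five _ hK)
  simp [tightPats, h3, h4, h5] at hH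

end

end Pattern

/-! ### Independent sets in tight sets; intersecting cliques and diamonds -/

namespace Pattern

open RAM SimpleGraph

section

variable {n : ℕ} {G : SimpleGraph (Fin n)}

/-- The list `c` collects the vertices selected so far; a branch is abandoned when its next vertex
has a neighbour in `c`. -/
theorem noIndep_spec {E : List (ℕ × ℕ)} : ∀ (l : List ℕ) (k : ℕ) (c : List ℕ),
    noIndep E l k c = true → ∀ s : List ℕ, s.Sublist l → s.length = k →
      (∀ x ∈ s, ∀ y ∈ c, ¬ Joined E x y) → s.Pairwise (fun x y => ¬ Joined E x y) → False
  | _, 0, _, h, _, _, _, _, _ => by simp [noIndep] at h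
  | [], k + 1, _, _, s, hs, hk, _, _ => by simp [List.sublist_nil.1 hs] at hk
  | v :: l, k + 1, c, h, s, hs, hk, hc, hp => by
    simp only [noIndep, Bool.and_eq_true, Bool.or_eq_true, List.any_eq_true,
      List.contains_iff_mem] at h
    cases hs with
    | cons _ hs => exact noIndep_spec l (k + 1) c h.1 s hs hk hc hp
    | @cons_cons s _ _ hs =>
      rcases h.2 with ⟨w, hw, hJ⟩ | h'
      · exact hc v List.mem_cons_self w hw hJ
      · rw [List.pairwise_cons] at hp
        refine noIndep_spec l k (v :: c) h' s hs (by simpa using hk) ?_ hp.2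
        intro x hx y hy
        rcases List.mem_cons.1 hy with rfl | hy
        · exact fun hJ => hp.1 x hx hJ.symm
        · exact hc x (List.mem_cons_of_mem _ hx) y hy

variable [DecidableRel G.Adj]

omit [DecidableRel G.Adj] in
/-- An independent set contains at most `1 / Δ` of the vertices of a tight set. -/
theorem card_inter_le {Δ : ℕ} {H : Pattern} {J : List ℕ} (hH : (H, J) ∈ tightPats Δ)
    {g : ℕ → Fin n} (hg : H.IsCopy G g) {I : Finset (Fin n)}
    (hI : ∀ x ∈ I, ∀ y ∈ I, ¬ G.Adj x y) :
    Δ * (I ∩ H.verts g).card ≤ (H.verts g).card := by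
  have hOK := tightOK_of_mem hH
  simp only [tightOK, Bool.and_eq_true, decide_eq_true_eq] at hOK
  obtain ⟨⟨_, hJ⟩, hno⟩ := hOK
  set s := (List.range H.size).filter fun i => decide (g i ∈ I) with hs
  have hcard : (I ∩ H.verts g).card = s.length := by
    rw [← List.toFinset_card_of_nodup (List.nodup_range.filter _),
      ← Finset.card_image_of_injOn (f := g)]
    · congr 1
      ext w
      simp only [Finset.mem_inter, mem_verts, Finset.mem_image, List.mem_toFinset, List.mem_filter,
        List.mem_range, decide_eq_true_eq]
      constructor
      · rintro ⟨hw, i, hi, rfl⟩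
        exact ⟨i, ⟨hi, hw⟩, rfl⟩
      · rintro ⟨i, ⟨hi, hw⟩, rfl⟩
        exact ⟨hw, i, hi, rfl⟩
    · intro a ha b hb hab
      simp only [List.coe_toFinset, Set.mem_ofPred_eq, List.mem_filter, List.mem_range] at ha hb
      exact hg.inj a ha.1 b hb.1 hab
  rw [hcard, hg.card_verts, ← hJ]
  refine Nat.mul_le_mul_left Δ ?_
  by_contra! hlt
  refine noIndep_spec _ _ _ hno (s.take (J.length + 1))
    ((List.take_sublist _ _).trans List.filter_sublist) (by simp; omega) (by simp) ?_
  refine List.Pairwise.sublist (List.take_sublist _ _) ?_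
  refine (List.nodup_range.filter _).pairwise_of_forall_ne ?_
  intro a ha b hb hab hj
  simp only [List.mem_filter, List.mem_range, decide_eq_true_eq] at ha hb
  exact hI _ ha.2 _ hb.2 (hg.adj a ha.1 b hb.1 hab hj)

/-- A tight set other than a clique contains an independent set of `1 / Δ` of its vertices without
neighbours outside. -/
theorem exists_indep {Δ : ℕ} (hΔ : ∀ v, G.degree v ≤ Δ) {H : Pattern} {J : List ℕ}
    (hH : (H, J) ∈ tightPats Δ) {g : ℕ → Fin n} (hg : H.IsCopy G g) :
    ∃ I ⊆ H.verts g, (∀ x ∈ I, ∀ y ∈ I, ¬ G.Adj x y) ∧ Δ * I.card = (H.verts g).card ∧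
      ∀ x ∈ I, ∀ w, G.Adj x w → w ∈ H.verts g := by
  have hOK := tightOK_of_mem hH
  simp only [tightOK, indepOK, Bool.and_eq_true, decide_eq_true_eq, List.all_eq_true,
    Bool.not_eq_true', decide_eq_false_iff_not] at hOK
  obtain ⟨⟨⟨⟨_, hcl⟩, ⟨hnd, hlt⟩, hind⟩, hJ⟩, -⟩ := hOK
  refine ⟨J.toFinset.image g, ?_, ?_, ?_, ?_⟩
  · intro w hw
    obtain ⟨i, hi, rfl⟩ := Finset.mem_image.1 hw
    exact mem_verts.2 ⟨i, (hlt i (List.mem_toFinset.1 hi)).1, rfl⟩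
  · intro x hx y hy hxy
    obtain ⟨i, hi, rfl⟩ := Finset.mem_image.1 hx
    obtain ⟨j, hj, rfl⟩ := Finset.mem_image.1 hy
    rw [List.mem_toFinset] at hi hj
    exact hind i hi j hj (hg.isInduced hΔ hcl i (hlt i hi).1 j (hlt j hj).1 hxy)
  · rw [hg.card_verts, Finset.card_image_of_injOn, List.toFinset_card_of_nodup hnd, hJ]
    intro a ha b hb hab
    simp only [List.coe_toFinset, Set.mem_ofPred_eq] at ha hb
    exact hg.inj a (hlt a ha).1 b (hlt b hb).1 hab
  · intro x hx w hw
    obtain ⟨i, hi, rfl⟩ := Finset.mem_image.1 hx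
    rw [List.mem_toFinset] at hi
    exact hg.mem_verts_of_adj hΔ (hlt i hi).1 (hlt i hi).2 hw

/-- Of the at most Δ neighbours of `u`, Δ - 1 lie in the clique. The peeling bound and the
application of Hall's theorem both rest on this. -/
theorem card_outNbrs_of_isNClique {Δ : ℕ} (hΔ : ∀ v, G.degree v ≤ Δ) {K : Finset (Fin n)}
    (hK : G.IsNClique Δ K) {u : Fin n} (hu : u ∈ K) : (outNbrs G K u).card ≤ 1 := by
  have h₁ : K.erase u ⊆ (G.neighborFinset u).filter (· ∈ K) := by
    intro w hw
    rw [Finset.mem_erase] at hw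
    simp only [Finset.mem_filter, mem_neighborFinset]
    exact ⟨hK.isClique hu hw.2 hw.1.symm, hw.2⟩
  have h₂ := Finset.card_le_card h₁
  rw [Finset.card_erase_of_mem hu, hK.card_eq] at h₂
  have h₃ := hΔ u
  rw [← card_neighborFinset_eq_degree, ← Finset.card_filter_add_card_filter_not (· ∈ K)] at h₃
  have h₄ : 0 < K.card := Finset.card_pos.2 ⟨u, hu⟩
  rw [hK.card_eq] at h₄
  rw [outNbrs]
  omega

/-- Two distinct cliques of size `Δ` with a common vertex share all but one of their vertices. -/
theorem card_inter_of_isNClique {Δ : ℕ} (hΔ : ∀ v, G.degree v ≤ Δ) {K L : Finset (Fin n)}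
    (hK : G.IsNClique Δ K) (hL : G.IsNClique Δ L) (hKL : K ≠ L) {v : Fin n} (hvK : v ∈ K)
    (hvL : v ∈ L) : (K ∩ L).card + 1 = Δ := by
  -- The union lies in the closed neighbourhood of the common vertex, so it has at most one vertex
  -- more than each clique.
  have h₁ : (K ∪ L).card ≤ Δ + 1 := by
    have : K ∪ L ⊆ insert v (G.neighborFinset v) := by
      intro w hw
      rw [Finset.mem_insert, mem_neighborFinset]
      by_cases hwv : w = v
      · exact Or.inl hwv
      · right
        rcases Finset.mem_union.1 hw with hw | hw
        · exact hK.isClique hvK hw (Ne.symm hwv)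
        · exact hL.isClique hvL hw (Ne.symm hwv)
    refine (Finset.card_le_card this).trans ((Finset.card_insert_le _ _).trans ?_)
    have := hΔ v
    rw [← card_neighborFinset_eq_degree] at this
    omega
  have h₂ := Finset.card_union_add_card_inter K L
  rw [hK.card_eq, hL.card_eq] at h₂
  have h₃ : (K ∩ L).card < Δ := by
    rw [← hK.card_eq]
    refine Finset.card_lt_card ⟨Finset.inter_subset_left, fun h => hKL ?_⟩
    exact Finset.eq_of_subset_of_card_le (fun x hx => (Finset.mem_inter.1 (h hx)).2)
      (by rw [hK.card_eq, hL.card_eq])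
  omega

omit [DecidableRel G.Adj] in
-- The two tips are not saturated, so the degree bound does not exclude an edge between them; the
-- absence of cliques on four vertices does.
theorem diamondPat_isInduced (hω : G.CliqueFree 4) {g : ℕ → Fin n} (hg : diamondPat.IsCopy G g) :
    diamondPat.IsInduced G g := by
  intro i hi j hj hij
  by_contra hJ
  have hE : ∀ i < 4, ∀ j < 4, i = j ∨ Joined diamondPat.edges i j ∨
      (i = 2 ∧ j = 3) ∨ (i = 3 ∧ j = 2) := by decide +kernel
  have h23 : G.Adj (g 2) (g 3) := by
    rcases hE i hi j hj with rfl | h | ⟨rfl, rfl⟩ | ⟨rfl, rfl⟩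
    · exact absurd hij G.irrefl
    · exact absurd h hJ
    · exact hij
    · exact hij.symm
  have hwf : diamondPat.wf = true := by decide +kernel
  have h01 : G.Adj (g 0) (g 1) := hg.adj_edge hwf (by simp [diamondPat])
  have h02 : G.Adj (g 0) (g 2) := hg.adj_edge hwf (by simp [diamondPat])
  have h03 : G.Adj (g 0) (g 3) := hg.adj_edge hwf (by simp [diamondPat])
  have h12 : G.Adj (g 1) (g 2) := hg.adj_edge hwf (by simp [diamondPat])
  have h13 : G.Adj (g 1) (g 3) := hg.adj_edge hwf (by simp [diamondPat])
  refine hω _ ((is3Clique_triple_iff.2 ⟨h12, h13, h23⟩).insert (a := g 0) ?_)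
  simp [h01, h02, h03]

/-- A triangle that meets a diamond is contained in it. -/
theorem subset_diamond (hΔ : ∀ v, G.degree v ≤ 3) (hω : G.CliqueFree 4) {g : ℕ → Fin n}
    (hg : diamondPat.IsCopy G g) {K : Finset (Fin n)} (hK : G.IsNClique 3 K)
    (hd : ¬ Disjoint K (diamondPat.verts g)) : K ⊆ diamondPat.verts g := by
  have hi := diamondPat_isInduced hω hg
  have hdeg : ∀ i < 4, 2 ≤ diamondPat.deg i ∧ (i = 2 ∨ i = 3 ∨ 3 ≤ diamondPat.deg i) := by
    decide +kernel
  have htip : ∀ x ∈ diamondPat.verts g, ∀ w, G.Adj x w → w ∉ diamondPat.verts g →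
      x = g 2 ∨ x = g 3 := by
    intro x hx w hxw hw
    obtain ⟨i, hi, rfl⟩ := mem_verts.1 hx
    rcases (hdeg i hi).2 with rfl | rfl | h
    · exact Or.inl rfl
    · exact Or.inr rfl
    · exact absurd (hg.mem_verts_of_adj hΔ hi h hxw) hw
  have h23 : ¬ G.Adj (g 2) (g 3) := fun h =>
    absurd (hi 2 (by decide) 3 (by decide) h) (by decide +kernel)
  obtain ⟨x, hxK, hx⟩ := Finset.not_disjoint_iff.1 hd
  intro w hwK
  by_contra hw
  have hxw : G.Adj x w := hK.isClique hxK hwK fun hc => hw (hc ▸ hx)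
  obtain ⟨t, htK, ht⟩ : ∃ t ∈ K, t ∉ ({x, w} : Finset (Fin n)) := by
    by_contra! hc
    have := (Finset.card_le_card (fun t ht => hc t ht)).trans Finset.card_le_two
    rw [hK.card_eq] at this
    omega
  simp only [Finset.mem_insert, Finset.mem_singleton, not_or] at ht
  have hxt : G.Adj x t := hK.isClique hxK htK (Ne.symm ht.1)
  have htw : G.Adj t w := hK.isClique htK hwK ht.2
  -- With two triangle vertices inside, both would be tips, which are not adjacent; with only one
  -- inside, it would have two neighbours outside.
  by_cases htX : t ∈ diamondPat.verts g
  · rcases htip x hx w hxw hw with rfl | rfl <;> rcases htip t htX w htw hw with rfl | rfl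
    · exact G.irrefl hxt
    · exact h23 hxt
    · exact h23 hxt.symm
    · exact G.irrefl hxt
  · obtain ⟨i, hi', rfl⟩ := mem_verts.1 hx
    have h₁ := hg.deg_add_card_outNbrs hΔ hi'
    have h₂ := (hdeg i hi').1
    have h₃ : ({t, w} : Finset (Fin n)) ⊆ outNbrs G (diamondPat.verts g) (g i) := by
      intro z hz
      simp only [Finset.mem_insert, Finset.mem_singleton] at hz
      rw [mem_outNbrs]
      rcases hz with rfl | rfl
      · exact ⟨hxt, htX⟩
      · exact ⟨hxw, hw⟩
    have h₄ := Finset.card_le_card h₃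
    rw [Finset.card_pair ht.2] at h₄
    omega

/-- Two triangles with a common vertex form a diamond. -/
theorem exists_diamond (hΔ : ∀ v, G.degree v ≤ 3) {K L : Finset (Fin n)} (hK : G.IsNClique 3 K)
    (hL : G.IsNClique 3 L) (hKL : K ≠ L) {v : Fin n} (hvK : v ∈ K) (hvL : v ∈ L) :
    ∃ g, diamondPat.IsCopy G g ∧ diamondPat.verts g ⊆ K ∪ L := by
  have hI := card_inter_of_isNClique hΔ hK hL hKL hvK hvL
  obtain ⟨x, y, hxy, hI'⟩ := Finset.card_eq_two.1 (Nat.succ_injective hI : (K ∩ L).card = 2)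
  have hx : x ∈ K ∩ L := by rw [hI']; simp
  have hy : y ∈ K ∩ L := by rw [hI']; simp
  rw [Finset.mem_inter] at hx hy
  have third : ∀ M : Finset (Fin n), M.card = 3 → ∃ a ∈ M, a ∉ K ∩ L := by
    intro M hM
    by_contra! hc
    have := Finset.card_le_card (fun a ha => hc a ha)
    omega
  obtain ⟨a, haK, ha⟩ := third K hK.card_eq
  obtain ⟨b, hbL, hb⟩ := third L hL.card_eq
  have hab : a ≠ b := by
    rintro rfl
    exact ha (Finset.mem_inter.2 ⟨haK, hbL⟩)
  have ha' : x ≠ a ∧ y ≠ a := by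
    constructor <;> rintro rfl <;> exact ha (Finset.mem_inter.2 ‹_›)
  have hb' : x ≠ b ∧ y ≠ b := by
    constructor <;> rintro rfl <;> exact hb (Finset.mem_inter.2 ‹_›)
  refine ⟨fun i => [x, y, a, b].getD i x, isCopy_of_edges ?_ ?_, ?_⟩
  · intro i hi j hj hij
    have hj' : j < 4 := hj
    interval_cases j <;> interval_cases i <;> simp <;> tauto
  · intro e he
    simp only [diamondPat, List.mem_cons, List.not_mem_nil, or_false] at he
    rcases he with rfl | rfl | rfl | rfl | rfl
    · exact hK.isClique hx.1 hy.1 hxy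
    · exact hK.isClique hx.1 haK ha'.1
    · exact hL.isClique hx.2 hbL hb'.1
    · exact hK.isClique hy.1 haK ha'.2
    · exact hL.isClique hy.2 hbL hb'.2
  · intro w hw
    obtain ⟨i, hi, rfl⟩ := mem_verts.1 hw
    have hi' : i < 4 := hi
    rw [Finset.mem_union]
    interval_cases i
    · exact Or.inl hx.1
    · exact Or.inl hy.1
    · exact Or.inl haK
    · exact Or.inr hbL

end

end Pattern

/-! ### Profitable nibbles -/

namespace RAM

open SimpleGraph Pattern

section

variable {n : ℕ} {G : SimpleGraph (Fin n)}

theorem isProfitable_congr {Δ : ℕ} {Z Z' Y Y' : Set (Fin n)} (hZ : Z = Z') (hY : Y = Y')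
    (h : (G.induce Zᶜ).IsProfitable Δ (Subtype.val ⁻¹' Y)) :
    (G.induce Z'ᶜ).IsProfitable Δ (Subtype.val ⁻¹' Y') := by
  subst hZ hY
  exact h

/-- The new set is appended as the last part. Profitability of the earlier parts is unaffected,
since it only depends on the parts before them. -/
theorem isProfitablyNibbled_union {Δ : ℕ} {Z Y : Set (Fin n)} (hZ : G.IsProfitablyNibbled Δ Z)
    (hd : Disjoint Z Y) (hp : (G.induce Zᶜ).IsProfitable Δ (Subtype.val ⁻¹' Y))
    (hc : Y.ncard ≤ max (Δ + 3) 10) : G.IsProfitablyNibbled Δ (Z ∪ Y) := by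
  obtain ⟨r, X, hX, rfl, hX'⟩ := hZ
  have hlast : (⋃ b < Fin.last r, Fin.snoc (α := fun _ => Set (Fin n)) X Y b) = ⋃ a, X a := by
    ext w
    simp only [Set.mem_iUnion]
    constructor
    · rintro ⟨b, hb, hw⟩
      obtain ⟨c, rfl⟩ := Fin.exists_castSucc_eq.2 hb.ne
      exact ⟨c, by simpa using hw⟩
    · rintro ⟨c, hw⟩
      exact ⟨c.castSucc, Fin.castSucc_lt_last c, by simpa using hw⟩
  have hcast : ∀ a : Fin r, (⋃ b < a.castSucc, Fin.snoc (α := fun _ => Set (Fin n)) X Y b) =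
      ⋃ b < a, X b := by
    intro a
    ext w
    simp only [Set.mem_iUnion]
    constructor
    · rintro ⟨b, hb, hw⟩
      obtain ⟨c, rfl⟩ := Fin.exists_castSucc_eq.2 (hb.trans (Fin.castSucc_lt_last a)).ne
      exact ⟨c, by simpa using hb, by simpa using hw⟩
    · rintro ⟨c, hc, hw⟩
      exact ⟨c.castSucc, by simpa using hc, by simpa using hw⟩
  refine ⟨r + 1, Fin.snoc (α := fun _ => Set (Fin n)) X Y, ?_, ?_, ?_⟩
  · intro a b hab
    induction a using Fin.lastCases with
    | last =>
      induction b using Fin.lastCases with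
      | last => exact absurd rfl hab
      | cast b =>
        simp only [Fin.snoc_last, Fin.snoc_castSucc]
        exact (hd.mono_left (Set.subset_iUnion X b)).symm
    | cast a =>
      induction b using Fin.lastCases with
      | last =>
        simp only [Fin.snoc_last, Fin.snoc_castSucc]
        exact hd.mono_left (Set.subset_iUnion X a)
      | cast b =>
        simp only [Fin.snoc_castSucc]
        exact hX fun hc => hab (by rw [hc])
  · ext w
    simp only [Set.mem_iUnion, Set.mem_union]
    constructor
    · rintro ⟨b, hw⟩
      induction b using Fin.lastCases with
      | last => exact Or.inr (by simpa using hw)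
      | cast b => exact Or.inl ⟨b, by simpa using hw⟩
    · rintro (⟨b, hw⟩ | hw)
      · exact ⟨b.castSucc, by simpa using hw⟩
      · exact ⟨Fin.last r, by simpa using hw⟩
  · intro a
    induction a using Fin.lastCases with
    | last =>
      exact ⟨isProfitable_congr hlast.symm (by simp) hp, by simpa using hc⟩
    | cast a =>
      exact ⟨isProfitable_congr (hcast a).symm (by simp) (hX' a).1, by simpa using (hX' a).2⟩

theorem isProfitablyNibbled_empty (Δ : ℕ) : G.IsProfitablyNibbled Δ (∅ : Set (Fin n)) :=
  ⟨0, fun _ => ∅, fun a => a.elim0, by simp, fun a => a.elim0⟩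

/-- Only the statuses 0 and 2 occur, and the vertices of status 2 form a nibbled set. -/
def Nibbled (Δ : ℕ) (G : SimpleGraph (Fin n)) (st : Fin n → ℕ) : Prop :=
  (∀ w, st w = 0 ∨ st w = 2) ∧ G.IsProfitablyNibbled Δ {w | st w = 2}

variable [DecidableRel G.Adj]

/-- In the graph left over, the closed neighbourhood of `S` consists of the vertices of status 0
only. The superset `Z` merely bounds its size; it may contain vertices that are already nibbled. -/
theorem Nibbled.consume {Δ : ℕ} {st : Fin n → ℕ} (h : Nibbled Δ G st) {S Z : Finset (Fin n)}
    (hS : ∀ v ∈ S, st v = 0) (hind : ∀ x ∈ S, ∀ y ∈ S, ¬ G.Adj x y)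
    (hZ : ∀ v ∈ S, ∀ w, st w = 0 → w = v ∨ G.Adj v w → w ∈ Z)
    (hcard : Z.card + 1 ≤ Δ * S.card) (hmax : Z.card ≤ max (Δ + 3) 10) :
    Nibbled Δ G (RAM.consume G S st) := by
  set Y : Set (Fin n) := {w | st w = 0 ∧ ∃ v ∈ S, w = v ∨ G.Adj v w} with hY
  have hYZ : Y ⊆ Z := fun w ⟨hw, v, hv, hvw⟩ => hZ v hv w hw hvw
  have hYc : Y.ncard ≤ Z.card := by
    rw [← Set.ncard_coe_finset]
    exact Set.ncard_le_ncard hYZ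
  have hcompl : ∀ w, w ∈ ({w | st w = 2} : Set (Fin n))ᶜ ↔ st w = 0 := by
    intro w
    rcases h.1 w with hw | hw <;> simp [hw]
  have hst : {w | RAM.consume G S st w = 2} = {w | st w = 2} ∪ Y := by
    ext w
    simp only [RAM.consume, Set.mem_ofPred_eq, Set.mem_union, hY]
    split_ifs with h' <;> simp [h']
  refine ⟨fun w => ?_, ?_⟩
  · rw [RAM.consume]
    split_ifs
    · exact Or.inr rfl
    · exact h.1 w
  · rw [hst]
    refine isProfitablyNibbled_union h.2 ?_ ?_ (hYc.trans hmax)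
    · rw [Set.disjoint_left]
      rintro w hw ⟨hw', -⟩
      simp [hw'] at hw
    · refine ⟨Subtype.val ⁻¹' (S : Set (Fin n)), ?_, ?_, ?_, ?_⟩
      · intro w hw
        exact ⟨hS _ hw, w, hw, Or.inl rfl⟩
      · intro x hx y hy _
        exact hind _ hx _ hy
      · rintro w ⟨v, hv, hvw⟩
        refine ⟨(hcompl w).1 w.2, v, hv, hvw.imp (congrArg Subtype.val) fun h => h⟩
      · rw [Set.ncard_preimage_of_injective_subset_range Subtype.val_injective,
          Set.ncard_preimage_of_injective_subset_range Subtype.val_injective,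
          Set.ncard_coe_finset]
        · omega
        · rw [Subtype.range_coe]
          exact fun w hw => (hcompl w).2 (hS w hw)
        · rw [Subtype.range_coe]
          exact fun w hw => (hcompl w).2 hw.1

theorem consume_eq_zero {S : Finset (Fin n)} {st : Fin n → ℕ} {w : Fin n}
    (h : RAM.consume G S st w = 0) : st w = 0 := by
  rw [RAM.consume] at h
  split_ifs at h
  exact h

/-- The independent set consists of both tips of the diamond and the common neighbour 6. The tips
are saturated and the vertex 6 has at most one neighbour outside, so at most 8 = 3 · 3 - 1 vertices
are consumed. -/
theorem nibbled_linkPat₁ (hΔ : ∀ v, G.degree v ≤ 3) {st : Fin n → ℕ} (h : Nibbled 3 G st)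
    {g : ℕ → Fin n} (hg : linkPat₁.IsCopy G g) (hst : ∀ w ∈ linkPat₁.verts g, st w = 0) :
    Nibbled 3 G (RAM.consume G ([2, 3, 6].toFinset.image g) st) := by
  have hi := hg.isInduced hΔ (by decide +kernel)
  have hmem : ∀ i < 7, g i ∈ linkPat₁.verts g := fun i hi => mem_verts.2 ⟨i, hi, rfl⟩
  have hS : ∀ x ∈ [2, 3, 6].toFinset.image g, x = g 2 ∨ x = g 3 ∨ x = g 6 := by simp
  refine h.consume (Z := linkPat₁.verts g ∪ outNbrs G (linkPat₁.verts g) (g 6)) ?_ ?_ ?_ ?_ ?_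
  · intro v hv
    rcases hS v hv with rfl | rfl | rfl <;> exact hst _ (hmem _ (by decide))
  · intro x hx y hy hxy
    have hJ : ∀ i ∈ [2, 3, 6], ∀ j ∈ [2, 3, 6], ¬ Joined linkPat₁.edges i j := by decide +kernel
    have hlt : ∀ i ∈ [2, 3, 6], i < 7 := by decide
    obtain ⟨i, hi', rfl⟩ := Finset.mem_image.1 hx
    obtain ⟨j, hj', rfl⟩ := Finset.mem_image.1 hy
    rw [List.mem_toFinset] at hi' hj'
    exact hJ i hi' j hj' (hi i (hlt i hi') j (hlt j hj') hxy)
  · intro v hv w hw hvw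
    rw [Finset.mem_union]
    rcases hvw with rfl | hvw
    · left
      rcases hS w hv with rfl | rfl | rfl <;> exact hmem _ (by decide)
    · rcases hS v hv with rfl | rfl | rfl
      · exact Or.inl (hg.mem_verts_of_adj hΔ (by decide) (by decide +kernel) hvw)
      · exact Or.inl (hg.mem_verts_of_adj hΔ (by decide) (by decide +kernel) hvw)
      · by_cases hw' : w ∈ linkPat₁.verts g
        · exact Or.inl hw'
        · exact Or.inr (mem_outNbrs.2 ⟨hvw, hw'⟩)
  all_goals
    have h₁ := Finset.card_union_le (linkPat₁.verts g) (outNbrs G (linkPat₁.verts g) (g 6))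
    have h₂ := hg.deg_add_card_outNbrs hΔ (i := 6) (by decide)
    have h₃ : linkPat₁.deg 6 = 2 := by decide +kernel
    have h₄ : linkPat₁.size = 7 := rfl
    rw [hg.card_verts] at h₁
    try rw [Finset.card_image_of_injOn (fun a ha b hb hab => hg.inj a (by
      simp at ha; rcases ha with rfl | rfl | rfl <;> decide) b (by
      simp at hb; rcases hb with rfl | rfl | rfl <;> decide) hab)]
    try rw [show [2, 3, 6].toFinset.card = 3 from rfl]
    omega

/-- The independent set consists of the four tips, which are all saturated. So at most the 10
vertices of the pattern are consumed, below 3 · 4 - 1; this is the case that needs the bound 10 on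
the size of a part. -/
theorem nibbled_linkPat₂ (hΔ : ∀ v, G.degree v ≤ 3) {st : Fin n → ℕ} (h : Nibbled 3 G st)
    {g : ℕ → Fin n} (hg : linkPat₂.IsCopy G g) (hst : ∀ w ∈ linkPat₂.verts g, st w = 0) :
    Nibbled 3 G (RAM.consume G ([2, 3, 8, 9].toFinset.image g) st) := by
  have hi := hg.isInduced hΔ (by decide +kernel)
  have hS : ∀ i ∈ [2, 3, 8, 9], i < linkPat₂.size ∧ 3 ≤ linkPat₂.deg i := by decide +kernel
  refine h.consume (Z := linkPat₂.verts g) ?_ ?_ ?_ ?_ ?_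
  · intro v hv
    obtain ⟨i, hi', rfl⟩ := Finset.mem_image.1 hv
    exact hst _ (mem_verts.2 ⟨i, (hS i (List.mem_toFinset.1 hi')).1, rfl⟩)
  · intro x hx y hy hxy
    have hJ : ∀ i ∈ [2, 3, 8, 9], ∀ j ∈ [2, 3, 8, 9], ¬ Joined linkPat₂.edges i j := by
      decide +kernel
    obtain ⟨i, hi', rfl⟩ := Finset.mem_image.1 hx
    obtain ⟨j, hj', rfl⟩ := Finset.mem_image.1 hy
    rw [List.mem_toFinset] at hi' hj'
    exact hJ i hi' j hj' (hi i (hS i hi').1 j (hS j hj').1 hxy)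
  · intro v hv w hw hvw
    obtain ⟨i, hi', rfl⟩ := Finset.mem_image.1 hv
    rw [List.mem_toFinset] at hi'
    rcases hvw with rfl | hvw
    · exact mem_verts.2 ⟨i, (hS i hi').1, rfl⟩
    · exact hg.mem_verts_of_adj hΔ (hS i hi').1 (hS i hi').2 hvw
  · rw [hg.card_verts, Finset.card_image_of_injOn (fun a ha b hb hab =>
      hg.inj a (hS a (List.mem_toFinset.1 ha)).1 b (hS b (List.mem_toFinset.1 hb)).1 hab),
      show [2, 3, 8, 9].toFinset.card = 4 from rfl]
    decide
  · rw [hg.card_verts]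
    decide

end

end RAM

/-! ### Correctness of the tests for cliques and pairs of cliques -/

namespace RAM

open SimpleGraph Pattern

section

variable {n : ℕ} {G : SimpleGraph (Fin n)} [DecidableRel G.Adj]

/-- Counting replaces pairwise tests: a vertex of `X` with `|X| - 1` neighbours in `X` is adjacent
to all others. -/
theorem adj_of_card_le_degIn {X : Finset (Fin n)} {u w : Fin n} (hu : u ∈ X) (hw : w ∈ X)
    (hne : u ≠ w) (h : X.card ≤ degIn G X u + 1) : G.Adj u w := by
  by_contra hadj
  have h₁ : (G.neighborFinset u).filter (· ∈ X) ⊆ (X.erase u).erase w := by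
    intro z hz
    simp only [Finset.mem_filter, mem_neighborFinset] at hz
    rw [Finset.mem_erase, Finset.mem_erase]
    exact ⟨fun hc => hadj (hc ▸ hz.1), hz.1.ne', hz.2⟩
  have h₂ := Finset.card_le_card h₁
  rw [Finset.card_erase_of_mem (Finset.mem_erase.2 ⟨hne.symm, hw⟩),
    Finset.card_erase_of_mem hu] at h₂
  have h₃ : 1 < X.card := Finset.one_lt_card.2 ⟨u, hu, w, hw, hne⟩
  rw [degIn] at h
  omega

theorem card_le_degIn {X Y : Finset (Fin n)} {u : Fin n} (hY : Y ⊆ X)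
    (h : ∀ w ∈ Y, G.Adj u w) : Y.card ≤ degIn G X u :=
  Finset.card_le_card fun w hw => by
    simp only [Finset.mem_filter, mem_neighborFinset]
    exact ⟨h w hw, hY hw⟩

theorem mem_freeNbrs {st : Fin n → ℕ} {v w : Fin n} :
    w ∈ freeNbrs G st v ↔ G.Adj v w ∧ st w = 0 := by
  simp [freeNbrs]

theorem card_freeNbrs_le {Δ : ℕ} (hΔ : ∀ v, G.degree v ≤ Δ) (st : Fin n → ℕ) (v : Fin n) :
    (freeNbrs G st v).card ≤ Δ :=
  (Finset.card_filter_le _ _).trans (by rw [card_neighborFinset_eq_degree]; exact hΔ v)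

/-- The vertex `v` lies in two cliques of size `Δ` of vertices of status 0. -/
def Crowded (Δ : ℕ) (G : SimpleGraph (Fin n)) (st : Fin n → ℕ) (v : Fin n) : Prop :=
  ∃ K L : Finset (Fin n), G.IsNClique Δ K ∧ G.IsNClique Δ L ∧ K ≠ L ∧ v ∈ K ∧ v ∈ L ∧
    (∀ w ∈ K, st w = 0) ∧ ∀ w ∈ L, st w = 0

omit [DecidableRel G.Adj] in
theorem Crowded.mono {Δ : ℕ} {st st' : Fin n → ℕ} {v : Fin n} (h : ∀ w, st' w = 0 → st w = 0) :
    Crowded Δ G st' v → Crowded Δ G st v := by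
  rintro ⟨K, L, h₁, h₂, h₃, h₄, h₅, h₆, h₇⟩
  exact ⟨K, L, h₁, h₂, h₃, h₄, h₅, fun w hw => h _ (h₆ w hw), fun w hw => h _ (h₇ w hw)⟩

/-- The two cliques share Δ - 1 vertices, so their union without `v` has Δ vertices and exhausts the
neighbours of `v`. The Δ - 2 common vertices other than `v` are adjacent to all others. -/
theorem Crowded.pairTest {Δ : ℕ} (hΔ : ∀ v, G.degree v ≤ Δ) {st : Fin n → ℕ} {v : Fin n}
    (h : Crowded Δ G st v) : st v = 0 ∧ PairTest Δ G st v := by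
  obtain ⟨K, L, hK, hL, hKL, hvK, hvL, hK0, hL0⟩ := h
  have hI := card_inter_of_isNClique hΔ hK hL hKL hvK hvL
  have hU := Finset.card_union_add_card_inter K L
  rw [hK.card_eq, hL.card_eq] at hU
  have hsub : (K ∪ L).erase v ⊆ freeNbrs G st v := by
    intro w hw
    rw [Finset.mem_erase, Finset.mem_union] at hw
    rw [mem_freeNbrs]
    rcases hw.2 with hw' | hw'
    · exact ⟨hK.isClique hvK hw' hw.1.symm, hK0 w hw'⟩
    · exact ⟨hL.isClique hvL hw' hw.1.symm, hL0 w hw'⟩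
  have hcard : ((K ∪ L).erase v).card = Δ := by
    rw [Finset.card_erase_of_mem (Finset.mem_union_left _ hvK)]
    omega
  have heq := Finset.eq_of_subset_of_card_le hsub (by
    rw [hcard]; exact card_freeNbrs_le hΔ st v)
  refine ⟨hK0 v hvK, by rw [← heq, hcard], ?_⟩
  have hmem : (K ∩ L).erase v ⊆
      (freeNbrs G st v).filter fun u => ¬ degIn G (freeNbrs G st v) u + 1 < Δ := by
    intro u hu
    rw [Finset.mem_erase, Finset.mem_inter] at hu
    have huF : u ∈ (K ∪ L).erase v :=
      Finset.mem_erase.2 ⟨hu.1, Finset.mem_union_left _ hu.2.1⟩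
    rw [Finset.mem_filter, ← heq]
    refine ⟨huF, ?_⟩
    have := card_le_degIn (G := G) (X := (K ∪ L).erase v) (Y := ((K ∪ L).erase v).erase u) (u := u)
      (Finset.erase_subset _ _) (fun w hw => by
        simp only [Finset.mem_erase, Finset.mem_union] at hw
        rcases hw.2.2 with hw' | hw'
        · exact hK.isClique hu.2.1 hw' hw.1.symm
        · exact hL.isClique hu.2.2 hw' hw.1.symm)
    rw [Finset.card_erase_of_mem huF, hcard] at this
    omega
  have := Finset.card_le_card hmem
  rw [Finset.card_erase_of_mem (Finset.mem_inter.2 ⟨hvK, hvL⟩)] at this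
  omega

/-- If `v` keeps status 0, no neighbour of `v` is defective. Together with the Δ free neighbours
required by the test, this makes `v` and its neighbours a clique on Δ + 1 vertices. -/
theorem not_crowded_consume {Δ : ℕ} {st : Fin n → ℕ} {v : Fin n} (hΔ : ∀ v, G.degree v ≤ Δ)
    (hω : G.CliqueFree (Δ + 1))
    (hC : Crowded Δ G (RAM.consume G (defective Δ G st v) st) v) : ¬ PairTest Δ G st v := by
  rintro ⟨h₁, -⟩
  obtain ⟨K, L, -, -, -, hvK, -, hK0, -⟩ := hC
  have h0 := hK0 v hvK
  have hst := consume_eq_zero h0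
  have hF : (freeNbrs G st v).card = Δ := le_antisymm (card_freeNbrs_le hΔ st v) h₁
  have hdef : defective Δ G st v = ∅ := by
    rw [Finset.eq_empty_iff_forall_notMem]
    intro u hu
    rw [RAM.consume, if_pos ⟨hst, u, hu, Or.inr
      (mem_freeNbrs.1 (Finset.mem_filter.1 hu).1).1.symm⟩] at h0
    exact absurd h0 (by decide)
  refine hω (insert v (freeNbrs G st v)) (IsNClique.insert ⟨?_, hF⟩ fun w hw => (mem_freeNbrs.1 hw).1)
  intro x hx y hy hxy
  refine adj_of_card_le_degIn hx hy hxy ?_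
  by_contra! hlt
  have : x ∈ defective Δ G st v := Finset.mem_filter.2 ⟨hx, by rw [hF] at hlt; exact hlt⟩
  simp [hdef] at this

/-- At most two free neighbours are defective, and two of them must be non-adjacent, since otherwise
there is a clique on Δ + 1 vertices. So there are exactly two, and they form the independent set. -/
theorem Nibbled.consume_defective {Δ : ℕ} (hΔ : ∀ v, G.degree v ≤ Δ) (h4 : 4 ≤ Δ)
    (hω : G.CliqueFree (Δ + 1)) {st : Fin n → ℕ} {v : Fin n} (h : Nibbled Δ G st) (hv : st v = 0)
    (hp : PairTest Δ G st v) : Nibbled Δ G (RAM.consume G (defective Δ G st v) st) := by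
  obtain ⟨h₁, h₂⟩ := hp
  have hF : (freeNbrs G st v).card = Δ := le_antisymm (card_freeNbrs_le hΔ st v) h₁
  have hsum := Finset.card_filter_add_card_filter_not (s := freeNbrs G st v)
    (fun u => degIn G (freeNbrs G st v) u + 1 < Δ)
  set F := freeNbrs G st v with hFdef
  set U := F.filter fun u => ¬ degIn G F u + 1 < Δ with hUdef
  change (defective Δ G st v).card + U.card = F.card at hsum
  change Δ ≤ U.card + 2 at h₂
  have huni : ∀ u ∈ U, ∀ w ∈ F, u ≠ w → G.Adj u w := by
    intro u hu w hw huw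
    rw [hUdef, Finset.mem_filter] at hu
    exact adj_of_card_le_degIn hu.1 hw huw (by rw [hF]; omega)
  have hvF : v ∉ F := fun hc => G.irrefl (mem_freeNbrs.1 hc).1
  have hDF : ∀ x ∈ F, x ∉ defective Δ G st v → x ∈ U := fun x hx hx' =>
    Finset.mem_filter.2 ⟨hx, fun hc => hx' (Finset.mem_filter.2 ⟨hx, hc⟩)⟩
  have hDsub : ∀ x ∈ defective Δ G st v, x ∈ F := fun x hx => (Finset.mem_filter.1 hx).1
  obtain ⟨x, hx, y, hy, hxy, hnadj⟩ : ∃ x ∈ defective Δ G st v, ∃ y ∈ defective Δ G st v,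
      x ≠ y ∧ ¬ G.Adj x y := by
    by_contra! hc
    refine hω (insert v F) (IsNClique.insert ⟨?_, hF⟩ fun w hw => (mem_freeNbrs.1 hw).1)
    intro a ha b hb hab
    by_cases ha' : a ∈ defective Δ G st v
    · by_cases hb' : b ∈ defective Δ G st v
      · exact hc a ha' b hb' hab
      · exact (huni b (hDF b hb hb') a ha hab.symm).symm
    · exact huni a (hDF a ha ha') b hb hab
  have hD : defective Δ G st v = {x, y} := by
    symm
    apply Finset.eq_of_subset_of_card_le
    · intro z hz
      simp only [Finset.mem_insert, Finset.mem_singleton] at hz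
      rcases hz with rfl | rfl <;> assumption
    · rw [Finset.card_pair hxy]
      omega
  have hD2 : (defective Δ G st v).card = 2 := by rw [hD, Finset.card_pair hxy]
  -- A defective vertex is adjacent to `v` and to the Δ - 2 universal vertices, so one edge is left
  -- at most.
  have hout : ∀ z ∈ defective Δ G st v, (outNbrs G (insert v F) z).card ≤ 1 := by
    intro z hz
    have hz' := Finset.mem_filter.1 hz
    have hsub : insert v U ⊆ (G.neighborFinset z).filter (· ∈ insert v F) := by
      intro w hw
      simp only [Finset.mem_filter, mem_neighborFinset, Finset.mem_insert]
      rcases Finset.mem_insert.1 hw with rfl | hw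
      · exact ⟨(mem_freeNbrs.1 hz'.1).1.symm, Or.inl rfl⟩
      · refine ⟨(huni w hw z hz'.1 ?_).symm, Or.inr (Finset.mem_filter.1 hw).1⟩
        rintro rfl
        exact (Finset.mem_filter.1 hw).2 hz'.2
    have h₃ := Finset.card_le_card hsub
    rw [Finset.card_insert_of_notMem fun hc => hvF (Finset.mem_filter.1 hc).1] at h₃
    change U.card + 1 ≤ _ at h₃
    have h₄ := hΔ z
    rw [← card_neighborFinset_eq_degree,
      ← Finset.card_filter_add_card_filter_not (· ∈ insert v F)] at h₄
    rw [outNbrs]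
    omega
  -- `v`, its Δ neighbours and one outside neighbour for each of the two defective vertices. It is Δ
  -- ≥ 4 that makes Δ + 3 + 1 ≤ 2Δ.
  have hZ : (insert v F ∪ (outNbrs G (insert v F) x ∪ outNbrs G (insert v F) y)).card ≤ Δ + 3 := by
    refine (Finset.card_union_le _ _).trans ?_
    rw [Finset.card_insert_of_notMem hvF]
    have h₃ := Finset.card_union_le (outNbrs G (insert v F) x) (outNbrs G (insert v F) y)
    have h₄ := hout x hx
    have h₅ := hout y hy
    omega
  refine h.consume (Z := insert v F ∪ (outNbrs G (insert v F) x ∪ outNbrs G (insert v F) y))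
    (fun z hz => (mem_freeNbrs.1 (hDsub z hz)).2) ?_ ?_ (by rw [hD2]; omega)
    (hZ.trans (le_max_left _ _))
  · rw [hD]
    simp only [Finset.mem_insert, Finset.mem_singleton]
    rintro a (rfl | rfl) b (rfl | rfl)
    · exact G.irrefl
    · exact hnadj
    · exact fun hc => hnadj hc.symm
    · exact G.irrefl
  · intro z hz w _ hzw
    by_cases hw' : w ∈ insert v F
    · exact Finset.mem_union_left _ hw'
    · refine Finset.mem_union_right _ ?_
      rcases hzw with rfl | hzw
      · exact absurd (Finset.mem_insert_of_mem (hDsub w hz)) hw'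
      · rw [hD, Finset.mem_insert, Finset.mem_singleton] at hz
        rw [Finset.mem_union, mem_outNbrs, mem_outNbrs]
        rcases hz with rfl | rfl
        · exact Or.inl ⟨hzw, hw'⟩
        · exact Or.inr ⟨hzw, hw'⟩

/-- At most one free neighbour of `v` lies outside the clique. If it had Δ - 2 neighbours among the
others, these together with it and `v` would form a second clique, so that `v` would be crowded.
Hence the clique is found without any search. -/
theorem core_eq {Δ : ℕ} (hΔ : ∀ v, G.degree v ≤ Δ) (h2 : 2 ≤ Δ) {st : Fin n → ℕ} {v : Fin n}
    (hC : ¬ Crowded Δ G st v) {K : Finset (Fin n)} (hK : G.IsNClique Δ K) (hvK : v ∈ K)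
    (hK0 : ∀ w ∈ K, st w = 0) : core Δ G st v = K.erase v := by
  have hsub : K.erase v ⊆ freeNbrs G st v := by
    intro w hw
    rw [Finset.mem_erase] at hw
    exact mem_freeNbrs.2 ⟨hK.isClique hvK hw.2 hw.1.symm, hK0 w hw.2⟩
  ext x
  rw [core, Finset.mem_filter]
  constructor
  · rintro ⟨hx, hdeg⟩
    by_contra hxK
    have hxv : G.Adj v x := (mem_freeNbrs.1 hx).1
    have hxK' : x ∉ K := fun h => hxK (Finset.mem_erase.2 ⟨hxv.ne', h⟩)
    -- `K` without `v` has Δ - 1 vertices, so `x` is the only free neighbour outside `K`.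
    have hF : insert x (K.erase v) = freeNbrs G st v := by
      apply Finset.eq_of_subset_of_card_le
      · rw [Finset.insert_subset_iff]
        exact ⟨hx, hsub⟩
      · rw [Finset.card_insert_of_notMem hxK, Finset.card_erase_of_mem hvK, hK.card_eq]
        have := card_freeNbrs_le hΔ st v
        omega
    have hA : Δ - 2 ≤ ((G.neighborFinset x).filter (· ∈ freeNbrs G st v)).card := by
      rw [degIn] at hdeg
      omega
    obtain ⟨A, hA, hAc⟩ := Finset.exists_subset_card_eq hA
    have hA' : ∀ a ∈ A, G.Adj x a ∧ a ∈ K ∧ a ≠ v := by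
      intro a ha
      have := hA ha
      simp only [Finset.mem_filter, mem_neighborFinset, ← hF, Finset.mem_insert,
        Finset.mem_erase] at this
      rcases this with ⟨hxa, rfl | ⟨hav, haK⟩⟩
      · exact absurd hxa G.irrefl
      · exact ⟨hxa, haK, hav⟩
    have hN : G.IsNClique (Δ - 2) A :=
      ⟨fun a ha b hb hab => hK.isClique (hA' a ha).2.1 (hA' b hb).2.1 hab, hAc⟩
    have hN' := (hN.insert (a := x) fun a ha => (hA' a ha).1).insert (a := v) (by
      intro a ha
      rcases Finset.mem_insert.1 ha with rfl | ha
      · exact hxv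
      · exact hK.isClique hvK (hA' a ha).2.1 (hA' a ha).2.2.symm)
    rw [show Δ - 2 + 1 + 1 = Δ by omega] at hN'
    refine hC ⟨K, _, hK, hN', ?_, hvK, Finset.mem_insert_self _ _, hK0, ?_⟩
    · intro hc
      exact hxK' (hc ▸ by simp)
    · intro w hw
      simp only [Finset.mem_insert] at hw
      rcases hw with rfl | rfl | hw
      · exact hK0 w hvK
      · exact (mem_freeNbrs.1 hx).2
      · exact hK0 w (hA' w hw).2.1
  · intro hx
    refine ⟨hsub hx, ?_⟩
    have hx' := Finset.mem_erase.1 hx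
    have := card_le_degIn (G := G) (X := freeNbrs G st v) (Y := (K.erase v).erase x) (u := x)
      ((Finset.erase_subset _ _).trans hsub) fun w hw => by
        simp only [Finset.mem_erase] at hw
        exact hK.isClique hx'.2 hw.2.2 hw.1.symm
    rw [Finset.card_erase_of_mem hx, Finset.card_erase_of_mem hvK, hK.card_eq] at this
    omega

theorem cliqueTest_of_isNClique {Δ : ℕ} (hΔ : ∀ v, G.degree v ≤ Δ) (h2 : 2 ≤ Δ)
    {st : Fin n → ℕ} {v : Fin n} (hC : ¬ Crowded Δ G st v) {K : Finset (Fin n)}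
    (hK : G.IsNClique Δ K) (hvK : v ∈ K) (hK0 : ∀ w ∈ K, st w = 0) : CliqueTest Δ G st v := by
  have hcore := core_eq hΔ h2 hC hK hvK hK0
  have hcard : (K.erase v).card + 1 = Δ := by
    rw [Finset.card_erase_of_mem hvK, hK.card_eq]
    omega
  refine ⟨by rw [hcore, hcard], ?_⟩
  rw [hcore, Finset.filter_true_of_mem, hcard]
  intro x hx
  have hx' := Finset.mem_erase.1 hx
  have := card_le_degIn (G := G) (X := K.erase v) (Y := (K.erase v).erase x) (u := x)
    (Finset.erase_subset _ _) fun w hw => by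
      simp only [Finset.mem_erase] at hw
      exact hK.isClique hx'.2 hw.2.2 hw.1.symm
  rw [Finset.card_erase_of_mem hx] at this
  omega

/-- This needs no assumption on crowdedness: the second part of the test already forces all vertices
of the core to be pairwise adjacent. -/
theorem CliqueTest.isNClique {Δ : ℕ} {st : Fin n → ℕ} {v : Fin n} (h : CliqueTest Δ G st v) :
    G.IsNClique Δ (insert v (core Δ G st v)) := by
  obtain ⟨h₁, h₂⟩ := h
  have hN : G.IsNClique (core Δ G st v).card (core Δ G st v) := ⟨?_, rfl⟩
  · have := hN.insert fun w hw => (mem_freeNbrs.1 (Finset.mem_filter.1 hw).1).1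
    rwa [h₁] at this
  intro x hx y hy hxy
  have heq := Finset.eq_of_subset_of_card_le (Finset.filter_subset
    (fun u => ¬ degIn G (core Δ G st v) u + 2 < Δ) (core Δ G st v)) (by omega)
  rw [Finset.mem_coe, ← heq, Finset.mem_filter] at hx
  exact adj_of_card_le_degIn hx.1 hy hxy (by omega)

theorem core_eq_zero {Δ : ℕ} {st : Fin n → ℕ} {v w : Fin n} (hw : w ∈ core Δ G st v) : st w = 0 :=
  (mem_freeNbrs.1 (Finset.mem_filter.1 hw).1).2

end

end RAM

/-! ### Correctness of the peeling and the number of peeled vertices -/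

namespace RAM

open SimpleGraph Pattern

section

variable {n : ℕ} {G : SimpleGraph (Fin n)}

/-- The vertices of status 4 are partitioned by `id` into cliques of size `Δ`. -/
def CliqueIds (Δ : ℕ) (G : SimpleGraph (Fin n)) (st id : Fin n → ℕ) : Prop :=
  ∀ v, st v = 4 → ∃ K : Finset (Fin n), G.IsNClique Δ K ∧ ∀ w, w ∈ K ↔ st w = 4 ∧ id w = id v

/-- The statuses arise from `st₀` by turning whole cliques from status 4 to status 5. -/
def Turned (st₀ id st : Fin n → ℕ) : Prop :=
  (∀ w, st w = st₀ w ∨ st₀ w = 4 ∧ st w = 5) ∧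
    ∀ v w, st₀ v = 4 → st₀ w = 4 → id v = id w → st v = st w

theorem Turned.eq_four {st₀ id st : Fin n → ℕ} (h : Turned st₀ id st) {v : Fin n}
    (hv : st v = 4) : st₀ v = 4 := by
  rcases h.1 v with h' | ⟨h', -⟩
  · rw [← h', hv]
  · exact h'

variable [DecidableRel G.Adj]

/-- A clique is turned as a whole, so the neighbours of `c` with the same identifier that are still
pending are the rest of its original clique. -/
theorem Turned.members_eq {Δ : ℕ} {st₀ id st : Fin n → ℕ} (h : Turned st₀ id st) {c : Fin n}
    (hc : st c = 4) {K : Finset (Fin n)} (hK : G.IsNClique Δ K)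
    (hK' : ∀ w, w ∈ K ↔ st₀ w = 4 ∧ id w = id c) : members G st id c = K := by
  have hc₀ := h.eq_four hc
  ext w
  simp only [members, Finset.mem_insert, Finset.mem_filter, mem_neighborFinset]
  rw [hK' w]
  constructor
  · rintro (rfl | ⟨-, hw, hid⟩)
    · exact ⟨hc₀, rfl⟩
    · exact ⟨h.eq_four hw, hid⟩
  · rintro ⟨hw, hid⟩
    by_cases hwc : w = c
    · exact Or.inl hwc
    · exact Or.inr ⟨hK.isClique ((hK' c).2 ⟨hc₀, rfl⟩) ((hK' w).2 ⟨hw, hid⟩) (Ne.symm hwc),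
        (h.2 w c hw hc₀ hid).trans hc, hid⟩

theorem mem_lostNbrs {st : Fin n → ℕ} {u y : Fin n} :
    y ∈ lostNbrs G st u ↔ G.Adj u y ∧ st y ≠ 1 ∧ st y ≠ 4 := by
  simp [lostNbrs]

theorem peelable_congr {Δ : ℕ} {st₀ id st : Fin n → ℕ} (h₀ : CliqueIds Δ G st₀ id)
    (h : Turned st₀ id st) {c d : Fin n} (hc : st c = 4) (hd : st d = 4) (hcd : id c = id d) :
    Peelable Δ G st id c → Peelable Δ G st id d := by
  obtain ⟨K, hK, hK'⟩ := h₀ c (h.eq_four hc)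
  rw [Peelable, Peelable, h.members_eq hc hK hK',
    h.members_eq hd hK (fun w => by rw [hK' w, hcd])]
  exact fun h => ⟨hd, h.2⟩

/-- The contribution of the edge `y w` to the count of edges leaving the peeled cliques. -/
def edgeWeight (G : SimpleGraph (Fin n)) [DecidableRel G.Adj] (st id : Fin n → ℕ) (y w : Fin n) :
    ℕ :=
  if G.Adj y w then (if st w = 1 ∨ st w = 4 then 0 else if st w = 5 then
    (if id w = id y then 0 else 1) else 2) else 0

/-- The peeled cliques have many edges to one another or to vertices outside of all cliques. -/
def PeelCount (Δ : ℕ) (G : SimpleGraph (Fin n)) [DecidableRel G.Adj] (st id : Fin n → ℕ) : Prop :=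
  2 * Δ * (Finset.univ.filter fun y => st y = 5).card ≤
    2 * (Finset.univ.filter fun y => st y = 5).card +
      Δ * ∑ y ∈ Finset.univ.filter fun y => st y = 5, ∑ w, edgeWeight G st id y w

/-- The total weight grows by at least twice the number of lost neighbours of the new clique: an
edge to an earlier peeled clique counts once from either end, and any other lost edge has weight 2.
As Δ - 1 vertices have lost neighbours, the growth is at least 2(Δ - 1), which is what Δ new
vertices demand. -/
theorem PeelCount.peel {Δ : ℕ} {st₀ id st : Fin n → ℕ} (h₀ : CliqueIds Δ G st₀ id)
    (h₅ : ∀ w, st₀ w ≠ 5)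
    (h : Turned st₀ id st) (hcount : PeelCount Δ G st id) {c : Fin n}
    (hc : Peelable Δ G st id c) :
    PeelCount Δ G (fun w => if w ∈ members G st id c then 5 else st w) id := by
  obtain ⟨K, hK, hK'⟩ := h₀ c (h.eq_four hc.1)
  obtain ⟨hc4, hc⟩ := hc
  rw [h.members_eq hc4 hK hK'] at hc ⊢
  have hKst : ∀ w ∈ K, st w = 4 := fun w hw =>
    (h.2 w c ((hK' w).1 hw).1 (h.eq_four hc4) ((hK' w).1 hw).2).trans hc4
  set B := Finset.univ.filter fun y => st y = 5 with hB
  set st' : Fin n → ℕ := fun w => if w ∈ K then 5 else st w with hst'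
  have hB' : (Finset.univ.filter fun y => st' y = 5) = B ∪ K := by
    ext y
    simp only [Finset.mem_filter, Finset.mem_univ, true_and, Finset.mem_union, hB, hst']
    split_ifs with hy <;> simp [hy]
  have hdisj : Disjoint B K := by
    rw [Finset.disjoint_left]
    intro y hy hyK
    have := (Finset.mem_filter.1 hy).2
    rw [hKst y hyK] at this
    exact absurd this (by decide)
  have hid : ∀ y ∈ B, ∀ w ∈ K, id w ≠ id y := by
    intro y hy w hw hc'
    have hy5 := (Finset.mem_filter.1 hy).2
    rcases h.1 y with h' | h'
    · exact h₅ y (by rw [← h', hy5])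
    · exact Finset.disjoint_left.1 hdisj hy
        ((hK' y).2 ⟨h'.1, by rw [← hc']; exact ((hK' w).1 hw).2⟩)
  let e : Fin n → Fin n → ℕ := fun y w => if G.Adj y w then 1 else 0
  -- For the clique vertices peeled before, only the weights of edges into the new clique change,
  -- from 0 to 1.
  have h₁ : ∑ y ∈ B, ∑ w, edgeWeight G st' id y w =
      ∑ y ∈ B, ∑ w, edgeWeight G st id y w + ∑ y ∈ B, ∑ w ∈ K, e y w := by
    rw [← Finset.sum_add_distrib]
    refine Finset.sum_congr rfl fun y hy => ?_
    rw [← Finset.sum_filter_add_sum_filter_not Finset.univ (· ∈ K),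
      ← Finset.sum_filter_add_sum_filter_not Finset.univ (· ∈ K) (fun w => edgeWeight G st id y w)]
    have e₁ : ∑ w ∈ Finset.univ.filter (· ∈ K), edgeWeight G st id y w = 0 := by
      refine Finset.sum_eq_zero fun w hw => ?_
      simp [edgeWeight, hKst w (Finset.mem_filter.1 hw).2]
    have e₂ : ∑ w ∈ Finset.univ.filter (· ∈ K), edgeWeight G st' id y w = ∑ w ∈ K, e y w := by
      rw [Finset.filter_mem_eq_inter, Finset.univ_inter]
      refine Finset.sum_congr rfl fun w hw => ?_
      simp [edgeWeight, hst', hw, hid y hy w hw, e]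
    have e₃ : ∑ w ∈ Finset.univ.filter (¬ · ∈ K), edgeWeight G st' id y w =
        ∑ w ∈ Finset.univ.filter (¬ · ∈ K), edgeWeight G st id y w := by
      refine Finset.sum_congr rfl fun w hw => ?_
      simp [edgeWeight, hst', (Finset.mem_filter.1 hw).2]
    rw [e₁, e₂, e₃]
    ring
  have h₂ : ∑ y ∈ K, 2 * (lostNbrs G st y).card ≤
      ∑ y ∈ K, ∑ w, edgeWeight G st' id y w + ∑ y ∈ B, ∑ w ∈ K, e y w := by
    rw [Finset.sum_comm (s := B), ← Finset.sum_add_distrib]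
    refine Finset.sum_le_sum fun y hy => ?_
    have e₁ : 2 * (lostNbrs G st y).card = ∑ w, if w ∈ lostNbrs G st y then 2 else 0 := by
      rw [Finset.sum_ite_mem, Finset.univ_inter, Finset.sum_const, smul_eq_mul, mul_comm]
    have e₂ : ∑ w ∈ B, e w y = ∑ w, if w ∈ B then e w y else 0 := by
      rw [Finset.sum_ite_mem, Finset.univ_inter]
    rw [e₁, e₂, ← Finset.sum_add_distrib]
    refine Finset.sum_le_sum fun w _ => ?_
    by_cases hw : w ∈ lostNbrs G st y
    · rw [if_pos hw]
      obtain ⟨hyw, hw1, hw4⟩ := mem_lostNbrs.1 hw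
      have hwK : w ∉ K := fun hc => hw4 (hKst w hc)
      by_cases hwB : w ∈ B
      · have := hid w hwB y hy
        simp [edgeWeight, hst', hwK, hyw, hwB, e, hyw.symm, (Finset.mem_filter.1 hwB).2, this.symm]
      · have : st w ≠ 5 := fun hc => hwB (Finset.mem_filter.2 ⟨Finset.mem_univ _, hc⟩)
        simp [edgeWeight, hst', hwK, hyw, hwB, hw1, hw4, this]
    · rw [if_neg hw]
      exact Nat.zero_le _
  have h₃ : Δ ≤ ∑ y ∈ K, (lostNbrs G st y).card + 1 := by
    refine hc.trans (Nat.add_le_add_right ?_ 1)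
    rw [Finset.card_eq_sum_ones, Finset.sum_filter]
    refine Finset.sum_le_sum fun y _ => ?_
    split_ifs with hy
    · exact hy
    · exact Nat.zero_le _
  rw [← Finset.mul_sum] at h₂
  rw [PeelCount, hB', Finset.card_union_of_disjoint hdisj, Finset.sum_union hdisj, h₁, hK.card_eq]
  rw [PeelCount, ← hB] at hcount
  nlinarith

/-- The peeled cliques are few compared to the vertices outside of all cliques. -/
theorem PeelCount.card_le {Δ : ℕ} (hΔ : ∀ v, G.degree v ≤ Δ) (h3 : 3 ≤ Δ) {st₀ id st : Fin n → ℕ}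
    (h₀ : CliqueIds Δ G st₀ id) (h₅ : ∀ w, st₀ w ≠ 5) (h : Turned st₀ id st)
    (hcount : PeelCount Δ G st id) :
    (Finset.univ.filter fun y => st y = 5).card ≤
      3 * Δ * (Finset.univ.filter fun y => st y ≠ 1 ∧ st y ≠ 4 ∧ st y ≠ 5).card := by
  set B := Finset.univ.filter fun y => st y = 5 with hB
  set R := Finset.univ.filter fun y => st y ≠ 1 ∧ st y ≠ 4 ∧ st y ≠ 5 with hR
  -- A peeled vertex has at most one neighbour outside its clique, of weight at most 1, with an
  -- extra 1 if that neighbour lies in `R`.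
  have h₁ : ∀ y ∈ B, ∑ w, edgeWeight G st id y w ≤ 1 + ∑ w ∈ R, if G.Adj w y then 1 else 0 := by
    intro y hy
    have hy5 := (Finset.mem_filter.1 hy).2
    have hy₀ : st₀ y = 4 := by
      rcases h.1 y with h' | h'
      · exact absurd (by rw [← h', hy5]) (h₅ y)
      · exact h'.1
    obtain ⟨K, hK, hK'⟩ := h₀ y hy₀
    have hout := card_outNbrs_of_isNClique hΔ hK ((hK' y).2 ⟨hy₀, rfl⟩)
    have e₁ : (outNbrs G K y).card = ∑ w, if w ∈ outNbrs G K y then 1 else 0 := by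
      rw [Finset.sum_ite_mem, Finset.univ_inter, Finset.card_eq_sum_ones]
    have e₂ : (∑ w ∈ R, if G.Adj w y then 1 else 0) =
        ∑ w, if w ∈ R then (if G.Adj w y then 1 else 0) else 0 := by
      rw [Finset.sum_ite_mem, Finset.univ_inter]
    refine le_trans ?_ (Nat.add_le_add_right hout _)
    rw [e₁, e₂, ← Finset.sum_add_distrib]
    refine Finset.sum_le_sum fun w _ => ?_
    by_cases hyw : G.Adj y w
    · by_cases hwR : w ∈ R
      · have hwR' := (Finset.mem_filter.1 hwR).2
        have hwK : w ∉ K := by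
          intro hc
          have hc' := (hK' w).1 hc
          exact hwR'.2.2 ((h.2 w y hc'.1 hy₀ hc'.2).trans hy5)
        have hmem : w ∈ outNbrs G K y := mem_outNbrs.2 ⟨hyw, hwK⟩
        simp [edgeWeight, hyw, hwR', hmem, hwR, hyw.symm]
      · by_cases hw : st w = 1 ∨ st w = 4
        · simp [edgeWeight, hw]
        · have hw5 : st w = 5 := by
            by_contra hc
            exact hwR (Finset.mem_filter.2 ⟨Finset.mem_univ _, fun h' => hw (Or.inl h'),
              fun h' => hw (Or.inr h'), hc⟩)
          by_cases hid : id w = id y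
          · simp [edgeWeight, hw5, hid]
          · have hmem : w ∈ outNbrs G K y := mem_outNbrs.2 ⟨hyw, fun hc => hid ((hK' w).1 hc).2⟩
            simp [edgeWeight, hyw, hw5, hid, hmem]
    · simp [edgeWeight, hyw]
  have h₂ : ∑ y ∈ B, ∑ w, edgeWeight G st id y w ≤ B.card + Δ * R.card := by
    refine (Finset.sum_le_sum h₁).trans ?_
    rw [Finset.sum_add_distrib, Finset.sum_const, smul_eq_mul, mul_one, Finset.sum_comm]
    refine Nat.add_le_add_left ?_ _
    rw [mul_comm, ← smul_eq_mul, ← Finset.sum_const]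
    refine Finset.sum_le_sum fun w _ => ?_
    rw [← Finset.card_filter]
    refine le_trans (Finset.card_le_card fun y hy => ?_)
      ((card_neighborFinset_eq_degree G w).le.trans (hΔ w))
    exact (mem_neighborFinset _ _ _).2 (Finset.mem_filter.1 hy).2
  rw [PeelCount, ← hB] at hcount
  obtain ⟨k, rfl⟩ : ∃ k, Δ = k + 3 := ⟨Δ - 3, by omega⟩
  -- Combining both counts gives (Δ - 2)|B| ≤ Δ²|R|, and Δ ≤ 3(Δ - 2) because Δ ≥ 3.
  have h₃ : (k + 1) * B.card ≤ (k + 1) * (3 * (k + 3) * R.card) := by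
    have := Nat.mul_le_mul_left (k + 3) h₂
    nlinarith [Nat.zero_le (k * k * R.card), Nat.zero_le (k * R.card)]
  exact Nat.le_of_mul_le_mul_left h₃ (Nat.succ_pos k)

/-- The invariant of the peeling phase. -/
structure PeelInv (Δ : ℕ) (G : SimpleGraph (Fin n)) [DecidableRel G.Adj] (st₀ id : Fin n → ℕ)
    (st : Fin n → ℕ) (v x : ℕ) : Prop where
  turned : Turned st₀ id st
  count : PeelCount Δ G st id
  peelable : ∀ c : Fin n, (c : ℕ) ≤ v → Peelable Δ G st id c →
    ∃ d : Fin n, x = d ∧ id c = id d ∧ st d = 4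
  le : n ≤ v → n ≤ x

theorem peelInv_start {Δ : ℕ} {st₀ id : Fin n → ℕ} (h₅ : ∀ w, st₀ w ≠ 5) :
    PeelInv Δ G st₀ id st₀ 0 0 where
  turned := ⟨fun w => Or.inl rfl, fun v w hv hw _ => hv.trans hw.symm⟩
  count := by simp [PeelCount, h₅]
  peelable c hc hp := ⟨c, by omega, rfl, hp.1⟩
  le h := h

/-- Up to `v`, only the clique of `x` could be peelable, and it is not; so beyond this step the only
candidate is `v + 1` itself. -/
theorem PeelInv.adv {Δ : ℕ} {st₀ id st : Fin n → ℕ} {v x : ℕ} (h₀ : CliqueIds Δ G st₀ id)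
    (h : PeelInv Δ G st₀ id st v x) (hx : ∀ c : Fin n, x = c → ¬ Peelable Δ G st id c) :
    PeelInv Δ G st₀ id st (v + 1) (v + 1) where
  turned := h.turned
  count := h.count
  peelable c hc hp := by
    rcases Nat.lt_or_ge v c with hvc | hvc
    · exact ⟨c, by omega, rfl, hp.1⟩
    · obtain ⟨d, hd, hcd, hd4⟩ := h.peelable c hvc hp
      exact absurd (peelable_congr h₀ h.turned hp.1 hd4 hcd hp) (hx d hd)
  le h := h

/-- Peeling can only affect cliques adjacent to the peeled one. At most one vertex of the peeled
clique has no lost neighbour, and a vertex has only one neighbour outside the clique, so at most one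
edge leads to other pending cliques; following it reaches the only clique that can become peelable.
-/
theorem PeelInv.peel {Δ : ℕ} (hΔ : ∀ v, G.degree v ≤ Δ) {st₀ id st : Fin n → ℕ} {v x : ℕ}
    {c : Fin n} (h₀ : CliqueIds Δ G st₀ id) (h₅ : ∀ w, st₀ w ≠ 5)
    (h : PeelInv Δ G st₀ id st v c) (hc : Peelable Δ G st id c)
    (hx : (x = v ∧ ∀ y, ¬ IsNext G st id c y) ∨ ∃ y : Fin n, x = y ∧ IsNext G st id c y) :
    PeelInv Δ G st₀ id (fun w => if w ∈ members G st id c then 5 else st w) v x := by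
  have hcount := h.count.peel h₀ h₅ h.turned hc
  obtain ⟨K, hK, hK'⟩ := h₀ c (h.turned.eq_four hc.1)
  have hmem := h.turned.members_eq hc.1 hK hK'
  rw [hmem] at hcount ⊢
  have hc4 := hc.1
  have hKst : ∀ w ∈ K, st w = 4 := fun w hw =>
    (h.turned.2 w c ((hK' w).1 hw).1 (h.turned.eq_four hc4) ((hK' w).1 hw).2).trans hc4
  have hturned : Turned st₀ id fun w => if w ∈ K then 5 else st w := by
    constructor
    · intro w
      by_cases hw : w ∈ K
      · simp only [hw, if_true]
        exact Or.inr ⟨((hK' w).1 hw).1, trivial⟩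
      · simp only [hw, if_false]
        exact h.turned.1 w
    · intro a b ha hb hab
      have : a ∈ K ↔ b ∈ K := by rw [hK', hK', hab]; simp [ha, hb]
      simp only [this]
      split_ifs
      · rfl
      · exact h.turned.2 a b ha hb hab
  -- The single edge leaving the clique at `y` goes to a pending vertex, so `y` has lost nothing.
  have hlost : ∀ y ∈ K, ∀ u, G.Adj y u → u ∉ K → st u = 4 → lostNbrs G st y = ∅ := by
    intro y hy u hyu hu hu4
    rw [Finset.eq_empty_iff_forall_notMem]
    intro w hw
    obtain ⟨hyw, -, hw4⟩ := mem_lostNbrs.1 hw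
    have hwK : w ∉ K := fun hc => hw4 (hKst w hc)
    have := Finset.card_le_one.1 (card_outNbrs_of_isNClique hΔ hK hy) w (mem_outNbrs.2 ⟨hyw, hwK⟩) u
      (mem_outNbrs.2 ⟨hyu, hu⟩)
    exact hw4 (this ▸ hu4)
  have huniq : ∀ y ∈ K, ∀ u, G.Adj y u → u ∉ K → st u = 4 → ∀ y' ∈ K, ∀ u', G.Adj y' u' →
      u' ∉ K → st u' = 4 → u = u' := by
    intro y hy u hyu hu hu4 y' hy' u' hyu' hu' hu4'
    by_cases hyy : y = y'
    · subst hyy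
      exact Finset.card_le_one.1 (card_outNbrs_of_isNClique hΔ hK hy) u (mem_outNbrs.2 ⟨hyu, hu⟩) u'
        (mem_outNbrs.2 ⟨hyu', hu'⟩)
    · exfalso
      have hp := hc.2
      rw [hmem] at hp
      have hsub : (K.filter fun u => 0 < (lostNbrs G st u).card) ⊆ (K.erase y).erase y' := by
        intro z hz
        rw [Finset.mem_filter] at hz
        rw [Finset.mem_erase, Finset.mem_erase]
        refine ⟨?_, ?_, hz.1⟩
        · rintro rfl
          simp [hlost z hy' u' hyu' hu' hu4'] at hz
        · rintro rfl
          simp [hlost z hy u hyu hu hu4] at hz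
      have := Finset.card_le_card hsub
      rw [Finset.card_erase_of_mem (Finset.mem_erase.2 ⟨Ne.symm hyy, hy'⟩),
        Finset.card_erase_of_mem hy, hK.card_eq] at this
      have h2 : 1 < K.card := Finset.one_lt_card.2 ⟨y, hy, y', hy', hyy⟩
      rw [hK.card_eq] at h2
      omega
  refine ⟨hturned, hcount, ?_, ?_⟩
  · intro d hd hp
    have hd4 := hp.1
    have hdK : d ∉ K := by
      intro hdK
      simp [hdK] at hd4
    simp only [hdK, if_false] at hd4
    have hidc : ∀ w, st₀ w = 4 → w ∉ K → id w ≠ id c := fun w hw hwK hc' =>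
      hwK ((hK' w).2 ⟨hw, hc'⟩)
    -- Before this step, the clique of `c` was the only peelable one up to `v`.
    have hnp : ¬ Peelable Δ G st id d := by
      intro hpd
      obtain ⟨d', hd', hdd', -⟩ := h.peelable d hd hpd
      exact hidc d (h.turned.eq_four hd4) hdK (by rw [hdd', Fin.ext hd'])
    obtain ⟨L, hL, hL'⟩ := h₀ d (h.turned.eq_four hd4)
    have hm := h.turned.members_eq hd4 hL hL'
    have hm' := hturned.members_eq hp.1 hL hL'
    obtain ⟨u, huL, y, hy, huy⟩ : ∃ u ∈ L, ∃ y ∈ K, G.Adj u y := by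
      by_contra! hno
      refine hnp ⟨hd4, ?_⟩
      have hp2 := hp.2
      rw [hm'] at hp2
      rw [hm]
      refine hp2.trans (Nat.add_le_add_right (Finset.card_le_card ?_) 1)
      intro u hu
      rw [Finset.mem_filter] at hu ⊢
      refine ⟨hu.1, hu.2.trans_le (Finset.card_le_card fun w hw => ?_)⟩
      rw [mem_lostNbrs] at hw ⊢
      have hwK : w ∉ K := fun hc' => hno u hu.1 w hc' hw.1
      simpa [hwK] using hw
    have hu' := (hL' u).1 huL
    have huK : u ∉ K := by
      intro hc'
      exact hidc d (h.turned.eq_four hd4) hdK (by rw [← hu'.2, ((hK' u).1 hc').2])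
    have hu4 : st u = 4 := (h.turned.2 u d hu'.1 (h.turned.eq_four hd4) hu'.2).trans hd4
    rcases hx with ⟨-, hno⟩ | ⟨z, hz, hz4, hzid, w, hw, hwz⟩
    · exact absurd ⟨hu4, hidc u hu'.1 huK, y, by rwa [hmem], huy.symm⟩ (hno u)
    · rw [hmem] at hw
      have hzK : z ∉ K := fun hc' => hzid ((hK' z).1 hc').2
      have := huniq y hy u huy.symm huK hu4 w hw z hwz hzK hz4
      subst this
      exact ⟨u, hz, hu'.2.symm, by simp [huK, hu4]⟩
  -- This case cannot occur: a clique is being peeled, so the vertex under inspection is below `n`.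
  · intro hv
    exact absurd (h.le hv) (by omega)

end

end RAM

/-! ### The independence number of the remaining graph -/

namespace RAM

open SimpleGraph Pattern

section

variable {n : ℕ} {G : SimpleGraph (Fin n)}

/-- For the lower bound, `T` can be added to any independent set outside `A`, as it has no
neighbours there. For the upper bound, an independent set is split along `A`. -/
theorem indepNum_induce_add {Δ : ℕ} {A : Finset (Fin n)}
    (hup : ∀ I : Finset (Fin n), (∀ x ∈ I, ∀ y ∈ I, ¬ G.Adj x y) → Δ * (I ∩ A).card ≤ A.card)
    {T : Finset (Fin n)} (hTA : T ⊆ A) (hT : ∀ x ∈ T, ∀ y ∈ T, ¬ G.Adj x y)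
    (hTc : Δ * T.card = A.card) (hTn : ∀ x ∈ T, ∀ w, G.Adj x w → w ∈ A) {R : Set (Fin n)}
    (hR : ∀ w, w ∈ R ↔ w ∉ A) :
    Δ * G.indepNum = Δ * (G.induce R).indepNum + A.card := by
  classical
  apply le_antisymm
  · obtain ⟨I, hI⟩ := G.exists_isNIndepSet_indepNum
    have hI' : ∀ x ∈ I, ∀ y ∈ I, ¬ G.Adj x y := fun x hx y hy hxy =>
      hI.isIndepSet hx hy hxy.ne hxy
    have h₁ : (I.subtype (· ∈ R)).card ≤ (G.induce R).indepNum := by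
      apply IsIndepSet.card_le_indepNum
      intro x hx y hy _
      exact hI' x (by simpa using hx) y (by simpa using hy)
    rw [Finset.card_subtype] at h₁
    have h₂ : (I.filter (· ∈ R)).card + (I ∩ A).card = I.card := by
      rw [← Finset.card_filter_add_card_filter_not (s := I) (· ∈ R)]
      congr 2
      ext w
      simp [hR]
    rw [← hI.card_eq, ← h₂, mul_add]
    exact Nat.add_le_add (Nat.mul_le_mul_left Δ h₁) (hup I hI')
  · obtain ⟨I, hI⟩ := (G.induce R).exists_isNIndepSet_indepNum
    have hmem : ∀ x ∈ I.map (Function.Embedding.subtype (· ∈ R)), x ∈ R ∧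
        ∀ y ∈ I.map (Function.Embedding.subtype (· ∈ R)), ¬ G.Adj x y := by
      intro x hx
      obtain ⟨a, ha, rfl⟩ := Finset.mem_map.1 hx
      refine ⟨a.2, fun y hy hxy => ?_⟩
      obtain ⟨b, hb, rfl⟩ := Finset.mem_map.1 hy
      exact hI.isIndepSet ha hb (fun hc => G.irrefl (hc ▸ hxy)) hxy
    have hind : G.IsIndepSet (I.map (Function.Embedding.subtype (· ∈ R)) ∪ T : Finset (Fin n)) := by
      intro x hx y hy _ hxy
      rw [Finset.mem_coe, Finset.mem_union] at hx hy
      rcases hx with hx | hx <;> rcases hy with hy | hy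
      · exact (hmem x hx).2 y hy hxy
      · exact (hR x).1 (hmem x hx).1 (hTn y hy x hxy.symm)
      · exact (hR y).1 (hmem y hy).1 (hTn x hx y hxy)
      · exact hT x hx y hy hxy
    have h₁ := hind.card_le_indepNum
    rw [Finset.card_union_of_disjoint (Finset.disjoint_left.2 fun x hx hx' =>
      (hR x).1 (hmem x hx).1 (hTA hx')), Finset.card_map, hI.card_eq] at h₁
    rw [← hTc, ← mul_add]
    exact Nat.mul_le_mul_left Δ h₁

/-- The set consists of the vertices of a copy of a tight pattern other than a clique. -/
def IsTile (Δ : ℕ) (G : SimpleGraph (Fin n)) (X : Finset (Fin n)) : Prop :=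
  ∃ H J, (H, J) ∈ tightPats Δ ∧ ∃ g, H.IsCopy G g ∧ H.verts g = X

/-- The vertices of status `c` are partitioned into the sets in `P`, which have the property `T`. -/
def Packed (T : Finset (Fin n) → Prop) (c : ℕ) (st : Fin n → ℕ) (P : Finset (Finset (Fin n))) :
    Prop :=
  (∀ X ∈ P, T X) ∧ (∀ X ∈ P, ∀ Y ∈ P, X ≠ Y → Disjoint X Y) ∧
    ∀ w, st w = c ↔ ∃ X ∈ P, w ∈ X

/-- The clique of status 4 that contains `v`. -/
def fiber (st id : Fin n → ℕ) (v : Fin n) : Finset (Fin n) :=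
  Finset.univ.filter fun w => st w = 4 ∧ id w = id v

theorem mem_fiber {st id : Fin n → ℕ} {v w : Fin n} :
    w ∈ fiber st id v ↔ st w = 4 ∧ id w = id v := by
  simp [fiber]

theorem CliqueIds.fiber {Δ : ℕ} {st id : Fin n → ℕ} (h : CliqueIds Δ G st id) {v : Fin n}
    (hv : st v = 4) : G.IsNClique Δ (fiber st id v) := by
  obtain ⟨K, hK, hK'⟩ := h v hv
  convert hK
  ext w
  rw [mem_fiber, hK']

variable [DecidableRel G.Adj]

/-- A vertex together with its neighbours in other cliques. -/
def crossNbrs (G : SimpleGraph (Fin n)) [DecidableRel G.Adj] (st id : Fin n → ℕ) (u : Fin n) :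
    Finset (Fin n) :=
  insert u ((G.neighborFinset u).filter fun w => st w = 4 ∧ id w ≠ id u)

theorem card_filter_crossNbrs {Δ : ℕ} (hΔ : ∀ v, G.degree v ≤ Δ) {st id : Fin n → ℕ}
    (h : CliqueIds Δ G st id) {u : Fin n} (hu : st u = 4) :
    ((G.neighborFinset u).filter fun w => st w = 4 ∧ id w ≠ id u).card ≤ 1 := by
  refine (Finset.card_le_card fun w hw => ?_).trans
    (card_outNbrs_of_isNClique hΔ (h.fiber hu) (mem_fiber.2 ⟨hu, rfl⟩))
  simp only [Finset.mem_filter, mem_neighborFinset] at hw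
  exact mem_outNbrs.2 ⟨hw.1, fun hc => hw.2.2 (mem_fiber.1 hc).2⟩

theorem crossNbrs_eq {Δ : ℕ} (hΔ : ∀ v, G.degree v ≤ Δ) {st id : Fin n → ℕ}
    (h : CliqueIds Δ G st id) {u w : Fin n} (hu : st u = 4) (hw : st w = 4) (huw : G.Adj u w)
    (hid : id w ≠ id u) : crossNbrs G st id u = {u, w} := by
  have hmem : w ∈ (G.neighborFinset u).filter fun w => st w = 4 ∧ id w ≠ id u := by
    simp [huw, hw, hid]
  rw [crossNbrs]
  congr 1
  rw [Finset.eq_singleton_iff_unique_mem]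
  exact ⟨hmem, fun x hx => Finset.card_le_one.1 (card_filter_crossNbrs hΔ h hu) x hx w hmem⟩

/-- Pairwise non-adjacent representatives of the cliques. -/
theorem exists_transversal {Δ : ℕ} (hΔ : ∀ v, G.degree v ≤ Δ) {st id : Fin n → ℕ}
    (h : CliqueIds Δ G st id)
    (hnp : ∀ v, st v = 4 → 2 ≤ ((fiber st id v).filter fun u => lostNbrs G st u = ∅).card) :
    ∃ T : Finset (Fin n), (∀ x ∈ T, st x = 4 ∧ lostNbrs G st x = ∅) ∧
      (∀ x ∈ T, ∀ y ∈ T, ¬ G.Adj x y) ∧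
      Δ * T.card = (Finset.univ.filter fun w => st w = 4).card := by
  classical
  set Q := (Finset.univ.filter fun w => st w = 4).image (fiber st id) with hQ
  have hQmem : ∀ K ∈ Q, ∃ v, st v = 4 ∧ fiber st id v = K := by
    intro K hK
    obtain ⟨v, hv, rfl⟩ := Finset.mem_image.1 hK
    exact ⟨v, (Finset.mem_filter.1 hv).2, rfl⟩
  have hQdisj : ∀ K ∈ Q, ∀ L ∈ Q, ∀ x, x ∈ K → x ∈ L → K = L := by
    intro K hK L hL x hxK hxL
    obtain ⟨v, hv, rfl⟩ := hQmem K hK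
    obtain ⟨w, hw, rfl⟩ := hQmem L hL
    ext y
    rw [mem_fiber, mem_fiber, ← (mem_fiber.1 hxK).2, ← (mem_fiber.1 hxL).2]
  have hQst : ∀ K ∈ Q, ∀ x ∈ K, st x = 4 := by
    intro K hK x hx
    obtain ⟨v, hv, rfl⟩ := hQmem K hK
    exact (mem_fiber.1 hx).1
  let good : Finset (Fin n) → Finset (Fin n) := fun K => K.filter fun u => lostNbrs G st u = ∅
  let t : Q → Finset (Finset (Fin n)) := fun K => (good K).image (crossNbrs G st id)
  have hall : ∀ s : Finset Q, s.card ≤ (s.biUnion t).card := by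
    intro s
    have e₁ : s.biUnion t = (s.biUnion fun K => good K).image (crossNbrs G st id) := by
      ext z
      simp only [Finset.mem_biUnion, Finset.mem_image, t]
      constructor
      · rintro ⟨K, hK, x, hx, rfl⟩
        exact ⟨x, ⟨K, hK, hx⟩, rfl⟩
      · rintro ⟨x, ⟨K, hK, hx⟩, rfl⟩
        exact ⟨K, hK, x, hx, rfl⟩
    -- Each clique has two vertices without lost neighbours, and the cliques are disjoint.
    have e₂ : 2 * s.card ≤ (s.biUnion fun K => good K).card := by
      rw [Finset.card_biUnion, mul_comm, ← smul_eq_mul, ← Finset.sum_const]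
      · refine Finset.sum_le_sum fun K _ => ?_
        obtain ⟨v, hv, hK⟩ := hQmem K K.2
        have := hnp v hv
        rwa [hK] at this
      · intro K _ L _ hKL
        refine Finset.disjoint_left.2 fun x hx hx' => ?_
        exact hKL (Subtype.ext (hQdisj K K.2 L L.2 x (Finset.mem_filter.1 hx).1
          (Finset.mem_filter.1 hx').1))
    -- A set `crossNbrs` has at most two elements and contains every vertex that gives rise to it.
    -- So Hall's condition holds for the assignment of these sets to cliques.
    have e₃ : (s.biUnion fun K => good K).card ≤
        2 * ((s.biUnion fun K => good K).image (crossNbrs G st id)).card := by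
      refine Finset.card_le_mul_card_image _ 2 ?_
      intro a ha
      obtain ⟨u, hu, rfl⟩ := Finset.mem_image.1 ha
      obtain ⟨K, -, huK⟩ := Finset.mem_biUnion.1 hu
      have hu4 := hQst K K.2 u (Finset.mem_filter.1 huK).1
      refine (Finset.card_le_card (t := crossNbrs G st id u) fun x hx => ?_).trans
        ((Finset.card_insert_le _ _).trans (Nat.succ_le_succ (card_filter_crossNbrs hΔ h hu4)))
      rw [← (Finset.mem_filter.1 hx).2]
      exact Finset.mem_insert_self _ _
    rw [e₁]
    omega
  obtain ⟨f, hf, hft⟩ := (Finset.all_card_le_biUnion_card_iff_exists_injective t).1 hall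
  have hp : ∀ K : Q, ∃ u ∈ good K, crossNbrs G st id u = f K := fun K => Finset.mem_image.1 (hft K)
  choose p hpg hpf using hp
  have hpK : ∀ K : Q, p K ∈ K.1 := fun K => (Finset.mem_filter.1 (hpg K)).1
  have hp4 : ∀ K : Q, st (p K) = 4 := fun K => hQst K K.2 _ (hpK K)
  refine ⟨Finset.univ.image p, ?_, ?_, ?_⟩
  · intro x hx
    obtain ⟨K, -, rfl⟩ := Finset.mem_image.1 hx
    exact ⟨hp4 K, (Finset.mem_filter.1 (hpg K)).2⟩
  · intro x hx y hy hxy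
    obtain ⟨K, -, rfl⟩ := Finset.mem_image.1 hx
    obtain ⟨L, -, rfl⟩ := Finset.mem_image.1 hy
    have hKL : K ≠ L := fun hc => G.irrefl (hc ▸ hxy)
    have hid : id (p L) ≠ id (p K) := by
      intro hc
      obtain ⟨v, hv, hK⟩ := hQmem K K.2
      refine hKL (Subtype.ext (hQdisj K K.2 L L.2 (p L) ?_ (hpK L)))
      have := hpK K
      rw [← hK, mem_fiber] at this ⊢
      exact ⟨hp4 L, hc.trans this.2⟩
    -- Two adjacent representatives would have the same set of cross neighbours, contradicting the
    -- injectivity from Hall's theorem.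
    have h₁ := crossNbrs_eq hΔ h (hp4 K) (hp4 L) hxy hid
    have h₂ := crossNbrs_eq hΔ h (hp4 L) (hp4 K) hxy.symm hid.symm
    refine hKL (hf ?_)
    rw [← hpf K, ← hpf L, h₁, h₂, Finset.pair_comm]
  · have e₁ : (Finset.univ.filter fun w => st w = 4) = Q.biUnion fun K => K := by
      ext w
      simp only [Finset.mem_filter, Finset.mem_univ, true_and, Finset.mem_biUnion]
      constructor
      · intro hw
        exact ⟨fiber st id w, Finset.mem_image.2 ⟨w, by simp [hw], rfl⟩, mem_fiber.2 ⟨hw, rfl⟩⟩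
      · rintro ⟨K, hK, hw⟩
        exact hQst K hK w hw
    have e₂ : ∑ K ∈ Q, K.card = ∑ _K ∈ Q, Δ := by
      refine Finset.sum_congr rfl fun K hK => ?_
      obtain ⟨v, hv, rfl⟩ := hQmem K hK
      exact (h.fiber hv).card_eq
    rw [e₁, Finset.card_biUnion, e₂, Finset.sum_const, smul_eq_mul, mul_comm,
      Finset.card_image_of_injective, Finset.card_univ, Fintype.card_coe]
    · intro K L hKL
      exact Subtype.ext (hQdisj K K.2 L L.2 (p K) (hpK K) (hKL ▸ hpK L))
    · intro K hK L hL hKL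
      exact Finset.disjoint_left.2 fun x hx hx' => hKL (hQdisj K hK L hL x hx hx')

/-- Each part of the tiling meets an independent set in at most `1 / Δ` of its vertices. Equality is
attained by the independent sets of `exists_indep` together with the transversal; the former have no
neighbours outside their own tile, so the two kinds do not interfere. -/
theorem indepNum_eq_of_tiling {Δ : ℕ} (hΔ : ∀ v, G.degree v ≤ Δ) {st id : Fin n → ℕ}
    {P : Finset (Finset (Fin n))} (hP : Packed (IsTile Δ G) 1 st P) (h : CliqueIds Δ G st id)
    (hnp : ∀ v, st v = 4 → 2 ≤ ((fiber st id v).filter fun u => lostNbrs G st u = ∅).card)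
    {A : Finset (Fin n)} (hA : ∀ w, w ∈ A ↔ st w = 1 ∨ st w = 4) {R : Set (Fin n)}
    (hR : ∀ w, w ∈ R ↔ w ∉ A) : Δ * G.indepNum = Δ * (G.induce R).indepNum + A.card := by
  classical
  obtain ⟨hPt, hPd, hPst⟩ := hP
  obtain ⟨T₂, hT₂, hT₂i, hT₂c⟩ := exists_transversal hΔ h hnp
  have hex : ∀ X : P, ∃ I ⊆ X.1, (∀ x ∈ I, ∀ y ∈ I, ¬ G.Adj x y) ∧ Δ * I.card = X.1.card ∧
      ∀ x ∈ I, ∀ w, G.Adj x w → w ∈ X.1 := by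
    rintro ⟨X, hX⟩
    obtain ⟨H, J, hH, g, hg, rfl⟩ := hPt X hX
    exact exists_indep hΔ hH hg
  choose I hIX hI hIc hIn using hex
  set A₁ := Finset.univ.filter fun w => st w = 1 with hA₁
  set A₂ := Finset.univ.filter fun w => st w = 4 with hA₂
  have hA₁' : A₁ = Finset.univ.biUnion fun X : P => X.1 := by
    ext w
    simp [hA₁, hPst]
  have hdisj : ∀ X Y : P, X ≠ Y → Disjoint X.1 Y.1 := fun X Y hXY =>
    hPd X X.2 Y Y.2 fun hc => hXY (Subtype.ext hc)
  have hA₁₂ : Disjoint A₁ A₂ := by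
    rw [Finset.disjoint_left]
    intro w hw hw'
    rw [hA₁, Finset.mem_filter] at hw
    rw [hA₂, Finset.mem_filter] at hw'
    omega
  have hAeq : A = A₁ ∪ A₂ := by
    ext w
    simp [hA, hA₁, hA₂]
  have hX1 : ∀ X : P, ∀ x ∈ X.1, st x = 1 := fun X x hx => (hPst x).2 ⟨X, X.2, hx⟩
  refine indepNum_induce_add (T := (Finset.univ.biUnion I) ∪ T₂) ?_ ?_ ?_ ?_ ?_ hR
  · intro S hS
    rw [hAeq, Finset.inter_union_distrib_left, Finset.card_union_of_disjoint
      (hA₁₂.mono Finset.inter_subset_right Finset.inter_subset_right), mul_add,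
      Finset.card_union_of_disjoint hA₁₂]
    refine Nat.add_le_add ?_ ?_
    · rw [hA₁', Finset.inter_biUnion, Finset.card_biUnion (fun X _ Y _ hXY => (hdisj X Y hXY).mono
        Finset.inter_subset_right Finset.inter_subset_right),
        Finset.card_biUnion (fun X _ Y _ hXY => hdisj X Y hXY), Finset.mul_sum]
      refine Finset.sum_le_sum fun X _ => ?_
      obtain ⟨H, J, hH, g, hg, hX⟩ := hPt X X.2
      rw [← hX]
      exact card_inter_le hH hg hS
    -- An independent set has at most one vertex in each clique, so the cliques of its vertices are
    -- disjoint sets of size Δ.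
    · have e₁ : ∑ x ∈ S ∩ A₂, (fiber st id x).card = Δ * (S ∩ A₂).card := by
        rw [mul_comm, ← smul_eq_mul, ← Finset.sum_const]
        refine Finset.sum_congr rfl fun x hx => ?_
        exact (h.fiber (Finset.mem_filter.1 (Finset.mem_inter.1 hx).2).2).card_eq
      rw [← e₁, ← Finset.card_biUnion]
      · refine Finset.card_le_card fun w hw => ?_
        obtain ⟨x, -, hx⟩ := Finset.mem_biUnion.1 hw
        exact Finset.mem_filter.2 ⟨Finset.mem_univ _, (mem_fiber.1 hx).1⟩
      · intro x hx y hy hxy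
        refine Finset.disjoint_left.2 fun w hw hw' => ?_
        rw [Finset.mem_coe, Finset.mem_inter] at hx hy
        have hx4 := (Finset.mem_filter.1 hx.2).2
        have hy4 := (Finset.mem_filter.1 hy.2).2
        refine hS x hx.1 y hy.1 ((h.fiber hx4).isClique (mem_fiber.2 ⟨hx4, rfl⟩)
          (mem_fiber.2 ⟨hy4, ?_⟩) hxy)
        rw [← (mem_fiber.1 hw).2, (mem_fiber.1 hw').2]
  · rw [Finset.union_subset_iff]
    constructor
    · intro x hx
      obtain ⟨X, -, hx⟩ := Finset.mem_biUnion.1 hx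
      exact (hA x).2 (Or.inl (hX1 X x (hIX X hx)))
    · exact fun x hx => (hA x).2 (Or.inr (hT₂ x hx).1)
  · intro x hx y hy hxy
    rcases Finset.mem_union.1 hx with hx | hx
    · obtain ⟨X, -, hx⟩ := Finset.mem_biUnion.1 hx
      have hyX := hIn X x hx y hxy
      rcases Finset.mem_union.1 hy with hy | hy
      · obtain ⟨Y, -, hy⟩ := Finset.mem_biUnion.1 hy
        by_cases hXY : X = Y
        · subst hXY
          exact hI X x hx y hy hxy
        · exact Finset.disjoint_left.1 (hdisj X Y hXY) hyX (hIX Y hy)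
      · have h₁ := hX1 X y hyX
        rw [(hT₂ y hy).1] at h₁
        exact absurd h₁ (by decide)
    · rcases Finset.mem_union.1 hy with hy | hy
      · obtain ⟨Y, -, hy⟩ := Finset.mem_biUnion.1 hy
        have h₁ := hX1 Y x (hIn Y y hy x hxy.symm)
        rw [(hT₂ x hx).1] at h₁
        exact absurd h₁ (by decide)
      · exact hT₂i x hx y hy hxy
  · rw [hAeq, Finset.card_union_of_disjoint, mul_add, hT₂c, Finset.card_union_of_disjoint hA₁₂,
      hA₁', Finset.card_biUnion (fun X _ Y _ hXY => hdisj X Y hXY), Finset.card_biUnion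
        (fun X _ Y _ hXY => (hdisj X Y hXY).mono (hIX X) (hIX Y)), Finset.mul_sum]
    · exact congrArg (· + A₂.card) (Finset.sum_congr rfl fun X _ => hIc X)
    · rw [Finset.disjoint_left]
      intro x hx hx'
      obtain ⟨X, -, hx⟩ := Finset.mem_biUnion.1 hx
      have h₁ := hX1 X x (hIX X hx)
      rw [(hT₂ x hx').1] at h₁
      exact absurd h₁ (by decide)
  · intro x hx w hxw
    rcases Finset.mem_union.1 hx with hx | hx
    · obtain ⟨X, -, hx⟩ := Finset.mem_biUnion.1 hx
      exact (hA w).2 (Or.inl (hX1 X w (hIn X x hx w hxw)))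
    · by_contra hc
      rw [hA, not_or] at hc
      have h₁ : w ∈ lostNbrs G st x := mem_lostNbrs.2 ⟨hxw, hc.1, hc.2⟩
      simp [(hT₂ x hx).2] at h₁

end

end RAM

/-! ### Partitions of induced subgraphs -/

namespace SimpleGraph

theorem IsTight.of_iso {Δ : ℕ} {V W : Type*} {H : SimpleGraph V} {H' : SimpleGraph W} (e : H ≃g H')
    (h : H.IsTight Δ) : H'.IsTight Δ := by
  have key : ∀ {U : Type} {K : SimpleGraph U}, Nonempty (H ≃g K) → Nonempty (H' ≃g K) :=
    fun ⟨φ⟩ => ⟨e.symm.trans φ⟩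
  exact h.imp key (Or.imp (And.imp_right key) (Or.imp (And.imp_right (Or.imp key (Or.imp key key)))
    (And.imp_right (Or.imp (Or.imp key (Or.imp key (Or.imp key (Or.imp key key)))) key))))

/-- An induced subgraph of an induced subgraph. -/
def induceInduceIso {V : Type*} (G : SimpleGraph V) {S : Set V} (X : Set S) (Y : Set V)
    (h : ∀ w, w ∈ Y ↔ ∃ hw : w ∈ S, ⟨w, hw⟩ ∈ X) : (G.induce S).induce X ≃g G.induce Y where
  toFun x := ⟨x.1.1, (h _).2 ⟨x.1.2, x.2⟩⟩
  invFun y := ⟨⟨y.1, ((h _).1 y.2).1⟩, ((h _).1 y.2).2⟩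
  left_inv _ := rfl
  right_inv _ := rfl
  map_rel_iff' := Iff.rfl

theorem isPartitionOf_of_cover {V : Type*} {P : Set (Set V)} {Z : Set V}
    (h₁ : ∀ X ∈ P, X.Nonempty ∧ X ⊆ Z) (h₂ : ∀ X ∈ P, ∀ Y ∈ P, ∀ w ∈ X, w ∈ Y → X = Y)
    (h₃ : ∀ w ∈ Z, ∃ X ∈ P, w ∈ X) : IsPartitionOf P Z := by
  refine ⟨fun h => Set.not_nonempty_empty (h₁ _ h).1, fun X hX Y hY hXY => ?_, ?_⟩
  · exact Set.disjoint_left.2 fun w hw hw' => hXY (h₂ X hX Y hY w hw hw')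
  · ext w
    rw [Set.mem_sUnion]
    exact ⟨fun ⟨X, hX, hw⟩ => (h₁ X hX).2 hw, fun hw => by
      obtain ⟨X, hX, hw⟩ := h₃ w hw
      exact ⟨X, hX, hw⟩⟩

theorem IsPartitionOf.preimage {V : Type*} {P : Set (Set V)} {Z S : Set V} (h : IsPartitionOf P Z)
    (hZ : Z ⊆ S) : IsPartitionOf ((fun X => (Subtype.val ⁻¹' X : Set S)) '' P)
      (Subtype.val ⁻¹' Z) := by
  obtain ⟨h₁, h₂, rfl⟩ := h
  have hsub : ∀ X ∈ P, X ⊆ S := fun X hX => (Set.subset_sUnion_of_mem hX).trans hZ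
  apply isPartitionOf_of_cover
  · rintro _ ⟨X, hX, rfl⟩
    obtain ⟨w, hw⟩ := Set.nonempty_iff_ne_empty.2 fun hc => h₁ (hc ▸ hX)
    exact ⟨⟨⟨w, hsub X hX hw⟩, hw⟩, Set.preimage_mono (Set.subset_sUnion_of_mem hX)⟩
  · rintro _ ⟨X, hX, rfl⟩ _ ⟨Y, hY, rfl⟩ w hw hw'
    by_cases hXY : X = Y
    · rw [hXY]
    · exact absurd hw' (Set.disjoint_left.1 (h₂ hX hY hXY) hw)
  · rintro w ⟨X, hX, hw⟩
    exact ⟨_, ⟨X, hX, rfl⟩, hw⟩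

theorem isTightlyPartitioned_induce {V : Type*} {G : SimpleGraph V} {Δ : ℕ} {P : Set (Set V)}
    {A : Set V} (h : IsPartitionOf P A) (hP : ∀ X ∈ P, (G.induce X).IsTight Δ) :
    (G.induce A).IsTightlyPartitioned Δ := by
  refine ⟨(fun X => Subtype.val ⁻¹' X) '' P, ?_, ?_⟩
  · have := h.preimage subset_rfl
    rwa [Subtype.coe_preimage_self] at this
  · rintro _ ⟨X, hX, rfl⟩
    refine (hP X hX).of_iso (induceInduceIso G _ X fun w => ?_).symm
    have hXA : X ⊆ A := by
      rw [← h.2.2]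
      exact Set.subset_sUnion_of_mem hX
    exact ⟨fun hw => ⟨hXA hw, hw⟩, fun ⟨_, hw⟩ => hw⟩

theorem isCliquePartitioned_induce {V : Type*} {G : SimpleGraph V} {Δ : ℕ} {P : Set (Set V)}
    {B : Set V} (h : IsPartitionOf P B) (hP : ∀ X ∈ P, G.IsClique X ∧ X.ncard = Δ) :
    (G.induce B).IsCliquePartitioned Δ := by
  refine ⟨(fun X => Subtype.val ⁻¹' X) '' P, ?_, ?_⟩
  · have := h.preimage subset_rfl
    rwa [Subtype.coe_preimage_self] at this
  · rintro _ ⟨X, hX, rfl⟩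
    have hXB : X ⊆ B := by
      rw [← h.2.2]
      exact Set.subset_sUnion_of_mem hX
    refine ⟨fun x hx y hy hxy => (hP X hX).1 hx hy fun hc => hxy (Subtype.ext hc), ?_⟩
    rw [Set.ncard_preimage_of_injective_subset_range Subtype.val_injective, (hP X hX).2]
    rwa [Subtype.range_coe]

end SimpleGraph

/-! ### Free vertices and free diamonds -/

namespace RAM

open SimpleGraph Pattern

section

variable {n : ℕ} {G : SimpleGraph (Fin n)}

/-- The set consists of the vertices of a diamond, and `Δ = 3`. -/
def IsDiamondSet (Δ : ℕ) (G : SimpleGraph (Fin n)) (X : Finset (Fin n)) : Prop :=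
  Δ = 3 ∧ ∃ g, diamondPat.IsCopy G g ∧ diamondPat.verts g = X

/-- The statuses `st₁` after the removal of nibbled sets, `st₂` after the choice of tight sets
other than cliques and `st₃` after the choice of diamonds. -/
structure Prepared (Δ : ℕ) (G : SimpleGraph (Fin n)) (st₁ st₂ st₃ : Fin n → ℕ)
    (P Q : Finset (Finset (Fin n))) : Prop where
  nibbled : Nibbled Δ G st₁
  link : Δ = 3 → linkPat₁.Avoids G {w | st₁ w = 0} ∧ linkPat₂.Avoids G {w | st₁ w = 0}
  crowded : 4 ≤ Δ → ∀ v, ¬ Crowded Δ G st₁ v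
  step₁ : ∀ w, st₂ w = st₁ w ∨ st₁ w = 0 ∧ st₂ w = 1
  tiles : Packed (IsTile Δ G) 1 st₂ P
  avoids : ∀ H J, (H, J) ∈ tightPats Δ → H.Avoids G {w | st₂ w = 0}
  step₂ : ∀ w, st₃ w = st₂ w ∨ st₂ w = 0 ∧ st₃ w = 3
  diamonds : Packed (IsDiamondSet Δ G) 3 st₃ Q
  avoids_diamond : Δ = 3 → diamondPat.Avoids G {w | st₃ w = 0}

variable {Δ : ℕ} {st₁ st₂ st₃ : Fin n → ℕ} {P Q : Finset (Finset (Fin n))}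

variable [DecidableRel G.Adj]

/-- For Δ = 3 two intersecting triangles would contain a diamond, and none is left; for larger Δ
this was achieved by nibbling and persists. -/
theorem Prepared.not_crowded (h : Prepared Δ G st₁ st₂ st₃ P Q) (hΔ : ∀ v, G.degree v ≤ Δ)
    (h3 : 3 ≤ Δ) (v : Fin n) : ¬ Crowded Δ G st₃ v := by
  intro hc
  rcases h3.eq_or_lt with rfl | h4
  · obtain ⟨K, L, hK, hL, hKL, hvK, hvL, hK0, hL0⟩ := hc
    obtain ⟨g, hg, hsub⟩ := exists_diamond hΔ hK hL hKL hvK hvL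
    refine h.avoids_diamond rfl g hg fun w hw => ?_
    rcases Finset.mem_union.1 (hsub hw) with hw | hw
    · exact hK0 w hw
    · exact hL0 w hw
  · refine h.crowded h4 v (hc.mono fun w hw => ?_)
    have h₁ := h.step₁ w
    have h₂ := h.step₂ w
    omega

/-- A tight set without nibbled vertices lies in a tile or is a clique of vertices that are not in
tiles. -/
theorem Prepared.tight_cases (h : Prepared Δ G st₁ st₂ st₃ P Q) (hΔ : ∀ v, G.degree v ≤ Δ)
    (h3 : 3 ≤ Δ) {Y : Finset (Fin n)} (hY : (G.induce (Y : Set (Fin n))).IsTight Δ)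
    (hY0 : ∀ w ∈ Y, st₁ w = 0) :
    (∃ X ∈ P, Y ⊆ X) ∨ G.IsNClique Δ Y ∧ ∀ w ∈ Y, st₂ w = 0 := by
  have hX0 : ∀ X ∈ P, ∀ w ∈ X, st₁ w = 0 := by
    intro X hX w hw
    have h₁ := (h.tiles.2.2 w).2 ⟨X, hX, hw⟩
    have h₂ := h.step₁ w
    have h₃ := h.nibbled.1 w
    omega
  by_cases hmeet : ∃ X ∈ P, ¬ Disjoint Y X
  · left
    obtain ⟨X, hX, hXY⟩ := hmeet
    refine ⟨X, hX, ?_⟩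
    obtain ⟨H, J, hH, g, hg, rfl⟩ := h.tiles.1 X hX
    obtain ⟨K, hK, k, hk, hi, rfl⟩ := exists_copy_of_isTight (by omega) hΔ hY
    exact subset_of_not_disjoint hΔ h.link hH hg (hX0 _ hX) hK hk hi hY0 hXY
  · right
    have hY2 : ∀ w ∈ Y, st₂ w = 0 := by
      intro w hw
      rcases h.step₁ w with h₁ | ⟨-, h₁⟩
      · rw [h₁, hY0 w hw]
      · obtain ⟨X, hX, hwX⟩ := (h.tiles.2.2 w).1 h₁
        exact absurd ⟨X, hX, Finset.not_disjoint_iff.2 ⟨w, hw, hwX⟩⟩ hmeet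
    refine ⟨?_, hY2⟩
    rcases (isTight_iff hΔ Y).1 hY with hY | ⟨H, J, hH, g, hg, rfl⟩
    · exact hY
    · exact absurd hY2 (h.avoids H J hH g hg)

/-- A vertex that is finally left over lies in no tight set without nibbled vertices. -/
theorem Prepared.free_vertex (h : Prepared Δ G st₁ st₂ st₃ P Q) (hΔ : ∀ v, G.degree v ≤ Δ)
    (h3 : 3 ≤ Δ) (hω : G.CliqueFree (Δ + 1)) {st id : Fin n → ℕ}
    (hst : ∀ w, st w = st₃ w ∨ st₃ w = 0 ∧ st w = 4) (hid : CliqueIds Δ G st id)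
    (hno : ∀ K : Finset (Fin n), G.IsNClique Δ K → ¬ ∀ w ∈ K, st w = 0) {v : Fin n} (hv : st v = 0)
    {Y : Finset (Fin n)} (hvY : v ∈ Y) (hY : (G.induce (Y : Set (Fin n))).IsTight Δ)
    (hY0 : ∀ w ∈ Y, st₁ w = 0) : False := by
  have hv3 : st₃ v = 0 := by
    have := hst v
    omega
  have hv2 : st₂ v = 0 := by
    have := h.step₂ v
    omega
  rcases h.tight_cases hΔ h3 hY hY0 with ⟨X, hX, hYX⟩ | ⟨hK, hY2⟩
  · have := (h.tiles.2.2 v).2 ⟨X, hX, hYX hvY⟩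
    omega
  · have hY3 : ∀ w ∈ Y, st₃ w = 0 := by
      intro w hw
      rcases h.step₂ w with h₁ | ⟨-, h₁⟩
      · rw [h₁, hY2 w hw]
      · obtain ⟨X, hX, hwX⟩ := (h.diamonds.2.2 w).1 h₁
        obtain ⟨rfl, g, hg, rfl⟩ := h.diamonds.1 X hX
        -- A triangle that meets a chosen diamond lies inside it, so `v` would have status 3.
        have := subset_diamond hΔ hω hg hK (Finset.not_disjoint_iff.2 ⟨w, hw, hwX⟩)
        have := (h.diamonds.2.2 v).2 ⟨_, hX, this hvY⟩
        omega
    obtain ⟨u, huY, hu⟩ : ∃ u ∈ Y, st u ≠ 0 := by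
      have := hno Y hK
      push Not at this
      exact this
    have hu4 : st u = 4 := by
      have h₁ := hst u
      have h₂ := hY3 u huY
      omega
    -- The clique chosen around `u` does not contain `v`, so it is another clique than `Y` through
    -- `u`.
    refine h.not_crowded hΔ h3 u ⟨fiber st id u, Y, hid.fiber hu4, hK, ?_, mem_fiber.2 ⟨hu4, rfl⟩,
      huY, fun w hw => ?_, hY3⟩
    · rintro rfl
      rw [mem_fiber, hv] at hvY
      exact absurd hvY.1 (by decide)
    · have h₁ := (mem_fiber.1 hw).1
      have h₂ := hst w
      have h₃ := h.step₂ w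
      have h₄ := h.step₁ w
      have h₅ := h.nibbled.1 w
      omega

/-- A necklace around the diamond in the graph without nibbled vertices would lie in a tile, whereas
the diamond avoids all tiles. The other case of `tight_cases`, a triangle, is too small to contain a
diamond. -/
theorem Prepared.isFreeDiamond (h : Prepared Δ G st₁ st₂ st₃ P Q) (hΔ : ∀ v, G.degree v ≤ Δ)
    (hω : G.CliqueFree (Δ + 1)) {C : Set (Fin n)} (hC : ∀ w, w ∈ C ↔ st₁ w = 2)
    {X : Finset (Fin n)} (hX : X ∈ Q) : (G.induce Cᶜ).IsFreeDiamond (Subtype.val ⁻¹' (X : Set (Fin n))) := by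
  classical
  obtain ⟨rfl, g, hg, rfl⟩ := h.diamonds.1 X hX
  have hX2 : ∀ w ∈ diamondPat.verts g, st₂ w = 0 ∧ st₁ w = 0 := by
    intro w hw
    have h₁ := (h.diamonds.2.2 w).2 ⟨_, hX, hw⟩
    have h₂ := h.step₂ w
    have h₃ := h.step₁ w
    have h₄ := h.nibbled.1 w
    omega
  have hmemC : ∀ w, w ∈ Cᶜ ↔ st₁ w = 0 := by
    intro w
    rw [Set.mem_compl_iff, hC]
    have h₄ := h.nibbled.1 w
    omega
  constructor
  · obtain ⟨φ⟩ := hg.iso (diamondPat_isInduced hω hg) (K := ofEdges 4 diamondPat.edges) ofEdges_adj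
    refine ⟨(induceInduceIso G _ _ fun w => ?_).trans φ⟩
    exact ⟨fun hw => ⟨(hmemC w).2 (hX2 w hw).2, hw⟩, fun ⟨_, hw⟩ => hw⟩
  · intro Y hXY hY
    have hY' : ((G.induce Cᶜ).induce Y).IsTight 3 := Or.inr (Or.inr (Or.inr ⟨rfl, Or.inl hY⟩))
    have hmem : ∀ w, w ∈ ((Finset.univ.filter fun w => ∃ hw : w ∈ Cᶜ, ⟨w, hw⟩ ∈ Y :
        Finset (Fin n)) : Set (Fin n)) ↔ ∃ hw : w ∈ Cᶜ, ⟨w, hw⟩ ∈ Y := by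
      intro w
      simp
    have hsub : diamondPat.verts g ⊆ Finset.univ.filter fun w => ∃ hw : w ∈ Cᶜ, ⟨w, hw⟩ ∈ Y := by
      intro w hw
      rw [← Finset.mem_coe, hmem]
      exact ⟨(hmemC w).2 (hX2 w hw).2, hXY hw⟩
    rcases h.tight_cases hΔ le_rfl (hY'.of_iso (induceInduceIso G _ _ hmem)) (fun w hw => by
      rw [← Finset.mem_coe, hmem] at hw
      exact (hmemC w).1 hw.1) with ⟨Z, hZ, hYZ⟩ | ⟨hK, -⟩
    · have h0 : g 0 ∈ diamondPat.verts g := mem_verts.2 ⟨0, by decide, rfl⟩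
      have h₁ := (h.tiles.2.2 (g 0)).2 ⟨Z, hZ, hYZ (hsub h0)⟩
      have h₂ := (hX2 _ h0).1
      omega
    · have := Finset.card_le_card hsub
      rw [hK.card_eq, hg.card_verts] at this
      exact absurd this (by decide)

end

end RAM

/-! ### Assembling the decomposition -/

namespace RAM

open SimpleGraph Pattern

section

variable {n : ℕ} {G : SimpleGraph (Fin n)} [DecidableRel G.Adj] {Δ : ℕ}
  {st₁ st₂ st₃ st₄ st₅ id : Fin n → ℕ} {P Q : Finset (Finset (Fin n))}

theorem Prepared.isDecomposition (h : Prepared Δ G st₁ st₂ st₃ P Q) (hΔ : ∀ v, G.degree v ≤ Δ)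
    (h3 : 3 ≤ Δ) (hω : G.CliqueFree (Δ + 1)) (hst₄ : ∀ w, st₄ w = st₃ w ∨ st₃ w = 0 ∧ st₄ w = 4)
    (hid : CliqueIds Δ G st₄ id)
    (hno : ∀ K : Finset (Fin n), G.IsNClique Δ K → ¬ ∀ w ∈ K, st₄ w = 0) {v x : ℕ} (hv : n ≤ v)
    (hp : PeelInv Δ G st₄ id st₅ v x) :
    G.IsDecomposition Δ {w | st₅ w = 1 ∨ st₅ w = 4} {w | st₅ w = 5} {w | st₅ w = 2}
      {w | st₅ w = 0 ∨ st₅ w = 3} := by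
  classical
  -- The possible histories of a status, from which arithmetic derives all relations between the
  -- five stages.
  have facts : ∀ w, (st₁ w = 0 ∨ st₁ w = 2) ∧ (st₂ w = st₁ w ∨ st₁ w = 0 ∧ st₂ w = 1) ∧
      (st₃ w = st₂ w ∨ st₂ w = 0 ∧ st₃ w = 3) ∧ (st₄ w = st₃ w ∨ st₃ w = 0 ∧ st₄ w = 4) ∧
      (st₅ w = st₄ w ∨ st₄ w = 4 ∧ st₅ w = 5) := fun w =>
    ⟨h.nibbled.1 w, h.step₁ w, h.step₂ w, hst₄ w, hp.turned.1 w⟩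
  have h₅ : ∀ w, st₄ w ≠ 5 := fun w => by have := facts w; omega
  have hC : ∀ w, st₅ w = 2 ↔ st₁ w = 2 := fun w => by have := facts w; omega
  have hid₅ : CliqueIds Δ G st₅ id := by
    intro u hu
    refine ⟨fiber st₄ id u, hid.fiber (hp.turned.eq_four hu), fun w => ?_⟩
    rw [mem_fiber]
    constructor
    · rintro ⟨hw, hwu⟩
      exact ⟨(hp.turned.2 w u hw (hp.turned.eq_four hu) hwu).trans hu, hwu⟩
    · rintro ⟨hw, hwu⟩
      exact ⟨hp.turned.eq_four hw, hwu⟩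
  have hB : ∀ u, st₅ u = 5 → st₄ u = 4 ∧ ∀ w, w ∈ fiber st₄ id u ↔ st₅ w = 5 ∧ id w = id u := by
    intro u hu
    have hu4 : st₄ u = 4 := by have := facts u; omega
    refine ⟨hu4, fun w => ?_⟩
    rw [mem_fiber]
    constructor
    · rintro ⟨hw, hwu⟩
      exact ⟨(hp.turned.2 w u hw hu4 hwu).trans hu, hwu⟩
    · rintro ⟨hw, hwu⟩
      refine ⟨?_, hwu⟩
      have := facts w
      omega
  have htiles : Packed (IsTile Δ G) 1 st₅ P := by
    refine ⟨h.tiles.1, h.tiles.2.1, fun w => ?_⟩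
    rw [← h.tiles.2.2 w]
    have := facts w
    omega
  have hdia : ∀ w, st₅ w = 3 ↔ ∃ X ∈ Q, w ∈ X := by
    intro w
    rw [← h.diamonds.2.2 w]
    have := facts w
    omega
  have hnp : ∀ u, st₅ u = 4 →
      2 ≤ ((fiber st₅ id u).filter fun z => lostNbrs G st₅ z = ∅).card := by
    intro u hu
    -- The walk has ended, with both pointers at least `n`, so the invariant leaves no peelable
    -- clique.
    have hnot : ¬ Peelable Δ G st₅ id u := by
      intro hpu
      obtain ⟨d, hd, -⟩ := hp.peelable u (u.2.le.trans hv) hpu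
      have := hp.le hv
      omega
    have hm : members G st₅ id u = fiber st₅ id u := by
      have hu4 := hp.turned.eq_four hu
      rw [hp.turned.members_eq hu (hid.fiber hu4) fun w => mem_fiber]
      ext w
      rw [mem_fiber, mem_fiber]
      exact ⟨fun hw => ⟨(hp.turned.2 w u hw.1 hu4 hw.2).trans hu, hw.2⟩,
        fun hw => ⟨hp.turned.eq_four hw.1, hw.2⟩⟩
    rw [Peelable, hm] at hnot
    have hsum := Finset.card_filter_add_card_filter_not (s := fiber st₅ id u)
      fun z => 0 < (lostNbrs G st₅ z).card
    rw [(hid₅.fiber hu).card_eq] at hsum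
    have heq : ((fiber st₅ id u).filter fun z => ¬ 0 < (lostNbrs G st₅ z).card) =
        (fiber st₅ id u).filter fun z => lostNbrs G st₅ z = ∅ := by
      refine Finset.filter_congr fun z _ => ?_
      rw [Finset.card_pos, Finset.not_nonempty_iff_eq_empty]
    rw [heq] at hsum
    have hnot' := fun h => hnot ⟨hu, h⟩
    omega
  refine ⟨?_, ?_, ?_, ?_, ?_, ?_, ?_, ?_⟩
  · ext w
    simp only [Set.mem_union, Set.mem_ofPred_eq, Set.mem_univ, iff_true]
    have := facts w
    omega
  · simp only [List.pairwise_cons, List.mem_cons, List.not_mem_nil, or_false, forall_eq_or_imp,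
      forall_eq, List.Pairwise.nil, and_true, IsEmpty.forall_iff, implies_true, Set.disjoint_left,
      Set.mem_ofPred_eq]
    refine ⟨⟨fun w => ?_, fun w => ?_, fun w => ?_⟩, ⟨fun w => ?_, fun w => ?_⟩, fun w => ?_⟩ <;> omega
  · refine isTightlyPartitioned_induce (P := {Y | (∃ X ∈ P, Y = (X : Set (Fin n))) ∨
      ∃ u, st₅ u = 4 ∧ Y = (fiber st₅ id u : Set (Fin n))}) (isPartitionOf_of_cover ?_ ?_ ?_) ?_
    · rintro _ (⟨X, hX, rfl⟩ | ⟨u, hu, rfl⟩)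
      · refine ⟨?_, fun w hw => Or.inl ((htiles.2.2 w).2 ⟨X, hX, hw⟩)⟩
        obtain ⟨H, J, hH, g, hg, rfl⟩ := h.tiles.1 X hX
        have hOK := tightOK_of_mem hH
        simp only [tightOK, Bool.and_eq_true] at hOK
        exact ⟨g 0, mem_verts.2 ⟨0, pos_of_wf hOK.1.1.1.1.1, rfl⟩⟩
      · exact ⟨⟨u, mem_fiber.2 ⟨hu, rfl⟩⟩, fun w hw => Or.inr (mem_fiber.1 hw).1⟩
    · rintro _ (⟨X, hX, rfl⟩ | ⟨u, hu, rfl⟩) _ (⟨Y, hY, rfl⟩ | ⟨z, hz, rfl⟩) w hw hw'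
      · by_cases hXY : X = Y
        · rw [hXY]
        · exact absurd hw' (Finset.disjoint_left.1 (htiles.2.1 X hX Y hY hXY) hw)
      · have h₁ := (htiles.2.2 w).2 ⟨X, hX, hw⟩
        rw [(mem_fiber.1 hw').1] at h₁
        exact absurd h₁ (by decide)
      · have h₁ := (htiles.2.2 w).2 ⟨Y, hY, hw'⟩
        rw [(mem_fiber.1 hw).1] at h₁
        exact absurd h₁ (by decide)
      · ext y
        rw [Finset.mem_coe, Finset.mem_coe, mem_fiber, mem_fiber, ← (mem_fiber.1 hw).2,
          ← (mem_fiber.1 hw').2]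
    · rintro w (hw | hw)
      · obtain ⟨X, hX, hwX⟩ := (htiles.2.2 w).1 hw
        exact ⟨X, Or.inl ⟨X, hX, rfl⟩, hwX⟩
      · exact ⟨_, Or.inr ⟨w, hw, rfl⟩, mem_fiber.2 ⟨hw, rfl⟩⟩
    · rintro _ (⟨X, hX, rfl⟩ | ⟨u, hu, rfl⟩)
      · exact (isTight_iff hΔ X).2 (Or.inr (h.tiles.1 X hX))
      · exact (isTight_iff hΔ _).2 (Or.inl (hid₅.fiber hu))
  · refine isCliquePartitioned_induce (P := {Y | ∃ u, st₅ u = 5 ∧ Y = (fiber st₄ id u : Set (Fin n))})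
      (isPartitionOf_of_cover ?_ ?_ ?_) ?_
    · rintro _ ⟨u, hu, rfl⟩
      exact ⟨⟨u, mem_fiber.2 ⟨(hB u hu).1, rfl⟩⟩, fun w hw => (((hB u hu).2 w).1 hw).1⟩
    · rintro _ ⟨u, hu, rfl⟩ _ ⟨z, hz, rfl⟩ w hw hw'
      ext y
      rw [Finset.mem_coe, Finset.mem_coe, mem_fiber, mem_fiber, ← (mem_fiber.1 hw).2,
        ← (mem_fiber.1 hw').2]
    · exact fun w hw => ⟨_, ⟨w, hw, rfl⟩, mem_fiber.2 ⟨(hB w hw).1, rfl⟩⟩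
    · rintro _ ⟨u, hu, rfl⟩
      refine ⟨(hid.fiber (hB u hu).1).isClique, ?_⟩
      rw [Set.ncard_coe_finset, (hid.fiber (hB u hu).1).card_eq]
  · have hle := hp.count.card_le hΔ h3 hid h₅ hp.turned
    have e₁ : ({w | st₅ w = 5} : Set (Fin n)) = (Finset.univ.filter fun w => st₅ w = 5 :
        Finset (Fin n)) := by
      ext w
      simp
    rw [e₁, Set.ncard_coe_finset]
    refine hle.trans (Nat.mul_le_mul_left _ ?_)
    refine le_trans ?_ (Set.ncard_union_le _ _)
    rw [← Set.ncard_coe_finset]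
    refine Set.ncard_le_ncard fun w hw => ?_
    simp only [Finset.coe_filter, Finset.mem_univ, true_and, Set.mem_ofPred_eq] at hw
    simp only [Set.mem_union, Set.mem_ofPred_eq]
    have := facts w
    omega
  · have e₁ : {w | st₅ w = 2} = {w | st₁ w = 2} := by
      ext w
      exact hC w
    rw [e₁]
    exact h.nibbled.2
  · have hfree : ∀ (u : ({w | st₅ w = 2} : Set (Fin n))ᶜ.Elem), st₅ u.1 = 0 →
        (G.induce ({w | st₅ w = 2} : Set (Fin n))ᶜ).IsFreeVertex Δ u := by
      intro u hu X huX hX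
      have hmem : ∀ w, w ∈ ((Finset.univ.filter fun w =>
          ∃ hw : w ∈ ({w | st₅ w = 2} : Set (Fin n))ᶜ, ⟨w, hw⟩ ∈ X : Finset (Fin n)) : Set (Fin n)) ↔
          ∃ hw : w ∈ ({w | st₅ w = 2} : Set (Fin n))ᶜ, ⟨w, hw⟩ ∈ X := by
        intro w
        simp
      refine h.free_vertex hΔ h3 hω hst₄ hid hno (v := u.1) ?_ ?_
        (hX.of_iso (induceInduceIso G _ _ hmem)) ?_
      · have := facts u.1
        omega
      · rw [← Finset.mem_coe, hmem]
        exact ⟨u.2, huX⟩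
      · intro w hw
        rw [← Finset.mem_coe, hmem] at hw
        obtain ⟨hw, -⟩ := hw
        rw [Set.mem_compl_iff, Set.mem_ofPred_eq, hC] at hw
        have := facts w
        omega
    rcases h3.eq_or_lt with rfl | h4
    -- For Δ = 3 the parts of D are the chosen diamonds and singletons of free vertices.
    · refine Or.inr ⟨rfl, _, IsPartitionOf.preimage (P := {Y | (∃ X ∈ Q, Y = (X : Set (Fin n))) ∨
        ∃ u, st₅ u = 0 ∧ Y = {u}}) (isPartitionOf_of_cover ?_ ?_ ?_) ?_, ?_⟩
      · rintro _ (⟨X, hX, rfl⟩ | ⟨u, hu, rfl⟩)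
        · refine ⟨?_, fun w hw => Or.inr ((hdia w).2 ⟨X, hX, hw⟩)⟩
          obtain ⟨-, g, hg, rfl⟩ := h.diamonds.1 X hX
          exact ⟨g 0, mem_verts.2 ⟨0, by decide, rfl⟩⟩
        · exact ⟨⟨u, rfl⟩, by rintro w rfl; exact Or.inl hu⟩
      · rintro _ (⟨X, hX, rfl⟩ | ⟨u, hu, rfl⟩) _ (⟨Y, hY, rfl⟩ | ⟨z, hz, rfl⟩) w hw hw'
        · by_cases hXY : X = Y
          · rw [hXY]
          · exact absurd hw' (Finset.disjoint_left.1 (h.diamonds.2.1 X hX Y hY hXY) hw)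
        · have h₁ := (hdia w).2 ⟨X, hX, hw⟩
          rw [Set.mem_singleton_iff.1 hw', hz] at h₁
          exact absurd h₁ (by decide)
        · have h₁ := (hdia w).2 ⟨Y, hY, hw'⟩
          rw [Set.mem_singleton_iff.1 hw, hu] at h₁
          exact absurd h₁ (by decide)
        · rw [← Set.mem_singleton_iff.1 hw, ← Set.mem_singleton_iff.1 hw']
      · rintro w (hw | hw)
        · exact ⟨_, Or.inr ⟨w, hw, rfl⟩, rfl⟩
        · obtain ⟨X, hX, hwX⟩ := (hdia w).1 hw
          exact ⟨X, Or.inl ⟨X, hX, rfl⟩, hwX⟩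
      · intro w hw
        simp only [Set.mem_compl_iff, Set.mem_ofPred_eq] at hw ⊢
        omega
      · rintro _ ⟨_, ⟨X, hX, rfl⟩ | ⟨u, hu, rfl⟩, rfl⟩
        · exact Or.inl (h.isFreeDiamond hΔ hω hC hX)
        · refine Or.inr fun z hz => hfree z ?_
          rw [Set.mem_singleton_iff.1 hz, hu]
    · refine Or.inl ⟨h4, fun u hu => hfree u ?_⟩
      rcases hu with hu | hu
      · exact hu
      · obtain ⟨X, hX, -⟩ := (hdia u).1 hu
        have := (h.diamonds.1 X hX).1
        omega
  · have hA : ∀ w, w ∈ (Finset.univ.filter fun w => st₅ w = 1 ∨ st₅ w = 4 : Finset (Fin n)) ↔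
        st₅ w = 1 ∨ st₅ w = 4 := by
      intro w
      simp
    have key := indepNum_eq_of_tiling hΔ htiles hid₅ hnp hA
      (R := {w | st₅ w = 5} ∪ {w | st₅ w = 2} ∪ {w | st₅ w = 0 ∨ st₅ w = 3}) (by
        intro w
        rw [hA]
        simp only [Set.mem_union, Set.mem_ofPred_eq]
        have := facts w
        omega)
    have e₁ : ({w | st₅ w = 1 ∨ st₅ w = 4} : Set (Fin n)).ncard =
        (Finset.univ.filter fun w => st₅ w = 1 ∨ st₅ w = 4 : Finset (Fin n)).card := by
      rw [← Set.ncard_coe_finset]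
      congr 1
      ext w
      simp
    rw [e₁]
    have hpos : (Δ : ℚ) ≠ 0 := by
      have : 0 < Δ := by omega
      exact_mod_cast this.ne'
    have key' : (Δ : ℚ) * G.indepNum = Δ * (G.induce ({w | st₅ w = 5} ∪ {w | st₅ w = 2} ∪
      {w | st₅ w = 0 ∨ st₅ w = 3})).indepNum + (Finset.univ.filter fun w =>
        st₅ w = 1 ∨ st₅ w = 4 : Finset (Fin n)).card := by exact_mod_cast key
    field_simp
    linarith

end

end RAM

/-! ### The phases of the algorithm -/

namespace RAM

open SimpleGraph Pattern

namespace Stmt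

/-- Search for copies of the pattern and give them the status `c`. -/
def patSearch (c : ℕ) (H : Pattern) : Stmt :=
  searchPhase H.edges H.order (markAll c (full H.order [0]))

/-- Search for copies of the listed patterns. -/
def searchAll : List (Pattern × List ℕ) → Stmt
  | [] => skip
  | a :: L => seq (patSearch 1 a.1) (searchAll L)

/-- Find tight sets other than cliques. -/
def tightPhase : Stmt :=
  seq (ifEq (.var 1) (.lit 3) (searchAll (tightPats 3)))
    (seq (ifEq (.var 1) (.lit 4) (searchAll (tightPats 4)))
      (ifEq (.var 1) (.lit 5) (searchAll (tightPats 5))))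

/-- Find diamonds. -/
def diamondPhase : Stmt := ifEq (.var 1) (.lit 3) (patSearch 3 diamondPat)

/-- Nibble where tight sets may overlap. -/
def nibblePhase : Stmt :=
  seq (ifEq (.var 1) (.lit 3)
    (seq (searchPhase linkPat₁.edges linkPat₁.order (markNbhds [2, 3, 6]))
      (searchPhase linkPat₂.edges linkPat₂.order (markNbhds [2, 3, 8, 9]))))
    (ite (.lit 3) (.var 1) pairPhase skip)

/-- Write the label of the vertex in register 2. -/
def outputBody : Stmt :=
  ite (.get 3 (.var 2)) (.lit 1) (store 2 (.var 2) (.lit 3))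
    (ite (.get 3 (.var 2)) (.lit 2) (store 2 (.var 2) (.lit 0))
      (ite (.get 3 (.var 2)) (.lit 3) (store 2 (.var 2) (.lit 2))
        (ite (.get 3 (.var 2)) (.lit 4) (store 2 (.var 2) (.lit 3))
          (ite (.get 3 (.var 2)) (.lit 5) (store 2 (.var 2) (.lit 0))
            (store 2 (.var 2) (.lit 1))))))

/-- Write the labels of all vertices. -/
def outputPhase : Stmt := vertLoop outputBody

/-- The whole algorithm. -/
def decompose : Stmt :=
  seq nibblePhase (seq tightPhase (seq diamondPhase (seq cliquePhase (seq peelPhase outputPhase))))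

section

variable {Δ n : ℕ} {G : SimpleGraph (Fin n)} [DecidableRel G.Adj]

/-- The label that belongs to a status. -/
def label (k : ℕ) : ℕ :=
  if k < 1 then 3 else if k < 2 then 0 else if k < 3 then 2 else if k < 4 then 3 else
    if k < 5 then 0 else 1

theorem outputBody_denote (s : State) :
    outputBody.denote s = s.setArr 2 (s.reg 2) (label (s.arr 3 (s.reg 2))) := by
  simp only [outputBody, denote, Exp.eval]
  unfold label
  repeat' refine (congrArg _ ?_).trans (apply_ite (s.setArr 2 (s.reg 2)) _ _ _).symm
  all_goals rfl

omit [DecidableRel G.Adj] in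
theorem outputPhase_spec {s : State} (rep : Rep Δ G s) (v : Fin n) :
    (outputPhase.denote s).arr 2 v = label (s.status n v) := by
  have key := vertLoop_induction rep (p := outputBody) rfl rfl
    (fun k s' => s'.arr 3 = s.arr 3 ∧ ∀ w : Fin n, (w : ℕ) < k → s'.arr 2 w = label (s.arr 3 w))
    (fun k l => ⟨rfl, fun w hw => absurd hw (Nat.not_lt_zero _)⟩) (by
      rintro v s' - hv ⟨h₁, h₂⟩ k
      rw [outputBody_denote, hv, h₁]
      refine ⟨?_, fun w hw => ?_⟩
      · rw [State.setReg_arr, ← h₁]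
        funext i
        rw [State.setArr_arr, if_neg (by simp)]
      · rw [State.setReg_arr, State.setArr_arr]
        split_ifs with h
        · rw [h.2]
        · exact h₂ w (by
            have : (w : ℕ) ≠ v := fun hc => h ⟨rfl, hc⟩
            omega))
  exact key.2 v v.2

/-- Copies are sought among vertices of status 0 and marked with the nonzero status `c`, so the
chosen copies are disjoint, and the search continues until none is left. -/
theorem patSearch_spec (h5 : ∀ v, G.degree v ≤ 5) {H : Pattern} (hH : H.orderOK = true)
    (hpos : 0 < H.size) {c : ℕ} (hc : c ≠ 0) {T : Finset (Fin n) → Prop}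
    (hT : ∀ g, H.IsCopy G g → T (H.verts g)) {s : State} (rep : Rep Δ G s)
    (hs : ∃ P, Packed T c (s.status n) P) :
    (∃ P, Packed T c (((patSearch c H).denote s).status n) P) ∧
    (∀ w, ((patSearch c H).denote s).status n w = s.status n w ∨
      s.status n w = 0 ∧ ((patSearch c H).denote s).status n w = c) ∧
    H.Avoids G {w | ((patSearch c H).denote s).status n w = 0} := by
  have hfit : Fits H.edges H.order [0] = true := by
    simp only [orderOK, Bool.and_eq_true] at hH
    exact hH.1.1
  have hmem : ∀ (g : ℕ → Fin n) w, (∃ i ∈ full H.order [0], g i = w) ↔ w ∈ H.verts g := by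
    intro g w
    simp only [mem_full_iff hH, mem_verts]
  have key := searchPhase_spec h5 hfit (marks_markAll c (full H.order [0]))
    (fun g st w => if ∃ i ∈ full H.order [0], g i = w then c else st w)
    (fun g s _ hg => markAll_spec c _ hg)
    (fun g st w h => by
      split_ifs at h
      · exact absurd h hc
      · exact h)
    (fun g st _ => by
      rw [if_pos ⟨0, (mem_full_iff hH 0).2 hpos, rfl⟩]
      exact hc)
    (fun st => (∃ P, Packed T c st P) ∧
      ∀ w, st w = s.status n w ∨ s.status n w = 0 ∧ st w = c)
    (by
      rintro g st ⟨⟨P, hP₁, hP₂, hP₃⟩, hst⟩ hg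
      rw [valid_iff hH] at hg
      obtain ⟨hg, hg0⟩ := hg
      have hdisj : ∀ X ∈ P, Disjoint X (H.verts g) := by
        intro X hX
        refine Finset.disjoint_left.2 fun w hw hw' => hc ?_
        rw [← (hP₃ w).2 ⟨X, hX, hw⟩]
        exact hg0 w hw'
      refine ⟨⟨insert (H.verts g) P, ?_, ?_, ?_⟩, ?_⟩
      · intro X hX
        rcases Finset.mem_insert.1 hX with rfl | hX
        · exact hT g hg
        · exact hP₁ X hX
      · intro X hX Y hY hXY
        rcases Finset.mem_insert.1 hX with rfl | hX <;> rcases Finset.mem_insert.1 hY with rfl | hY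
        · exact absurd rfl hXY
        · exact (hdisj Y hY).symm
        · exact hdisj X hX
        · exact hP₂ X hX Y hY hXY
      · intro w
        simp only [hmem, Finset.exists_mem_insert]
        rw [← hP₃ w]
        split_ifs with hw <;> simp [hw]
      · intro w
        simp only [hmem]
        split_ifs with hw
        · have h₁ := hg0 w hw
          simp only [Set.mem_ofPred_eq] at h₁
          rcases hst w with h₂ | h₂
          · exact Or.inr ⟨by rw [← h₂, h₁], rfl⟩
          · exact Or.inr ⟨h₂.1, rfl⟩
        · exact hst w)
    rep ⟨hs, fun w => Or.inl rfl⟩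
  refine ⟨key.1.1, key.1.2, fun g hg hg0 => key.2 g ?_⟩
  rw [valid_iff hH]
  exact ⟨hg, hg0⟩

theorem safe_patSearch (c : ℕ) (H : Pattern) : (patSearch c H).safe = true := by
  rw [safe_iff]
  exact ⟨writes_searchPhase (marks_markAll c _) (by omega),
    writes_searchPhase (marks_markAll c _) (by omega),
    stores_searchPhase _ _ (marks_markAll c _) (by omega),
    stores_searchPhase _ _ (marks_markAll c _) (by omega)⟩

theorem safe_searchAll : ∀ L : List (Pattern × List ℕ), (searchAll L).safe = true
  | [] => rfl
  | a :: L => by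
    have h₁ := safe_iff.1 (safe_patSearch 1 a.1)
    have h₂ := safe_iff.1 (safe_searchAll L)
    rw [safe_iff]
    simp [searchAll, writes, stores, h₁, h₂]

/-- Patterns treated earlier remain excluded, since the set of vertices of status 0 only shrinks. -/
theorem searchAll_spec (h5 : ∀ v, G.degree v ≤ 5) (L : List (Pattern × List ℕ)) :
    (∀ a ∈ L, a ∈ tightPats Δ) → ∀ {s : State}, Rep Δ G s →
    (∃ P, Packed (IsTile Δ G) 1 (s.status n) P) →
    (∃ P, Packed (IsTile Δ G) 1 (((searchAll L).denote s).status n) P) ∧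
    (∀ w, ((searchAll L).denote s).status n w = s.status n w ∨
        s.status n w = 0 ∧ ((searchAll L).denote s).status n w = 1) ∧
    ∀ a ∈ L, a.1.Avoids G {w | ((searchAll L).denote s).status n w = 0} := by
  induction L with
  | nil => exact fun _ s _ hs => ⟨hs, fun w => Or.inl rfl, by simp⟩
  | cons a L ih =>
    intro hL s rep hs
    have ha := hL a List.mem_cons_self
    have hOK := tightOK_of_mem ha
    simp only [tightOK, Bool.and_eq_true] at hOK
    obtain ⟨h₁, h₂, h₃⟩ := patSearch_spec h5 hOK.1.1.1.1.2 (pos_of_wf hOK.1.1.1.1.1) one_ne_zero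
      (T := IsTile Δ G) (fun g hg => ⟨a.1, a.2, ha, g, hg, rfl⟩) rep hs
    obtain ⟨h₄, h₅, h₆⟩ := ih (fun b hb => hL b (List.mem_cons_of_mem _ hb))
      (rep_denote rep (safe_patSearch 1 a.1)) h₁
    refine ⟨h₄, fun w => ?_, fun b hb => ?_⟩
    · change ((searchAll L).denote ((patSearch 1 a.1).denote s)).status n w = _ ∨
        _ ∧ ((searchAll L).denote ((patSearch 1 a.1).denote s)).status n w = _
      have e₁ := h₂ w
      have e₂ := h₅ w
      omega
    · rcases List.mem_cons.1 hb with rfl | hb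
      · refine h₃.mono fun w hw => ?_
        change ((searchAll L).denote ((patSearch 1 b.1).denote s)).status n w = 0 at hw
        have e₂ := h₅ w
        rw [Set.mem_ofPred_eq]
        omega
      · exact h₆ b hb

omit [DecidableRel G.Adj] in
theorem denote_ifEq_one {s : State} (rep : Rep Δ G s) (k : ℕ) (p : Stmt) :
    (ifEq (.var 1) (.lit k) p).denote s = if Δ = k then p.denote s else s := by
  rw [denote_ifEq]
  simp only [Exp.eval, rep.reg_one]

theorem tightPhase_spec (hΔ : ∀ v, G.degree v ≤ Δ) {s : State} (rep : Rep Δ G s)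
    (hs : ∀ w, s.status n w ≠ 1) :
    (∃ P, Packed (IsTile Δ G) 1 ((tightPhase.denote s).status n) P) ∧
    (∀ w, (tightPhase.denote s).status n w = s.status n w ∨
        s.status n w = 0 ∧ (tightPhase.denote s).status n w = 1) ∧
    ∀ H J, (H, J) ∈ tightPats Δ → H.Avoids G {w | (tightPhase.denote s).status n w = 0} := by
  have hs' : ∃ P, Packed (IsTile Δ G) 1 (s.status n) P := ⟨∅, by simp, by simp, by simp [hs]⟩
  have main : Δ ≤ 5 → (tightPhase.denote s).status n = ((searchAll (tightPats Δ)).denote s).status n →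
      (∃ P, Packed (IsTile Δ G) 1 ((tightPhase.denote s).status n) P) ∧
      (∀ w, (tightPhase.denote s).status n w = s.status n w ∨
          s.status n w = 0 ∧ (tightPhase.denote s).status n w = 1) ∧
      ∀ H J, (H, J) ∈ tightPats Δ → H.Avoids G {w | (tightPhase.denote s).status n w = 0} := by
    intro h5 he
    rw [he]
    obtain ⟨h₁, h₂, h₃⟩ := searchAll_spec (fun v => (hΔ v).trans h5) (tightPats Δ)
      (fun a ha => ha) rep hs'
    exact ⟨h₁, h₂, fun H J hH => h₃ _ hH⟩
  have hden : tightPhase.denote s = if Δ = 3 then (searchAll (tightPats 3)).denote s else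
      if Δ = 4 then (searchAll (tightPats 4)).denote s else
      if Δ = 5 then (searchAll (tightPats 5)).denote s else s := by
    have e : tightPhase.denote s = (ifEq (.var 1) (.lit 5) (searchAll (tightPats 5))).denote
        ((ifEq (.var 1) (.lit 4) (searchAll (tightPats 4))).denote
          ((ifEq (.var 1) (.lit 3) (searchAll (tightPats 3))).denote s)) := rfl
    rw [e, denote_ifEq_one rep]
    have rep₃ := rep_denote rep (safe_searchAll (tightPats 3))
    have rep₄ := rep_denote rep (safe_searchAll (tightPats 4))
    split_ifs with h3 h4 h5
    · subst h3
      rw [denote_ifEq_one rep₃, if_neg (by decide), denote_ifEq_one rep₃, if_neg (by decide)]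
    · subst h4
      rw [denote_ifEq_one rep, if_pos rfl, denote_ifEq_one rep₄, if_neg (by decide)]
    · subst h5
      rw [denote_ifEq_one rep, if_neg (by decide), denote_ifEq_one rep, if_pos rfl]
    · rw [denote_ifEq_one rep, if_neg h4, denote_ifEq_one rep, if_neg h5]
  by_cases h3 : Δ = 3
  · subst h3
    exact main (by decide) (by rw [hden, if_pos rfl])
  by_cases h4 : Δ = 4
  · subst h4
    exact main (by decide) (by rw [hden, if_neg (by decide), if_pos rfl])
  by_cases h5 : Δ = 5
  · subst h5
    exact main (by decide) (by rw [hden, if_neg (by decide), if_neg (by decide), if_pos rfl])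
  rw [hden, if_neg h3, if_neg h4, if_neg h5]
  exact ⟨hs', fun w => Or.inl rfl, fun H J hH => by simp [tightPats, h3, h4, h5] at hH⟩

theorem orderOK_diamondPat : diamondPat.orderOK = true := by decide +kernel

theorem orderOK_linkPat₁ : linkPat₁.orderOK = true := by decide +kernel

theorem orderOK_linkPat₂ : linkPat₂.orderOK = true := by decide +kernel

theorem diamondPhase_spec (hΔ : ∀ v, G.degree v ≤ Δ) {s : State} (rep : Rep Δ G s)
    (hs : ∀ w, s.status n w ≠ 3) :
    (∃ Q, Packed (IsDiamondSet Δ G) 3 ((diamondPhase.denote s).status n) Q) ∧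
    (∀ w, (diamondPhase.denote s).status n w = s.status n w ∨
        s.status n w = 0 ∧ (diamondPhase.denote s).status n w = 3) ∧
    (Δ = 3 → diamondPat.Avoids G {w | (diamondPhase.denote s).status n w = 0}) := by
  have hs' : ∃ P, Packed (IsDiamondSet Δ G) 3 (s.status n) P := ⟨∅, by simp, by simp, by simp [hs]⟩
  rw [diamondPhase, denote_ifEq_one rep]
  split_ifs with h3
  · subst h3
    have := patSearch_spec (fun v => (hΔ v).trans (by decide)) orderOK_diamondPat (by decide)
      (c := 3) (by decide) (T := IsDiamondSet 3 G) (fun g hg => ⟨rfl, g, hg, rfl⟩) rep hs'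
    exact ⟨this.1, this.2.1, fun _ => this.2.2⟩
  · exact ⟨hs', fun w => Or.inl rfl, fun h => absurd h h3⟩

/-- The edge from 0 to a vertex of `S` guarantees that the root is consumed together with the
neighbourhood of `S`, as required by `searchPhase_spec`. -/
theorem linkSearch_spec (hΔ : ∀ v, G.degree v ≤ 3) {H : Pattern} (hH : H.orderOK = true)
    {S : List ℕ} (hS : ∀ i ∈ S, i < H.size) {i : ℕ} (hi : i ∈ S) (h0i : (0, i) ∈ H.edges)
    (hwf : H.wf = true)
    (hnib : ∀ (g : ℕ → Fin n) (st : Fin n → ℕ), Nibbled 3 G st → H.IsCopy G g →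
      (∀ w ∈ H.verts g, st w = 0) → Nibbled 3 G (consume G (S.toFinset.image g) st))
    {s : State} (rep : Rep Δ G s) (hs : Nibbled 3 G (s.status n)) :
    (Nibbled 3 G (((searchPhase H.edges H.order (markNbhds S)).denote s).status n) ∧
      ∀ w, ((searchPhase H.edges H.order (markNbhds S)).denote s).status n w = 0 →
        s.status n w = 0) ∧
    H.Avoids G {w | ((searchPhase H.edges H.order (markNbhds S)).denote s).status n w = 0} := by
  have hfit : Fits H.edges H.order [0] = true := by
    simp only [orderOK, Bool.and_eq_true] at hH
    exact hH.1.1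
  have h5 : ∀ v, G.degree v ≤ 5 := fun v => (hΔ v).trans (by decide)
  have key := searchPhase_spec h5 hfit (marks_markNbhds S)
    (fun g st => consume G (S.toFinset.image g) st)
    (fun g s rep hg => markNbhds_spec h5 S rep fun j hj => hg j ((mem_full_iff hH j).2 (hS j hj)))
    (fun g st w h => consume_eq_zero h)
    (fun g st hg => by
      rw [valid_iff hH] at hg
      have h0 := hg.2 (g 0) (mem_verts.2 ⟨0, (ne_of_wf hwf h0i).1, rfl⟩)
      rw [consume, if_pos ⟨h0, g i, Finset.mem_image_of_mem g (List.mem_toFinset.2 hi),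
        Or.inr (hg.1.adj_edge hwf h0i).symm⟩]
      decide)
    (fun st => Nibbled 3 G st ∧ ∀ w, st w = 0 → s.status n w = 0)
    (fun g st hst hg => by
      rw [valid_iff hH] at hg
      exact ⟨hnib g st hst.1 hg.1 hg.2, fun w hw => hst.2 w (consume_eq_zero hw)⟩)
    rep ⟨hs, fun w hw => hw⟩
  refine ⟨key.1, fun g hg hg0 => key.2 g ?_⟩
  rw [valid_iff hH]
  exact ⟨hg, hg0⟩

theorem nibblePhase_spec (hΔ : ∀ v, G.degree v ≤ Δ) (h3 : 3 ≤ Δ) (hω : G.CliqueFree (Δ + 1))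
    {s : State} (rep : Rep Δ G s) (hs : ∀ w, s.status n w = 0) (h4 : ∀ w : Fin n, s.arr 4 w = 0) :
    Nibbled Δ G ((nibblePhase.denote s).status n) ∧
    (Δ = 3 → linkPat₁.Avoids G {w | (nibblePhase.denote s).status n w = 0} ∧
      linkPat₂.Avoids G {w | (nibblePhase.denote s).status n w = 0}) ∧
    (4 ≤ Δ → ∀ v, ¬ Crowded Δ G ((nibblePhase.denote s).status n) v) := by
  have hnib : Nibbled Δ G (s.status n) := by
    refine ⟨fun w => Or.inl (hs w), ?_⟩
    convert isProfitablyNibbled_empty Δ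
    ext w
    simp [hs w]
  have e : nibblePhase.denote s = (ite (.lit 3) (.var 1) pairPhase skip).denote
      ((ifEq (.var 1) (.lit 3)
        (seq (searchPhase linkPat₁.edges linkPat₁.order (markNbhds [2, 3, 6]))
          (searchPhase linkPat₂.edges linkPat₂.order (markNbhds [2, 3, 8, 9])))).denote s) := rfl
  rw [e, denote_ifEq_one rep]
  rcases h3.eq_or_lt with rfl | h4'
  · rw [if_pos rfl]
    have hsafe : ∀ (H : Pattern) S, (searchPhase H.edges H.order (markNbhds S)).safe = true := by
      intro H S
      rw [safe_iff]
      exact ⟨writes_searchPhase (marks_markNbhds S) (by omega),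
        writes_searchPhase (marks_markNbhds S) (by omega),
        stores_searchPhase _ _ (marks_markNbhds S) (by omega),
        stores_searchPhase _ _ (marks_markNbhds S) (by omega)⟩
    have rep₁ := rep_denote rep (hsafe linkPat₁ [2, 3, 6])
    have rep₂ := rep_denote rep₁ (hsafe linkPat₂ [2, 3, 8, 9])
    obtain ⟨⟨h₁, -⟩, h₂⟩ := linkSearch_spec hΔ orderOK_linkPat₁ (S := [2, 3, 6]) (by decide) (i := 2)
      (by decide) (by decide) (by decide +kernel) (fun g st => fun hst hg h0 =>
        nibbled_linkPat₁ hΔ hst hg h0) rep hnib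
    obtain ⟨⟨h₃, h₄⟩, h₅⟩ := linkSearch_spec hΔ orderOK_linkPat₂ (S := [2, 3, 8, 9]) (by decide)
      (i := 2) (by decide) (by decide) (by decide +kernel) (fun g st => fun hst hg h0 =>
        nibbled_linkPat₂ hΔ hst hg h0) rep₁ h₁
    have e₂ : ∀ s' : State, Rep 3 G s' →
        (ite (.lit 3) (.var 1) pairPhase skip).denote s' = s' := by
      intro s' rep'
      simp only [denote, Exp.eval, rep'.reg_one]
      rfl
    rw [show (seq (searchPhase linkPat₁.edges linkPat₁.order (markNbhds [2, 3, 6]))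
      (searchPhase linkPat₂.edges linkPat₂.order (markNbhds [2, 3, 8, 9]))).denote s =
      (searchPhase linkPat₂.edges linkPat₂.order (markNbhds [2, 3, 8, 9])).denote
        ((searchPhase linkPat₁.edges linkPat₁.order (markNbhds [2, 3, 6])).denote s) from rfl,
      e₂ _ rep₂]
    exact ⟨h₃, fun _ => ⟨h₂.mono fun w hw => h₄ w hw, h₅⟩, fun h => absurd h (by decide)⟩
  · rw [if_neg (by omega)]
    have e₂ : (ite (.lit 3) (.var 1) pairPhase skip).denote s = pairPhase.denote s := by
      simp only [denote, Exp.eval, rep.reg_one, if_pos h4']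
    rw [e₂]
    have key := pairPhase_spec hΔ (Nibbled Δ G) (fun v st hst hv hp =>
      hst.consume_defective hΔ h4' hω hv hp) (Crowded Δ G) (fun st st' v h => Crowded.mono h)
      (fun st v h => h.pairTest hΔ) (fun st v h => not_crowded_consume hΔ hω h) rep hnib h4
    exact ⟨key.1, fun h => absurd h (by omega), fun _ => key.2⟩

end

end Stmt

end RAM

/-! ### The whole algorithm -/

namespace RAM

open SimpleGraph Pattern

namespace Stmt

theorem denote_decompose (s : State) : decompose.denote s = outputPhase.denote (peelPhase.denote
    (cliquePhase.denote (diamondPhase.denote (tightPhase.denote (nibblePhase.denote s))))) := by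
  simp only [decompose, denote]

/-- The program is a concrete term, so its syntactic properties, including the one that gives the
running time, are decided by evaluation. -/
theorem WF_decompose : decompose.WF = true := by decide +kernel

theorem quadratic_decompose : decompose.quadratic = true := by decide +kernel

theorem safe_decompose : decompose.safe = true := by decide +kernel

theorem safe_nibblePhase : nibblePhase.safe = true := by decide +kernel

theorem safe_tightPhase : tightPhase.safe = true := by decide +kernel

theorem safe_diamondPhase : diamondPhase.safe = true := by decide +kernel

theorem safe_cliquePhase : cliquePhase.safe = true := by decide +kernel

theorem safe_peelPhase : peelPhase.safe = true := by decide +kernel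

theorem stores_phases {a : ℕ} (ha : a = 5 ∨ a = 6) : nibblePhase.stores a = false ∧
    tightPhase.stores a = false ∧ diamondPhase.stores a = false := by
  rcases ha with rfl | rfl <;> decide +kernel

section

variable {Δ n : ℕ} {G : SimpleGraph (Fin n)} [DecidableRel G.Adj]

/-- The clique phase finds all cliques of size `Δ` among the free vertices. -/
theorem cliquePhase_cliques (hΔ : ∀ v, G.degree v ≤ Δ) (h2 : 2 ≤ Δ) {s : State} (rep : Rep Δ G s)
    (hs : ∀ w, s.status n w ≠ 4) (hC : ∀ v, ¬ Crowded Δ G (s.status n) v)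
    (h5 : ∀ w : Fin n, s.arr 5 w = 0) (h6 : ∀ w : Fin n, s.arr 6 w = 0) :
    (∀ w, (cliquePhase.denote s).status n w = s.status n w ∨
      s.status n w = 0 ∧ (cliquePhase.denote s).status n w = 4) ∧
    CliqueIds Δ G ((cliquePhase.denote s).status n) ((cliquePhase.denote s).ident n) ∧
    ∀ K : Finset (Fin n), G.IsNClique Δ K → ¬ ∀ w ∈ K, (cliquePhase.denote s).status n w = 0 := by
  have key := cliquePhase_spec hΔ
    (fun st id => (∀ w, st w = s.status n w ∨ s.status n w = 0 ∧ st w = 4) ∧ CliqueIds Δ G st id)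
    (fun st id id' h hid => ⟨h.1, fun v hv => by
      obtain ⟨K, hK, hK'⟩ := h.2 v hv
      refine ⟨K, hK, fun w => (hK' w).trans (and_congr_right fun hw => ?_)⟩
      rw [hid w (by omega), hid v (by omega)]⟩)
    (fun v st id h hv ht hfresh => by
      have h0 : ∀ w, w = v ∨ w ∈ core Δ G st v → st w = 0 := by
        rintro w (rfl | hw)
        · exact hv
        · exact core_eq_zero hw
      refine ⟨fun w => ?_, fun u hu => ?_⟩
      · dsimp only
        split_ifs with hw
        · have h₁ := h.1 w
          have h₂ := h0 w hw
          exact Or.inr ⟨by omega, rfl⟩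
        · exact h.1 w
      · by_cases hu' : u = v ∨ u ∈ core Δ G st v
        · refine ⟨_, ht.isNClique, fun w => ?_⟩
          rw [Finset.mem_insert]
          by_cases hw : w = v ∨ w ∈ core Δ G st v
          · simp [hw, hu']
          · simp [hw, hu', hfresh w]
        · simp only [hu', if_false] at hu
          obtain ⟨K, hK, hK'⟩ := h.2 u hu
          refine ⟨K, hK, fun w => (hK' w).trans ?_⟩
          by_cases hw : w = v ∨ w ∈ core Δ G st v
          · simp [hw, hu', h0 w hw, (hfresh u).symm]
          · simp [hw, hu'])
    (fun st v => ∃ K : Finset (Fin n), G.IsNClique Δ K ∧ v ∈ K ∧ ∀ w ∈ K, st w = 0)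
    (fun st st' v h ⟨K, hK, hv, h0⟩ => ⟨K, hK, hv, fun w hw => h w (h0 w hw)⟩)
    (fun st id v h ⟨K, hK, hv, h0⟩ => ⟨h0 v hv, cliqueTest_of_isNClique hΔ h2
      (fun hc => hC v (hc.mono fun w hw => by
        have := h.1 w
        omega)) hK hv h0⟩)
    rep ⟨fun w => Or.inl rfl, fun v hv => absurd hv (hs v)⟩ h5 h6
  refine ⟨key.1.1, key.1.2, fun K hK h0 => ?_⟩
  obtain ⟨v, hv⟩ : K.Nonempty := Finset.card_pos.1 (by rw [hK.card_eq]; omega)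
  exact key.2 v ⟨K, hK, hv, h0⟩

theorem decompose_spec (hΔ : ∀ v, G.degree v ≤ Δ) (h3 : 3 ≤ Δ) (hω : G.CliqueFree (Δ + 1))
    {s : State} (hs : IsInput Δ G s) :
    G.IsDecomposition Δ ((decompose.denote s).labelled n 0) ((decompose.denote s).labelled n 1)
      ((decompose.denote s).labelled n 2) ((decompose.denote s).labelled n 3) := by
  have rep := hs.rep
  have hzero : ∀ w, s.status n w = 0 := fun w => hs.arr_other 3 w (by decide)
  obtain ⟨hn, hlink, hcrowd⟩ := nibblePhase_spec hΔ h3 hω rep hzero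
    fun w => hs.arr_other 4 w (by decide)
  have rep₁ := rep_denote rep safe_nibblePhase
  have harr₁ : ∀ a, a = 5 ∨ a = 6 → ∀ i, (nibblePhase.denote s).arr a i = 0 := by
    intro a ha i
    rw [denote_arr _ (stores_phases ha).1]
    exact hs.arr_other a i (by omega)
  set s₁ := nibblePhase.denote s
  obtain ⟨⟨P, hP⟩, hstep₁, havoids⟩ := tightPhase_spec hΔ rep₁ fun w => by
    have := hn.1 w
    omega
  have rep₂ := rep_denote rep₁ safe_tightPhase
  set s₂ := tightPhase.denote s₁
  obtain ⟨⟨Q, hQ⟩, hstep₂, hdia⟩ := diamondPhase_spec hΔ rep₂ fun w => by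
    have := hn.1 w
    have := hstep₁ w
    omega
  have rep₃ := rep_denote rep₂ safe_diamondPhase
  have harr₃ : ∀ a, a = 5 ∨ a = 6 → ∀ i, (diamondPhase.denote s₂).arr a i = 0 := by
    intro a ha i
    rw [denote_arr _ (stores_phases ha).2.2, denote_arr _ (stores_phases ha).2.1, harr₁ a ha]
  set s₃ := diamondPhase.denote s₂
  have prep : Prepared Δ G (s₁.status n) (s₂.status n) (s₃.status n) P Q :=
    ⟨hn, hlink, hcrowd, hstep₁, hP, havoids, hstep₂, hQ, hdia⟩
  have h₄ : ∀ w, s₃.status n w ≠ 4 ∧ s₃.status n w ≠ 5 := fun w => by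
    have := hn.1 w
    have := hstep₁ w
    have := hstep₂ w
    omega
  obtain ⟨hstep₃, hid, hno⟩ := cliquePhase_cliques hΔ (by omega) rep₃ (fun w => (h₄ w).1)
    (prep.not_crowded hΔ h3) (fun w => harr₃ 5 (by decide) w) fun w => harr₃ 6 (by decide) w
  have rep₄ := rep_denote rep₃ safe_cliquePhase
  set s₄ := cliquePhase.denote s₃
  have h₅ : ∀ w, s₄.status n w ≠ 5 := fun w => by
    have := h₄ w
    have := hstep₃ w
    omega
  obtain ⟨v, x, hv, hp⟩ := peelPhase_spec hΔ (s₄.ident n) (PeelInv Δ G (s₄.status n) (s₄.ident n))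
    (fun st v c x h hc hx => h.peel hΔ hid h₅ hc hx) (fun st v x h hx => h.adv hid hx)
    rep₄ rfl (peelInv_start h₅)
  have rep₅ := rep_denote rep₄ safe_peelPhase
  set s₅ := peelPhase.denote s₄
  -- The labels need only be compared for the six statuses, a finite check.
  have hle : ∀ w, s₅.status n w ≤ 5 := fun w => by
    have := hn.1 w
    have := hstep₁ w
    have := hstep₂ w
    have := hstep₃ w
    have := hp.turned.1 w
    omega
  have hlabel : ∀ k, (decompose.denote s).labelled n k = {w | label (s₅.status n w) = k} := by
    intro k
    ext w
    rw [State.labelled, Set.mem_ofPred_eq, Set.mem_ofPred_eq, ← outputPhase_spec rep₅ w, denote_decompose]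
  have hset : ∀ (k : ℕ) (p : ℕ → Prop), (∀ i ≤ 5, label i = k ↔ p i) →
      (decompose.denote s).labelled n k = {w | p (s₅.status n w)} := by
    intro k p h
    rw [hlabel]
    ext w
    exact h _ (hle w)
  rw [hset 0 (fun i => i = 1 ∨ i = 4) (by decide), hset 1 (fun i => i = 5) (by decide),
    hset 2 (fun i => i = 2) (by decide), hset 3 (fun i => i = 0 ∨ i = 3) (by decide)]
  exact prep.isDecomposition hΔ h3 hω hstep₃ hid hno hv hp

end

end Stmt

end RAM

theorem mainTheorem4 :
    ∃ (P : RAM.Cmd) (c : ℕ), ∀ (Δ n : ℕ) (G : SimpleGraph (Fin n)) [DecidableRel G.Adj]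
      (s : RAM.State),
      3 ≤ Δ → max G.maxDegree G.cliqueNum ≤ Δ → RAM.IsInput Δ G s →
      ∃ (t : ℕ) (s' : RAM.State), RAM.Exec P s t s' ∧ t ≤ c * (Δ ^ 2 * n + 1) ∧
        G.IsDecomposition Δ (s'.labelled n 0) (s'.labelled n 1) (s'.labelled n 2)
          (s'.labelled n 3) := by
  obtain ⟨c, hc⟩ := RAM.Stmt.bound_le_of_quadratic _ RAM.Stmt.quadratic_decompose
  refine ⟨RAM.Stmt.decompose.compile, c, ?_⟩
  intro Δ n G _ s h3 hmax hs
  have hw := RAM.Stmt.safe_iff.1 RAM.Stmt.safe_decompose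
  obtain ⟨t, ht, he⟩ := RAM.Stmt.exec_compile _ RAM.Stmt.WF_decompose hw.1 hw.2.1 s
  rw [hs.reg_zero, hs.reg_one] at ht
  refine ⟨t, _, he, ht.trans (hc Δ n (by omega)), RAM.Stmt.decompose_spec
    (fun v => (G.degree_le_maxDegree v).trans ((le_max_left _ _).trans hmax)) h3 ?_ hs⟩
  -- The bound on the clique number excludes cliques on Δ + 1 vertices.
  intro K hK
  have h₁ := hK.isClique.card_le_cliqueNum
  have h₂ := (le_max_right _ _).trans hmax
  rw [hK.card_eq] at h₁
  omega
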